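/- **Setting.** Let $T\subset B\subset \mathrm{GL}_2$ be the diagonal and the upper triangular matrices over $\mathbb{C}$, $U\subset B$ the unipotent radical, $\mathfrak n=\mathrm{Lie}\,U$, and write $Y_i=\begin{pmatrix}0&y_i\\0&0\end{pmatrix}\in\mathfrak n$, $X=(x_{ij})\in\mathfrak{gl}_2$, $g=(g_{ij})\in \mathrm{GL}_2$, $\mathrm{Ad}_gX=gXg^{-1}$. Put $$\mathcal X=\mathfrak{gl}_2\times\mathfrak n\times \mathrm{GL}_2\times\mathfrak n\ni(X,Y_1,g,Y_2),\qquad W=\mathrm{Tr}\bigl(X(Y_1-\mathrm{Ad}_gY_2)\bigr)$$ (the slice of the space $\mathcal X(\mathrm{GL}_2)$ by the free action of $\mathrm{GL}_2$), with the actions of $B^2$ and of $T_{sc}=\mathbb C^*_a\times\mathbb C^*_t$ $$(b_1,b_2)\cdot(X,Y_1,g,Y_2)=(\mathrm{Ad}_{b_1}^{-1}X,\mathrm{Ad}_{b_1}^{-1}Y_1,b_1^{-1}gb_2,\mathrm{Ad}_{b_2}^{-1}Y_2),\qquad(\lambda,\mu)\cdot(X,Y_1,g,Y_2)=(\lambda^2X,\lambda^{-2}\mu^2Y_1,g,\lambda^{-2}\mu^2Y_2).$$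 The torus acts on functions by $(t\cdot f)(z)=f(t^{-1}z)$; $\delta_1,\delta_2$ are the derivations of $\mathbb C[\mathcal X]$ by which $E_{12}$ of the two copies of $\mathfrak n$ acts, $(\delta f)(z)=\frac{d}{d\epsilon}f(e^{-\epsilon E_{12}}\cdot z)|_{\epsilon=0}$. **The category** $\mathrm{MF}_{B^2}(\mathcal X,W)$ of strongly $T^2$-equivariant, weakly $U^2$-equivariant matrix factorizations. An object is a $\mathbb Z/2$-graded $\mathbb C[\mathcal X]$-module $M$ with a compatible action of $T^2\times T_{sc}$, an odd $\mathbb C[\mathcal X]$-linear $D$, even operators $\nabla_i$ with $\nabla_i(fm)=\delta_i(f)m+f\nabla_i m$ ($i=1,2$), and an odd $\mathbb C[\mathcal X]$-linear operator $E$, such that the Chevalley–Eilenberg total differential $D_{tot}=D+e_1\nabla_1+e_2\nabla_2+e_1e_2E$ on $\Lambda(e_1,e_2)\otimes M=\Lambda(\mathfrak n^2)^*\otimes M$ satisfies $D_{tot}^2=W$, is $T^2$-invariant and has $T_{sc}$-weight $[\mathbb C^*_t]$, i.e. $D_{tot}\,t=\mu\,t\,D_{tot}$ for $t\in T^2\times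 T_{sc}$ with $T_{sc}$-component $(\lambda,\mu)$ (so $e_i$, dual to $E_{12}$, has weight $(\text{root of the }i\text{-th } T)\cdot\mu^{-1}$). Morphisms are even equivariant $\Lambda(e_1,e_2)\otimes\mathbb C[\mathcal X]$-linear maps commuting with $D_{tot}$, modulo the homotopies $D_{tot}h+hD_{tot}$; equality of objects means isomorphism in this homotopy category. $\mathcal F\langle\chi_l,\chi_r\rangle$ is the tensor product with the characters $\chi_l,\chi_r$ of the left and right $T$; $\chi_1,\chi_2$ are the two diagonal entries; $\mathbf q,\mathbf t$ denote the twists by the tautological characters of $\mathbb C^*_a,\mathbb C^*_t$. **Convolution.** On $\mathcal X_{con}=\mathfrak{gl}_2\times\mathfrak n\times \mathrm{GL}_2\times\mathfrak n\times \mathrm{GL}_2\times\mathfrak n\ni(X,Y_1,a,Y_2,b,Y_3)$ let $\pi_{12}=(X,Y_1,a,Y_2)$, $\pi_{23}=(\mathrm{Ad}_a^{-1}X,Y_2,b,Y_3)$, $\pi_{13}=(X,Y_1,ab,Y_3)$. Then $$\mathcal F\star\mathcal G=\pi_{13*}\bigl(\mathrm{CE}_{\mathfrak n^{(2)}}(\pi_{12}^*\mathcal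 F\otimes\pi_{23}^*\mathcal G)^{T^{(2)}}\bigr),$$ where $\mathfrak n^{(2)},T^{(2)}$ belong to the middle factor of $B^3$. **Objects.** Put $\tilde x_0=g_{11}(x_{11}-x_{22})+g_{21}x_{12}$. The following are Koszul factorizations $\mathbb C[\mathcal X]\otimes\Lambda(\theta_1,\theta_2)$ with $D=\sum_{i=1,2}(a_i\theta_i+b_i\,\partial/\partial\theta_i)$, where $$a_1=x_{21},\quad b_1=y_1-y_2g_{11}^2/\det g,$$ where the weights of $\theta_1,\theta_2$ relative to $1$ are those which make $D$ of weight $[\mathbb C^*_t]$ and $T^2$-invariant, $E=0$, $\nabla_2=\delta_2$ and $\nabla_1=\delta_1+s\,\theta_2\,\partial/\partial\theta_1$: * the positive crossing $\mathcal C_+$: $a_2=\tilde x_0$, $b_2=g_{21}y_2/\det g$, $s=-2g_{11}$, with generator $1$ of trivial $T^2$-weight; the whole factorization is twisted by $\mathbf q^{-1}\mathbf t$ (normalization of the $T_{sc}$-weights); * the negative crossing $\mathcal C_-=\mathcal C_+\langle-\chi_1,\chi_2\rangle$; * the unit (identity braid) $\mathbb 1_2$: $a_2=y_2\tilde x_0$,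 $b_2=g_{21}/\det g$, $s=-2y_2g_{11}$, with generator $1$ of trivial weight. **Theorem.** In $\mathrm{MF}_{B^2}(\mathcal X(\mathrm{GL}_2),W)$ one has $\mathcal C_+\star\mathcal C_-\cong\mathbb 1_2$. -/

import Mathlib

open Matrix
open scoped Kronecker

namespace BraidMF

noncomputable section

/-- The strictly upper triangular `2 × 2` matrix with corner entry `y`. -/
def nil {S : Type} [CommRing S] (y : S) : Matrix (Fin 2) (Fin 2) S := !![0, y; 0, 0]

/-- An `S`-valued point of `𝔤𝔩₂ × GL₂ᵏ × 𝔫ᵏ⁺¹`. -/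
@[ext] structure Pt (k : ℕ) (S : Type) [CommRing S] where
  X : Matrix (Fin 2) (Fin 2) S
  g : Fin k → GL (Fin 2) S
  y : Fin (k + 1) → S

/-- Change of scalars of a point along a ring homomorphism. -/
def Pt.map {k : ℕ} {S S' : Type} [CommRing S] [CommRing S'] (f : S →+* S') (p : Pt k S) :
    Pt k S' where
  X := p.X.map f
  g j := Matrix.GeneralLinearGroup.map f (p.g j)
  y j := f (p.y j)

/-- The action of `(b₀, …, b_k)` (upper triangular) and of `(l, m) ∈ T_sc`:
`X ↦ l² Ad(b₀)⁻¹ X`, `g_j ↦ b_j⁻¹ g_j b_{j+1}`, `Y_j ↦ l⁻² m² Ad(b_j)⁻¹ Y_j`. -/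
def Pt.act {k : ℕ} {S : Type} [CommRing S] (b : Fin (k + 1) → GL (Fin 2) S) (l m : Sˣ)
    (p : Pt k S) : Pt k S where
  X := ((l ^ 2 : Sˣ) : S) • (((b 0)⁻¹ : GL (Fin 2) S).val * p.X * (b 0).val)
  g j := (b j.castSucc)⁻¹ * p.g j * b j.succ
  y j := (l⁻¹ ^ 2 * m ^ 2 : Sˣ) * (((b j)⁻¹ : GL (Fin 2) S).val * nil (p.y j) * (b j).val) 0 1

/-- The diagonal matrix with the given invertible entries. -/
def diagGL {S : Type} [CommRing S] (t : Fin 2 → Sˣ) : GL (Fin 2) S where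
  val := Matrix.diagonal fun i => (t i : S)
  inv := Matrix.diagonal fun i => ((t i)⁻¹ : Sˣ)
  val_inv := by simp
  inv_val := by simp

/-- The unipotent matrix `1 + s E₁₂ = exp (s E₁₂)`. -/
def unipGL {S : Type} [CommRing S] (s : S) : GL (Fin 2) S where
  val := !![1, s; 0, 1]
  inv := !![1, -s; 0, 1]
  val_inv := by ext i j; fin_cases i <;> fin_cases j <;> simp
  inv_val := by ext i j; fin_cases i <;> fin_cases j <;> simp

/-- Names of the coordinates: entries of `X`, of the `g_j`, and the corners `y_j`. -/
abbrev Var (k : ℕ) : Type := (Fin 2 × Fin 2) ⊕ ((Fin k × Fin 2 × Fin 2) ⊕ Fin (k + 1))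

/-- The matrix of coordinates of the `j`-th group factor. -/
def polyG (k : ℕ) (j : Fin k) : Matrix (Fin 2) (Fin 2) (MvPolynomial (Var k) ℂ) :=
  Matrix.of fun i i' => MvPolynomial.X (Sum.inr (Sum.inl (j, i, i')))

/-- The product of the determinants of the group factors. -/
def polyDet (k : ℕ) : MvPolynomial (Var k) ℂ := ∏ j, (polyG k j).det

/-- The coordinate ring of `𝔤𝔩₂ × GL₂ᵏ × 𝔫ᵏ⁺¹`. -/
def Coord (k : ℕ) : Type := Localization.Away (polyDet k)

instance (k : ℕ) : CommRing (Coord k) := inferInstanceAs (CommRing (Localization.Away (polyDet k)))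
instance (k : ℕ) : Algebra (MvPolynomial (Var k) ℂ) (Coord k) :=
  inferInstanceAs (Algebra (MvPolynomial (Var k) ℂ) (Localization.Away (polyDet k)))
instance (k : ℕ) : Algebra ℂ (Coord k) :=
  inferInstanceAs (Algebra ℂ (Localization.Away (polyDet k)))
instance (k : ℕ) : IsScalarTower ℂ (MvPolynomial (Var k) ℂ) (Coord k) :=
  inferInstanceAs (IsScalarTower ℂ (MvPolynomial (Var k) ℂ) (Localization.Away (polyDet k)))
instance (k : ℕ) : IsLocalization.Away (polyDet k) (Coord k) :=
  inferInstanceAs (IsLocalization.Away (polyDet k) (Localization.Away (polyDet k)))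

theorem isUnit_det_polyG (k : ℕ) (j : Fin k) :
    IsUnit (((polyG k j).map (algebraMap (MvPolynomial (Var k) ℂ) (Coord k))).det) := by
  have h : IsUnit (algebraMap (MvPolynomial (Var k) ℂ) (Coord k) (polyDet k)) :=
    IsLocalization.Away.algebraMap_isUnit (polyDet k)
  have hd : (polyG k j).det ∣ polyDet k := Finset.dvd_prod_of_mem _ (Finset.mem_univ j)
  have := isUnit_of_dvd_unit (map_dvd (algebraMap (MvPolynomial (Var k) ℂ) (Coord k)) hd) h
  rwa [RingHom.map_det, RingHom.mapMatrix_apply] at this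

/-- The tautological point, with values in the coordinate ring. -/
def generic (k : ℕ) : Pt k (Coord k) where
  X := Matrix.of fun i i' => algebraMap (MvPolynomial (Var k) ℂ) _ (MvPolynomial.X (Sum.inl (i, i')))
  g j := Matrix.nonsingInvUnit
    ((polyG k j).map (algebraMap (MvPolynomial (Var k) ℂ) (Coord k))) (isUnit_det_polyG k j)
  y j := algebraMap (MvPolynomial (Var k) ℂ) _ (MvPolynomial.X (Sum.inr (Sum.inr j)))

/-- The polynomial version of evaluation at a point. -/
def evalPoly {k : ℕ} {S : Type} [CommRing S] [Algebra ℂ S] (p : Pt k S) :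
    MvPolynomial (Var k) ℂ →ₐ[ℂ] S :=
  MvPolynomial.aeval
    (Sum.elim (fun v => p.X v.1 v.2)
      (Sum.elim (fun v => (p.g v.1).val v.2.1 v.2.2) fun j => p.y j))

theorem isUnit_evalPoly {k : ℕ} {S : Type} [CommRing S] [Algebra ℂ S] (p : Pt k S)
    (d : Submonoid.powers (polyDet k)) : IsUnit (evalPoly p d) := by
  obtain ⟨d, n, rfl⟩ := d
  simp only [map_pow]
  apply IsUnit.pow
  rw [polyDet, map_prod]
  rw [IsUnit.prod_univ_iff]
  intro j
  have : evalPoly p (polyG k j).det = (p.g j).val.det := by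
    simp [Matrix.det_fin_two, polyG, evalPoly]
  rw [this]
  exact (Matrix.isUnit_iff_isUnit_det _).1 (p.g j).isUnit

/-- Evaluation of regular functions at a point with values in a `ℂ`-algebra. -/
def evalPt {k : ℕ} {S : Type} [CommRing S] [Algebra ℂ S] (p : Pt k S) : Coord k →ₐ[ℂ] S :=
  IsLocalization.liftAlgHom (M := Submonoid.powers (polyDet k)) (S := Coord k)
    (f := evalPoly p) (isUnit_evalPoly p)

theorem evalPt_algebraMap {k : ℕ} {S : Type} [CommRing S] [Algebra ℂ S] (p : Pt k S)
    (f : MvPolynomial (Var k) ℂ) :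
    evalPt p (algebraMap (MvPolynomial (Var k) ℂ) (Coord k) f) = evalPoly p f := by
  simp only [evalPt, IsLocalization.liftAlgHom_apply]
  exact IsLocalization.lift_eq _ f

theorem evalPt_X {k : ℕ} {S : Type} [CommRing S] [Algebra ℂ S] (p : Pt k S) (i i' : Fin 2) :
    evalPt p ((generic k).X i i') = p.X i i' := by
  simp [generic, evalPt_algebraMap, evalPoly]

theorem evalPt_g {k : ℕ} {S : Type} [CommRing S] [Algebra ℂ S] (p : Pt k S) (j : Fin k)
    (i i' : Fin 2) : evalPt p (((generic k).g j).val i i') = (p.g j).val i i' := by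
  have : ((generic k).g j).val i i' = algebraMap (MvPolynomial (Var k) ℂ) (Coord k)
      (MvPolynomial.X (Sum.inr (Sum.inl (j, i, i')))) := rfl
  rw [this, evalPt_algebraMap]
  simp [evalPoly]

theorem evalPt_y {k : ℕ} {S : Type} [CommRing S] [Algebra ℂ S] (p : Pt k S) (j : Fin (k + 1)) :
    evalPt p ((generic k).y j) = p.y j := by
  simp [generic, evalPt_algebraMap, evalPoly]

theorem evalPt_generic {k : ℕ} {S : Type} [CommRing S] [Algebra ℂ S] (p : Pt k S) :
    (generic k).map (evalPt p : Coord k →+* S) = p := by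
  ext i i'
  · exact evalPt_X p i i'
  · exact evalPt_g p i _ _
  · exact evalPt_y p i

/-- A homomorphism out of the coordinate ring is determined by the coordinates. -/
theorem hom_ext {k : ℕ} {S : Type} [CommRing S] [Algebra ℂ S] {φ ψ : Coord k →ₐ[ℂ] S}
    (hX : ∀ i i', φ ((generic k).X i i') = ψ ((generic k).X i i'))
    (hg : ∀ j i i', φ (((generic k).g j).val i i') = ψ (((generic k).g j).val i i'))
    (hy : ∀ j, φ ((generic k).y j) = ψ ((generic k).y j)) : φ = ψ := by
  apply IsLocalization.algHom_ext (Submonoid.powers (polyDet k)) (A := MvPolynomial (Var k) ℂ)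
  apply MvPolynomial.algHom_ext
  rintro (⟨i, i'⟩ | ⟨j, i, i'⟩ | j)
  · exact hX i i'
  · exact hg j i i'
  · exact hy j

/-- Uniqueness of a derivation along a homomorphism with given values on the coordinates. -/
theorem deriv_ext {k : ℕ} {S : Type} [CommRing S] [Algebra ℂ S] (φ : Coord k →ₐ[ℂ] S)
    {d d' : Coord k →ₗ[ℂ] S}
    (hd : ∀ a b, d (a * b) = φ a * d b + d a * φ b)
    (hd' : ∀ a b, d' (a * b) = φ a * d' b + d' a * φ b)
    (hX : ∀ i i', d ((generic k).X i i') = d' ((generic k).X i i'))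
    (hg : ∀ j i i', d (((generic k).g j).val i i') = d' (((generic k).g j).val i i'))
    (hy : ∀ j, d ((generic k).y j) = d' ((generic k).y j)) : d = d' := by
  have one : ∀ e : Coord k →ₗ[ℂ] S, (∀ a b, e (a * b) = φ a * e b + e a * φ b) → e 1 = 0 := by
    intro e he
    have := he 1 1
    simpa using this
  let mk : ∀ e : Coord k →ₗ[ℂ] S, (∀ a b, e (a * b) = φ a * e b + e a * φ b) →
      (Coord k →ₐ[ℂ] DualNumber S) := fun e he =>
    AlgHom.ofLinearMap
      (((TrivSqZeroExt.inlAlgHom ℂ S S).toLinearMap ∘ₗ φ.toLinearMap) +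
        ((TrivSqZeroExt.inrHom S S).restrictScalars ℂ) ∘ₗ e)
      (by ext <;> simp [one e he])
      (by
        intro a b
        ext
        · simp
        · simp [he])
  have key : mk d hd = mk d' hd' := by
    apply hom_ext
    · intro i i'; simp [mk, hX]
    · intro j i i'; simp [mk, hg]
    · intro j; simp [mk, hy]
  ext f
  have := congrArg (fun ψ : Coord k →ₐ[ℂ] DualNumber S => TrivSqZeroExt.snd (ψ f)) key
  simpa [mk] using this

/-! ### Torus and Lie algebra actions on functions -/

/-- The complex torus `Tᵏ⁺¹ × T_sc`. -/
abbrev Torus (k : ℕ) : Type := (Fin (k + 1) → Fin 2 → ℂˣ) × ℂˣ × ℂˣ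

/-- A nonzero scalar as a unit of a `ℂ`-algebra. -/
def scal (S : Type) [CommRing S] [Algebra ℂ S] : ℂˣ →* Sˣ := Units.map (algebraMap ℂ S : ℂ →* S)

/-- The torus action on points. -/
def Pt.torus {k : ℕ} {S : Type} [CommRing S] [Algebra ℂ S] (t : Torus k) (p : Pt k S) : Pt k S :=
  p.act (fun j => diagGL fun i => scal S (t.1 j i)) (scal S t.2.1) (scal S t.2.2)

/-- The torus action on functions, `(t · f)(z) = f(t⁻¹ · z)`. -/
def torusAut (k : ℕ) (t : Torus k) : Coord k →ₐ[ℂ] Coord k := evalPt ((generic k).torus t⁻¹)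

theorem diagGL_inv {S : Type} [CommRing S] (t : Fin 2 → Sˣ) :
    ((diagGL t)⁻¹ : GL (Fin 2) S).val = Matrix.diagonal fun i => ((t i)⁻¹ : Sˣ).val := rfl

theorem unipGL_inv {S : Type} [CommRing S] (s : S) :
    ((unipGL s)⁻¹ : GL (Fin 2) S).val = !![1, -s; 0, 1] := rfl

theorem torusAut_X {k : ℕ} (t : Torus k) (i i' : Fin 2) :
    torusAut k t ((generic k).X i i') =
      ((t.2.1⁻¹ ^ 2 * t.1 0 i * (t.1 0 i')⁻¹ : ℂˣ) : ℂ) • (generic k).X i i' := by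
  rw [torusAut, evalPt_X]
  simp only [Pt.torus, Pt.act, Matrix.smul_apply, smul_eq_mul, diagGL_inv]
  simp [diagGL, Matrix.mul_diagonal, scal, Algebra.smul_def, -map_inv₀, -inv_pow]
  ring

theorem torusAut_g {k : ℕ} (t : Torus k) (j : Fin k) (i i' : Fin 2) :
    torusAut k t (((generic k).g j).val i i') =
      ((t.1 j.castSucc i * (t.1 j.succ i')⁻¹ : ℂˣ) : ℂ) • ((generic k).g j).val i i' := by
  rw [torusAut, evalPt_g]
  simp only [Pt.torus, Pt.act, Units.val_mul, diagGL_inv]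
  simp [diagGL, Matrix.mul_diagonal, scal, Algebra.smul_def, -map_inv₀, -inv_pow]
  ring

theorem torusAut_y {k : ℕ} (t : Torus k) (j : Fin (k + 1)) :
    torusAut k t ((generic k).y j) =
      ((t.2.1 ^ 2 * t.2.2⁻¹ ^ 2 * t.1 j 0 * (t.1 j 1)⁻¹ : ℂˣ) : ℂ) • (generic k).y j := by
  rw [torusAut, evalPt_y]
  simp only [Pt.torus, Pt.act, diagGL_inv]
  simp [diagGL, Matrix.mul_diagonal, nil, scal, Algebra.smul_def, -map_inv₀, -inv_pow]
  ring

theorem torusAut_one (k : ℕ) : torusAut k 1 = AlgHom.id ℂ _ := by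
  apply hom_ext
  · intro i i'; simp [torusAut_X]
  · intro i i'; simp [torusAut_g]
  · intro i; simp [torusAut_y]

theorem torusAut_mul {k : ℕ} (t s : Torus k) (f : Coord k) :
    torusAut k (t * s) f = torusAut k t (torusAut k s f) := by
  suffices h : torusAut k (t * s) = (torusAut k t).comp (torusAut k s) from DFunLike.congr_fun h f
  apply hom_ext
  · intro i i'
    simp only [AlgHom.comp_apply, torusAut_X, map_smul, smul_smul, ← Units.val_mul]
    congr 2
    simp only [Prod.fst_mul, Prod.snd_mul, Pi.mul_apply, mul_inv, mul_pow]
    ac_rfl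
  · intro j i i'
    simp only [AlgHom.comp_apply, torusAut_g, map_smul, smul_smul, ← Units.val_mul]
    congr 2
    simp only [Prod.fst_mul, Pi.mul_apply, mul_inv]
    ac_rfl
  · intro j
    simp only [AlgHom.comp_apply, torusAut_y, map_smul, smul_smul, ← Units.val_mul]
    congr 2
    simp only [Prod.fst_mul, Prod.snd_mul, Pi.mul_apply, mul_inv, mul_pow]
    ac_rfl

/-- The homomorphism `f ↦ f(exp(ε E₁₂)⁻¹ · z)` to the dual numbers, `E₁₂` in the `a`-th factor. -/
def lieHom (k : ℕ) (a : Fin (k + 1)) : Coord k →ₐ[ℂ] DualNumber (Coord k) :=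
  evalPt (((generic k).map (TrivSqZeroExt.inlHom (Coord k) (Coord k))).act
    (fun j => if j = a then unipGL (-DualNumber.eps) else 1) 1 1)

/-- `E₁₂`. -/
def E12 (S : Type) [CommRing S] : Matrix (Fin 2) (Fin 2) S := !![0, 1; 0, 0]

theorem lieHom_X {k : ℕ} (a : Fin (k + 1)) (i i' : Fin 2) :
    lieHom k a ((generic k).X i i') = TrivSqZeroExt.inl ((generic k).X i i') +
      TrivSqZeroExt.inr (if a = 0 then
        (E12 (Coord k) * (generic k).X - (generic k).X * E12 (Coord k)) i i' else 0) := by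
  rw [lieHom, evalPt_X]
  by_cases h : a = 0
  · subst h
    simp only [Pt.map, Pt.act, if_true, unipGL_inv]
    fin_cases i <;> fin_cases i' <;> ext <;>
      simp [unipGL, E12, Matrix.mul_apply, Fin.sum_univ_two, sub_eq_add_neg, Matrix.vecMul,
        dotProduct, add_comm]
  · simp [Pt.map, Pt.act, h, Ne.symm h]

theorem lieHom_g {k : ℕ} (a : Fin (k + 1)) (j : Fin k) (i i' : Fin 2) :
    lieHom k a (((generic k).g j).val i i') = TrivSqZeroExt.inl (((generic k).g j).val i i') +
      TrivSqZeroExt.inr (((if a = j.castSucc then E12 (Coord k) * ((generic k).g j).val else 0) -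
        (if a = j.succ then ((generic k).g j).val * E12 (Coord k) else 0) :
          Matrix (Fin 2) (Fin 2) (Coord k)) i i') := by
  rw [lieHom, evalPt_g]
  by_cases h : a = j.castSucc
  · subst h
    have h2 : j.castSucc ≠ j.succ := (Fin.castSucc_lt_succ).ne
    simp only [if_true, h2, h2.symm, if_false, Pt.act, Pt.map, mul_one, Units.val_mul, unipGL_inv]
    fin_cases i <;> fin_cases i' <;> ext <;>
      simp [E12, Matrix.mul_apply, Fin.sum_univ_two, Matrix.vecMul, dotProduct]
  · by_cases h2 : a = j.succ
    · subst h2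
      simp only [if_true, h, Ne.symm h, if_false, Pt.act, Pt.map, inv_one, one_mul]
      fin_cases i <;> fin_cases i' <;> ext <;>
        simp [unipGL, E12, Matrix.mul_apply, Fin.sum_univ_two]
    · simp [Pt.map, Pt.act, h, h2, Ne.symm h, Ne.symm h2]

theorem lieHom_y {k : ℕ} (a : Fin (k + 1)) (j : Fin (k + 1)) :
    lieHom k a ((generic k).y j) = TrivSqZeroExt.inl ((generic k).y j) := by
  rw [lieHom, evalPt_y]
  by_cases h : j = a
  · simp only [Pt.map, Pt.act, h, if_true, unipGL_inv]
    ext <;> simp [nil, unipGL, Matrix.mul_apply, Fin.sum_univ_two]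
  · ext <;> simp [Pt.map, Pt.act, h, nil]

theorem fst_lieHom {k : ℕ} (a : Fin (k + 1)) (f : Coord k) :
    TrivSqZeroExt.fst (lieHom k a f) = f := by
  suffices h : (TrivSqZeroExt.fstHom ℂ (Coord k) (Coord k)).comp (lieHom k a) = AlgHom.id ℂ _ from
    DFunLike.congr_fun h f
  apply hom_ext
  · intro i i'; rw [AlgHom.comp_apply, lieHom_X]; split_ifs <;> simp
  · intro j i i'; simp [lieHom_g]
  · intro j; simp [lieHom_y]

/-- The action of `E₁₂`, in the `a`-th factor of `𝔫ᵏ⁺¹`, on functions: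
the derivative of `f(exp(s E₁₂)⁻¹ · z)` at `s = 0`. -/
def lieDer (k : ℕ) (a : Fin (k + 1)) : Derivation ℂ (Coord k) (Coord k) :=
  Derivation.mk' ((TrivSqZeroExt.sndHom (Coord k) (Coord k)).restrictScalars ℂ ∘ₗ
    (lieHom k a).toLinearMap) (by
      intro f g
      simp [fst_lieHom, mul_comm])

theorem lieDer_X {k : ℕ} (a : Fin (k + 1)) :
    (generic k).X.map (lieDer k a) =
      if a = 0 then E12 (Coord k) * (generic k).X - (generic k).X * E12 (Coord k) else 0 := by
  ext i i'
  rw [Matrix.map_apply]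
  simp only [lieDer, Derivation.coe_mk', LinearMap.comp_apply, AlgHom.toLinearMap_apply, lieHom_X]
  split_ifs <;> simp

theorem lieDer_g {k : ℕ} (a : Fin (k + 1)) (j : Fin k) :
    ((generic k).g j).val.map (lieDer k a) =
      (if a = j.castSucc then E12 (Coord k) * ((generic k).g j).val else 0) -
        (if a = j.succ then ((generic k).g j).val * E12 (Coord k) else 0) := by
  ext i i'
  simp [lieDer, lieHom_g]

theorem lieDer_y {k : ℕ} (a : Fin (k + 1)) (j : Fin (k + 1)) :
    lieDer k a ((generic k).y j) = 0 := by
  simp [lieDer, lieHom_y]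

theorem map_mul_deriv {k : ℕ} (d : Derivation ℂ (Coord k) (Coord k)) {m n o : Type} [Fintype n]
    (A : Matrix m n (Coord k)) (B : Matrix n o (Coord k)) :
    (A * B).map d = A.map d * B + A * B.map d := by
  ext i j
  simp only [Matrix.map_apply, Matrix.mul_apply, Matrix.add_apply, map_sum, Derivation.leibniz,
    smul_eq_mul, ← Finset.sum_add_distrib]
  exact Finset.sum_congr rfl fun x _ => by ring

theorem map_E12_deriv {k : ℕ} (d : Derivation ℂ (Coord k) (Coord k)) :
    (E12 (Coord k)).map d = 0 := by
  ext i j; fin_cases i <;> fin_cases j <;> simp [E12]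

theorem lieDer_comm {k : ℕ} (a b : Fin (k + 1)) (f : Coord k) :
    lieDer k a (lieDer k b f) = lieDer k b (lieDer k a f) := by
  rcases eq_or_ne a b with rfl | hab
  · rfl
  obtain ⟨c, hc⟩ : ∃ c : Derivation ℂ (Coord k) (Coord k),
      ∀ x, c x = lieDer k a (lieDer k b x) - lieDer k b (lieDer k a x) :=
    ⟨⁅lieDer k a, lieDer k b⁆, fun x => Derivation.commutator_apply x⟩
  have hM : ∀ {A : Matrix (Fin 2) (Fin 2) (Coord k)},
      (A.map (lieDer k b)).map (lieDer k a) = (A.map (lieDer k a)).map (lieDer k b) →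
      ∀ i i', c (A i i') = 0 := by
    intro A h i i'
    have := congrFun (congrFun h i) i'
    simp only [Matrix.map_apply] at this
    rw [hc, this, sub_self]
  have hsub : ∀ (d : Derivation ℂ (Coord k) (Coord k)) (A B : Matrix (Fin 2) (Fin 2) (Coord k)),
      (A - B).map d = A.map d - B.map d := by
    intro d A B; ext; simp
  have hneg : ∀ (d : Derivation ℂ (Coord k) (Coord k)) (A : Matrix (Fin 2) (Fin 2) (Coord k)),
      (-A).map d = -A.map d := by
    intro d A; ext; simp
  have hzero : ∀ (d : Derivation ℂ (Coord k) (Coord k)),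
      (0 : Matrix (Fin 2) (Fin 2) (Coord k)).map d = 0 := by
    intro d; ext; simp
  have key : c.toLinearMap = 0 := by
    apply deriv_ext (AlgHom.id ℂ _)
    · intro f g
      simp [mul_comm]
    · intro f g; simp
    · intro i i'
      refine hM ?_ i i'
      rw [lieDer_X, lieDer_X]
      by_cases h : a = 0
      · have hb : b ≠ 0 := fun hb => hab (h.trans hb.symm)
        simp only [h, hb, if_true, if_false, hsub, hzero, map_mul_deriv, map_E12_deriv, lieDer_X]
        simp
      · by_cases hb : b = 0
        · simp only [h, hb, if_true, if_false, hsub, hzero, map_mul_deriv, map_E12_deriv, lieDer_X]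
          simp
        · simp [h, hb]
    · intro j i i'
      refine hM ?_ i i'
      rw [lieDer_g, lieDer_g]
      have hj : j.castSucc ≠ j.succ := (Fin.castSucc_lt_succ).ne
      by_cases h1 : a = j.castSucc
      · by_cases h4 : b = j.succ
        · subst h1 h4
          simp [hj, hj.symm, hneg, map_mul_deriv, map_E12_deriv, lieDer_g, mul_assoc]
        · simp [h1, hj, h4, h1 ▸ hab.symm, hzero, map_mul_deriv, map_E12_deriv, lieDer_g]
      · by_cases h2 : a = j.succ
        · by_cases h3 : b = j.castSucc
          · subst h2 h3
            simp [hj, hj.symm, hneg, map_mul_deriv, map_E12_deriv, lieDer_g, mul_assoc]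
          · simp [h2, hj.symm, h3, h2 ▸ hab.symm, hzero, hneg, map_mul_deriv, map_E12_deriv, lieDer_g]
        · by_cases h3 : b = j.castSucc
          · simp [h1, h2, h3, hj, hzero, map_mul_deriv, map_E12_deriv, lieDer_g]
          · by_cases h4 : b = j.succ
            · simp [h1, h2, h4, hj.symm, hzero, hneg, map_mul_deriv, map_E12_deriv, lieDer_g]
            · simp [h1, h2, h3, h4]
    · intro j
      simp [hc, lieDer_y]
  have := LinearMap.congr_fun key f
  exact sub_eq_zero.1 ((hc f).symm.trans this)

theorem lieDer_torusAut {k : ℕ} (a : Fin (k + 1)) (t : Torus k) (f : Coord k) :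
    lieDer k a (torusAut k t f) =
      ((t.1 a 0 * (t.1 a 1)⁻¹ : ℂˣ) : ℂ) • torusAut k t (lieDer k a f) := by
  suffices h : (lieDer k a).toLinearMap ∘ₗ (torusAut k t).toLinearMap =
      ((t.1 a 0 * (t.1 a 1)⁻¹ : ℂˣ) : ℂ) • ((torusAut k t).toLinearMap ∘ₗ (lieDer k a).toLinearMap)
    from LinearMap.congr_fun h f
  have eX : ∀ i i', lieDer k a ((generic k).X i i') = ((generic k).X.map (lieDer k a)) i i' :=
    fun _ _ => rfl
  have eg : ∀ j i i', lieDer k a (((generic k).g j).val i i') =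
    (((generic k).g j).val.map (lieDer k a)) i i' := fun _ _ _ => rfl
  apply deriv_ext (torusAut k t)
  · intro f g
    simp [mul_comm]
  · intro f g
    simp only [LinearMap.smul_apply, LinearMap.comp_apply, AlgHom.toLinearMap_apply,
      Derivation.coeFn_coe, Derivation.leibniz, smul_eq_mul, map_add, map_mul, smul_add,
      mul_smul_comm, smul_mul_assoc]
    rw [mul_comm (torusAut k t g)]
  · intro i i'
    simp only [LinearMap.smul_apply, LinearMap.comp_apply, AlgHom.toLinearMap_apply,
      Derivation.coeFn_coe, torusAut_X, Derivation.map_smul, eX, lieDer_X]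
    by_cases h : a = 0
    · subst h
      fin_cases i <;> fin_cases i' <;>
        simp [E12, Matrix.mul_apply, Fin.sum_univ_two, torusAut_X, Matrix.vecMul, dotProduct, smul_sub,
          smul_smul] <;>
          (first | (congr 1; field_simp; done) | module)
    · simp [h]
  · intro j i i'
    simp only [LinearMap.smul_apply, LinearMap.comp_apply, AlgHom.toLinearMap_apply,
      Derivation.coeFn_coe, torusAut_g, Derivation.map_smul, eg, lieDer_g]
    have hj : j.castSucc ≠ j.succ := (Fin.castSucc_lt_succ).ne
    by_cases h1 : a = j.castSucc
    · subst h1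
      fin_cases i <;> fin_cases i' <;>
        simp [hj, E12, Matrix.mul_apply, Fin.sum_univ_two, torusAut_g, Matrix.vecMul, dotProduct,
          smul_smul] <;>
          (first | (congr 1; field_simp; done) | (congr 2 <;> ring))
    · by_cases h2 : a = j.succ
      · subst h2
        fin_cases i <;> fin_cases i' <;>
          simp [hj.symm, E12, Matrix.mul_apply, Fin.sum_univ_two, torusAut_g, Matrix.vecMul, dotProduct,
            smul_smul] <;>
          (first | (congr 1; field_simp; done) | (congr 2 <;> ring))
      · simp [h1, h2]
  · intro j
    simp [torusAut_y, lieDer_y]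

/-! ### Pullbacks from `𝒳°` to the convolution space -/

/-- `π₁₂(X, Y₁, a, Y₂, b, Y₃) = (X, Y₁, a, Y₂)`. -/
def pt12 {S : Type} [CommRing S] (p : Pt 2 S) : Pt 1 S where
  X := p.X
  g _ := p.g 0
  y := ![p.y 0, p.y 1]

/-- `π₂₃(X, Y₁, a, Y₂, b, Y₃) = (Ad(a)⁻¹ X, Y₂, b, Y₃)`. -/
def pt23 {S : Type} [CommRing S] (p : Pt 2 S) : Pt 1 S where
  X := ((p.g 0)⁻¹ : GL (Fin 2) S).val * p.X * (p.g 0).val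
  g _ := p.g 1
  y := ![p.y 1, p.y 2]

/-- `π₁₃(X, Y₁, a, Y₂, b, Y₃) = (X, Y₁, ab, Y₃)`. -/
def pt13 {S : Type} [CommRing S] (p : Pt 2 S) : Pt 1 S where
  X := p.X
  g _ := p.g 0 * p.g 1
  y := ![p.y 0, p.y 2]

/-- `π₁₂^*` on functions. -/
def pull12 : Coord 1 →ₐ[ℂ] Coord 2 := evalPt (pt12 (generic 2))
/-- `π₂₃^*` on functions. -/
def pull23 : Coord 1 →ₐ[ℂ] Coord 2 := evalPt (pt23 (generic 2))
/-- `π₁₃^*` on functions. -/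
def pull13 : Coord 1 →ₐ[ℂ] Coord 2 := evalPt (pt13 (generic 2))

/-- The potential `Tr (X (Y₁ - Ad(g) Y₂))` at a point. -/
def Pt.potential {S : Type} [CommRing S] (p : Pt 1 S) : S :=
  Matrix.trace (p.X * (nil (p.y 0) -
    (p.g 0).val * nil (p.y 1) * ((p.g 0)⁻¹ : GL (Fin 2) S).val))

/-- The potential `W ∈ ℂ[𝒳°]`. -/
def W : Coord 1 := (generic 1).potential

theorem map_nil {S S' : Type} [CommRing S] [CommRing S'] (f : S →+* S') (y : S) :
    (nil y).map f = nil (f y) := by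
  ext i j; fin_cases i <;> fin_cases j <;> simp [nil]

theorem map_GL_inv {S S' : Type} [CommRing S] [CommRing S'] (f : S →+* S') (g : GL (Fin 2) S) :
    ((g⁻¹ : GL (Fin 2) S).val).map f =
      ((Matrix.GeneralLinearGroup.map f g)⁻¹ : GL (Fin 2) S').val := rfl

theorem map_potential {S S' : Type} [CommRing S] [CommRing S'] (f : S →+* S') (p : Pt 1 S) :
    f p.potential = (p.map f).potential := by
  have h1 : ∀ A : Matrix (Fin 2) (Fin 2) S, f A.trace = (A.map f).trace := by
    intro A; simp [Matrix.trace_fin_two]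
  have hsub : ∀ A B : Matrix (Fin 2) (Fin 2) S, (A - B).map f = A.map f - B.map f := by
    intro A B; ext; simp
  rw [Pt.potential, h1, Matrix.map_mul, hsub, Matrix.map_mul, Matrix.map_mul, map_nil, map_nil,
    map_GL_inv]
  rfl

theorem evalPt_W {S : Type} [CommRing S] [Algebra ℂ S] (p : Pt 1 S) :
    evalPt p W = p.potential := by
  have := map_potential (evalPt p : Coord 1 →+* S) (generic 1)
  rw [evalPt_generic] at this
  exact this

theorem potential_add {S : Type} [CommRing S] (p : Pt 2 S) :
    (pt12 p).potential + (pt23 p).potential = (pt13 p).potential := by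
  simp only [Pt.potential, pt12, pt23, pt13, Matrix.cons_val_zero, Matrix.cons_val_one]
  set X := p.X
  set Y := nil (p.y 1)
  set Z := nil (p.y 2)
  have h : ∀ M : Matrix (Fin 2) (Fin 2) S,
      Matrix.trace (((p.g 0)⁻¹ : GL (Fin 2) S).val * X * (p.g 0).val * M) =
      Matrix.trace (X * ((p.g 0).val * M * ((p.g 0)⁻¹ : GL (Fin 2) S).val)) := by
    intro M
    rw [mul_assoc, mul_assoc, Matrix.trace_mul_comm]
    simp only [mul_assoc]
  rw [h, ← Matrix.trace_add, ← mul_add]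
  congr 2
  simp only [_root_.mul_inv_rev, Units.val_mul]
  noncomm_ring

theorem pull_W : pull12 W + pull23 W = pull13 W := by
  simp only [pull12, pull23, pull13, evalPt_W, potential_add]

/-- The projections `T³ × T_sc → T² × T_sc`. -/
def tor12 (t : Torus 2) : Torus 1 := (![t.1 0, t.1 1], t.2)
/-- The projection to the last two factors. -/
def tor23 (t : Torus 2) : Torus 1 := (![t.1 1, t.1 2], t.2)
/-- The projection to the outer factors. -/
def tor13 (t : Torus 2) : Torus 1 := (![t.1 0, t.1 2], t.2)

theorem evalPt_comp {k l : ℕ} {S : Type} [CommRing S] [Algebra ℂ S] (φ : Coord l →ₐ[ℂ] S)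
    (p : Pt k (Coord l)) (f : Coord k) : φ (evalPt p f) = evalPt (p.map (φ : Coord l →+* S)) f := by
  suffices h : φ.comp (evalPt p) = evalPt (p.map (φ : Coord l →+* S)) from DFunLike.congr_fun h f
  apply hom_ext
  · intro i i'; simp [evalPt_X, Pt.map]
  · intro i i'; simp [evalPt_g, Pt.map]
  · intro i; simp [evalPt_y, Pt.map]

theorem map_torus {k : ℕ} {S S' : Type} [CommRing S] [CommRing S'] [Algebra ℂ S] [Algebra ℂ S']
    (φ : S →ₐ[ℂ] S') (t : Torus k) (p : Pt k S) :
    (p.torus t).map (φ : S →+* S') = (p.map (φ : S →+* S')).torus t := by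
  ext i i'
  · simp [Pt.torus, Pt.act, Pt.map, -Matrix.coe_units_inv, diagGL,
      Matrix.mul_diagonal, Matrix.diagonal_mul, scal]
  · simp [Pt.torus, Pt.act, Pt.map, -Matrix.coe_units_inv, diagGL,
      Matrix.mul_diagonal, Matrix.diagonal_mul, scal]
  · simp [Pt.torus, Pt.act, Pt.map, -Matrix.coe_units_inv, diagGL,
      Matrix.mul_diagonal, Matrix.diagonal_mul, scal, nil]

theorem pt12_act {S : Type} [CommRing S] (b : Fin 3 → GL (Fin 2) S) (l m : Sˣ) (p : Pt 2 S) :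
    pt12 (p.act b l m) = (pt12 p).act ![b 0, b 1] l m := by
  ext i i'
  · simp [pt12, Pt.act]
  · fin_cases i; simp [pt12, Pt.act]
  · fin_cases i <;> simp [pt12, Pt.act]

theorem pt13_act {S : Type} [CommRing S] (b : Fin 3 → GL (Fin 2) S) (l m : Sˣ) (p : Pt 2 S) :
    pt13 (p.act b l m) = (pt13 p).act ![b 0, b 2] l m := by
  have h : ∀ j, (p.act b l m).g j = (b j.castSucc)⁻¹ * p.g j * b j.succ := fun _ => rfl
  apply Pt.ext
  · simp [pt13, Pt.act]
  · funext j
    fin_cases j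
    simp [pt13, Pt.act, mul_assoc]
  · funext i; fin_cases i <;> simp [pt13, Pt.act]

theorem pt23_act {S : Type} [CommRing S] (b : Fin 3 → GL (Fin 2) S) (l m : Sˣ) (p : Pt 2 S) :
    pt23 (p.act b l m) = (pt23 p).act ![b 1, b 2] l m := by
  apply Pt.ext
  · have h1 : (b 0).val * ((b 0)⁻¹ : GL (Fin 2) S).val = 1 := by
      rw [← Units.val_mul, mul_inv_cancel, Units.val_one]
    have h2 : ∀ M, (b 0).val * (((b 0)⁻¹ : GL (Fin 2) S).val * M) = M := by
      intro M; rw [← mul_assoc, h1, one_mul]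
    simp only [pt23, Pt.act, Fin.castSucc_zero, Fin.succ_zero_eq_one, _root_.mul_inv_rev, inv_inv,
      Units.val_mul, mul_smul_comm, smul_mul_assoc, mul_assoc, h2, Matrix.cons_val_zero]
  · funext j
    fin_cases j
    simp [pt23, Pt.act]
  · funext i; fin_cases i <;> simp [pt23, Pt.act]

theorem torus_pull12 (t : Torus 2) (f : Coord 1) :
    torusAut 2 t (pull12 f) = pull12 (torusAut 1 (tor12 t) f) := by
  rw [pull12, torusAut, torusAut, evalPt_comp, evalPt_comp, map_torus, evalPt_generic]
  have : (pt12 (generic 2)).map (evalPt ((generic 2).torus t⁻¹) : Coord 2 →+* Coord 2) =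
      pt12 ((generic 2).map (evalPt ((generic 2).torus t⁻¹) : Coord 2 →+* Coord 2)) := by
    ext i i'
    · rfl
    · rfl
    · fin_cases i <;> rfl
  rw [this, evalPt_generic, Pt.torus, pt12_act, Pt.torus]
  refine congrArg (fun b => evalPt (Pt.act b _ _ _) f) ?_
  funext i; fin_cases i <;> rfl

theorem torus_pull13 (t : Torus 2) (f : Coord 1) :
    torusAut 2 t (pull13 f) = pull13 (torusAut 1 (tor13 t) f) := by
  rw [pull13, torusAut, torusAut, evalPt_comp, evalPt_comp, map_torus, evalPt_generic]
  have : (pt13 (generic 2)).map (evalPt ((generic 2).torus t⁻¹) : Coord 2 →+* Coord 2) =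
      pt13 ((generic 2).map (evalPt ((generic 2).torus t⁻¹) : Coord 2 →+* Coord 2)) := by
    apply Pt.ext
    · rfl
    · funext i; simp [pt13, Pt.map]
    · funext i; fin_cases i <;> rfl
  rw [this, evalPt_generic, Pt.torus, pt13_act, Pt.torus]
  refine congrArg (fun b => evalPt (Pt.act b _ _ _) f) ?_
  funext i; fin_cases i <;> rfl

theorem torus_pull23 (t : Torus 2) (f : Coord 1) :
    torusAut 2 t (pull23 f) = pull23 (torusAut 1 (tor23 t) f) := by
  rw [pull23, torusAut, torusAut, evalPt_comp, evalPt_comp, map_torus, evalPt_generic]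
  have : (pt23 (generic 2)).map (evalPt ((generic 2).torus t⁻¹) : Coord 2 →+* Coord 2) =
      pt23 ((generic 2).map (evalPt ((generic 2).torus t⁻¹) : Coord 2 →+* Coord 2)) := by
    apply Pt.ext
    · simp only [pt23, Pt.map, Matrix.map_mul, map_GL_inv]
      rfl
    · funext i; simp [pt23, Pt.map]
    · funext i; fin_cases i <;> rfl
  rw [this, evalPt_generic, Pt.torus, pt23_act, Pt.torus]
  refine congrArg (fun b => evalPt (Pt.act b _ _ _) f) ?_
  funext i; fin_cases i <;> rfl

/-- A derivation of `ℂ[𝒳_con]` restricted along `π` agrees with a given map if it does so on the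
coordinates. -/
theorem lie_pull (φ : Coord 1 →ₐ[ℂ] Coord 2) (d : Derivation ℂ (Coord 2) (Coord 2))
    (d' : Derivation ℂ (Coord 1) (Coord 1))
    (hX : ((generic 1).X.map φ).map d = ((generic 1).X.map d').map φ)
    (hg : (((generic 1).g 0).val.map φ).map d = (((generic 1).g 0).val.map d').map φ)
    (hy : ∀ j, d (φ ((generic 1).y j)) = φ (d' ((generic 1).y j))) (f : Coord 1) :
    d (φ f) = φ (d' f) := by
  suffices h : d.toLinearMap ∘ₗ φ.toLinearMap = φ.toLinearMap ∘ₗ d'.toLinearMap from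
    LinearMap.congr_fun h f
  apply deriv_ext φ
  · intro a b; simp [mul_comm]
  · intro a b; simp [mul_comm]
  · intro i i'; exact congrFun (congrFun hX i) i'
  · intro j i i'
    have : j = 0 := Subsingleton.elim _ _
    subst this
    exact congrFun (congrFun hg i) i'
  · exact hy

theorem map_pull12 : ((generic 1).map (pull12 : Coord 1 →+* Coord 2)) = pt12 (generic 2) :=
  evalPt_generic _
theorem map_pull23 : ((generic 1).map (pull23 : Coord 1 →+* Coord 2)) = pt23 (generic 2) :=
  evalPt_generic _
theorem map_pull13 : ((generic 1).map (pull13 : Coord 1 →+* Coord 2)) = pt13 (generic 2) :=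
  evalPt_generic _

theorem map_sub_hom {k l : ℕ} (φ : Coord k →ₐ[ℂ] Coord l) (A B : Matrix (Fin 2) (Fin 2) (Coord k)) :
    (A - B).map φ = A.map φ - B.map φ := by ext; simp
theorem map_mul_hom {k l : ℕ} (φ : Coord k →ₐ[ℂ] Coord l) (A B : Matrix (Fin 2) (Fin 2) (Coord k)) :
    (A * B).map φ = A.map φ * B.map φ := by
  ext; simp [Matrix.mul_apply]
theorem map_zero_hom {k l : ℕ} (φ : Coord k →ₐ[ℂ] Coord l) :
    (0 : Matrix (Fin 2) (Fin 2) (Coord k)).map φ = 0 := by ext; simp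
theorem map_neg_hom {k l : ℕ} (φ : Coord k →ₐ[ℂ] Coord l) (A : Matrix (Fin 2) (Fin 2) (Coord k)) :
    (-A).map φ = -A.map φ := by ext; simp
theorem map_E12_hom {k l : ℕ} (φ : Coord k →ₐ[ℂ] Coord l) :
    (E12 (Coord k)).map φ = E12 (Coord l) := by
  ext i j; fin_cases i <;> fin_cases j <;> simp [E12]

theorem pull12_X : (generic 1).X.map pull12 = (generic 2).X := congrArg Pt.X map_pull12
theorem pull13_X : (generic 1).X.map pull13 = (generic 2).X := congrArg Pt.X map_pull13
theorem pull23_X : (generic 1).X.map pull23 =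
    (((generic 2).g 0)⁻¹ : GL (Fin 2) (Coord 2)).val * (generic 2).X * ((generic 2).g 0).val :=
  congrArg Pt.X map_pull23
theorem pull12_g : ((generic 1).g 0).val.map pull12 = ((generic 2).g 0).val :=
  congrArg (fun p => (p.g 0).val) map_pull12
theorem pull23_g : ((generic 1).g 0).val.map pull23 = ((generic 2).g 1).val :=
  congrArg (fun p => (p.g 0).val) map_pull23
theorem pull13_g : ((generic 1).g 0).val.map pull13 =
    ((generic 2).g 0).val * ((generic 2).g 1).val :=
  congrArg (fun p => (p.g 0).val) map_pull13

theorem lieDer_pull_y (φ : Coord 1 →ₐ[ℂ] Coord 2) (a : Fin 3) (d' : Derivation ℂ (Coord 1) (Coord 1))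
    (h : φ = pull12 ∨ φ = pull23 ∨ φ = pull13) (hd : ∀ j, d' ((generic 1).y j) = 0) (j : Fin 2) :
    lieDer 2 a (φ ((generic 1).y j)) = φ (d' ((generic 1).y j)) := by
  rw [hd, map_zero]
  rcases h with rfl | rfl | rfl
  · have := congrFun (congrArg Pt.y map_pull12) j
    simp only [Pt.map, RingHom.coe_coe, pt12] at this
    rw [this]; fin_cases j <;> simp [lieDer_y]
  · have := congrFun (congrArg Pt.y map_pull23) j
    simp only [Pt.map, RingHom.coe_coe, pt23] at this
    rw [this]; fin_cases j <;> simp [lieDer_y]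
  · have := congrFun (congrArg Pt.y map_pull13) j
    simp only [Pt.map, RingHom.coe_coe, pt13] at this
    rw [this]; fin_cases j <;> simp [lieDer_y]

theorem zero_deriv_y (j : Fin 2) : (0 : Derivation ℂ (Coord 1) (Coord 1)) ((generic 1).y j) = 0 := rfl

theorem map_zero_deriv {k : ℕ} (A : Matrix (Fin 2) (Fin 2) (Coord k)) :
    A.map (0 : Derivation ℂ (Coord k) (Coord k)) = 0 := by ext; simp

theorem lie_pull12_0 (f : Coord 1) : lieDer 2 0 (pull12 f) = pull12 (lieDer 1 0 f) :=
  lie_pull _ _ _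
    (by rw [pull12_X, lieDer_X, lieDer_X, if_pos rfl, if_pos rfl, map_sub_hom, map_mul_hom,
          map_mul_hom, map_E12_hom, pull12_X])
    (by rw [pull12_g, lieDer_g, lieDer_g]; simp [map_mul_hom, map_E12_hom, pull12_g])
    (lieDer_pull_y _ _ _ (by simp) (lieDer_y _)) f

theorem lie_pull12_1 (f : Coord 1) : lieDer 2 1 (pull12 f) = pull12 (lieDer 1 1 f) :=
  lie_pull _ _ _
    (by rw [pull12_X, lieDer_X, lieDer_X]; simp [map_zero_hom])
    (by rw [pull12_g, lieDer_g, lieDer_g]; simp [map_neg_hom, map_mul_hom, map_E12_hom, pull12_g])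
    (lieDer_pull_y _ _ _ (by simp) (lieDer_y _)) f

theorem lie_pull12_2 (f : Coord 1) : lieDer 2 2 (pull12 f) = 0 := by
  rw [lie_pull pull12 (lieDer 2 2) 0
    (by rw [pull12_X, lieDer_X, map_zero_deriv]; simp [map_zero_hom])
    (by rw [pull12_g, lieDer_g, map_zero_deriv]; simp [map_zero_hom])
    (lieDer_pull_y _ _ _ (by simp) zero_deriv_y) f]
  simp

theorem lie_pull13_0 (f : Coord 1) : lieDer 2 0 (pull13 f) = pull13 (lieDer 1 0 f) :=
  lie_pull _ _ _
    (by rw [pull13_X, lieDer_X, lieDer_X, if_pos rfl, if_pos rfl, map_sub_hom, map_mul_hom,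
          map_mul_hom, map_E12_hom, pull13_X])
    (by rw [pull13_g, map_mul_deriv, lieDer_g, lieDer_g, lieDer_g]
        simp [map_mul_hom, map_E12_hom, pull13_g, mul_assoc])
    (lieDer_pull_y _ _ _ (by simp) (lieDer_y _)) f

theorem lie_pull13_1 (f : Coord 1) : lieDer 2 1 (pull13 f) = 0 := by
  rw [lie_pull pull13 (lieDer 2 1) 0
    (by rw [pull13_X, lieDer_X, map_zero_deriv]; simp [map_zero_hom])
    (by rw [pull13_g, map_mul_deriv, lieDer_g, lieDer_g, map_zero_deriv]
        simp [map_zero_hom, mul_assoc])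
    (lieDer_pull_y _ _ _ (by simp) zero_deriv_y) f]
  simp

theorem lie_pull13_2 (f : Coord 1) : lieDer 2 2 (pull13 f) = pull13 (lieDer 1 1 f) :=
  lie_pull _ _ _
    (by rw [pull13_X, lieDer_X, lieDer_X]; simp [map_zero_hom])
    (by rw [pull13_g, map_mul_deriv, lieDer_g, lieDer_g, lieDer_g]
        simp [map_neg_hom, map_mul_hom, map_E12_hom, pull13_g, mul_assoc])
    (lieDer_pull_y _ _ _ (by simp) (lieDer_y _)) f

/-- The derivative of `Ad(a)⁻¹ X`. -/
theorem lieDer_pull23_X (c : Fin 3) :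
    (((generic 2).g 0)⁻¹.val * (generic 2).X * ((generic 2).g 0).val).map (lieDer 2 c) =
      ((generic 2).g 0)⁻¹.val * ((generic 2).X.map (lieDer 2 c) * ((generic 2).g 0).val +
        (generic 2).X * ((generic 2).g 0).val.map (lieDer 2 c) -
        ((generic 2).g 0).val.map (lieDer 2 c) *
          (((generic 2).g 0)⁻¹.val * (generic 2).X * ((generic 2).g 0).val)) := by
  set a := (generic 2).g 0
  set X := (generic 2).X
  have h1 : a⁻¹.val * a.val = 1 := by rw [← Units.val_mul, inv_mul_cancel, Units.val_one]
  have h2 : a.val * a⁻¹.val = 1 := by rw [← Units.val_mul, mul_inv_cancel, Units.val_one]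
  have h3 : (a.val * (a⁻¹.val * X * a.val)).map (lieDer 2 c) = (X * a.val).map (lieDer 2 c) := by
    congr 1
    rw [← mul_assoc, ← mul_assoc, h2, one_mul]
  rw [map_mul_deriv, map_mul_deriv _ X] at h3
  have h4 : a.val * (a⁻¹.val * X * a.val).map (lieDer 2 c) =
      X.map (lieDer 2 c) * a.val + X * a.val.map (lieDer 2 c) -
        a.val.map (lieDer 2 c) * (a⁻¹.val * X * a.val) := by
    rw [← h3]; abel
  rw [← h4, ← mul_assoc, h1, one_mul]

theorem lie_pull23_0 (f : Coord 1) : lieDer 2 0 (pull23 f) = 0 := by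
  have h2 : ((generic 2).g 0).val * ((generic 2).g 0)⁻¹.val = 1 := by
    rw [← Units.val_mul, mul_inv_cancel, Units.val_one]
  have h3 : ∀ M, ((generic 2).g 0).val * (((generic 2).g 0)⁻¹.val * M) = M := by
    intro M; rw [← mul_assoc, h2, one_mul]
  rw [lie_pull pull23 (lieDer 2 0) 0
    (by
      rw [pull23_X, lieDer_pull23_X, lieDer_X, lieDer_g, map_zero_deriv, map_zero_hom]
      simp only [if_true, Fin.castSucc_zero, Fin.succ_zero_eq_one, zero_ne_one, if_false, sub_zero,
        mul_assoc, h3, sub_mul]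
      rw [sub_add_cancel, sub_self, mul_zero])
    (by rw [pull23_g, lieDer_g, map_zero_deriv]; simp [map_zero_hom])
    (lieDer_pull_y _ _ _ (by simp) zero_deriv_y) f]
  simp

theorem lie_pull23_1 (f : Coord 1) : lieDer 2 1 (pull23 f) = pull23 (lieDer 1 0 f) := by
  have h1 : ((generic 2).g 0)⁻¹.val * ((generic 2).g 0).val = 1 := by
    rw [← Units.val_mul, inv_mul_cancel, Units.val_one]
  have h3 : ∀ M, ((generic 2).g 0)⁻¹.val * (((generic 2).g 0).val * M) = M := by
    intro M; rw [← mul_assoc, h1, one_mul]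
  exact lie_pull _ _ _
    (by
      rw [pull23_X, lieDer_pull23_X, lieDer_X, lieDer_g, lieDer_X, if_pos rfl, map_sub_hom,
        map_mul_hom, map_mul_hom, map_E12_hom, pull23_X]
      simp only [if_true, Fin.castSucc_zero, Fin.succ_zero_eq_one, one_ne_zero, if_false, zero_sub,
        zero_mul, zero_add, mul_neg, neg_mul, sub_neg_eq_add, mul_add, mul_assoc, h3]
      abel)
    (by rw [pull23_g, lieDer_g, lieDer_g]; simp [map_mul_hom, map_E12_hom, pull23_g])
    (lieDer_pull_y _ _ _ (by simp) (lieDer_y _)) f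

theorem lie_pull23_2 (f : Coord 1) : lieDer 2 2 (pull23 f) = pull23 (lieDer 1 1 f) :=
  lie_pull _ _ _
    (by
      rw [pull23_X, lieDer_pull23_X, lieDer_X, lieDer_g, lieDer_X]
      simp [map_zero_hom])
    (by rw [pull23_g, lieDer_g, lieDer_g]; simp [map_neg_hom, map_mul_hom, map_E12_hom, pull23_g])
    (lieDer_pull_y _ _ _ (by simp) (lieDer_y _)) f

/-! ### Weakly `U²`-equivariant, strongly `T² × T_sc`-equivariant factorizations -/

/-- The root `t ↦ t_{a,1} / t_{a,2}` of the `a`-th torus factor. -/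
def root (k : ℕ) (a : Fin (k + 1)) : Torus k →* ℂˣ where
  toFun t := t.1 a 0 * (t.1 a 1)⁻¹
  map_one' := by simp
  map_mul' s t := by
    simp only [Prod.fst_mul, Pi.mul_apply, mul_inv]
    ac_rfl

/-- The character `t ↦ t_{a,i}` of the `a`-th torus factor (`χ₁` for `i = 0`, `χ₂` for `i = 1`). -/
def chi (k : ℕ) (a : Fin (k + 1)) (i : Fin 2) : Torus k →* ℂˣ where
  toFun t := t.1 a i
  map_one' := rfl
  map_mul' _ _ := rfl

/-- The tautological character of `ℂ*_a`. -/
def chiQ (k : ℕ) : Torus k →* ℂˣ where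
  toFun t := t.2.1
  map_one' := rfl
  map_mul' _ _ := rfl

/-- The tautological character of `ℂ*_t`. -/
def chiT (k : ℕ) : Torus k →* ℂˣ where
  toFun t := t.2.2
  map_one' := rfl
  map_mul' _ _ := rfl

/-- Multiplication by a complex scalar in a module over the coordinate ring. -/
def csmul {M : Type} [AddCommGroup M] [Module (Coord 1) M] (c : ℂˣ) (m : M) : M :=
  algebraMap ℂ (Coord 1) (c : ℂ) • m

/-- The total differential `D + e₀ ∇₀ + e₁ ∇₁ + e₀ e₁ E` on `M ⊗ Λ(e₀, e₁)`, where
`(m, m₀, m₁, m₀₁)` stands for `m + e₀ m₀ + e₁ m₁ + e₀ e₁ m₀₁`; it anticommutes with `e₀, e₁`. -/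
def totD {M : Type} [AddCommGroup M] (D N₀ N₁ E : M → M) (m : M × M × M × M) : M × M × M × M :=
  (D m.1, N₀ m.1 - D m.2.1, N₁ m.1 - D m.2.2.1,
    E m.1 - N₁ m.2.1 + N₀ m.2.2.1 + D m.2.2.2)

/-- A `W`-factorization on `𝒳° = 𝔤𝔩₂ × GL₂ × 𝔫 × 𝔫` which is strongly equivariant for the torus
`T² × T_sc` and weakly equivariant for `U²`. It consists of a `ℤ/2`-graded `ℂ[𝒳°]`-module `M` (`par` is
the parity operator, with eigenvalues `1` on even and `-1` on odd elements) with a torus action `ρ`, an odd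
differential `D` of weight `1` for `ℂ*_t` and weight `0` for the rest of the torus, and Chevalley-Eilenberg
correction terms: `nabla a` is the sum of the action of the `a`-th copy of `𝔫 = Lie U` and of a
`ℂ[𝒳°]`-linear correction `∂_a`, and `corr` is the correction in the direction `e₀ e₁ ∈ Λ²(𝔫²)^*`. They
have to satisfy `D_tot ^ 2 = W` for `D_tot = D + e₀ ∇₀ + e₁ ∇₁ + e₀ e₁ corr` on `M ⊗ Λ(𝔫²)^*`. -/
structure WMF where
  M : Type
  [addCommGroup : AddCommGroup M]
  [module : Module (Coord 1) M]
  par : M →ₗ[Coord 1] M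
  ρ : Torus 1 →* AddMonoid.End M
  D : M →ₗ[Coord 1] M
  nabla : Fin 2 → M →+ M
  corr : M →ₗ[Coord 1] M
  par_par : ∀ m, par (par m) = m
  par_ρ : ∀ t m, par (ρ t m) = ρ t (par m)
  par_D : ∀ m, par (D m) = -D (par m)
  par_nabla : ∀ a m, par (nabla a m) = nabla a (par m)
  par_corr : ∀ m, par (corr m) = -corr (par m)
  ρ_smul : ∀ t (f : Coord 1) m, ρ t (f • m) = torusAut 1 t f • ρ t m
  nabla_smul : ∀ a (f : Coord 1) m, nabla a (f • m) = lieDer 1 a f • m + f • nabla a m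
  D_ρ : ∀ t m, D (ρ t m) = csmul (chiT 1 t) (ρ t (D m))
  nabla_ρ : ∀ a t m, nabla a (ρ t m) = csmul (root 1 a t) (ρ t (nabla a m))
  corr_ρ : ∀ t m, corr (ρ t m) =
    csmul (root 1 0 t * root 1 1 t * (chiT 1 t)⁻¹) (ρ t (corr m))
  sq : ∀ m, totD D (nabla 0) (nabla 1) corr (totD D (nabla 0) (nabla 1) corr m) = W • m

attribute [instance] WMF.addCommGroup WMF.module

namespace WMF

/-- `M ⊗ Λ(e₀, e₁)`. -/
abbrev Tot (P : WMF) : Type := P.M × P.M × P.M × P.M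

/-- The total differential. -/
def dTot (P : WMF) : P.Tot → P.Tot := totD P.D (P.nabla 0) (P.nabla 1) P.corr

/-- Left multiplication by `e₀`. -/
def e₀ (P : WMF) (m : P.Tot) : P.Tot := (0, m.1, 0, m.2.2.1)

/-- Left multiplication by `e₁`. -/
def e₁ (P : WMF) (m : P.Tot) : P.Tot := (0, 0, m.1, -m.2.1)

/-- The parity operator; `e₀, e₁` are odd. -/
def parTot (P : WMF) (m : P.Tot) : P.Tot :=
  (P.par m.1, -P.par m.2.1, -P.par m.2.2.1, P.par m.2.2.2)

/-- The torus action; `e_a` has weight `root a - [ℂ*_t]`. -/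
def ρTot (P : WMF) (t : Torus 1) (m : P.Tot) : P.Tot :=
  (P.ρ t m.1, csmul (root 1 0 t * (chiT 1 t)⁻¹) (P.ρ t m.2.1),
    csmul (root 1 1 t * (chiT 1 t)⁻¹) (P.ρ t m.2.2.1),
    csmul (root 1 0 t * root 1 1 t * (chiT 1 t)⁻¹ ^ 2) (P.ρ t m.2.2.2))

/-- Closed morphisms: even maps of `Λ(𝔫²)^* ⊗ ℂ[𝒳°]`-modules which commute with the torus action and
with the total differentials. -/
structure IsHom (P Q : WMF) (f : P.Tot →ₗ[Coord 1] Q.Tot) : Prop where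
  e₀ : ∀ m, f (P.e₀ m) = Q.e₀ (f m)
  e₁ : ∀ m, f (P.e₁ m) = Q.e₁ (f m)
  par : ∀ m, f (P.parTot m) = Q.parTot (f m)
  ρ : ∀ t m, f (P.ρTot t m) = Q.ρTot t (f m)
  d : ∀ m, f (P.dTot m) = Q.dTot (f m)

/-- Homotopies: odd maps of `Λ(𝔫²)^* ⊗ ℂ[𝒳°]`-modules, of weight `-1` for `ℂ*_t`. -/
structure IsHtpy (P Q : WMF) (h : P.Tot →ₗ[Coord 1] Q.Tot) : Prop where
  e₀ : ∀ m, h (P.e₀ m) = -Q.e₀ (h m)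
  e₁ : ∀ m, h (P.e₁ m) = -Q.e₁ (h m)
  par : ∀ m, h (P.parTot m) = -Q.parTot (h m)
  ρ : ∀ t m, h (P.ρTot t m) = csmul (chiT 1 t)⁻¹ (Q.ρTot t (h m))

/-- Equality of morphisms in the homotopy category. -/
def Homotopic (P Q : WMF) (f g : P.Tot →ₗ[Coord 1] Q.Tot) : Prop :=
  ∃ h : P.Tot →ₗ[Coord 1] Q.Tot, IsHtpy P Q h ∧ ∀ m, f m - g m = Q.dTot (h m) + h (P.dTot m)

/-- Isomorphism in the homotopy category of matrix factorizations. -/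
def Isomorphic (P Q : WMF) : Prop :=
  ∃ (f : P.Tot →ₗ[Coord 1] Q.Tot) (g : Q.Tot →ₗ[Coord 1] P.Tot),
    IsHom P Q f ∧ IsHom Q P g ∧
    Homotopic P P (g ∘ₗ f) LinearMap.id ∧ Homotopic Q Q (f ∘ₗ g) LinearMap.id

end WMF

/-! ### Operators on free modules -/

/-- The operator `v ↦ ∂_a v + A v`. -/
def cov {k : ℕ} {I : Type} [Fintype I] (a : Fin (k + 1)) (A : Matrix I I (Coord k)) :
    (I → Coord k) →+ (I → Coord k) where
  toFun v := (fun i => lieDer k a (v i)) + A *ᵥ v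
  map_zero' := by ext; simp
  map_add' v w := by ext; simp [Matrix.mulVec_add]; ring

/-- The torus action on a free module whose basis vectors have the weights `w`. -/
def tw {k : ℕ} {I : Type} (w : I → Torus k →* ℂˣ) : Torus k →* AddMonoid.End (I → Coord k) where
  toFun t :=
    { toFun := fun v i => ((w i t : ℂˣ) : ℂ) • torusAut k t (v i)
      map_zero' := by ext; simp
      map_add' := fun v w => by ext; simp }
  map_one' := by
    refine AddMonoidHom.ext fun v => funext fun i => ?_
    change ((w i 1 : ℂˣ) : ℂ) • torusAut k 1 (v i) = v i
    simp [torusAut_one]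
  map_mul' s t := by
    refine AddMonoidHom.ext fun v => funext fun i => ?_
    change ((w i (s * t) : ℂˣ) : ℂ) • torusAut k (s * t) (v i) =
      ((w i s : ℂˣ) : ℂ) • torusAut k s (((w i t : ℂˣ) : ℂ) • torusAut k t (v i))
    simp [torusAut_mul, smul_smul]

theorem tw_apply {k : ℕ} {I : Type} (w : I → Torus k →* ℂˣ) (t : Torus k) (v : I → Coord k) (i : I) :
    tw w t v i = ((w i t : ℂˣ) : ℂ) • torusAut k t (v i) := rfl

theorem cov_smul {k : ℕ} {I : Type} [Fintype I] (a : Fin (k + 1)) (A : Matrix I I (Coord k))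
    (f : Coord k) (v : I → Coord k) : cov a A (f • v) = lieDer k a f • v + f • cov a A v := by
  ext i
  simp [cov, Matrix.mulVec_smul]
  ring

theorem mulVec_cov {k : ℕ} {I : Type} [Fintype I] (a : Fin (k + 1)) (A D : Matrix I I (Coord k))
    (h : D * A = D.map (lieDer k a) + A * D) (v : I → Coord k) :
    D *ᵥ cov a A v = cov a A (D *ᵥ v) := by
  have h1 : (fun i => lieDer k a ((D *ᵥ v) i)) =
      D.map (lieDer k a) *ᵥ v + D *ᵥ fun i => lieDer k a (v i) := by
    ext i
    simp only [Matrix.mulVec, dotProduct, map_sum, Derivation.leibniz, smul_eq_mul, Pi.add_apply,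
      Matrix.map_apply, ← Finset.sum_add_distrib]
    exact Finset.sum_congr rfl fun j _ => by ring
  change D *ᵥ ((fun i => lieDer k a (v i)) + A *ᵥ v) =
    (fun i => lieDer k a ((D *ᵥ v) i)) + A *ᵥ (D *ᵥ v)
  rw [h1, Matrix.mulVec_add, Matrix.mulVec_mulVec, h, Matrix.mulVec_mulVec, Matrix.add_mulVec]
  abel

theorem cov_comm {k : ℕ} {I : Type} [Fintype I] (a b : Fin (k + 1)) (A B : Matrix I I (Coord k))
    (v : I → Coord k) : cov a A (cov b B v) - cov b B (cov a A v) =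
      (B.map (lieDer k a) - A.map (lieDer k b) + A * B - B * A) *ᵥ v := by
  have h1 : ∀ (c : Fin (k + 1)) (D : Matrix I I (Coord k)), (fun i => lieDer k c ((D *ᵥ v) i)) =
      D.map (lieDer k c) *ᵥ v + D *ᵥ fun i => lieDer k c (v i) := by
    intro c D
    ext i
    simp only [Matrix.mulVec, dotProduct, map_sum, Derivation.leibniz, smul_eq_mul, Pi.add_apply,
      Matrix.map_apply, ← Finset.sum_add_distrib]
    exact Finset.sum_congr rfl fun j _ => by ring
  have h2 : ∀ (c d : Fin (k + 1)) (C D : Matrix I I (Coord k)), cov c C (cov d D v) =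
      (fun i => lieDer k c (lieDer k d (v i))) + (D.map (lieDer k c) *ᵥ v +
        D *ᵥ fun i => lieDer k c (v i)) + (C *ᵥ (fun i => lieDer k d (v i)) + (C * D) *ᵥ v) := by
    intro c d C D
    rw [← h1, ← Matrix.mulVec_mulVec, ← Matrix.mulVec_add]
    ext i
    simp [cov]
  rw [h2, h2]
  have h3 : (fun i => lieDer k b (lieDer k a (v i))) = fun i => lieDer k a (lieDer k b (v i)) := by
    ext i; exact lieDer_comm _ _ _
  rw [h3, Matrix.sub_mulVec, Matrix.add_mulVec, Matrix.sub_mulVec]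
  abel

theorem mulVec_tw {k : ℕ} {I : Type} [Fintype I] (w : I → Torus k →* ℂˣ) (D : Matrix I I (Coord k))
    (t : Torus k) (c : ℂˣ)
    (h : ∀ i j, ((w j t : ℂˣ) : ℂ) • D i j = ((c * w i t : ℂˣ) : ℂ) • torusAut k t (D i j))
    (v : I → Coord k) : D *ᵥ tw w t v = (c : ℂ) • tw w t (D *ᵥ v) := by
  ext i
  simp only [Matrix.mulVec, dotProduct, tw_apply, Pi.smul_apply, map_sum, map_mul, Finset.smul_sum,
    smul_smul, ← Units.val_mul]
  refine Finset.sum_congr rfl fun j _ => ?_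
  rw [mul_smul_comm, ← smul_mul_assoc, h, smul_mul_assoc]

theorem cov_tw {k : ℕ} {I : Type} [Fintype I] (w : I → Torus k →* ℂˣ) (a : Fin (k + 1))
    (A : Matrix I I (Coord k)) (t : Torus k)
    (h : ∀ i j, ((w j t : ℂˣ) : ℂ) • A i j = ((root k a t * w i t : ℂˣ) : ℂ) • torusAut k t (A i j))
    (v : I → Coord k) : cov a A (tw w t v) = (root k a t : ℂ) • tw w t (cov a A v) := by
  have h1 := mulVec_tw w A t (root k a t) h v
  have h2 : (fun i => lieDer k a (tw w t v i)) =
      (root k a t : ℂ) • tw w t (fun i => lieDer k a (v i)) := by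
    ext i
    simp only [tw_apply, Derivation.map_smul, lieDer_torusAut, Pi.smul_apply, root, MonoidHom.coe_mk,
      OneHom.coe_mk]
    rw [smul_comm]
  change (fun i => lieDer k a (tw w t v i)) + A *ᵥ tw w t v = _
  rw [h1, h2, ← smul_add, ← map_add]
  rfl

theorem tw_smul {k : ℕ} {I : Type} (w : I → Torus k →* ℂˣ) (t : Torus k) (f : Coord k)
    (v : I → Coord k) : tw w t (f • v) = torusAut k t f • tw w t v := by
  ext i
  simp [tw_apply]

theorem tw_csmul {k : ℕ} {I : Type} (w : I → Torus k →* ℂˣ) (t : Torus k) (c : ℂ)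
    (v : I → Coord k) : tw w t (c • v) = c • tw w t v := by
  ext i
  simp [tw_apply, smul_comm c]

theorem csmul_eq {I : Type} (c : ℂˣ) (v : I → Coord 1) : csmul c v = (c : ℂ) • v := by
  simp [csmul, algebraMap_smul]

/-- The signs of a `ℤ/2`-graded basis as a diagonal matrix. -/
def signMat {k : ℕ} {I : Type} [DecidableEq I] (s : I → ℤˣ) : Matrix I I (Coord k) :=
  Matrix.diagonal fun i => (((s i : ℤˣ) : ℤ) : Coord k)

theorem signMat_sq {k : ℕ} {I : Type} [Fintype I] [DecidableEq I] (s : I → ℤˣ) :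
    (signMat s * signMat s : Matrix I I (Coord k)) = 1 := by
  rw [signMat, Matrix.diagonal_mul_diagonal, ← Matrix.diagonal_one]
  congr 1
  funext i
  rcases Int.units_eq_one_or (s i) with h | h <;> simp [h]

theorem signMat_odd {k : ℕ} {I : Type} [Fintype I] [DecidableEq I] (s : I → ℤˣ)
    (D : Matrix I I (Coord k)) (h : ∀ i j, s i = s j → D i j = 0) :
    signMat s * D = -(D * signMat s) := by
  ext i j
  rw [signMat, Matrix.diagonal_mul, Matrix.neg_apply, Matrix.mul_diagonal]
  rcases Int.units_eq_one_or (s i) with hi | hi <;> rcases Int.units_eq_one_or (s j) with hj | hj <;>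
    simp [hi, hj, h i j]

theorem signMat_even {k : ℕ} {I : Type} [Fintype I] [DecidableEq I] (s : I → ℤˣ)
    (A : Matrix I I (Coord k)) (h : ∀ i j, s i ≠ s j → A i j = 0) :
    signMat s * A = A * signMat s := by
  ext i j
  rw [signMat, Matrix.diagonal_mul, Matrix.mul_diagonal]
  rcases Int.units_eq_one_or (s i) with hi | hi <;> rcases Int.units_eq_one_or (s j) with hj | hj <;>
    simp [hi, hj, h i j]

theorem signMat_cov {k : ℕ} {I : Type} [Fintype I] [DecidableEq I] (s : I → ℤˣ) (a : Fin (k + 1))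
    (A : Matrix I I (Coord k)) (h : signMat s * A = A * signMat s) (v : I → Coord k) :
    (signMat s : Matrix I I (Coord k)) *ᵥ cov a A v = cov a A (signMat s *ᵥ v) := by
  apply mulVec_cov
  have : (signMat s : Matrix I I (Coord k)).map (lieDer k a) = 0 := by
    ext i j
    rcases eq_or_ne i j with rfl | hij
    · simp [signMat]
    · simp [signMat, hij]
  rw [h, this, zero_add]

theorem signMat_tw {k : ℕ} {I : Type} [Fintype I] [DecidableEq I] (s : I → ℤˣ)
    (w : I → Torus k →* ℂˣ) (t : Torus k) (v : I → Coord k) :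
    (signMat s : Matrix I I (Coord k)) *ᵥ tw w t v = tw w t (signMat s *ᵥ v) := by
  ext i
  simp [signMat, Matrix.mulVec_diagonal, tw_apply]

theorem totD_sq {M : Type} [AddCommGroup M] [Module (Coord 1) M] (w : Coord 1) (D N₀ N₁ E : M →+ M)
    (hD : ∀ m, D (D m) = w • m) (h0 : ∀ m, D (N₀ m) = N₀ (D m)) (h1 : ∀ m, D (N₁ m) = N₁ (D m))
    (hE : ∀ m, D (E m) + E (D m) + (N₀ (N₁ m) - N₁ (N₀ m)) = 0) (m : M × M × M × M) :
    totD D N₀ N₁ E (totD D N₀ N₁ E m) = w • m := by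
  obtain ⟨m, m0, m1, m2⟩ := m
  simp only [totD, Prod.smul_mk, Prod.mk.injEq, map_sub, map_add, hD, h0, h1]
  refine ⟨trivial, by abel, by abel, ?_⟩
  have := hE m
  calc _ = (D (E m) + E (D m) + (N₀ (N₁ m) - N₁ (N₀ m))) + w • m2 := by abel
    _ = w • m2 := by rw [this, zero_add]

/-! ### Factorizations on free modules of finite rank -/

/-- A factorization whose module is `ℂ[𝒳°] ⊗ V`, where `V` has the finite basis `I`. The basis vector `i`
has the sign `sgn i` and the weight `wt i`; `D` is the matrix of the differential, `A a` is the matrix of the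
`ℂ[𝒳°]`-linear part of `∇_a` and `E` the matrix of the correction in the direction `e₀ e₁`. -/
structure FreeMF where
  I : Type
  [fintype : Fintype I]
  [decEq : DecidableEq I]
  sgn : I → ℤˣ
  wt : I → Torus 1 →* ℂˣ
  D : Matrix I I (Coord 1)
  A : Fin 2 → Matrix I I (Coord 1)
  E : Matrix I I (Coord 1)
  D_odd : ∀ i j, sgn i = sgn j → D i j = 0
  A_even : ∀ a i j, sgn i ≠ sgn j → A a i j = 0
  E_odd : ∀ i j, sgn i = sgn j → E i j = 0
  D_wt : ∀ t i j, ((wt j t : ℂˣ) : ℂ) • D i j =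
    ((chiT 1 t * wt i t : ℂˣ) : ℂ) • torusAut 1 t (D i j)
  A_wt : ∀ a t i j, ((wt j t : ℂˣ) : ℂ) • A a i j =
    ((root 1 a t * wt i t : ℂˣ) : ℂ) • torusAut 1 t (A a i j)
  E_wt : ∀ t i j, ((wt j t : ℂˣ) : ℂ) • E i j =
    ((root 1 0 t * root 1 1 t * (chiT 1 t)⁻¹ * wt i t : ℂˣ) : ℂ) • torusAut 1 t (E i j)
  D_sq : D * D = W • 1
  D_A : ∀ a, D * A a = D.map (lieDer 1 a) + A a * D
  D_E : D * E + E * D +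
    ((A 1).map (lieDer 1 0) - (A 0).map (lieDer 1 1) + A 0 * A 1 - A 1 * A 0) = 0

attribute [instance] FreeMF.fintype FreeMF.decEq

namespace FreeMF

/-- Tensor product with the one-dimensional representation of character `c`. -/
def twist (F : FreeMF) (c : Torus 1 →* ℂˣ) : FreeMF where
  I := F.I
  sgn := F.sgn
  wt i := F.wt i * c
  D := F.D
  A := F.A
  E := F.E
  D_odd := F.D_odd
  A_even := F.A_even
  E_odd := F.E_odd
  D_wt t i j := by
    have := congrArg (fun x => ((c t : ℂˣ) : ℂ) • x) (F.D_wt t i j)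
    simp only [smul_smul, ← Units.val_mul] at this
    rw [MonoidHom.mul_apply, MonoidHom.mul_apply, mul_comm (F.wt j t), this]
    rw [mul_left_comm, mul_comm (c t) (F.wt i t)]
  A_wt a t i j := by
    have := congrArg (fun x => ((c t : ℂˣ) : ℂ) • x) (F.A_wt a t i j)
    simp only [smul_smul, ← Units.val_mul] at this
    rw [MonoidHom.mul_apply, MonoidHom.mul_apply, mul_comm (F.wt j t), this]
    rw [mul_left_comm, mul_comm (c t) (F.wt i t)]
  E_wt t i j := by
    have := congrArg (fun x => ((c t : ℂˣ) : ℂ) • x) (F.E_wt t i j)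
    simp only [smul_smul, ← Units.val_mul] at this
    rw [MonoidHom.mul_apply, MonoidHom.mul_apply, mul_comm (F.wt j t), this]
    rw [mul_left_comm, mul_comm (c t) (F.wt i t)]
  D_sq := F.D_sq
  D_A := F.D_A
  D_E := F.D_E

/-- The free module `ℂ[𝒳°] ⊗ V` with its operators. -/
def toWMF (F : FreeMF) : WMF where
  M := F.I → Coord 1
  par := (signMat F.sgn : Matrix F.I F.I (Coord 1)).mulVecLin
  ρ := tw F.wt
  D := F.D.mulVecLin
  nabla a := cov a (F.A a)
  corr := F.E.mulVecLin
  par_par m := by simp [Matrix.mulVec_mulVec, signMat_sq]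
  par_ρ t m := signMat_tw _ _ _ _
  par_D m := by
    simp [Matrix.mulVec_mulVec, signMat_odd _ _ F.D_odd, Matrix.neg_mulVec]
  par_nabla a m := signMat_cov _ _ _ (signMat_even _ _ (F.A_even a)) _
  par_corr m := by
    simp [Matrix.mulVec_mulVec, signMat_odd _ _ F.E_odd, Matrix.neg_mulVec]
  ρ_smul t f m := tw_smul _ _ _ _
  nabla_smul a f m := cov_smul _ _ _ _
  D_ρ t m := by rw [csmul_eq]; exact mulVec_tw _ _ _ _ (F.D_wt t) m
  nabla_ρ a t m := by rw [csmul_eq]; exact cov_tw _ _ _ _ (F.A_wt a t) m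
  corr_ρ t m := by rw [csmul_eq]; exact mulVec_tw _ _ _ _ (F.E_wt t) m
  sq m := by
    refine totD_sq W F.D.mulVecLin.toAddMonoidHom (cov 0 (F.A 0)) (cov 1 (F.A 1))
      F.E.mulVecLin.toAddMonoidHom ?_ ?_ ?_ ?_ m
    · intro v
      simp [Matrix.mulVec_mulVec, F.D_sq, Matrix.smul_mulVec]
    · exact mulVec_cov _ _ _ (F.D_A 0)
    · exact mulVec_cov _ _ _ (F.D_A 1)
    · intro v
      rw [cov_comm]
      simp only [LinearMap.toAddMonoidHom_coe, Matrix.mulVecLin_apply, Matrix.mulVec_mulVec]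
      rw [← Matrix.add_mulVec, ← Matrix.add_mulVec, F.D_E, Matrix.zero_mulVec]

end FreeMF

/-! ### Convolution -/

/-- A factorization of `π₁₃^*(W)` on the convolution space `𝔤𝔩₂ × GL₂² × 𝔫³`, free with the finite
weight basis `I`, strongly equivariant for `T³ × T_sc` and weakly equivariant for `U³`. The matrices `D`,
`A a`, `E01`, `E12` describe `D + ∑ e_a (δ_a + A a) + e₀ e₁ E01 + e₁ e₂ E12`, whose square is
`π₁₃^*(W)`; the correction in the direction `e₀ e₂` vanishes. -/
structure ConMF where
  I : Type
  [fintype : Fintype I]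
  [decEq : DecidableEq I]
  sgn : I → ℤˣ
  wt : I → Torus 2 →* ℂˣ
  D : Matrix I I (Coord 2)
  A : Fin 3 → Matrix I I (Coord 2)
  E01 : Matrix I I (Coord 2)
  E12 : Matrix I I (Coord 2)
  D_odd : signMat sgn * D = -(D * signMat sgn)
  A_even : ∀ a, signMat sgn * A a = A a * signMat sgn
  E01_odd : signMat sgn * E01 = -(E01 * signMat sgn)
  E12_odd : signMat sgn * E12 = -(E12 * signMat sgn)
  D_wt : ∀ t i j, ((wt j t : ℂˣ) : ℂ) • D i j =
    ((chiT 2 t * wt i t : ℂˣ) : ℂ) • torusAut 2 t (D i j)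
  A_wt : ∀ a t i j, ((wt j t : ℂˣ) : ℂ) • A a i j =
    ((root 2 a t * wt i t : ℂˣ) : ℂ) • torusAut 2 t (A a i j)
  E01_wt : ∀ t i j, ((wt j t : ℂˣ) : ℂ) • E01 i j =
    ((root 2 0 t * root 2 1 t * (chiT 2 t)⁻¹ * wt i t : ℂˣ) : ℂ) • torusAut 2 t (E01 i j)
  E12_wt : ∀ t i j, ((wt j t : ℂˣ) : ℂ) • E12 i j =
    ((root 2 1 t * root 2 2 t * (chiT 2 t)⁻¹ * wt i t : ℂˣ) : ℂ) • torusAut 2 t (E12 i j)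
  D_sq : D * D = pull13 W • 1
  D_A : ∀ a, D * A a = D.map (lieDer 2 a) + A a * D
  D_E01 : D * E01 + E01 * D +
    ((A 1).map (lieDer 2 0) - (A 0).map (lieDer 2 1) + A 0 * A 1 - A 1 * A 0) = 0
  D_E12 : D * E12 + E12 * D +
    ((A 2).map (lieDer 2 1) - (A 1).map (lieDer 2 2) + A 1 * A 2 - A 2 * A 1) = 0
  A_02 : (A 2).map (lieDer 2 0) - (A 0).map (lieDer 2 2) + A 0 * A 2 - A 2 * A 0 = 0
  E01_A2 : E01 * A 2 = E01.map (lieDer 2 2) + A 2 * E01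
  E12_A0 : E12 * A 0 = E12.map (lieDer 2 0) + A 0 * E12

attribute [instance] ConMF.fintype ConMF.decEq

/-- `ℂ[𝒳_con]^I ⊗ Λ(e₁)`; the pair `(fst, snd)` stands for `fst + e₁ snd`. -/
@[ext] structure Amb (I : Type) : Type where
  fst : I → Coord 2
  snd : I → Coord 2

namespace Amb

variable {I : Type}

instance : Zero (Amb I) := ⟨⟨0, 0⟩⟩
instance : Add (Amb I) := ⟨fun m n => ⟨m.fst + n.fst, m.snd + n.snd⟩⟩
instance : Neg (Amb I) := ⟨fun n => ⟨-n.fst, -n.snd⟩⟩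

instance : AddCommGroup (Amb I) :=
  AddCommGroup.mk (toAddGroup := AddGroup.ofLeftAxioms (fun _ _ _ => Amb.ext (add_assoc _ _ _) (add_assoc _ _ _))
    (fun _ => Amb.ext (zero_add _) (zero_add _))
    (fun _ => Amb.ext (neg_add_cancel _) (neg_add_cancel _)))
    (fun _ _ => Amb.ext (add_comm _ _) (add_comm _ _))

@[simp] theorem fst_add (m n : Amb I) : (m + n).fst = m.fst + n.fst := rfl
@[simp] theorem snd_add (m n : Amb I) : (m + n).snd = m.snd + n.snd := rfl
@[simp] theorem fst_zero : (0 : Amb I).fst = 0 := rfl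
@[simp] theorem snd_zero : (0 : Amb I).snd = 0 := rfl
@[simp] theorem fst_neg (m : Amb I) : (-m).fst = -m.fst := rfl
@[simp] theorem snd_neg (m : Amb I) : (-m).snd = -m.snd := rfl
@[simp] theorem fst_sub (m n : Amb I) : (m - n).fst = m.fst - n.fst := by
  rw [sub_eq_add_neg, sub_eq_add_neg]; rfl
@[simp] theorem snd_sub (m n : Amb I) : (m - n).snd = m.snd - n.snd := by
  rw [sub_eq_add_neg, sub_eq_add_neg]; rfl

/-- `ℂ[𝒳°]` acts through `π₁₃`. -/
instance : Module (Coord 1) (Amb I) where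
  smul f n := ⟨pull13 f • n.fst, pull13 f • n.snd⟩
  one_smul n := by
    apply Amb.ext
    · change pull13 1 • n.fst = n.fst
      rw [map_one, one_smul]
    · change pull13 1 • n.snd = n.snd
      rw [map_one, one_smul]
  mul_smul f g n := by
    apply Amb.ext
    · change pull13 (f * g) • n.fst = pull13 f • pull13 g • n.fst
      rw [map_mul, mul_smul]
    · change pull13 (f * g) • n.snd = pull13 f • pull13 g • n.snd
      rw [map_mul, mul_smul]
  smul_zero f := Amb.ext (smul_zero (pull13 f)) (smul_zero (pull13 f))
  smul_add f m n := Amb.ext (smul_add (pull13 f) m.fst n.fst) (smul_add (pull13 f) m.snd n.snd)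
  add_smul f g n := by
    apply Amb.ext
    · change pull13 (f + g) • n.fst = pull13 f • n.fst + pull13 g • n.fst
      rw [map_add, add_smul]
    · change pull13 (f + g) • n.snd = pull13 f • n.snd + pull13 g • n.snd
      rw [map_add, add_smul]
  zero_smul n := by
    apply Amb.ext
    · change pull13 0 • n.fst = 0
      rw [map_zero, zero_smul]
    · change pull13 0 • n.snd = 0
      rw [map_zero, zero_smul]

@[simp] theorem fst_smul (f : Coord 1) (n : Amb I) : (f • n).fst = pull13 f • n.fst := rfl
@[simp] theorem snd_smul (f : Coord 1) (n : Amb I) : (f • n).snd = pull13 f • n.snd := rfl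

@[simp] theorem fst_csmul (c : ℂˣ) (n : Amb I) : (csmul c n).fst = (c : ℂ) • n.fst := by
  rw [csmul, fst_smul, AlgHom.commutes, algebraMap_smul]
@[simp] theorem snd_csmul (c : ℂˣ) (n : Amb I) : (csmul c n).snd = (c : ℂ) • n.snd := by
  rw [csmul, snd_smul, AlgHom.commutes, algebraMap_smul]

end Amb

theorem end_mul {A : Type} [AddCommGroup A] (f h : AddMonoid.End A) (x : A) :
    (f * h) x = f (h x) := rfl

theorem end_one {A : Type} [AddCommGroup A] (x : A) : (1 : AddMonoid.End A) x = x := rfl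

theorem pull13_torus (t : Torus 2) (f : Coord 1) :
    torusAut 2 t (pull13 f) = pull13 (torusAut 1 (tor13 t) f) := torus_pull13 t f

/-- The inclusion of the middle torus `T⁽²⁾`. -/
def mid (s : Fin 2 → ℂˣ) : Torus 2 := (![1, s, 1], 1, 1)

/-- The inclusion of `T⁽¹⁾ × T⁽³⁾ × T_sc`. -/
def outer : Torus 1 →* Torus 2 where
  toFun t := (![t.1 0, 1, t.1 1], t.2)
  map_one' := by
    ext i j <;> try rfl
    fin_cases i <;> rfl
  map_mul' s t := by
    ext i j <;> try rfl
    fin_cases i <;> simp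

theorem tor13_outer (t : Torus 1) : tor13 (outer t) = t := by
  ext i j <;> try rfl
  fin_cases i <;> rfl

theorem tor13_mid (s : Fin 2 → ℂˣ) : tor13 (mid s) = 1 := by
  ext i j <;> try rfl
  fin_cases i <;> rfl

namespace ConMF

/-- The torus action on `ℂ[𝒳_con]^I ⊗ Λ(e₁)`; `e₁` has weight `root 1 - [ℂ*_t]`. -/
def ρAmb (N : ConMF) : Torus 2 →* AddMonoid.End (Amb N.I) where
  toFun t :=
    { toFun := fun n => ⟨tw N.wt t n.fst,
        ((root 2 1 t * (chiT 2 t)⁻¹ : ℂˣ) : ℂ) • tw N.wt t n.snd⟩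
      map_zero' := Amb.ext (map_zero _) (by rw [Amb.snd_zero, map_zero, smul_zero])
      map_add' := fun m n => Amb.ext (map_add _ _ _)
        (by rw [Amb.snd_add, map_add, smul_add, Amb.snd_add]) }
  map_one' := by
    refine AddMonoidHom.ext fun n => Amb.ext ?_ ?_
    · change tw N.wt 1 n.fst = n.fst
      rw [map_one, end_one]
    · change ((root 2 1 1 * (chiT 2 1)⁻¹ : ℂˣ) : ℂ) • tw N.wt 1 n.snd = n.snd
      rw [map_one, map_one, map_one, inv_one, mul_one, Units.val_one, one_smul, end_one]
  map_mul' s t := by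
    refine AddMonoidHom.ext fun n => Amb.ext ?_ ?_
    · change tw N.wt (s * t) n.fst = tw N.wt s (tw N.wt t n.fst)
      rw [map_mul, end_mul]
    · change ((root 2 1 (s * t) * (chiT 2 (s * t))⁻¹ : ℂˣ) : ℂ) • tw N.wt (s * t) n.snd =
        ((root 2 1 s * (chiT 2 s)⁻¹ : ℂˣ) : ℂ) • tw N.wt s
          (((root 2 1 t * (chiT 2 t)⁻¹ : ℂˣ) : ℂ) • tw N.wt t n.snd)
      rw [tw_csmul, smul_smul, ← Units.val_mul, map_mul, map_mul, map_mul, mul_inv,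
        mul_mul_mul_comm, end_mul]

/-- The differential `D + e₁ ∇₁` of the Chevalley-Eilenberg complex of the middle factor. -/
def dAmb (N : ConMF) : Amb N.I →ₗ[Coord 1] Amb N.I where
  toFun n := ⟨N.D *ᵥ n.fst, cov 1 (N.A 1) n.fst - N.D *ᵥ n.snd⟩
  map_add' m n := Amb.ext (by simp [Matrix.mulVec_add])
    (by simp only [Amb.fst_add, Amb.snd_add, Matrix.mulVec_add, map_add]; abel)
  map_smul' f n := Amb.ext (by simp [Matrix.mulVec_smul]) (by
    simp only [Amb.fst_smul, Amb.snd_smul, cov_smul, lie_pull13_1, zero_smul, zero_add,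
      Matrix.mulVec_smul, smul_sub, RingHom.id_apply])

/-- The operator `∇` of the left outer factor. -/
def nablaAmb0 (N : ConMF) : Amb N.I →+ Amb N.I where
  toFun n := ⟨cov 0 (N.A 0) n.fst, cov 0 (N.A 0) n.snd + N.E01 *ᵥ n.fst⟩
  map_zero' := Amb.ext (by simp) (by simp)
  map_add' m n := Amb.ext (by simp)
    (by simp only [Amb.fst_add, Amb.snd_add, Matrix.mulVec_add, map_add]; abel)

/-- The operator `∇` of the right outer factor. -/
def nablaAmb1 (N : ConMF) : Amb N.I →+ Amb N.I where
  toFun n := ⟨cov 2 (N.A 2) n.fst, cov 2 (N.A 2) n.snd - N.E12 *ᵥ n.fst⟩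
  map_zero' := Amb.ext (by simp) (by simp)
  map_add' m n := Amb.ext (by simp)
    (by simp only [Amb.fst_add, Amb.snd_add, Matrix.mulVec_add, map_add]; abel)

/-- The operators `∇` of the two outer factors. -/
def nablaAmb (N : ConMF) : Fin 2 → Amb N.I →+ Amb N.I := ![N.nablaAmb0, N.nablaAmb1]

theorem nablaAmb_zero (N : ConMF) (n : Amb N.I) : N.nablaAmb 0 n =
    ⟨cov 0 (N.A 0) n.fst, cov 0 (N.A 0) n.snd + N.E01 *ᵥ n.fst⟩ := rfl
theorem nablaAmb_one (N : ConMF) (n : Amb N.I) : N.nablaAmb 1 n =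
    ⟨cov 2 (N.A 2) n.fst, cov 2 (N.A 2) n.snd - N.E12 *ᵥ n.fst⟩ := rfl

/-- The parity operator; `e₁` is odd. -/
def parAmb (N : ConMF) : Amb N.I →ₗ[Coord 1] Amb N.I where
  toFun n := ⟨(signMat N.sgn : Matrix N.I N.I (Coord 2)) *ᵥ n.fst,
    -((signMat N.sgn : Matrix N.I N.I (Coord 2)) *ᵥ n.snd)⟩
  map_add' m n := Amb.ext (by simp [Matrix.mulVec_add])
    (by simp only [Amb.snd_add, Matrix.mulVec_add]; abel)
  map_smul' f n := Amb.ext (by simp [Matrix.mulVec_smul]) (by simp [Matrix.mulVec_smul])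

theorem ρAmb_apply (N : ConMF) (t : Torus 2) (n : Amb N.I) : N.ρAmb t n = ⟨tw N.wt t n.fst,
    ((root 2 1 t * (chiT 2 t)⁻¹ : ℂˣ) : ℂ) • tw N.wt t n.snd⟩ := rfl
theorem dAmb_apply (N : ConMF) (n : Amb N.I) : N.dAmb n =
    ⟨N.D *ᵥ n.fst, cov 1 (N.A 1) n.fst - N.D *ᵥ n.snd⟩ := rfl
theorem parAmb_apply (N : ConMF) (n : Amb N.I) : N.parAmb n =
    ⟨(signMat N.sgn : Matrix N.I N.I (Coord 2)) *ᵥ n.fst,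
      -((signMat N.sgn : Matrix N.I N.I (Coord 2)) *ᵥ n.snd)⟩ := rfl

theorem dAmb_ρ (N : ConMF) (t : Torus 2) (n : Amb N.I) :
    N.dAmb (N.ρAmb t n) = csmul (chiT 2 t) (N.ρAmb t (N.dAmb n)) := by
  apply Amb.ext
  · rw [Amb.fst_csmul]
    exact mulVec_tw _ _ _ _ (N.D_wt t) _
  · rw [Amb.snd_csmul]
    change cov 1 (N.A 1) (tw N.wt t n.fst) -
        N.D *ᵥ (((root 2 1 t * (chiT 2 t)⁻¹ : ℂˣ) : ℂ) • tw N.wt t n.snd) =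
      ((chiT 2 t : ℂˣ) : ℂ) • (((root 2 1 t * (chiT 2 t)⁻¹ : ℂˣ) : ℂ) •
        tw N.wt t (cov 1 (N.A 1) n.fst - N.D *ᵥ n.snd))
    rw [cov_tw _ _ _ _ (N.A_wt 1 t), Matrix.mulVec_smul, mulVec_tw _ _ _ _ (N.D_wt t), map_sub,
      smul_smul, smul_smul, ← Units.val_mul, ← Units.val_mul,
      show chiT 2 t * (root 2 1 t * (chiT 2 t)⁻¹) = root 2 1 t by
        rw [mul_left_comm, mul_inv_cancel, mul_one], inv_mul_cancel_right, smul_sub]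

theorem cov_csmul {k : ℕ} {I : Type} [Fintype I] (a : Fin (k + 1)) (A : Matrix I I (Coord k))
    (c : ℂ) (v : I → Coord k) : cov a A (c • v) = c • cov a A v := by
  ext i
  simp [cov, Matrix.mulVec_smul]

theorem nablaAmb_ρ_zero (N : ConMF) (t : Torus 2) (n : Amb N.I) :
    N.nablaAmb 0 (N.ρAmb t n) = csmul (root 2 0 t) (N.ρAmb t (N.nablaAmb 0 n)) := by
  apply Amb.ext
  · rw [Amb.fst_csmul]
    exact cov_tw _ _ _ _ (N.A_wt 0 t) _
  · rw [Amb.snd_csmul]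
    change cov 0 (N.A 0) (((root 2 1 t * (chiT 2 t)⁻¹ : ℂˣ) : ℂ) • tw N.wt t n.snd) +
        N.E01 *ᵥ tw N.wt t n.fst =
      ((root 2 0 t : ℂˣ) : ℂ) • (((root 2 1 t * (chiT 2 t)⁻¹ : ℂˣ) : ℂ) •
        tw N.wt t (cov 0 (N.A 0) n.snd + N.E01 *ᵥ n.fst))
    rw [cov_csmul, cov_tw _ _ _ _ (N.A_wt 0 t), mulVec_tw _ _ _ _ (N.E01_wt t), map_add,
      smul_add, smul_add, smul_smul, smul_smul, smul_smul, ← Units.val_mul, ← Units.val_mul,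
      mul_comm (root 2 1 t * (chiT 2 t)⁻¹) (root 2 0 t), mul_assoc (root 2 0 t)]

theorem nablaAmb_ρ_one (N : ConMF) (t : Torus 2) (n : Amb N.I) :
    N.nablaAmb 1 (N.ρAmb t n) = csmul (root 2 2 t) (N.ρAmb t (N.nablaAmb 1 n)) := by
  apply Amb.ext
  · rw [Amb.fst_csmul]
    exact cov_tw _ _ _ _ (N.A_wt 2 t) _
  · rw [Amb.snd_csmul]
    change cov 2 (N.A 2) (((root 2 1 t * (chiT 2 t)⁻¹ : ℂˣ) : ℂ) • tw N.wt t n.snd) -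
        N.E12 *ᵥ tw N.wt t n.fst =
      ((root 2 2 t : ℂˣ) : ℂ) • (((root 2 1 t * (chiT 2 t)⁻¹ : ℂˣ) : ℂ) •
        tw N.wt t (cov 2 (N.A 2) n.snd - N.E12 *ᵥ n.fst))
    rw [cov_csmul, cov_tw _ _ _ _ (N.A_wt 2 t), mulVec_tw _ _ _ _ (N.E12_wt t), map_sub,
      smul_sub, smul_sub, smul_smul, smul_smul, smul_smul, ← Units.val_mul, ← Units.val_mul,
      mul_comm (root 2 1 t) (root 2 2 t), mul_assoc (root 2 2 t) (root 2 1 t),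
      mul_comm (root 2 1 t * (chiT 2 t)⁻¹) (root 2 2 t)]

theorem parAmb_ρ (N : ConMF) (t : Torus 2) (n : Amb N.I) :
    N.parAmb (N.ρAmb t n) = N.ρAmb t (N.parAmb n) := by
  refine Amb.ext (signMat_tw _ _ _ _) ?_
  change -(signMat N.sgn *ᵥ (((root 2 1 t * (chiT 2 t)⁻¹ : ℂˣ) : ℂ) • tw N.wt t n.snd)) =
    ((root 2 1 t * (chiT 2 t)⁻¹ : ℂˣ) : ℂ) • tw N.wt t (-(signMat N.sgn *ᵥ n.snd))
  rw [Matrix.mulVec_smul, signMat_tw, map_neg, smul_neg]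

theorem ρAmb_smul (N : ConMF) (t : Torus 2) (f : Coord 1) (n : Amb N.I) :
    N.ρAmb t (f • n) = torusAut 1 (tor13 t) f • N.ρAmb t n := by
  apply Amb.ext
  · simp only [ρAmb_apply, Amb.fst_smul, tw_smul, torus_pull13]
  · simp only [ρAmb_apply, Amb.snd_smul, tw_smul, torus_pull13]
    rw [smul_comm]

theorem root_mid (a : Fin 3) (ha : a ≠ 1) (s : Fin 2 → ℂˣ) : root 2 a (mid s) = 1 := by
  fin_cases a
  · simp [root, mid]
  · exact absurd rfl ha
  · simp [root, mid]

theorem csmul_one {M : Type} [AddCommGroup M] [Module (Coord 1) M] (m : M) : csmul 1 m = m := by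
  simp [csmul]

/-- The `T⁽²⁾`-invariants of `ℂ[𝒳_con]^I ⊗ Λ(e₁)`. -/
def inv (N : ConMF) : Submodule (Coord 1) (Amb N.I) where
  carrier := {n | ∀ s, N.ρAmb (mid s) n = n}
  add_mem' hm hn s := by rw [map_add, hm s, hn s]
  zero_mem' s := map_zero _
  smul_mem' f n hn s := by
    rw [ρAmb_smul, hn s, tor13_mid, torusAut_one]
    rfl

theorem mem_inv (N : ConMF) (n : Amb N.I) : n ∈ N.inv ↔ ∀ s, N.ρAmb (mid s) n = n := Iff.rfl

theorem dAmb_mem (N : ConMF) : ∀ n ∈ N.inv, N.dAmb n ∈ N.inv := by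
  intro n hn
  rw [mem_inv] at hn ⊢
  intro s
  have h := N.dAmb_ρ (mid s) n
  rw [hn s, show chiT 2 (mid s) = 1 from rfl, csmul_one] at h
  exact h.symm

theorem parAmb_mem (N : ConMF) : ∀ n ∈ N.inv, N.parAmb n ∈ N.inv := by
  intro n hn s
  rw [← parAmb_ρ, hn s]

theorem nablaAmb_mem (N : ConMF) (a : Fin 2) : ∀ n ∈ N.inv, N.nablaAmb a n ∈ N.inv := by
  intro n hn s
  fin_cases a
  · have := N.nablaAmb_ρ_zero (mid s) n
    rw [hn s, root_mid 0 (by decide), csmul_one] at this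
    exact this.symm
  · have := N.nablaAmb_ρ_one (mid s) n
    rw [hn s, root_mid 2 (by decide), csmul_one] at this
    exact this.symm

theorem ρAmb_comm (N : ConMF) (s t : Torus 2) (n : Amb N.I) :
    N.ρAmb s (N.ρAmb t n) = N.ρAmb t (N.ρAmb s n) := by
  have h : ∀ s t, N.ρAmb s (N.ρAmb t n) = N.ρAmb (s * t) n := by
    intro s t
    rw [map_mul, end_mul]
  rw [h, h, mul_comm]

theorem ρAmb_mem (N : ConMF) (t : Torus 2) : ∀ n ∈ N.inv, N.ρAmb t n ∈ N.inv := by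
  intro n hn
  rw [mem_inv] at hn ⊢
  intro s
  rw [ρAmb_comm, hn s]

theorem dAmb_sq (N : ConMF) (n : Amb N.I) : N.dAmb (N.dAmb n) = W • n := by
  refine Amb.ext ?_ ?_
  · change N.D *ᵥ (N.D *ᵥ n.fst) = pull13 W • n.fst
    rw [Matrix.mulVec_mulVec, N.D_sq, Matrix.smul_mulVec, Matrix.one_mulVec]
  · change cov 1 (N.A 1) (N.D *ᵥ n.fst) - N.D *ᵥ (cov 1 (N.A 1) n.fst - N.D *ᵥ n.snd) = pull13 W • n.snd
    rw [Matrix.mulVec_sub, mulVec_cov _ _ _ (N.D_A 1), Matrix.mulVec_mulVec, N.D_sq,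
      Matrix.smul_mulVec, Matrix.one_mulVec]
    abel

theorem dAmb_nabla_zero (N : ConMF) (n : Amb N.I) :
    N.dAmb (N.nablaAmb 0 n) = N.nablaAmb 0 (N.dAmb n) := by
  refine Amb.ext ?_ ?_
  · exact mulVec_cov _ _ _ (N.D_A 0) _
  · change cov 1 (N.A 1) (cov 0 (N.A 0) n.fst) - N.D *ᵥ (cov 0 (N.A 0) n.snd + N.E01 *ᵥ n.fst) =
      cov 0 (N.A 0) (cov 1 (N.A 1) n.fst - N.D *ᵥ n.snd) + N.E01 *ᵥ (N.D *ᵥ n.fst)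
    have h := cov_comm 0 1 (N.A 0) (N.A 1) n.fst
    have h2 := congrArg (fun X => X *ᵥ n.fst) N.D_E01
    simp only [Matrix.add_mulVec, ← Matrix.mulVec_mulVec, Matrix.zero_mulVec] at h2
    rw [Matrix.mulVec_add, mulVec_cov _ _ _ (N.D_A 0), map_sub]
    rw [sub_eq_iff_eq_add] at h
    simp only [Matrix.sub_mulVec, Matrix.add_mulVec, ← Matrix.mulVec_mulVec] at h h2
    rw [h]
    rw [← sub_eq_zero, ← neg_eq_zero, ← h2]
    abel

theorem dAmb_nabla_one (N : ConMF) (n : Amb N.I) :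
    N.dAmb (N.nablaAmb 1 n) = N.nablaAmb 1 (N.dAmb n) := by
  refine Amb.ext ?_ ?_
  · exact mulVec_cov _ _ _ (N.D_A 2) _
  · change cov 1 (N.A 1) (cov 2 (N.A 2) n.fst) - N.D *ᵥ (cov 2 (N.A 2) n.snd - N.E12 *ᵥ n.fst) =
      cov 2 (N.A 2) (cov 1 (N.A 1) n.fst - N.D *ᵥ n.snd) - N.E12 *ᵥ (N.D *ᵥ n.fst)
    have h := cov_comm 1 2 (N.A 1) (N.A 2) n.fst
    have h2 := congrArg (fun X => X *ᵥ n.fst) N.D_E12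
    rw [Matrix.mulVec_sub, mulVec_cov _ _ _ (N.D_A 2), map_sub]
    rw [sub_eq_iff_eq_add] at h
    simp only [Matrix.sub_mulVec, Matrix.add_mulVec, ← Matrix.mulVec_mulVec,
      Matrix.zero_mulVec] at h h2
    rw [h]
    rw [← sub_eq_zero, ← h2]
    abel

theorem nablaAmb_comm (N : ConMF) (n : Amb N.I) :
    N.nablaAmb 0 (N.nablaAmb 1 n) - N.nablaAmb 1 (N.nablaAmb 0 n) = 0 := by
  have h : ∀ v, cov 0 (N.A 0) (cov 2 (N.A 2) v) = cov 2 (N.A 2) (cov 0 (N.A 0) v) := by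
    intro v
    have := cov_comm 0 2 (N.A 0) (N.A 2) v
    rw [N.A_02, Matrix.zero_mulVec] at this
    exact sub_eq_zero.1 this
  rw [sub_eq_zero]
  refine Amb.ext (h _) ?_
  change cov 0 (N.A 0) (cov 2 (N.A 2) n.snd - N.E12 *ᵥ n.fst) + N.E01 *ᵥ cov 2 (N.A 2) n.fst =
    cov 2 (N.A 2) (cov 0 (N.A 0) n.snd + N.E01 *ᵥ n.fst) - N.E12 *ᵥ cov 0 (N.A 0) n.fst
  rw [map_sub, map_add, h, mulVec_cov _ _ _ N.E01_A2, mulVec_cov _ _ _ N.E12_A0]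
  abel

theorem parAmb_parAmb (N : ConMF) (n : Amb N.I) : N.parAmb (N.parAmb n) = n := by
  refine Amb.ext ?_ ?_
  · change signMat N.sgn *ᵥ (signMat N.sgn *ᵥ n.fst) = n.fst
    rw [Matrix.mulVec_mulVec, signMat_sq, Matrix.one_mulVec]
  · change -(signMat N.sgn *ᵥ -(signMat N.sgn *ᵥ n.snd)) = n.snd
    rw [Matrix.mulVec_neg, neg_neg, Matrix.mulVec_mulVec, signMat_sq, Matrix.one_mulVec]

theorem parAmb_dAmb (N : ConMF) (n : Amb N.I) : N.parAmb (N.dAmb n) = -N.dAmb (N.parAmb n) := by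
  have h : ∀ v, (signMat N.sgn : Matrix N.I N.I (Coord 2)) *ᵥ (N.D *ᵥ v) =
      -(N.D *ᵥ (signMat N.sgn *ᵥ v)) := by
    intro v
    rw [Matrix.mulVec_mulVec, N.D_odd, Matrix.neg_mulVec, Matrix.mulVec_mulVec]
  refine Amb.ext (h _) ?_
  change -(signMat N.sgn *ᵥ (cov 1 (N.A 1) n.fst - N.D *ᵥ n.snd)) =
    -(cov 1 (N.A 1) (signMat N.sgn *ᵥ n.fst) - N.D *ᵥ -(signMat N.sgn *ᵥ n.snd))
  rw [Matrix.mulVec_sub, h, signMat_cov _ _ _ (N.A_even 1), Matrix.mulVec_neg]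

theorem parAmb_nablaAmb (N : ConMF) (a : Fin 2) (n : Amb N.I) :
    N.parAmb (N.nablaAmb a n) = N.nablaAmb a (N.parAmb n) := by
  fin_cases a
  · change N.parAmb (N.nablaAmb 0 n) = N.nablaAmb 0 (N.parAmb n)
    refine Amb.ext (signMat_cov _ _ _ (N.A_even 0) _) ?_
    change -(signMat N.sgn *ᵥ (cov 0 (N.A 0) n.snd + N.E01 *ᵥ n.fst)) =
      cov 0 (N.A 0) (-(signMat N.sgn *ᵥ n.snd)) + N.E01 *ᵥ (signMat N.sgn *ᵥ n.fst)
    rw [Matrix.mulVec_add, signMat_cov _ _ _ (N.A_even 0), Matrix.mulVec_mulVec, N.E01_odd,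
      Matrix.neg_mulVec, Matrix.mulVec_mulVec, map_neg]
    abel
  · change N.parAmb (N.nablaAmb 1 n) = N.nablaAmb 1 (N.parAmb n)
    refine Amb.ext (signMat_cov _ _ _ (N.A_even 2) _) ?_
    change -(signMat N.sgn *ᵥ (cov 2 (N.A 2) n.snd - N.E12 *ᵥ n.fst)) =
      cov 2 (N.A 2) (-(signMat N.sgn *ᵥ n.snd)) - N.E12 *ᵥ (signMat N.sgn *ᵥ n.fst)
    rw [Matrix.mulVec_sub, signMat_cov _ _ _ (N.A_even 2), Matrix.mulVec_mulVec, N.E12_odd,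
      Matrix.neg_mulVec, Matrix.mulVec_mulVec, map_neg]
    abel

theorem nablaAmb_smul (N : ConMF) (a : Fin 2) (f : Coord 1) (n : Amb N.I) :
    N.nablaAmb a (f • n) = lieDer 1 a f • n + f • N.nablaAmb a n := by
  fin_cases a
  · change N.nablaAmb 0 (f • n) = lieDer 1 0 f • n + f • N.nablaAmb 0 n
    apply Amb.ext
    · simp only [nablaAmb_zero, Amb.fst_add, Amb.fst_smul, cov_smul, lie_pull13_0]
    · simp only [nablaAmb_zero, Amb.snd_add, Amb.fst_smul, Amb.snd_smul, cov_smul, lie_pull13_0,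
        Matrix.mulVec_smul, smul_add, add_assoc]
  · change N.nablaAmb 1 (f • n) = lieDer 1 1 f • n + f • N.nablaAmb 1 n
    apply Amb.ext
    · simp only [nablaAmb_one, Amb.fst_add, Amb.fst_smul, cov_smul, lie_pull13_2]
    · simp only [nablaAmb_one, Amb.snd_add, Amb.fst_smul, Amb.snd_smul, cov_smul, lie_pull13_2,
        Matrix.mulVec_smul, smul_sub, add_sub_assoc]

theorem coe_csmul (N : ConMF) (c : ℂˣ) (n : N.inv) : ((csmul c n : N.inv) : Amb N.I) = csmul c n.1 :=
  rfl

/-- `π₁₃₊(CE_{𝔫⁽²⁾}(N)^{T⁽²⁾})`: the invariants of the middle torus in the Chevalley-Eilenberg complex of the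
middle copy of `𝔫`, as a module over `ℂ[𝒳°]`. -/
def push (N : ConMF) : WMF where
  M := N.inv
  par := N.parAmb.restrict N.parAmb_mem
  ρ :=
    { toFun := fun t =>
        { toFun := fun n => ⟨N.ρAmb (outer t) n, N.ρAmb_mem _ n n.2⟩
          map_zero' := Subtype.ext (map_zero _)
          map_add' := fun m n => Subtype.ext (map_add (N.ρAmb (outer t)) m.1 n.1) }
      map_one' := by
        refine AddMonoidHom.ext fun n => Subtype.ext ?_
        change N.ρAmb (outer 1) n.1 = n.1
        rw [map_one, map_one, end_one]
      map_mul' := fun s t => by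
        refine AddMonoidHom.ext fun n => Subtype.ext ?_
        change N.ρAmb (outer (s * t)) n.1 = N.ρAmb (outer s) (N.ρAmb (outer t) n.1)
        rw [map_mul, map_mul, end_mul] }
  D := N.dAmb.restrict N.dAmb_mem
  nabla a :=
    { toFun := fun n => ⟨N.nablaAmb a n, N.nablaAmb_mem a n n.2⟩
      map_zero' := Subtype.ext (map_zero _)
      map_add' := fun m n => Subtype.ext (map_add (N.nablaAmb a) m.1 n.1) }
  corr := 0
  par_par n := Subtype.ext (N.parAmb_parAmb n)
  par_ρ t n := Subtype.ext (N.parAmb_ρ _ _)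
  par_D n := Subtype.ext (N.parAmb_dAmb n)
  par_nabla a n := Subtype.ext (N.parAmb_nablaAmb a n)
  par_corr n := by simp
  ρ_smul t f n := Subtype.ext (by
    have := N.ρAmb_smul (outer t) f n.1
    rw [tor13_outer] at this
    exact this)
  nabla_smul a f n := Subtype.ext (N.nablaAmb_smul a f n)
  D_ρ t n := Subtype.ext (N.dAmb_ρ (outer t) n)
  nabla_ρ a t n := Subtype.ext (by
    fin_cases a
    · exact N.nablaAmb_ρ_zero (outer t) n
    · exact N.nablaAmb_ρ_one (outer t) n)
  corr_ρ t n := by simp [csmul]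
  sq n := by
    refine totD_sq W (N.dAmb.restrict N.dAmb_mem).toAddMonoidHom
      { toFun := fun n => ⟨N.nablaAmb 0 n, N.nablaAmb_mem 0 n n.2⟩
        map_zero' := Subtype.ext (map_zero _)
        map_add' := fun m n => Subtype.ext (map_add (N.nablaAmb 0) m.1 n.1) }
      { toFun := fun n => ⟨N.nablaAmb 1 n, N.nablaAmb_mem 1 n n.2⟩
        map_zero' := Subtype.ext (map_zero _)
        map_add' := fun m n => Subtype.ext (map_add (N.nablaAmb 1) m.1 n.1) }
      (0 : N.inv →+ N.inv) ?_ ?_ ?_ ?_ n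
    · exact fun m => Subtype.ext (N.dAmb_sq m)
    · exact fun m => Subtype.ext (N.dAmb_nabla_zero m)
    · exact fun m => Subtype.ext (N.dAmb_nabla_one m)
    · intro m
      rw [AddMonoidHom.zero_apply, AddMonoidHom.zero_apply, map_zero, zero_add, zero_add]
      exact Subtype.ext (N.nablaAmb_comm m)

end ConMF

/-! ### The tensor product `π₁₂^*(F) ⊗ π₂₃^*(G)` -/

theorem tor12_mul (s t : Torus 2) : tor12 (s * t) = tor12 s * tor12 t := by
  ext i j <;> try rfl
  fin_cases i <;> rfl

theorem tor23_mul (s t : Torus 2) : tor23 (s * t) = tor23 s * tor23 t := by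
  ext i j <;> try rfl
  fin_cases i <;> rfl

/-- `tor12` as a homomorphism. -/
def tor12Hom : Torus 2 →* Torus 1 := MonoidHom.mk' tor12 tor12_mul

/-- `tor23` as a homomorphism. -/
def tor23Hom : Torus 2 →* Torus 1 := MonoidHom.mk' tor23 tor23_mul

/-- The matrix `M`, as an operator between spaces with weights `w`, has weight `c⁻¹`. -/
def HasWt {k : ℕ} {I : Type} (w : I → Torus k →* ℂˣ) (t : Torus k) (c : ℂˣ)
    (M : Matrix I I (Coord k)) : Prop :=
  ∀ i j, ((w j t : ℂˣ) : ℂ) • M i j = ((c * w i t : ℂˣ) : ℂ) • torusAut k t (M i j)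

theorem HasWt.add {k : ℕ} {I : Type} {w : I → Torus k →* ℂˣ} {t : Torus k} {c : ℂˣ}
    {M N : Matrix I I (Coord k)} (hM : HasWt w t c M) (hN : HasWt w t c N) :
    HasWt w t c (M + N) := by
  intro i j
  rw [Matrix.add_apply, smul_add, hM, hN, map_add, smul_add]

theorem HasWt.kronecker {k : ℕ} {I J : Type} {w : I → Torus k →* ℂˣ} {w' : J → Torus k →* ℂˣ}
    {t : Torus k} {c c' : ℂˣ} {M : Matrix I I (Coord k)} {N : Matrix J J (Coord k)}
    (hM : HasWt w t c M) (hN : HasWt w' t c' N) :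
    HasWt (fun p : I × J => w p.1 * w' p.2) t (c * c') (M ⊗ₖ N) := by
  intro i j
  rw [Matrix.kroneckerMap_apply, MonoidHom.mul_apply, MonoidHom.mul_apply, Units.val_mul,
    ← smul_mul_smul_comm, hM, hN, map_mul, smul_mul_smul_comm, ← Units.val_mul,
    mul_mul_mul_comm]

theorem HasWt.one {k : ℕ} {I : Type} [DecidableEq I] (w : I → Torus k →* ℂˣ) (t : Torus k) :
    HasWt w t 1 1 := by
  intro i j
  rcases eq_or_ne i j with rfl | h
  · simp
  · simp [h]

theorem HasWt.sign {k : ℕ} {I : Type} [DecidableEq I] (w : I → Torus k →* ℂˣ) (t : Torus k)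
    (s : I → ℤˣ) : HasWt w t 1 (signMat s) := by
  intro i j
  rcases eq_or_ne i j with rfl | h
  · simp [signMat]
  · simp [signMat, h]

theorem HasWt.pull12 {I : Type} {w : I → Torus 1 →* ℂˣ} {t : Torus 2} {c : ℂˣ}
    {M : Matrix I I (Coord 1)} (h : HasWt w (tor12 t) c M) :
    HasWt (fun i => (w i).comp tor12Hom) t c (M.map pull12) := by
  intro i j
  have := congrArg BraidMF.pull12 (h i j)
  rw [map_smul, map_smul, ← torus_pull12] at this
  exact this

theorem HasWt.pull23 {I : Type} {w : I → Torus 1 →* ℂˣ} {t : Torus 2} {c : ℂˣ}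
    {M : Matrix I I (Coord 1)} (h : HasWt w (tor23 t) c M) :
    HasWt (fun i => (w i).comp tor23Hom) t c (M.map pull23) := by
  intro i j
  have := congrArg BraidMF.pull23 (h i j)
  rw [map_smul, map_smul, ← torus_pull23] at this
  exact this

theorem signMat_prod {k : ℕ} {I J : Type} [DecidableEq I] [DecidableEq J] (s : I → ℤˣ)
    (s' : J → ℤˣ) : (signMat (fun p : I × J => s p.1 * s' p.2) : Matrix _ _ (Coord k)) =
      signMat s ⊗ₖ signMat s' := by
  rw [signMat, signMat, signMat, Matrix.diagonal_kronecker_diagonal]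
  congr 1
  funext p
  simp

theorem signMat_map {I : Type} [DecidableEq I] (φ : Coord 1 →ₐ[ℂ] Coord 2) (s : I → ℤˣ) :
    (signMat s : Matrix I I (Coord 1)).map φ = signMat s := by
  rw [signMat, Matrix.diagonal_map (map_zero φ), signMat]
  congr 1
  funext i
  simp

theorem kronecker_deriv {k : ℕ} {I J : Type} (d : Derivation ℂ (Coord k) (Coord k))
    (M : Matrix I I (Coord k)) (N : Matrix J J (Coord k)) :
    (M ⊗ₖ N).map d = M.map d ⊗ₖ N + M ⊗ₖ N.map d := by
  ext i j
  simp [Matrix.kroneckerMap_apply, Derivation.leibniz]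
  ring

theorem add_deriv {k : ℕ} {I : Type} (d : Derivation ℂ (Coord k) (Coord k))
    (M N : Matrix I I (Coord k)) : (M + N).map d = M.map d + N.map d := by
  ext i j
  simp

theorem signMat_deriv {k : ℕ} {I : Type} [DecidableEq I] (d : Derivation ℂ (Coord k) (Coord k))
    (s : I → ℤˣ) : (signMat s : Matrix I I (Coord k)).map d = 0 := by
  ext i j
  rcases eq_or_ne i j with rfl | hij
  · simp [signMat]
  · simp [signMat, hij]

theorem one_deriv {k : ℕ} {I : Type} [DecidableEq I] (d : Derivation ℂ (Coord k) (Coord k)) :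
    (1 : Matrix I I (Coord k)).map d = 0 := by
  ext i j
  rcases eq_or_ne i j with rfl | hij
  · simp
  · simp [hij]

theorem map_mulM {I : Type} [Fintype I] (φ : Coord 1 →ₐ[ℂ] Coord 2) (M N : Matrix I I (Coord 1)) :
    (M * N).map φ = M.map φ * N.map φ := Matrix.map_mul (f := (φ : Coord 1 →+* Coord 2))

theorem map_addM {I : Type} (φ : Coord 1 →ₐ[ℂ] Coord 2) (M N : Matrix I I (Coord 1)) :
    (M + N).map φ = M.map φ + N.map φ := by
  ext i j
  simp

theorem map_subM {I : Type} (φ : Coord 1 →ₐ[ℂ] Coord 2) (M N : Matrix I I (Coord 1)) :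
    (M - N).map φ = M.map φ - N.map φ := by
  ext i j
  simp

theorem map_negM {I : Type} (φ : Coord 1 →ₐ[ℂ] Coord 2) (M : Matrix I I (Coord 1)) :
    (-M).map φ = -M.map φ := by
  ext i j
  simp

theorem map_zeroM {I : Type} (φ : Coord 1 →ₐ[ℂ] Coord 2) :
    (0 : Matrix I I (Coord 1)).map φ = 0 := by
  ext i j
  simp

theorem map_smul_one {I : Type} [DecidableEq I] (φ : Coord 1 →ₐ[ℂ] Coord 2) (w : Coord 1) :
    (w • (1 : Matrix I I (Coord 1))).map φ = φ w • 1 := by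
  ext i j
  rcases eq_or_ne i j with rfl | hij
  · simp
  · simp [hij]

theorem map_lie {I : Type} (φ : Coord 1 →ₐ[ℂ] Coord 2) (d : Derivation ℂ (Coord 2) (Coord 2))
    (d' : Derivation ℂ (Coord 1) (Coord 1)) (h : ∀ f, d (φ f) = φ (d' f))
    (M : Matrix I I (Coord 1)) : (M.map φ).map d = (M.map d').map φ := by
  ext i j
  exact h _

theorem map_lie_zero {I : Type} (φ : Coord 1 →ₐ[ℂ] Coord 2) (d : Derivation ℂ (Coord 2) (Coord 2))
    (h : ∀ f, d (φ f) = 0) (M : Matrix I I (Coord 1)) : (M.map φ).map d = 0 := by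
  ext i j
  exact h _

/-- The laws of a factorization in matrix form, after a base change `φ`; `p, q` are the
derivations which extend the two Lie derivatives. -/
theorem FreeMF.pulled (F : FreeMF) (φ : Coord 1 →ₐ[ℂ] Coord 2) (p : Fin 2 → Fin 3)
    (hp : ∀ a f, lieDer 2 (p a) (φ f) = φ (lieDer 1 a f)) :
    (signMat F.sgn * F.D.map φ = -(F.D.map φ * signMat F.sgn)) ∧
    (signMat F.sgn * F.E.map φ = -(F.E.map φ * signMat F.sgn)) ∧
    (∀ a, signMat F.sgn * (F.A a).map φ = (F.A a).map φ * signMat F.sgn) ∧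
    (F.D.map φ * F.D.map φ = φ W • 1) ∧
    (∀ a, F.D.map φ * (F.A a).map φ =
      (F.D.map φ).map (lieDer 2 (p a)) + (F.A a).map φ * F.D.map φ) ∧
    (F.D.map φ * F.E.map φ + F.E.map φ * F.D.map φ +
      (((F.A 1).map φ).map (lieDer 2 (p 0)) - ((F.A 0).map φ).map (lieDer 2 (p 1)) +
        (F.A 0).map φ * (F.A 1).map φ - (F.A 1).map φ * (F.A 0).map φ) = 0) := by
  refine ⟨?_, ?_, ?_, ?_, ?_, ?_⟩
  · rw [← signMat_map φ, ← map_mulM, signMat_odd _ _ F.D_odd, map_negM, map_mulM]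
  · rw [← signMat_map φ, ← map_mulM, signMat_odd _ _ F.E_odd, map_negM, map_mulM]
  · intro a
    rw [← signMat_map φ, ← map_mulM, signMat_even _ _ (F.A_even a), map_mulM]
  · rw [← map_mulM, F.D_sq, map_smul_one]
  · intro a
    rw [← map_mulM, F.D_A, map_addM, map_mulM, map_lie φ _ _ (hp a)]
  · rw [map_lie φ _ _ (hp 0), map_lie φ _ _ (hp 1)]
    simp only [← map_mulM, ← map_addM, ← map_subM]
    rw [F.D_E, map_zeroM]

/-- The factors of `U³` which act on the target of `π₁₂`. -/
def lift12 : Fin 2 → Fin 3 := ![0, 1]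
/-- The factors of `U³` which act on the target of `π₂₃`. -/
def lift23 : Fin 2 → Fin 3 := ![1, 2]

theorem lie_lift12 (a : Fin 2) (f : Coord 1) :
    lieDer 2 (lift12 a) (pull12 f) = pull12 (lieDer 1 a f) := by
  fin_cases a
  · exact lie_pull12_0 f
  · exact lie_pull12_1 f

theorem lie_lift23 (a : Fin 2) (f : Coord 1) :
    lieDer 2 (lift23 a) (pull23 f) = pull23 (lieDer 1 a f) := by
  fin_cases a
  · exact lie_pull23_1 f
  · exact lie_pull23_2 f

/-- The differential `D_F ⊗ 1 + 1 ⊗ D_G`, with the Koszul sign. -/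
def tensorD (F G : FreeMF) : Matrix (F.I × G.I) (F.I × G.I) (Coord 2) :=
  F.D.map pull12 ⊗ₖ 1 + signMat F.sgn ⊗ₖ G.D.map pull23

/-- The linear parts of the operators `∇₀, ∇₁, ∇₂` of the tensor product. -/
def tensorA (F G : FreeMF) : Fin 3 → Matrix (F.I × G.I) (F.I × G.I) (Coord 2) :=
  ![(F.A 0).map pull12 ⊗ₖ 1, (F.A 1).map pull12 ⊗ₖ 1 + 1 ⊗ₖ (G.A 0).map pull23,
    1 ⊗ₖ (G.A 1).map pull23]

/-- The correction in the direction `e₀ e₁`. -/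
def tensorE01 (F G : FreeMF) : Matrix (F.I × G.I) (F.I × G.I) (Coord 2) :=
  F.E.map pull12 ⊗ₖ 1

/-- The correction in the direction `e₁ e₂`, with the Koszul sign. -/
def tensorE12 (F G : FreeMF) : Matrix (F.I × G.I) (F.I × G.I) (Coord 2) :=
  signMat F.sgn ⊗ₖ G.E.map pull23

/-- The weights of the tensor product. -/
def tensorWt (F G : FreeMF) (p : F.I × G.I) : Torus 2 →* ℂˣ :=
  (F.wt p.1).comp tor12Hom * (G.wt p.2).comp tor23Hom

theorem tensor_wt (F G : FreeMF) (t : Torus 2) :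
    HasWt (tensorWt F G) t (chiT 2 t) (tensorD F G) ∧
    (∀ a, HasWt (tensorWt F G) t (root 2 a t) (tensorA F G a)) ∧
    HasWt (tensorWt F G) t (root 2 0 t * root 2 1 t * (chiT 2 t)⁻¹) (tensorE01 F G) ∧
    HasWt (tensorWt F G) t (root 2 1 t * root 2 2 t * (chiT 2 t)⁻¹) (tensorE12 F G) := by
  have fD : HasWt (fun i => (F.wt i).comp tor12Hom) t (chiT 2 t) (F.D.map pull12) :=
    HasWt.pull12 (F.D_wt (tor12 t))
  have gD : HasWt (fun i => (G.wt i).comp tor23Hom) t (chiT 2 t) (G.D.map pull23) :=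
    HasWt.pull23 (G.D_wt (tor23 t))
  have fA0 : HasWt (fun i => (F.wt i).comp tor12Hom) t (root 2 0 t) ((F.A 0).map pull12) :=
    HasWt.pull12 (F.A_wt 0 (tor12 t))
  have fA1 : HasWt (fun i => (F.wt i).comp tor12Hom) t (root 2 1 t) ((F.A 1).map pull12) :=
    HasWt.pull12 (F.A_wt 1 (tor12 t))
  have gA0 : HasWt (fun i => (G.wt i).comp tor23Hom) t (root 2 1 t) ((G.A 0).map pull23) :=
    HasWt.pull23 (G.A_wt 0 (tor23 t))
  have gA1 : HasWt (fun i => (G.wt i).comp tor23Hom) t (root 2 2 t) ((G.A 1).map pull23) :=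
    HasWt.pull23 (G.A_wt 1 (tor23 t))
  have fE : HasWt (fun i => (F.wt i).comp tor12Hom) t
      (root 2 0 t * root 2 1 t * (chiT 2 t)⁻¹) (F.E.map pull12) :=
    HasWt.pull12 (F.E_wt (tor12 t))
  have gE : HasWt (fun i => (G.wt i).comp tor23Hom) t
      (root 2 1 t * root 2 2 t * (chiT 2 t)⁻¹) (G.E.map pull23) :=
    HasWt.pull23 (G.E_wt (tor23 t))
  have f1 := HasWt.one (fun i => (F.wt i).comp tor12Hom) t
  have g1 := HasWt.one (fun i => (G.wt i).comp tor23Hom) t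
  have fs := HasWt.sign (fun i => (F.wt i).comp tor12Hom) t F.sgn
  refine ⟨?_, ?_, ?_, ?_⟩
  · have h1 := fD.kronecker g1
    have h2 := fs.kronecker gD
    rw [mul_one] at h1
    rw [one_mul] at h2
    exact h1.add h2
  · intro a
    fin_cases a
    · have h1 := fA0.kronecker g1
      rw [mul_one] at h1
      exact h1
    · have h1 := fA1.kronecker g1
      have h2 := f1.kronecker gA0
      rw [mul_one] at h1
      rw [one_mul] at h2
      exact h1.add h2
    · have h2 := f1.kronecker gA1
      rw [one_mul] at h2
      exact h2
  · have h1 := fE.kronecker g1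
    rw [mul_one] at h1
    exact h1
  · have h2 := fs.kronecker gE
    rw [one_mul] at h2
    exact h2

theorem neg_kron {I J : Type} (M : Matrix I I (Coord 2)) (N : Matrix J J (Coord 2)) :
    (-M) ⊗ₖ N = -(M ⊗ₖ N) := by
  ext i j
  simp [Matrix.kroneckerMap_apply]

theorem kron_neg {I J : Type} (M : Matrix I I (Coord 2)) (N : Matrix J J (Coord 2)) :
    M ⊗ₖ (-N) = -(M ⊗ₖ N) := by
  ext i j
  simp [Matrix.kroneckerMap_apply]

theorem sub_kron {I J : Type} (M M' : Matrix I I (Coord 2)) (N : Matrix J J (Coord 2)) :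
    (M - M') ⊗ₖ N = M ⊗ₖ N - M' ⊗ₖ N := by
  rw [sub_eq_add_neg, Matrix.add_kronecker, neg_kron, ← sub_eq_add_neg]

theorem kron_sub {I J : Type} (M : Matrix I I (Coord 2)) (N N' : Matrix J J (Coord 2)) :
    M ⊗ₖ (N - N') = M ⊗ₖ N - M ⊗ₖ N' := by
  rw [sub_eq_add_neg, Matrix.kronecker_add, kron_neg, ← sub_eq_add_neg]

/-- `π₁₂^*(F) ⊗ π₂₃^*(G)`. -/
def tensor (F G : FreeMF) : ConMF :=
  have hf := F.pulled pull12 lift12 lie_lift12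
  have hg := G.pulled pull23 lift23 lie_lift23
  have fz := fun M : Matrix F.I F.I (Coord 1) => map_lie_zero pull12 (lieDer 2 2) lie_pull12_2 M
  have gz := fun M : Matrix G.I G.I (Coord 1) => map_lie_zero pull23 (lieDer 2 0) lie_pull23_0 M
  { I := F.I × G.I
    sgn := fun p => F.sgn p.1 * G.sgn p.2
    wt := tensorWt F G
    D := tensorD F G
    A := tensorA F G
    E01 := tensorE01 F G
    E12 := tensorE12 F G
    D_odd := by
      rw [signMat_prod, tensorD, mul_add, add_mul, ← Matrix.mul_kronecker_mul,
        ← Matrix.mul_kronecker_mul, ← Matrix.mul_kronecker_mul, ← Matrix.mul_kronecker_mul,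
        hf.1, hg.1, neg_kron, kron_neg, neg_add, one_mul, mul_one]
    A_even := by
      intro a
      rw [signMat_prod]
      fin_cases a
      · change _ * (F.A 0).map pull12 ⊗ₖ 1 = (F.A 0).map pull12 ⊗ₖ 1 * _
        rw [← Matrix.mul_kronecker_mul, ← Matrix.mul_kronecker_mul, hf.2.2.1, one_mul, mul_one]
      · change _ * ((F.A 1).map pull12 ⊗ₖ 1 + 1 ⊗ₖ (G.A 0).map pull23) =
          ((F.A 1).map pull12 ⊗ₖ 1 + 1 ⊗ₖ (G.A 0).map pull23) * _
        rw [mul_add, add_mul, ← Matrix.mul_kronecker_mul, ← Matrix.mul_kronecker_mul,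
          ← Matrix.mul_kronecker_mul, ← Matrix.mul_kronecker_mul, hf.2.2.1, hg.2.2.1,
          one_mul, mul_one, one_mul, mul_one]
      · change _ * 1 ⊗ₖ (G.A 1).map pull23 = 1 ⊗ₖ (G.A 1).map pull23 * _
        rw [← Matrix.mul_kronecker_mul, ← Matrix.mul_kronecker_mul, hg.2.2.1, one_mul, mul_one]
    E01_odd := by
      rw [signMat_prod, tensorE01, ← Matrix.mul_kronecker_mul, ← Matrix.mul_kronecker_mul,
        hf.2.1, neg_kron, one_mul, mul_one]
    E12_odd := by
      rw [signMat_prod, tensorE12, ← Matrix.mul_kronecker_mul, ← Matrix.mul_kronecker_mul,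
        hg.2.1, kron_neg]
    D_wt := fun t => (tensor_wt F G t).1
    A_wt := fun a t => (tensor_wt F G t).2.1 a
    E01_wt := fun t => (tensor_wt F G t).2.2.1
    E12_wt := fun t => (tensor_wt F G t).2.2.2
    D_sq := by
      rw [tensorD, mul_add, add_mul, add_mul]
      simp only [← Matrix.mul_kronecker_mul]
      rw [hf.1, hf.2.2.2.1, hg.2.2.2.1, signMat_sq, neg_kron, one_mul, one_mul, mul_one, ← pull_W,
        Matrix.smul_kronecker, Matrix.kronecker_smul, Matrix.one_kronecker_one, add_smul]
      abel
    D_A := by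
      obtain ⟨f1, f2, f3, f4, f5, f6⟩ := hf
      obtain ⟨g1, g2, g3, g4, g5, g6⟩ := hg
      intro a
      fin_cases a
      · change tensorD F G * (F.A 0).map pull12 ⊗ₖ 1 =
          (tensorD F G).map (lieDer 2 0) + (F.A 0).map pull12 ⊗ₖ 1 * tensorD F G
        rw [tensorD, mul_add, add_mul, add_deriv, kronecker_deriv, kronecker_deriv, gz, one_deriv,
          signMat_deriv]
        simp only [← Matrix.mul_kronecker_mul]
        rw [f3, f5]
        simp only [one_mul, mul_one, Matrix.add_kronecker, Matrix.zero_kronecker,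
          Matrix.kronecker_zero]
        change (F.D.map pull12).map (lieDer 2 0) ⊗ₖ 1 + _ + _ = _
        abel
      · change tensorD F G * ((F.A 1).map pull12 ⊗ₖ 1 + 1 ⊗ₖ (G.A 0).map pull23) =
          (tensorD F G).map (lieDer 2 1) +
            ((F.A 1).map pull12 ⊗ₖ 1 + 1 ⊗ₖ (G.A 0).map pull23) * tensorD F G
        rw [tensorD, mul_add, add_mul, add_mul, add_mul, mul_add, mul_add, add_deriv,
          kronecker_deriv, kronecker_deriv, one_deriv, signMat_deriv]
        simp only [← Matrix.mul_kronecker_mul]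
        rw [f3, f5, g5]
        simp only [one_mul, mul_one, Matrix.add_kronecker, Matrix.kronecker_add,
          Matrix.zero_kronecker, Matrix.kronecker_zero]
        change (F.D.map pull12).map (lieDer 2 1) ⊗ₖ 1 + _ + _ +
          (_ + (_ ⊗ₖ (G.D.map pull23).map (lieDer 2 1) + _)) = _
        abel
      · change tensorD F G * 1 ⊗ₖ (G.A 1).map pull23 =
          (tensorD F G).map (lieDer 2 2) + 1 ⊗ₖ (G.A 1).map pull23 * tensorD F G
        rw [tensorD, mul_add, add_mul, add_deriv, kronecker_deriv, kronecker_deriv, fz, one_deriv,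
          signMat_deriv]
        simp only [← Matrix.mul_kronecker_mul]
        rw [g5]
        simp only [one_mul, mul_one, Matrix.kronecker_add, Matrix.zero_kronecker,
          Matrix.kronecker_zero]
        change _ + (_ ⊗ₖ (G.D.map pull23).map (lieDer 2 2) + _) = _
        abel
    D_E01 := by
      obtain ⟨f1, f2, f3, f4, f5, f6⟩ := hf
      change (F.D.map pull12 ⊗ₖ 1 + signMat F.sgn ⊗ₖ G.D.map pull23) * (F.E.map pull12 ⊗ₖ 1) +
        (F.E.map pull12 ⊗ₖ 1) * (F.D.map pull12 ⊗ₖ 1 + signMat F.sgn ⊗ₖ G.D.map pull23) +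
        (((F.A 1).map pull12 ⊗ₖ 1 + 1 ⊗ₖ (G.A 0).map pull23).map (lieDer 2 0) -
          ((F.A 0).map pull12 ⊗ₖ 1).map (lieDer 2 1) +
          ((F.A 0).map pull12 ⊗ₖ 1) * ((F.A 1).map pull12 ⊗ₖ 1 + 1 ⊗ₖ (G.A 0).map pull23) -
          ((F.A 1).map pull12 ⊗ₖ 1 + 1 ⊗ₖ (G.A 0).map pull23) * ((F.A 0).map pull12 ⊗ₖ 1)) = 0
      rw [add_deriv, kronecker_deriv, kronecker_deriv, kronecker_deriv, gz, one_deriv, one_deriv,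
        one_deriv]
      simp only [mul_add, add_mul, ← Matrix.mul_kronecker_mul]
      rw [f2]
      have h := congrArg (fun M => M ⊗ₖ (1 : Matrix G.I G.I (Coord 2))) f6
      simp only [Matrix.add_kronecker, sub_kron, Matrix.zero_kronecker] at h
      simp only [one_mul, mul_one, Matrix.zero_kronecker, Matrix.kronecker_zero, neg_kron]
      refine Eq.trans ?_ h
      change _ = _ + (((F.A 1).map pull12).map (lieDer 2 0) ⊗ₖ 1 -
        ((F.A 0).map pull12).map (lieDer 2 1) ⊗ₖ 1 + _ - _)
      abel
    D_E12 := by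
      obtain ⟨f1, f2, f3, f4, f5, f6⟩ := hf
      obtain ⟨g1, g2, g3, g4, g5, g6⟩ := hg
      change (F.D.map pull12 ⊗ₖ 1 + signMat F.sgn ⊗ₖ G.D.map pull23) *
          (signMat F.sgn ⊗ₖ G.E.map pull23) +
        (signMat F.sgn ⊗ₖ G.E.map pull23) *
          (F.D.map pull12 ⊗ₖ 1 + signMat F.sgn ⊗ₖ G.D.map pull23) +
        ((1 ⊗ₖ (G.A 1).map pull23).map (lieDer 2 1) -
          ((F.A 1).map pull12 ⊗ₖ 1 + 1 ⊗ₖ (G.A 0).map pull23).map (lieDer 2 2) +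
          ((F.A 1).map pull12 ⊗ₖ 1 + 1 ⊗ₖ (G.A 0).map pull23) * (1 ⊗ₖ (G.A 1).map pull23) -
          (1 ⊗ₖ (G.A 1).map pull23) *
            ((F.A 1).map pull12 ⊗ₖ 1 + 1 ⊗ₖ (G.A 0).map pull23)) = 0
      rw [add_deriv, kronecker_deriv, kronecker_deriv, kronecker_deriv, fz, one_deriv, one_deriv,
        one_deriv]
      simp only [mul_add, add_mul, ← Matrix.mul_kronecker_mul]
      rw [f1, signMat_sq]
      have h := congrArg (fun M => (1 : Matrix F.I F.I (Coord 2)) ⊗ₖ M) g6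
      simp only [Matrix.kronecker_add, kron_sub, Matrix.kronecker_zero] at h
      simp only [one_mul, mul_one, Matrix.zero_kronecker, Matrix.kronecker_zero, neg_kron]
      refine Eq.trans ?_ h
      change _ = _ + (_ ⊗ₖ ((G.A 1).map pull23).map (lieDer 2 1) -
        _ ⊗ₖ ((G.A 0).map pull23).map (lieDer 2 2) + _ - _)
      abel
    A_02 := by
      change (1 ⊗ₖ (G.A 1).map pull23).map (lieDer 2 0) -
        ((F.A 0).map pull12 ⊗ₖ 1).map (lieDer 2 2) +
        ((F.A 0).map pull12 ⊗ₖ 1) * (1 ⊗ₖ (G.A 1).map pull23) -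
        (1 ⊗ₖ (G.A 1).map pull23) * ((F.A 0).map pull12 ⊗ₖ 1) = 0
      rw [kronecker_deriv, kronecker_deriv, fz, gz, one_deriv, one_deriv]
      simp only [← Matrix.mul_kronecker_mul]
      simp
    E01_A2 := by
      change (F.E.map pull12 ⊗ₖ 1) * (1 ⊗ₖ (G.A 1).map pull23) =
        (F.E.map pull12 ⊗ₖ 1).map (lieDer 2 2) +
          (1 ⊗ₖ (G.A 1).map pull23) * (F.E.map pull12 ⊗ₖ 1)
      rw [kronecker_deriv, fz, one_deriv]
      simp only [← Matrix.mul_kronecker_mul]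
      simp
    E12_A0 := by
      obtain ⟨f1, f2, f3, f4, f5, f6⟩ := hf
      change (signMat F.sgn ⊗ₖ G.E.map pull23) * ((F.A 0).map pull12 ⊗ₖ 1) =
        (signMat F.sgn ⊗ₖ G.E.map pull23).map (lieDer 2 0) +
          ((F.A 0).map pull12 ⊗ₖ 1) * (signMat F.sgn ⊗ₖ G.E.map pull23)
      rw [kronecker_deriv, gz, signMat_deriv]
      simp only [← Matrix.mul_kronecker_mul]
      rw [f3]
      simp }

/-- The convolution `F ⋆ G = π₁₃₊(CE_{𝔫⁽²⁾}(π₁₂^*(F) ⊗ π₂₃^*(G))^{T⁽²⁾})`. -/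
def conv (F G : FreeMF) : WMF := (tensor F G).push

/-! ### Koszul factorizations -/

/-- The operator `∑ a_i θ_i + b_i ∂/∂θ_i` in the basis `1, θ₁, θ₂, θ₁θ₂`. -/
def koszulD (a₁ b₁ a₂ b₂ : Coord 1) : Matrix (Fin 4) (Fin 4) (Coord 1) :=
  !![0, b₁, b₂, 0; a₁, 0, 0, -b₂; a₂, 0, 0, b₁; 0, -a₂, a₁, 0]

/-- The operator `s θ₂ ∂/∂θ₁`. -/
def koszulA (s : Coord 1) : Matrix (Fin 4) (Fin 4) (Coord 1) :=
  !![0, 0, 0, 0; 0, 0, 0, 0; 0, s, 0, 0; 0, 0, 0, 0]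

theorem wt_of {f : Coord 1} {t : Torus 1} {c u v : ℂˣ} (h : torusAut 1 t f = (c : ℂ) • f)
    (hu : u = v * c) : (u : ℂ) • f = (v : ℂ) • torusAut 1 t f := by
  rw [h, smul_smul, hu, Units.val_mul]

theorem wt_of_zero {t : Torus 1} {u v : ℂˣ} : (u : ℂ) • (0 : Coord 1) = (v : ℂ) • torusAut 1 t 0 := by
  simp

theorem torusAut_neg {f : Coord 1} {t : Torus 1} {c : ℂˣ} (h : torusAut 1 t f = (c : ℂ) • f) :
    torusAut 1 t (-f) = (c : ℂ) • -f := by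
  rw [map_neg, h, smul_neg]

/-- The Koszul factorization `ℂ[𝒳°] ⊗ Λ(θ₁, θ₂)` with differential `∑ a_i θ_i + b_i ∂/∂θ_i`, where
the odd generators `θ_i` have the weights `w_i`, the first copy of `𝔫` acts by `δ + s θ₂ ∂/∂θ₁`
and the second one by `δ`. -/
def koszul (a₁ b₁ a₂ b₂ s : Coord 1) (w₁ w₂ : Torus 1 →* ℂˣ)
    (hW : a₁ * b₁ + a₂ * b₂ = W)
    (ta₁ : ∀ t, torusAut 1 t a₁ = (((chiT 1 t)⁻¹ * (w₁ t)⁻¹ : ℂˣ) : ℂ) • a₁)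
    (tb₁ : ∀ t, torusAut 1 t b₁ = (((chiT 1 t)⁻¹ * w₁ t : ℂˣ) : ℂ) • b₁)
    (ta₂ : ∀ t, torusAut 1 t a₂ = (((chiT 1 t)⁻¹ * (w₂ t)⁻¹ : ℂˣ) : ℂ) • a₂)
    (tb₂ : ∀ t, torusAut 1 t b₂ = (((chiT 1 t)⁻¹ * w₂ t : ℂˣ) : ℂ) • b₂)
    (ts : ∀ t, torusAut 1 t s = (((root 1 0 t)⁻¹ * w₁ t * (w₂ t)⁻¹ : ℂˣ) : ℂ) • s)
    (la₁ : lieDer 1 0 a₁ = 0) (lb₁ : lieDer 1 0 b₁ = s * b₂)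
    (la₂ : lieDer 1 0 a₂ = -(s * a₁)) (lb₂ : lieDer 1 0 b₂ = 0)
    (ra₁ : lieDer 1 1 a₁ = 0) (rb₁ : lieDer 1 1 b₁ = 0)
    (ra₂ : lieDer 1 1 a₂ = 0) (rb₂ : lieDer 1 1 b₂ = 0) (rs : lieDer 1 1 s = 0) : FreeMF where
  I := Fin 4
  sgn := ![1, -1, -1, 1]
  wt := ![1, w₁, w₂, w₁ * w₂]
  D := koszulD a₁ b₁ a₂ b₂
  A := ![koszulA s, 0]
  E := 0
  D_odd i j h := by
    fin_cases i <;> fin_cases j <;> first | rfl | exact absurd h (by decide)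
  A_even a i j h := by
    fin_cases a
    · fin_cases i <;> fin_cases j <;> first | rfl | exact absurd rfl h
    · rfl
  E_odd _ _ _ := rfl
  D_wt t i j := by
    have c1 : ∀ m u v : ℂˣ, u * v = m * v * (m⁻¹ * u) := fun m u v => by
      ext; push_cast; field_simp
    have c2 : ∀ m u v : ℂˣ, u = m * (u * v) * (m⁻¹ * v⁻¹) := fun m u v => by
      ext; push_cast; field_simp
    have c3 : ∀ m u v : ℂˣ, v = m * (u * v) * (m⁻¹ * u⁻¹) := fun m u v => by
      ext; push_cast; field_simp
    have c4 : ∀ m u : ℂˣ, u = m * 1 * (m⁻¹ * u) := fun m u => by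
      ext; push_cast; field_simp
    have c5 : ∀ m u : ℂˣ, 1 = m * u * (m⁻¹ * u⁻¹) := fun m u => by
      ext; push_cast; field_simp
    fin_cases i <;> fin_cases j
    · exact wt_of_zero
    · exact wt_of (tb₁ t) (c4 _ _)
    · exact wt_of (tb₂ t) (c4 _ _)
    · exact wt_of_zero
    · exact wt_of (ta₁ t) (c5 _ _)
    · exact wt_of_zero
    · exact wt_of_zero
    · refine wt_of (torusAut_neg (tb₂ t)) ((mul_comm _ _).trans (c1 _ _ _))
    · exact wt_of (ta₂ t) (c5 _ _)
    · exact wt_of_zero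
    · exact wt_of_zero
    · exact wt_of (tb₁ t) (c1 _ _ _)
    · exact wt_of_zero
    · exact wt_of (torusAut_neg (ta₂ t)) (c2 _ _ _)
    · exact wt_of (ta₁ t) (c3 _ _ _)
    · exact wt_of_zero
  A_wt a t i j := by
    have c1 : ∀ m u v : ℂˣ, u = m * v * (m⁻¹ * u * v⁻¹) := fun m u v => by
      ext; push_cast; field_simp
    fin_cases a
    · fin_cases i <;> fin_cases j <;> first | exact wt_of_zero | exact wt_of (ts t) (c1 _ _ _)
    · exact wt_of_zero
  E_wt t i j := by simp
  D_sq := by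
    rw [← hW]
    ext i j
    fin_cases i <;> fin_cases j <;> simp [koszulD, Matrix.mul_apply, Fin.sum_univ_four] <;> ring
  D_A a := by
    fin_cases a
    · ext i j
      fin_cases i <;> fin_cases j <;>
        simp [koszulD, koszulA, Matrix.mul_apply, Fin.sum_univ_four, la₁, lb₁, la₂, lb₂] <;> ring
    · ext i j
      fin_cases i <;> fin_cases j <;>
        simp [koszulD, ra₁, rb₁, ra₂, rb₂]
  D_E := by
    ext i j
    fin_cases i <;> fin_cases j <;> simp [koszulA, rs]

/-! ### The positive crossing, the negative crossing and the unit -/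

/-- The coordinate `x_{ij}` (indices starting from `0`). -/
def x (i j : Fin 2) : Coord 1 := (generic 1).X i j
/-- The coordinate `g_{ij}` (indices starting from `0`). -/
def g (i j : Fin 2) : Coord 1 := ((generic 1).g 0).val i j
/-- The corner `y_{12}` of `Y₁` (`i = 0`) or `Y₂` (`i = 1`). -/
def y (i : Fin 2) : Coord 1 := (generic 1).y i
/-- `1 / det g`. -/
def detInv : Coord 1 := ((Matrix.GeneralLinearGroup.det ((generic 1).g 0))⁻¹ : (Coord 1)ˣ)

theorem detInv_mul : detInv * (g 0 0 * g 1 1 - g 0 1 * g 1 0) = 1 := by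
  have h : ((Matrix.GeneralLinearGroup.det ((generic 1).g 0) : (Coord 1)ˣ) : Coord 1) =
      g 0 0 * g 1 1 - g 0 1 * g 1 0 := Matrix.det_fin_two _
  rw [← h, detInv, Units.inv_mul]

theorem torusAut_x (t : Torus 1) (i j : Fin 2) : torusAut 1 t (x i j) =
    (((chiQ 1 t)⁻¹ ^ 2 * chi 1 0 i t * (chi 1 0 j t)⁻¹ : ℂˣ) : ℂ) • x i j := torusAut_X t i j
theorem torusAut_gg (t : Torus 1) (i j : Fin 2) : torusAut 1 t (g i j) =
    ((chi 1 0 i t * (chi 1 1 j t)⁻¹ : ℂˣ) : ℂ) • g i j := torusAut_g t 0 i j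
theorem torusAut_yy (t : Torus 1) (i : Fin 2) : torusAut 1 t (y i) =
    ((chiQ 1 t ^ 2 * (chiT 1 t)⁻¹ ^ 2 * chi 1 i 0 t * (chi 1 i 1 t)⁻¹ : ℂˣ) : ℂ) • y i :=
  torusAut_y t i

theorem torusAut_detInv (t : Torus 1) : torusAut 1 t detInv =
    (((chi 1 0 0 t * chi 1 0 1 t)⁻¹ * (chi 1 1 0 t * chi 1 1 1 t) : ℂˣ) : ℂ) • detInv := by
  have h := congrArg (torusAut 1 t) detInv_mul
  simp only [map_mul, map_sub, torusAut_gg, map_one] at h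
  have h2 := congrArg (fun z =>
    ((((chi 1 0 0 t * chi 1 0 1 t)⁻¹ * (chi 1 1 0 t * chi 1 1 1 t) : ℂˣ) : ℂ) • detInv) * z) h
  simp only [mul_one] at h2
  rw [← h2]
  have h3 := detInv_mul
  have : (((((chi 1 0 0 t * chi 1 0 1 t)⁻¹ * (chi 1 1 0 t * chi 1 1 1 t) : ℂˣ) : ℂ) • detInv) *
      ((((chi 1 0 0 t * (chi 1 1 0 t)⁻¹ : ℂˣ) : ℂ) • g 0 0) *
          (((chi 1 0 1 t * (chi 1 1 1 t)⁻¹ : ℂˣ) : ℂ) • g 1 1) -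
        (((chi 1 0 0 t * (chi 1 1 1 t)⁻¹ : ℂˣ) : ℂ) • g 0 1) *
          (((chi 1 0 1 t * (chi 1 1 0 t)⁻¹ : ℂˣ) : ℂ) • g 1 0))) = 1 := by
    rw [← h3]
    simp only [smul_mul_smul_comm, ← Units.val_mul]
    rw [show chi 1 0 0 t * (chi 1 1 1 t)⁻¹ * (chi 1 0 1 t * (chi 1 1 0 t)⁻¹) =
      chi 1 0 0 t * (chi 1 1 0 t)⁻¹ * (chi 1 0 1 t * (chi 1 1 1 t)⁻¹) by ext; push_cast; field_simp,
      ← smul_sub, smul_mul_smul_comm, ← Units.val_mul]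
    rw [show (chi 1 0 0 t * chi 1 0 1 t)⁻¹ * (chi 1 1 0 t * chi 1 1 1 t) *
      (chi 1 0 0 t * (chi 1 1 0 t)⁻¹ * (chi 1 0 1 t * (chi 1 1 1 t)⁻¹)) = 1 by
        ext; push_cast; field_simp, Units.val_one, one_smul]
  linear_combination (-torusAut 1 t detInv) * this

theorem lie_x (a : Fin 2) : lieDer 1 a (x 0 0) = (if a = 0 then x 1 0 else 0) ∧
    lieDer 1 a (x 0 1) = (if a = 0 then x 1 1 - x 0 0 else 0) ∧
    lieDer 1 a (x 1 0) = 0 ∧ lieDer 1 a (x 1 1) = (if a = 0 then -x 1 0 else 0) := by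
  have h := lieDer_X (k := 1) a
  have h' := fun i j => congrFun (congrFun h i) j
  refine ⟨(h' 0 0).trans ?_, (h' 0 1).trans ?_, (h' 1 0).trans ?_, (h' 1 1).trans ?_⟩ <;>
    split_ifs <;> simp [E12, Matrix.mul_apply, Fin.sum_univ_two, Matrix.vecMul, dotProduct, x]

theorem lie_g (a : Fin 2) : lieDer 1 a (g 0 0) = (if a = 0 then g 1 0 else 0) ∧
    lieDer 1 a (g 0 1) = (if a = 0 then g 1 1 else -g 0 0) ∧
    lieDer 1 a (g 1 0) = 0 ∧ lieDer 1 a (g 1 1) = (if a = 0 then 0 else -g 1 0) := by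
  have h := lieDer_g (k := 1) a 0
  have h' := fun i j => congrFun (congrFun h i) j
  refine ⟨(h' 0 0).trans ?_, (h' 0 1).trans ?_, (h' 1 0).trans ?_, (h' 1 1).trans ?_⟩ <;>
    fin_cases a <;> simp [E12, Matrix.mul_apply, Fin.sum_univ_two, Matrix.vecMul, dotProduct, g]

theorem lie_yy (a i : Fin 2) : lieDer 1 a (y i) = 0 := lieDer_y a i

theorem lie_detInv (a : Fin 2) : lieDer 1 a detInv = 0 := by
  have h := congrArg (lieDer 1 a) detInv_mul
  obtain ⟨h1, h2, h3, h4⟩ := lie_g a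
  have h5 : lieDer 1 a (g 0 0 * g 1 1 - g 0 1 * g 1 0) = 0 := by
    rw [map_sub, Derivation.leibniz, Derivation.leibniz, h1, h2, h3, h4]
    fin_cases a <;> simp [mul_comm]
  rw [Derivation.leibniz, h5, smul_zero, zero_add, smul_eq_mul, Derivation.map_one_eq_zero] at h
  linear_combination detInv * h - lieDer 1 a detInv * detInv_mul

/-- `x̃₀ = g₁₁ (x₁₁ - x₂₂) + g₂₁ x₁₂`. -/
def xt : Coord 1 := g 0 0 * (x 0 0 - x 1 1) + g 1 0 * x 0 1

theorem W_eq : W = x 1 0 * (y 0 - detInv * g 0 0 ^ 2 * y 1) + xt * (detInv * g 1 0 * y 1) := by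
  have hinv : (((generic 1).g 0)⁻¹ : GL (Fin 2) (Coord 1)).val =
      !![detInv * g 1 1, -(detInv * g 0 1); -(detInv * g 1 0), detInv * g 0 0] := by
    have h1 : ((generic 1).g 0).val * !![detInv * g 1 1, -(detInv * g 0 1);
        -(detInv * g 1 0), detInv * g 0 0] = 1 := by
      have h := detInv_mul
      ext i j
      fin_cases i <;> fin_cases j <;> simp [Matrix.mul_apply, Fin.sum_univ_two] <;>
        simp only [← g.eq_1]
      · linear_combination h
      · ring
      · ring
      · linear_combination h
    exact (Units.mul_eq_one_iff_inv_eq.1 h1)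
  have hX : (generic 1).X = !![x 0 0, x 0 1; x 1 0, x 1 1] := Matrix.eta_fin_two _
  have hg : ((generic 1).g 0).val = !![g 0 0, g 0 1; g 1 0, g 1 1] := Matrix.eta_fin_two _
  change Matrix.trace ((generic 1).X * (nil (y 0) - ((generic 1).g 0).val * nil (y 1) *
    (((generic 1).g 0)⁻¹ : GL (Fin 2) (Coord 1)).val)) = _
  rw [hinv, hX, hg]
  simp [nil, Matrix.trace_fin_two, xt]
  ring

theorem torusAut_xt (t : Torus 1) : torusAut 1 t xt =
    (((chiQ 1 t)⁻¹ ^ 2 * chi 1 0 0 t * (chi 1 1 0 t)⁻¹ : ℂˣ) : ℂ) • xt := by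
  rw [xt, map_add, map_mul, map_mul, map_sub, torusAut_gg, torusAut_gg, torusAut_x, torusAut_x,
    torusAut_x, smul_add]
  rw [show (chiQ 1 t)⁻¹ ^ 2 * chi 1 0 0 t * (chi 1 0 0 t)⁻¹ = (chiQ 1 t)⁻¹ ^ 2 from
      mul_inv_cancel_right _ _,
    show (chiQ 1 t)⁻¹ ^ 2 * chi 1 0 1 t * (chi 1 0 1 t)⁻¹ = (chiQ 1 t)⁻¹ ^ 2 from
      mul_inv_cancel_right _ _, ← smul_sub, smul_mul_smul_comm, smul_mul_smul_comm,
    ← Units.val_mul, ← Units.val_mul]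
  congr 3 <;> (ext; push_cast; field_simp)

theorem lie_xt : lieDer 1 0 xt = 2 * g 0 0 * x 1 0 ∧ lieDer 1 1 xt = 0 := by
  constructor <;>
    simp [xt, Derivation.leibniz, (lie_g _).1, (lie_g _).2.2.1, (lie_x _).1, (lie_x _).2.1,
      (lie_x _).2.2.2] <;> ring

theorem torusAut_smul_mul {t : Torus 1} {c d : ℂˣ} {f h : Coord 1}
    (hf : torusAut 1 t f = (c : ℂ) • f) (hh : torusAut 1 t h = (d : ℂ) • h) :
    torusAut 1 t (f * h) = ((c * d : ℂˣ) : ℂ) • (f * h) := by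
  rw [map_mul, hf, hh, smul_mul_smul_comm, ← Units.val_mul]

theorem torusAut_congr {t : Torus 1} {c d : ℂˣ} {f : Coord 1}
    (hf : torusAut 1 t f = (c : ℂ) • f) (h : c = d) : torusAut 1 t f = (d : ℂ) • f := h ▸ hf

theorem torusAut_neg_two (t : Torus 1) :
    torusAut 1 t (-2) = ((1 : ℂˣ) : ℂ) • (-2 : Coord 1) := by
  rw [map_neg, map_ofNat, Units.val_one, one_smul]

theorem lie_two (a : Fin 2) : lieDer 1 a (2 : Coord 1) = 0 := by
  rw [show (2 : Coord 1) = 1 + 1 by norm_num, map_add, Derivation.map_one_eq_zero, add_zero]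

/-- The weight of `θ₁`. -/
def wTheta1 : Torus 1 →* ℂˣ := (chiT 1)⁻¹ * chiQ 1 ^ 2 * chi 1 0 0 * (chi 1 0 1)⁻¹
/-- The weight of `θ₂` in the crossing. -/
def wTheta2 : Torus 1 →* ℂˣ := (chiT 1)⁻¹ * chiQ 1 ^ 2 * chi 1 1 0 * (chi 1 0 0)⁻¹
/-- The weight of `θ₂` in the unit. -/
def wUnit2 : Torus 1 →* ℂˣ := chiT 1 * chi 1 1 1 * (chi 1 0 0)⁻¹

theorem wTheta1_apply (t : Torus 1) :
    wTheta1 t = (chiT 1 t)⁻¹ * chiQ 1 t ^ 2 * chi 1 0 0 t * (chi 1 0 1 t)⁻¹ := rfl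
theorem wTheta2_apply (t : Torus 1) :
    wTheta2 t = (chiT 1 t)⁻¹ * chiQ 1 t ^ 2 * chi 1 1 0 t * (chi 1 0 0 t)⁻¹ := rfl
theorem wUnit2_apply (t : Torus 1) :
    wUnit2 t = chiT 1 t * chi 1 1 1 t * (chi 1 0 0 t)⁻¹ := rfl

/-- `b₁ = y₁ - y₂ g₁₁² / det g`. -/
def b1 : Coord 1 := y 0 - detInv * g 0 0 ^ 2 * y 1

theorem torusAut_b1 (t : Torus 1) :
    torusAut 1 t b1 = (((chiT 1 t)⁻¹ * wTheta1 t : ℂˣ) : ℂ) • b1 := by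
  rw [b1, map_sub, smul_sub]
  congr 1
  · refine torusAut_congr (torusAut_yy t 0) ?_
    rw [wTheta1_apply]
    ext; push_cast; field_simp
  · have h := torusAut_smul_mul (torusAut_smul_mul (torusAut_detInv t)
      (torusAut_smul_mul (torusAut_gg t 0 0) (torusAut_gg t 0 0))) (torusAut_yy t 1)
    rw [← pow_two] at h
    refine torusAut_congr h ?_
    rw [wTheta1_apply]
    ext; push_cast; field_simp

theorem lie_b1 : lieDer 1 0 b1 = -(2 * g 0 0) * (detInv * g 1 0 * y 1) ∧ lieDer 1 1 b1 = 0 := by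
  constructor <;>
    simp [b1, pow_two, Derivation.leibniz, (lie_g _).1, lie_yy, lie_detInv] <;> ring

/-- The Koszul factorization of the positive crossing, with the generator `1` of weight zero:
`a₁ = x₂₁`, `b₁ = y₁ - y₂ g₁₁² / det g`, `a₂ = g₁₁ (x₁₁ - x₂₂) + g₂₁ x₁₂`, `b₂ = y₂ g₂₁ / det g`. -/
def crossing : FreeMF :=
  koszul (x 1 0) b1 xt (detInv * g 1 0 * y 1) (-(2 * g 0 0)) wTheta1 wTheta2
    W_eq.symm
    (fun t => torusAut_congr (torusAut_x t 1 0) (by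
      rw [wTheta1_apply]; ext; push_cast; field_simp))
    torusAut_b1
    (fun t => torusAut_congr (torusAut_xt t) (by
      rw [wTheta2_apply]; ext; push_cast; field_simp))
    (fun t => torusAut_congr (torusAut_smul_mul (torusAut_smul_mul (torusAut_detInv t)
      (torusAut_gg t 1 0)) (torusAut_yy t 1)) (by
        rw [wTheta2_apply]; ext; push_cast; field_simp))
    (fun t => by
      rw [← neg_mul]
      refine torusAut_congr (torusAut_smul_mul (torusAut_neg_two t) (torusAut_gg t 0 0)) ?_
      rw [wTheta2_apply, wTheta1_apply, root]
      change _ = (chi 1 0 0 t * (chi 1 0 1 t)⁻¹)⁻¹ * _ * _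
      ext; push_cast; field_simp)
    (lie_x 0).2.2.1 lie_b1.1
    (by rw [lie_xt.1]; ring)
    (by simp [Derivation.leibniz, lie_yy, lie_detInv, (lie_g _).2.2.1])
    (lie_x 1).2.2.1 lie_b1.2 lie_xt.2
    (by simp [Derivation.leibniz, lie_yy, lie_detInv, (lie_g _).2.2.1])
    (by simp [Derivation.leibniz, (lie_g _).1, lie_two])

/-- The unit `1₂`, the Koszul factorization with `a₁ = x₂₁`, `b₁ = y₁ - y₂ g₁₁² / det g`,
`a₂ = y₂ (g₁₁ (x₁₁ - x₂₂) + g₂₁ x₁₂)`, `b₂ = g₂₁ / det g`. -/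
def unit2 : FreeMF :=
  koszul (x 1 0) b1 (y 1 * xt) (detInv * g 1 0) (-(2 * y 1 * g 0 0)) wTheta1 wUnit2
    (by rw [W_eq, b1]; ring)
    (fun t => torusAut_congr (torusAut_x t 1 0) (by
      rw [wTheta1_apply]; ext; push_cast; field_simp))
    torusAut_b1
    (fun t => torusAut_congr (torusAut_smul_mul (torusAut_yy t 1) (torusAut_xt t)) (by
      rw [wUnit2_apply]; ext; push_cast; field_simp))
    (fun t => torusAut_congr (torusAut_smul_mul (torusAut_detInv t) (torusAut_gg t 1 0)) (by
        rw [wUnit2_apply]; ext; push_cast; field_simp))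
    (fun t => by
      rw [← neg_mul, ← neg_mul]
      refine torusAut_congr (torusAut_smul_mul (torusAut_smul_mul (torusAut_neg_two t)
        (torusAut_yy t 1)) (torusAut_gg t 0 0)) ?_
      rw [wUnit2_apply, wTheta1_apply, root]
      change _ = (chi 1 0 0 t * (chi 1 0 1 t)⁻¹)⁻¹ * _ * _
      ext; push_cast; field_simp)
    (lie_x 0).2.2.1 (by rw [lie_b1.1]; ring)
    (by
      rw [Derivation.leibniz, lie_yy, lie_xt.1, smul_zero, add_zero, smul_eq_mul]
      ring)
    (by simp [Derivation.leibniz, lie_detInv, (lie_g _).2.2.1])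
    (lie_x 1).2.2.1 lie_b1.2 (by simp [Derivation.leibniz, lie_xt.2, lie_yy])
    (by simp [Derivation.leibniz, lie_detInv, (lie_g _).2.2.1])
    (by simp [Derivation.leibniz, (lie_g _).1, lie_yy, lie_two])

/-- The positive crossing `C₊`, with its `T_sc`-weights normalized by `[ℂ*_a]⁻¹ [ℂ*_t]`. -/
def Cplus : FreeMF := crossing.twist ((chiQ 1)⁻¹ * chiT 1)

/-- The negative crossing `C₋ = C₊⟨-χ₁, χ₂⟩`. -/
def Cminus : FreeMF := Cplus.twist ((chi 1 0 0)⁻¹ * chi 1 1 1)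

end

end BraidMF

/-!
Write `N` for the tensor product of the pullbacks of the two crossings, `θ₁, θ₂` for the odd generators of the
first factor and `θ₃, θ₄` for those of the second one. The convolution is the complex of functions with values
in `N ⊗ Λ(e₁)` which are invariant under the middle torus; its differential is `D + e₁ ∇`, where `∇` is the
action of `E₁₂` of the middle copy of `𝔫`.

*Change of basis.* Row operations `1 + ∂/∂θ ⊗ (α θ₃ + γ θ₄)` (`Con.Q`) bring the Koszul matrix of `N` into a
form in which the first factor has the coefficients `a₁ = x₂₁`, `b₁` of the unit, and in which the second factor
has `a₃ = 0` and `b₃ = z`, where `z = y₂ - y₃ b₁₁² / det b`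
(`Con.dOld_Q`, `Con.Q_cov_zero`, `Con.Q_cov_one`, `Con.Q_cov_two`). Hence `θ₃` eliminates the coordinate `y₂`:
every function is uniquely the sum of a function which does not depend on `y₂` and of a multiple of `z`
(`Con.eq_τ_add`, `Con.eq_zero_of_add_mul`).

*Cohomology of the middle copy of `𝔫`.* What remains are functions of `X, y₁, a, b, y₃`, on which `GL₂` acts by
`(a, b) ↦ (a c, c⁻¹ b)`. On them `E = E₁₂` is the raising operator of a locally finite action of `𝔰𝔩₂`, and the
theory of such actions (`IsSlTwo`) gives: `E` is injective on functions of negative weight and surjective onto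
functions of positive weight (`Con.eq_zero_of_E`, `Con.exists_eq_E`), and every function of weight zero is
uniquely the sum of an element of the image of `E` and of a `GL₂`-invariant function, that is, a function of
`X, y₁, a b, y₃` (`Con.exists_eq_pull13_add`, `Con.eq_zero_of_pull13_add`). This is the
cohomology of the relevant line bundles on `ℙ¹ = GL₂ / B`, in explicit form.

*The equivalence.* Of the coefficients which remain, only four have nonzero cohomology, and these assemble to the unit: there is
an explicit morphism from the unit to the convolution (`Con.exists_isHom`), and the convolution is the direct sum of
its image, of an explicit graded subspace `Con.comp` and of the image of `Con.comp` under the differential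
(`Con.exists_decomposition`, `Con.decomposition_unique`). The last two summands together are contractible, so the
morphism is a homotopy equivalence (`WMF.isomorphic_of_bijective`).
-/

open Matrix
open scoped Kronecker

namespace BraidMF

noncomputable section

/-! ### Complements of a factorization up to homotopy -/

namespace WMF

theorem dTot_apply (P : WMF) (m : P.Tot) : P.dTot m =
    (P.D m.1, P.nabla 0 m.1 - P.D m.2.1, P.nabla 1 m.1 - P.D m.2.2.1,
      P.corr m.1 - P.nabla 1 m.2.1 + P.nabla 0 m.2.2.1 + P.D m.2.2.2) := rfl

theorem dTot_add (P : WMF) (m n : P.Tot) : P.dTot (m + n) = P.dTot m + P.dTot n := by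
  simp only [dTot_apply, Prod.fst_add, Prod.snd_add, map_add, Prod.mk_add_mk]
  ext <;> simp only [] <;> abel

theorem dTot_zero (P : WMF) : P.dTot 0 = 0 := by
  simp [dTot_apply]

theorem dTot_neg (P : WMF) (m : P.Tot) : P.dTot (-m) = -P.dTot m := by
  rw [eq_neg_iff_add_eq_zero, ← dTot_add, neg_add_cancel, dTot_zero]

theorem dTot_sub (P : WMF) (m n : P.Tot) : P.dTot (m - n) = P.dTot m - P.dTot n := by
  rw [sub_eq_add_neg, dTot_add, dTot_neg, ← sub_eq_add_neg]

theorem dTot_e₀ (P : WMF) (m : P.Tot) : P.dTot (P.e₀ m) = -P.e₀ (P.dTot m) := by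
  simp only [dTot_apply, e₀, map_zero, Prod.neg_mk]
  ext <;> simp [sub_eq_add_neg, add_comm]

theorem dTot_e₁ (P : WMF) (m : P.Tot) : P.dTot (P.e₁ m) = -P.e₁ (P.dTot m) := by
  simp only [dTot_apply, e₁, map_zero, Prod.neg_mk]
  ext <;> simp [sub_eq_add_neg]

theorem dTot_smul (P : WMF) (f : Coord 1) (m : P.Tot) : P.dTot (f • m) =
    f • P.dTot m + (lieDer 1 0 f • P.e₀ m + lieDer 1 1 f • P.e₁ m) := by
  simp only [dTot_apply, e₀, e₁, Prod.smul_fst, Prod.smul_snd, map_smul, nabla_smul]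
  ext <;> simp [smul_sub, smul_add] <;> abel

theorem dTot_parTot (P : WMF) (m : P.Tot) : P.dTot (P.parTot m) = -P.parTot (P.dTot m) := by
  simp only [dTot_apply, parTot, map_neg, map_sub, map_add, par_D, par_nabla, par_corr]
  ext <;> simp; abel

theorem dTot_dTot (P : WMF) (m : P.Tot) : P.dTot (P.dTot m) = W • m := P.sq m

theorem csmul_csmul {M : Type} [AddCommGroup M] [Module (Coord 1) M] (a b : ℂˣ) (m : M) :
    csmul a (csmul b m) = csmul (a * b) m := by
  simp only [csmul, smul_smul, ← map_mul, Units.val_mul]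

theorem csmul_add {M : Type} [AddCommGroup M] [Module (Coord 1) M] (a : ℂˣ) (m n : M) :
    csmul a (m + n) = csmul a m + csmul a n := smul_add _ _ _

theorem csmul_sub {M : Type} [AddCommGroup M] [Module (Coord 1) M] (a : ℂˣ) (m n : M) :
    csmul a (m - n) = csmul a m - csmul a n := smul_sub _ _ _

theorem csmul_inv_csmul {M : Type} [AddCommGroup M] [Module (Coord 1) M] (a : ℂˣ) (m : M) :
    csmul a⁻¹ (csmul a m) = m := by
  rw [csmul_csmul, inv_mul_cancel]; simp [csmul]

theorem map_csmul {M N : Type} [AddCommGroup M] [Module (Coord 1) M] [AddCommGroup N]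
    [Module (Coord 1) N] (φ : M →ₗ[Coord 1] N) (a : ℂˣ) (m : M) :
    φ (csmul a m) = csmul a (φ m) := map_smul _ _ _

theorem nabla_csmul (P : WMF) (a : Fin 2) (c : ℂˣ) (m : P.M) :
    P.nabla a (csmul c m) = csmul c (P.nabla a m) := by
  simp [csmul, nabla_smul]

theorem dTot_ρTot (P : WMF) (t : Torus 1) (m : P.Tot) :
    P.dTot (P.ρTot t m) = csmul (chiT 1 t) (P.ρTot t (P.dTot m)) := by
  have hc : ∀ (a : ℂˣ) (m : P.Tot), csmul a m =
    (csmul a m.1, csmul a m.2.1, csmul a m.2.2.1, csmul a m.2.2.2) := fun a m => rfl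
  simp only [dTot_apply, ρTot, hc, map_sub, map_add, map_csmul, nabla_csmul, D_ρ, nabla_ρ, corr_ρ,
    csmul_csmul, csmul_add, csmul_sub]
  have e1 : ∀ c d : ℂˣ, c * (d * c⁻¹) = d := fun c d => by rw [mul_left_comm, mul_inv_cancel, mul_one]
  have e2 : ∀ c d : ℂˣ, c * (d * c⁻¹ ^ 2) = d * c⁻¹ := fun c d => by
    rw [pow_two, mul_left_comm, mul_inv_cancel_left]
  ext
  · rfl
  · simp only [inv_mul_cancel_right, e1]
  · simp only [inv_mul_cancel_right, e1]
  · simp only [e2]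
    rw [show root 1 0 t * (chiT 1 t)⁻¹ * root 1 1 t = root 1 0 t * root 1 1 t * (chiT 1 t)⁻¹ from
        mul_right_comm _ _ _,
      show root 1 1 t * (chiT 1 t)⁻¹ * root 1 0 t = root 1 0 t * root 1 1 t * (chiT 1 t)⁻¹ by
        rw [mul_right_comm, mul_comm (root 1 1 t)],
      show root 1 0 t * root 1 1 t * (chiT 1 t)⁻¹ ^ 2 * chiT 1 t =
          root 1 0 t * root 1 1 t * (chiT 1 t)⁻¹ by
        rw [pow_two, ← mul_assoc, inv_mul_cancel_right]]

/-- If the total space of `P` is the direct sum of the image of a closed morphism `i : Q → P`, of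
`Λ(e₀, e₁) ⊗ C` and of the image of the latter under the total differential, then `i` is a homotopy
equivalence: the map which sends `i q + c + d c'` to `-c'` is a homotopy between the identity and the
projection to `Q` followed by `i`. It suffices to know the decomposition modulo `e₀, e₁`. -/
theorem isomorphic_of_bijective (P Q : WMF) (i : Q.Tot →ₗ[Coord 1] P.Tot) (hi : IsHom Q P i)
    (C : Submodule (Coord 1) P.M) (hpar : ∀ c ∈ C, P.par c ∈ C) (hρ : ∀ t, ∀ c ∈ C, P.ρ t c ∈ C)
    (hsurj : ∀ m, ∃ q, ∃ c ∈ C, ∃ c' ∈ C, m = (i (q, 0, 0, 0)).1 + c + P.D c')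
    (hinj : ∀ q, ∀ c ∈ C, ∀ c' ∈ C, (i (q, 0, 0, 0)).1 + c + P.D c' = 0 → q = 0 ∧ c = 0 ∧ c' = 0) :
    Isomorphic P Q := by
  -- the submodule `Λ(e₀, e₁) ⊗ C` and its stability
  let CT : Submodule (Coord 1) P.Tot := C.prod (C.prod (C.prod C))
  have mem : ∀ c : P.Tot, c ∈ CT ↔ c.1 ∈ C ∧ c.2.1 ∈ C ∧ c.2.2.1 ∈ C ∧ c.2.2.2 ∈ C := fun c => by
    simp [CT, Submodule.mem_prod]
  have m0 : ∀ c ∈ CT, P.e₀ c ∈ CT := fun c hc => by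
    rw [mem] at hc ⊢; exact ⟨C.zero_mem, hc.1, C.zero_mem, hc.2.2.1⟩
  have m1 : ∀ c ∈ CT, P.e₁ c ∈ CT := fun c hc => by
    rw [mem] at hc ⊢; exact ⟨C.zero_mem, C.zero_mem, hc.1, C.neg_mem hc.2.1⟩
  have mp : ∀ c ∈ CT, P.parTot c ∈ CT := fun c hc => by
    rw [mem] at hc ⊢
    exact ⟨hpar _ hc.1, C.neg_mem (hpar _ hc.2.1), C.neg_mem (hpar _ hc.2.2.1), hpar _ hc.2.2.2⟩
  have mr : ∀ t, ∀ c ∈ CT, P.ρTot t c ∈ CT := fun t c hc => by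
    rw [mem] at hc ⊢
    exact ⟨hρ _ _ hc.1, C.smul_mem _ (hρ _ _ hc.2.1), C.smul_mem _ (hρ _ _ hc.2.2.1),
      C.smul_mem _ (hρ _ _ hc.2.2.2)⟩
  -- components of `i`
  have i1 : ∀ q : Q.Tot, (i q).1 = (i (q.1, 0, 0, 0)).1 := fun q => by
    have h : q = (q.1, 0, 0, 0) + (Q.e₀ (q.2.1, 0, 0, 0) + Q.e₁ (q.2.2.1, 0, 0, 0) +
        Q.e₀ (Q.e₁ (q.2.2.2, 0, 0, 0))) := by
      ext <;> simp [WMF.e₀, WMF.e₁]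
    conv_lhs => rw [h]
    simp only [map_add, hi.e₀, hi.e₁]
    simp [WMF.e₀, WMF.e₁]
  -- existence of the decomposition
  have ex : ∀ m : P.Tot, ∃ q, ∃ c ∈ CT, ∃ c' ∈ CT, m = i q + c + P.dTot c' := by
    let S : AddSubgroup P.Tot :=
      { carrier := {m | ∃ q, ∃ c ∈ CT, ∃ c' ∈ CT, m = i q + c + P.dTot c'}
        zero_mem' := ⟨0, 0, CT.zero_mem, 0, CT.zero_mem, by simp [dTot_zero]⟩
        add_mem' := by
          rintro _ _ ⟨q, c, hc, c', hc', rfl⟩ ⟨q2, c2, hc2, c2', hc2', rfl⟩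
          refine ⟨q + q2, c + c2, CT.add_mem hc hc2, c' + c2', CT.add_mem hc' hc2', ?_⟩
          rw [map_add, dTot_add]; abel
        neg_mem' := by
          rintro _ ⟨q, c, hc, c', hc', rfl⟩
          refine ⟨-q, -c, CT.neg_mem hc, -c', CT.neg_mem hc', ?_⟩
          rw [map_neg, dTot_neg]; abel }
    have S0 : ∀ m ∈ S, P.e₀ m ∈ S := by
      rintro _ ⟨q, c, hc, c', hc', rfl⟩
      refine ⟨Q.e₀ q, P.e₀ c, m0 _ hc, -P.e₀ c', CT.neg_mem (m0 _ hc'), ?_⟩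
      rw [hi.e₀, dTot_neg, dTot_e₀, neg_neg]
      ext <;> simp [WMF.e₀]
    have S1 : ∀ m ∈ S, P.e₁ m ∈ S := by
      rintro _ ⟨q, c, hc, c', hc', rfl⟩
      refine ⟨Q.e₁ q, P.e₁ c, m1 _ hc, -P.e₁ c', CT.neg_mem (m1 _ hc'), ?_⟩
      rw [hi.e₁, dTot_neg, dTot_e₁, neg_neg]
      ext <;> simp [WMF.e₁]; abel
    have lift : ∀ m : P.M, ∃ s ∈ S, s.1 = m := by
      intro m
      obtain ⟨q, c, hc, c', hc', rfl⟩ := hsurj m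
      exact ⟨_, ⟨(q, 0, 0, 0), (c, 0, 0, 0), (mem _).2 ⟨hc, C.zero_mem, C.zero_mem, C.zero_mem⟩,
        (c', 0, 0, 0), (mem _).2 ⟨hc', C.zero_mem, C.zero_mem, C.zero_mem⟩, rfl⟩, rfl⟩
    intro m
    change m ∈ S
    obtain ⟨s, hs, h1⟩ := lift m.1
    obtain ⟨s0, hs0, h2⟩ := lift (m - s).2.1
    obtain ⟨s1, hs1, h3⟩ := lift (m - s).2.2.1
    obtain ⟨s2, hs2, h4⟩ := lift (m - s - P.e₀ s0 - P.e₁ s1).2.2.2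
    have : m = s + P.e₀ s0 + P.e₁ s1 + P.e₀ (P.e₁ s2) := by
      ext
      · simp [WMF.e₀, WMF.e₁, h1]
      · simp [WMF.e₀, WMF.e₁, h2]
      · simp [WMF.e₀, WMF.e₁, h3]
      · simp [WMF.e₀, WMF.e₁, h4]; abel
    rw [this]
    exact S.add_mem (S.add_mem (S.add_mem hs (S0 _ hs0)) (S1 _ hs1)) (S0 _ (S1 _ hs2))
  -- uniqueness of the decomposition
  have un : ∀ q, ∀ c ∈ CT, ∀ c' ∈ CT, i q + c + P.dTot c' = 0 → q = 0 ∧ c = 0 ∧ c' = 0 := by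
    rintro ⟨q, q0, q1, q2⟩ ⟨c, c0, c1, c2⟩ hc ⟨c', c0', c1', c2'⟩ hc' h
    rw [mem] at hc hc'
    simp only at hc hc'
    have g1 := congrArg (fun x : P.Tot => x.1) h
    simp only [Prod.fst_add, Prod.fst_zero, dTot_apply, i1 (q, q0, q1, q2)] at g1
    obtain ⟨rfl, rfl, rfl⟩ := hinj _ _ hc.1 _ hc'.1 g1
    have hq : ((0, q0, q1, q2) : Q.Tot) = Q.e₀ (q0, 0, q2, 0) + Q.e₁ (q1, 0, 0, 0) := by
      ext <;> simp [WMF.e₀, WMF.e₁]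
    rw [hq, map_add, hi.e₀, hi.e₁] at h
    have g2 := congrArg (fun x : P.Tot => x.2.1) h
    have g3 := congrArg (fun x : P.Tot => x.2.2.1) h
    simp only [Prod.fst_add, Prod.snd_add, Prod.fst_zero, Prod.snd_zero, dTot_apply, WMF.e₀, WMF.e₁,
      i1 (q0, 0, q2, 0), map_zero, zero_sub, add_zero, zero_add, ← map_neg] at g2 g3
    obtain ⟨rfl, rfl, h5⟩ := hinj _ _ hc.2.1 _ (C.neg_mem hc'.2.1) g2
    obtain ⟨rfl, rfl, h6⟩ := hinj _ _ hc.2.2.1 _ (C.neg_mem hc'.2.2.1) g3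
    rw [neg_eq_zero] at h5 h6
    subst h5 h6
    have hq : ((0, 0, q2, 0) : Q.Tot) = Q.e₁ (q2, 0, 0, 0) := by
      ext <;> simp [WMF.e₁]
    have hz : ((0, 0, 0, 0) : Q.Tot) = 0 := rfl
    rw [hq, hi.e₁, hz, map_zero] at h
    have g4 := congrArg (fun x : P.Tot => x.2.2.2) h
    simp only [Prod.snd_add, Prod.snd_zero, dTot_apply, WMF.e₀, WMF.e₁, map_zero, sub_zero,
      add_zero, zero_add, neg_zero, Prod.fst_zero] at g4
    obtain ⟨rfl, rfl, rfl⟩ := hinj _ _ hc.2.2.2 _ hc'.2.2.2 g4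
    exact ⟨rfl, rfl, rfl⟩
  -- uniqueness determines the components of the decomposition under all structure maps
  choose q c hc c' hc' hm using ex
  have key : ∀ m a, ∀ b ∈ CT, ∀ b' ∈ CT, m = i a + b + P.dTot b' → q m = a ∧ c' m = b' := by
    intro m a b hb b' hb' h
    have := un (q m - a) (c m - b) (CT.sub_mem (hc m) hb) (c' m - b') (CT.sub_mem (hc' m) hb') (by
      rw [map_sub, dTot_sub]
      have := (hm m).symm.trans h
      rw [← sub_eq_zero] at this
      rw [← this]
      abel)
    exact ⟨sub_eq_zero.1 this.1, sub_eq_zero.1 this.2.2⟩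
  have kadd : ∀ m n, q (m + n) = q m + q n ∧ c' (m + n) = c' m + c' n := fun m n =>
    key _ _ (c m + c n) (CT.add_mem (hc m) (hc n)) _ (CT.add_mem (hc' m) (hc' n)) (by
      conv_lhs => rw [hm m, hm n]
      rw [map_add, dTot_add]; abel)
  have ksmul : ∀ (f : Coord 1) m, q (f • m) = f • q m ∧ c' (f • m) = f • c' m := fun f m =>
    key _ _ (f • c m - (lieDer 1 0 f • P.e₀ (c' m) + lieDer 1 1 f • P.e₁ (c' m)))
      (CT.sub_mem (CT.smul_mem _ (hc m))
        (CT.add_mem (CT.smul_mem _ (m0 _ (hc' m))) (CT.smul_mem _ (m1 _ (hc' m))))) _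
      (CT.smul_mem _ (hc' m)) (by
        conv_lhs => rw [hm m]
        rw [map_smul, dTot_smul, smul_add, smul_add]; abel)
  have ke0 : ∀ m, q (P.e₀ m) = Q.e₀ (q m) ∧ c' (P.e₀ m) = -P.e₀ (c' m) := fun m =>
    key _ _ (P.e₀ (c m)) (m0 _ (hc m)) _ (CT.neg_mem (m0 _ (hc' m))) (by
      conv_lhs => rw [hm m]
      rw [hi.e₀, dTot_neg, dTot_e₀, neg_neg]
      ext <;> simp [WMF.e₀])
  have ke1 : ∀ m, q (P.e₁ m) = Q.e₁ (q m) ∧ c' (P.e₁ m) = -P.e₁ (c' m) := fun m =>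
    key _ _ (P.e₁ (c m)) (m1 _ (hc m)) _ (CT.neg_mem (m1 _ (hc' m))) (by
      conv_lhs => rw [hm m]
      rw [hi.e₁, dTot_neg, dTot_e₁, neg_neg]
      ext <;> simp [WMF.e₁]; abel)
  have kpar : ∀ m, q (P.parTot m) = Q.parTot (q m) ∧ c' (P.parTot m) = -P.parTot (c' m) := fun m =>
    key _ _ (P.parTot (c m)) (mp _ (hc m)) _ (CT.neg_mem (mp _ (hc' m))) (by
      conv_lhs => rw [hm m]
      rw [hi.par, dTot_neg, dTot_parTot, neg_neg]
      ext <;> simp [WMF.parTot] <;> abel)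
  have kρ : ∀ t m, q (P.ρTot t m) = Q.ρTot t (q m) ∧
      c' (P.ρTot t m) = csmul (chiT 1 t)⁻¹ (P.ρTot t (c' m)) := fun t m =>
    key _ _ (P.ρTot t (c m)) (mr t _ (hc m)) _ (CT.smul_mem _ (mr t _ (hc' m))) (by
      conv_lhs => rw [hm m]
      have hd : P.dTot (csmul (chiT 1 t)⁻¹ (P.ρTot t (c' m))) = P.ρTot t (P.dTot (c' m)) := by
        rw [csmul, dTot_smul, dTot_ρTot]
        simp only [Derivation.map_algebraMap, zero_smul, add_zero]
        exact csmul_inv_csmul _ _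
      rw [hi.ρ, hd]
      ext <;> simp [WMF.ρTot, csmul_add])
  have kd : ∀ m, q (P.dTot m) = Q.dTot (q m) ∧ c' (P.dTot m) = c m := fun m =>
    key _ _ (W • c' m) (CT.smul_mem _ (hc' m)) _ (hc m) (by
      conv_lhs => rw [hm m]
      rw [dTot_add, dTot_add, dTot_dTot, hi.d]; abel)
  have ki : ∀ a, q (i a) = a ∧ c' (i a) = 0 := fun a =>
    key _ _ 0 CT.zero_mem _ CT.zero_mem (by rw [dTot_zero]; abel)
  let r : P.Tot →ₗ[Coord 1] Q.Tot :=
    { toFun := q, map_add' := fun m n => (kadd m n).1, map_smul' := fun f m => (ksmul f m).1 }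
  let h : P.Tot →ₗ[Coord 1] P.Tot :=
    { toFun := fun m => -c' m
      map_add' := fun m n => by rw [(kadd m n).2, neg_add]
      map_smul' := fun f m => by rw [(ksmul f m).2, RingHom.id_apply, smul_neg] }
  refine ⟨r, i, ⟨fun m => (ke0 m).1, fun m => (ke1 m).1, fun m => (kpar m).1, fun t m => (kρ t m).1,
    fun m => (kd m).1⟩, hi, ⟨h, ⟨fun m => ?_, fun m => ?_, fun m => ?_, fun t m => ?_⟩, fun m => ?_⟩,
    ⟨0, ⟨fun m => ?_, fun m => ?_, fun m => ?_, fun t m => ?_⟩, fun m => ?_⟩⟩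
  · change -c' (P.e₀ m) = -P.e₀ (-c' m)
    rw [(ke0 m).2]; ext <;> simp [WMF.e₀]
  · change -c' (P.e₁ m) = -P.e₁ (-c' m)
    rw [(ke1 m).2]; ext <;> simp [WMF.e₁]
  · change -c' (P.parTot m) = -P.parTot (-c' m)
    rw [(kpar m).2]; ext <;> simp [WMF.parTot]
  · change -c' (P.ρTot t m) = csmul _ (P.ρTot t (-c' m))
    rw [(kρ t m).2]
    ext <;> simp [WMF.ρTot, csmul]
  · change i (q m) - m = P.dTot (-c' m) + -c' (P.dTot m)
    rw [(kd m).2, dTot_neg]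
    conv_lhs => rw [hm m]
    rw [(key (i (q m) + c m + P.dTot (c' m)) _ _ (hc m) _ (hc' m) rfl).1]
    abel
  · ext <;> simp [WMF.e₀]
  · ext <;> simp [WMF.e₁]
  · ext <;> simp [WMF.parTot]
  · ext <;> simp [WMF.ρTot, csmul]
  · change q (i m) - m = Q.dTot 0 + 0
    rw [(ki m).1, dTot_zero]; abel

/-- A closed morphism `A + e₀ B` of factorizations without second order corrections. -/
theorem isHom_of_components (P Q : WMF) (A B : Q.M →ₗ[Coord 1] P.M) (hP : P.corr = 0)
    (hQ : Q.corr = 0) (hAD : ∀ m, P.D (A m) = A (Q.D m))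
    (hA0 : ∀ m, P.nabla 0 (A m) = A (Q.nabla 0 m) + (P.D (B m) + B (Q.D m)))
    (hA1 : ∀ m, P.nabla 1 (A m) = A (Q.nabla 1 m)) (hB1 : ∀ m, P.nabla 1 (B m) = B (Q.nabla 1 m))
    (hAp : ∀ m, P.par (A m) = A (Q.par m)) (hBp : ∀ m, P.par (B m) = -B (Q.par m))
    (hAρ : ∀ t m, P.ρ t (A m) = A (Q.ρ t m))
    (hBρ : ∀ t m, B (Q.ρ t m) = csmul (root 1 0 t * (chiT 1 t)⁻¹) (P.ρ t (B m))) :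
    ∃ i : Q.Tot →ₗ[Coord 1] P.Tot, IsHom Q P i ∧ ∀ q, (i (q, 0, 0, 0)).1 = A q := by
  let i : Q.Tot →ₗ[Coord 1] P.Tot :=
    { toFun := fun m => (A m.1, B m.1 + A m.2.1, A m.2.2.1, A m.2.2.2 - B m.2.2.1)
      map_add' := fun m n => by ext <;> simp <;> abel
      map_smul' := fun f m => by ext <;> simp [smul_sub] }
  have ia : ∀ m, i m = (A m.1, B m.1 + A m.2.1, A m.2.2.1, A m.2.2.2 - B m.2.2.1) := fun _ => rfl
  refine ⟨i, ⟨fun m => ?_, fun m => ?_, fun m => ?_, fun t m => ?_, fun m => ?_⟩, fun q => rfl⟩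
  · ext <;> simp [ia, WMF.e₀]
  · ext <;> simp [ia, WMF.e₁]
    abel
  · ext <;> simp [ia, WMF.parTot, hAp, hBp]
    · abel
  · have hc : ∀ (c : ℂˣ) (m : Q.M), B (csmul c m) = csmul c (B m) := fun c m => map_csmul _ _ _
    have hc' : ∀ (c : ℂˣ) (m : Q.M), A (csmul c m) = csmul c (A m) := fun c m => map_csmul _ _ _
    ext <;> simp [ia, WMF.ρTot, hAρ, hBρ, hc, hc', csmul_csmul, csmul_add, csmul_sub]
    rw [show root 1 1 t * (chiT 1 t)⁻¹ * (root 1 0 t * (chiT 1 t)⁻¹) =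
      root 1 0 t * root 1 1 t * ((chiT 1 t)⁻¹) ^ 2 by
        rw [mul_mul_mul_comm, ← pow_two, mul_comm (root 1 1 t)]]
    simp
  · ext
    · simp [ia, dTot_apply, hAD]
    · simp [ia, dTot_apply, hAD, hA0]; abel
    · simp [ia, dTot_apply, hAD, hA1]
    · simp [ia, dTot_apply, hAD, hA0, hA1, hB1, hP, hQ]; abel

end WMF

/-! ### Weight spaces of locally nilpotent `𝔰𝔩₂`-modules -/

section SlTwo

variable {M : Type} [AddCommGroup M] [Module ℂ M]

/-- Locally nilpotent operators `E`, `F` which raise and lower the index of the subspaces `V k` by one, whose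
commutator acts on `V k` by `2 k + c`. The subspaces need not span `M` or be independent. -/
structure IsSlTwo (E F : M →ₗ[ℂ] M) (c : ℤ) (V : ℤ → Submodule ℂ M) : Prop where
  raise : ∀ k, ∀ v ∈ V k, E v ∈ V (k + 1)
  lower : ∀ k, ∀ v ∈ V k, F v ∈ V (k - 1)
  comm : ∀ k, ∀ v ∈ V k, E (F v) = F (E v) + ((2 * k + c : ℤ) : ℂ) • v
  nilE : ∀ v, ∃ n : ℕ, (E ^ n) v = 0
  nilF : ∀ v, ∃ n : ℕ, (F ^ n) v = 0

namespace IsSlTwo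

variable {E F : M →ₗ[ℂ] M} {c : ℤ} {V : ℤ → Submodule ℂ M}

theorem swap (h : IsSlTwo E F c V) : IsSlTwo F E (-c) fun k => V (-k) where
  raise k v hv := by
    have := h.lower _ v hv
    rwa [show -k - 1 = -(k + 1) by ring] at this
  lower k v hv := by
    have := h.raise _ v hv
    rwa [show -k + 1 = -(k - 1) by ring] at this
  comm k v hv := by
    rw [h.comm _ v hv, add_assoc, ← add_smul]
    push_cast
    ring_nf
    simp
  nilE := h.nilF
  nilF := h.nilE

theorem pow_mem (h : IsSlTwo E F c V) (n : ℕ) {k : ℤ} {v : M} (hv : v ∈ V k) :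
    (E ^ n) v ∈ V (k + n) := by
  induction n with
  | zero => simpa using hv
  | succ n ih =>
    rw [pow_succ', Module.End.mul_apply]
    have := h.raise _ _ ih
    rwa [add_assoc] at this

theorem pow_comm (h : IsSlTwo E F c V) (n : ℕ) {k : ℤ} {v : M} (hv : v ∈ V k) :
    (E ^ (n + 1)) (F v) = F ((E ^ (n + 1)) v) +
      (((n + 1) * (2 * k + c + n) : ℤ) : ℂ) • (E ^ n) v := by
  induction n with
  | zero => simpa using h.comm k v hv
  | succ n ih =>
    rw [pow_succ', Module.End.mul_apply, ih, map_add, map_smul, h.comm _ _ (h.pow_mem (n + 1) hv),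
      ← Module.End.mul_apply E, ← pow_succ', ← Module.End.mul_apply E, ← pow_succ', add_assoc,
      ← add_smul]
    congr 2
    push_cast
    ring

/-- Vectors of negative weight are not killed by `F E`. -/
theorem eq_zero_of_comp_eq_zero (h : IsSlTwo E F c V) {k : ℤ} (hk : 2 * k + c < 0) {v : M}
    (hv : v ∈ V k) (h0 : F (E v) = 0) : v = 0 := by
  by_contra hne
  obtain ⟨n, hn, hmin⟩ : ∃ n, (F ^ (n + 1)) v = 0 ∧ (F ^ n) v ≠ 0 := by
    classical
    have hex := h.nilF v
    have hpos : Nat.find hex ≠ 0 := fun h0 => hne (by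
      have := Nat.find_spec hex
      rw [h0] at this
      simpa using this)
    obtain ⟨n, hn⟩ := Nat.exists_eq_succ_of_ne_zero hpos
    exact ⟨n, by simpa [hn] using Nat.find_spec hex, Nat.find_min hex (by omega)⟩
  have h1 := h.swap.pow_comm n (k := -k) (v := v) (by simpa using hv)
  rw [hn, map_zero, zero_add, pow_succ, Module.End.mul_apply, h0, map_zero] at h1
  rcases smul_eq_zero.1 h1.symm with h2 | h2
  · have : (((n : ℤ) + 1) * (2 * -k + -c + n) : ℤ) = 0 := by exact_mod_cast h2
    rcases mul_eq_zero.1 this with h3 | h3 <;> omega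
  · exact hmin h2

theorem eq_zero_of_map_eq_zero (h : IsSlTwo E F c V) {k : ℤ} (hk : 2 * k + c < 0) {v : M}
    (hv : v ∈ V k) (h0 : E v = 0) : v = 0 :=
  h.eq_zero_of_comp_eq_zero hk hv (by rw [h0, map_zero])

/-- Vectors of nonnegative weight are in the image of `E`, up to a vector of weight zero which is killed
by `E`. -/
theorem exists_eq_map_add (h : IsSlTwo E F c V) {k : ℤ} (hk : 0 ≤ 2 * k + c) {v : M} (hv : v ∈ V k) :
    ∃ w ∈ V (k - 1), ∃ x ∈ V k, E x = 0 ∧ (2 * k + c ≠ 0 → x = 0) ∧ v = E w + x := by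
  obtain ⟨n, hn⟩ := h.nilE v
  induction n generalizing v with
  | zero => exact ⟨0, Submodule.zero_mem _, 0, Submodule.zero_mem _, map_zero _, fun _ => rfl, by
      simpa using hn⟩
  | succ n ih =>
    by_cases h0 : ((n : ℤ) + 1) * (2 * k + c + n) = 0
    · have hn0 : n = 0 ∧ 2 * k + c = 0 := by
        rcases mul_eq_zero.1 h0 with h3 | h3
        · omega
        · constructor <;> omega
      obtain ⟨rfl, h3⟩ := hn0
      exact ⟨0, Submodule.zero_mem _, v, hv, by simpa using hn, fun h => absurd h3 h, by simp⟩
    · -- `E F - λ` lowers the nilpotency degree of `v`, where `λ` is the eigenvalue of `E F` on `E ^ n v`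
      set l : ℂ := (((n + 1) * (2 * k + c + n) : ℤ) : ℂ) with hl
      have hl0 : l ≠ 0 := by rw [hl]; exact_mod_cast h0
      have hEF : E (F v) ∈ V k := by
        have := h.raise _ _ (h.lower _ _ hv)
        rwa [sub_add_cancel] at this
      obtain ⟨w, hw, x, hx, hx0, hx1, he⟩ := ih (v := E (F v) - l • v)
        (Submodule.sub_mem _ hEF (Submodule.smul_mem _ _ hv)) (by
          rw [map_sub, map_smul, ← Module.End.mul_apply (E ^ n), ← pow_succ, h.pow_comm n hv, hn,
            map_zero, zero_add, sub_self])
      refine ⟨l⁻¹ • (F v - w), Submodule.smul_mem _ _ (Submodule.sub_mem _ (h.lower _ _ hv) hw),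
        -(l⁻¹ • x), Submodule.neg_mem _ (Submodule.smul_mem _ _ hx), by simp [hx0], fun h => by
          simp [hx1 h], ?_⟩
      have : l • v = E (F v) - (E w + x) := by rw [← he]; abel
      rw [map_smul, map_sub, ← sub_eq_add_neg, ← smul_sub, sub_sub, ← this, smul_smul,
        inv_mul_cancel₀ hl0, one_smul]

theorem exists_eq_map (h : IsSlTwo E F c V) {k : ℤ} (hk : 0 < 2 * k + c) {v : M} (hv : v ∈ V k) :
    ∃ w ∈ V (k - 1), v = E w := by
  obtain ⟨w, hw, x, -, -, hx, he⟩ := h.exists_eq_map_add hk.le hv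
  exact ⟨w, hw, by rw [he, hx hk.ne', add_zero]⟩

/-- In weight zero, `E` and `F` have the same kernel. -/
theorem map_lower_eq_zero (h : IsSlTwo E F c V) {k : ℤ} (hk : 2 * k + c = 0) {v : M} (hv : v ∈ V k)
    (h0 : E v = 0) : F v = 0 := by
  refine h.eq_zero_of_map_eq_zero (k := k - 1) (by omega) (h.lower _ _ hv) ?_
  rw [h.comm _ _ hv, h0, hk]
  simp

end IsSlTwo

end SlTwo

/-! ### Coordinates of the convolution space -/

theorem alg_evalPt {k : ℕ} {S S' : Type} [CommRing S] [CommRing S'] [Algebra ℂ S] [Algebra ℂ S']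
    (φ : S →ₐ[ℂ] S') (p : Pt k S) (f : Coord k) :
    φ (evalPt p f) = evalPt (p.map (φ : S →+* S')) f := by
  suffices h : φ.comp (evalPt p) = evalPt (p.map (φ : S →+* S')) from DFunLike.congr_fun h f
  apply hom_ext
  · intro i i'; simp [evalPt_X, Pt.map]
  · intro i i'; simp [evalPt_g, Pt.map]
  · intro i; simp [evalPt_y, Pt.map]

theorem evalPt_generic_self {k : ℕ} (f : Coord k) : evalPt (generic k) f = f := by
  suffices h : evalPt (generic k) = AlgHom.id ℂ _ from DFunLike.congr_fun h f
  apply hom_ext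
  · intro i i'; simp [evalPt_X]
  · intro i i'; simp [evalPt_g]
  · intro i; simp [evalPt_y]

instance (k : ℕ) : IsDomain (Coord k) := by
  refine IsLocalization.isDomain_of_le_nonZeroDivisors (M := Submonoid.powers (polyDet k))
    (Coord k) (powers_le_nonZeroDivisors_of_noZeroDivisors ?_)
  intro h
  have := isUnit_evalPoly (⟨0, fun _ => 1, 0⟩ : Pt k ℂ) ⟨polyDet k, Submonoid.mem_powers _⟩
  simp [h] at this

namespace Con

/-- The coordinates `x_{ij}` on the convolution space (indices starting from `0`). -/
def x (i j : Fin 2) : Coord 2 := (generic 2).X i j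
/-- The coordinates of the first group element `a`. -/
def a (i j : Fin 2) : Coord 2 := ((generic 2).g 0).val i j
/-- The coordinates of the second group element `b`. -/
def b (i j : Fin 2) : Coord 2 := ((generic 2).g 1).val i j
/-- The corners of `Y₁, Y₂, Y₃` (indices starting from `0`). -/
def y (i : Fin 3) : Coord 2 := (generic 2).y i
/-- `1 / det a`. -/
def ia : Coord 2 := ((Matrix.GeneralLinearGroup.det ((generic 2).g 0))⁻¹ : (Coord 2)ˣ)
/-- `1 / det b`. -/
def ib : Coord 2 := ((Matrix.GeneralLinearGroup.det ((generic 2).g 1))⁻¹ : (Coord 2)ˣ)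
/-- `det a`. -/
def da : Coord 2 := a 0 0 * a 1 1 - a 0 1 * a 1 0
/-- `det b`. -/
def db : Coord 2 := b 0 0 * b 1 1 - b 0 1 * b 1 0

theorem ia_da : ia * da = 1 := by
  have h : ((Matrix.GeneralLinearGroup.det ((generic 2).g 0) : (Coord 2)ˣ) : Coord 2) = da :=
    Matrix.det_fin_two _
  rw [← h, ia, Units.inv_mul]

theorem ib_db : ib * db = 1 := by
  have h : ((Matrix.GeneralLinearGroup.det ((generic 2).g 1) : (Coord 2)ˣ) : Coord 2) = db :=
    Matrix.det_fin_two _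
  rw [← h, ib, Units.inv_mul]

theorem matX : (generic 2).X = !![x 0 0, x 0 1; x 1 0, x 1 1] := Matrix.eta_fin_two _
theorem matA : ((generic 2).g 0).val = !![a 0 0, a 0 1; a 1 0, a 1 1] := Matrix.eta_fin_two _
theorem matB : ((generic 2).g 1).val = !![b 0 0, b 0 1; b 1 0, b 1 1] := Matrix.eta_fin_two _

theorem matA_inv : (((generic 2).g 0)⁻¹ : GL (Fin 2) (Coord 2)).val =
    !![ia * a 1 1, -(ia * a 0 1); -(ia * a 1 0), ia * a 0 0] := by
  have h1 : ((generic 2).g 0).val * !![ia * a 1 1, -(ia * a 0 1);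
      -(ia * a 1 0), ia * a 0 0] = 1 := by
    have h := ia_da
    rw [da] at h
    rw [matA]
    ext i j
    fin_cases i <;> fin_cases j <;> simp [Matrix.mul_apply, Fin.sum_univ_two]
    · linear_combination h
    · ring
    · ring
    · linear_combination h
  exact (Units.mul_eq_one_iff_inv_eq.1 h1)

/-- The entry `(i, 1)` of `a b`. -/
def gg (i : Fin 2) : Coord 2 := a i 0 * b 0 0 + a i 1 * b 1 0

/-- `a₁₁ (x₁₁ - x₂₂) + a₂₁ x₁₂` for `j = 0`, and the same expression in the second column of `a` for
`j = 1`. -/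
def xc (j : Fin 2) : Coord 2 := a 0 j * (x 0 0 - x 1 1) + a 1 j * x 0 1

/-- The value of `y₂` on the zero locus of `b₁` of the second factor. -/
def yb : Coord 2 := y 2 * b 0 0 ^ 2 * ib
/-- The pull back of `b₁` of the second factor. -/
def z : Coord 2 := y 1 - yb

theorem pull12_x (i j : Fin 2) : pull12 (BraidMF.x i j) = x i j := congrFun (congrFun pull12_X i) j
theorem pull12_gg (i j : Fin 2) : pull12 (BraidMF.g i j) = a i j := congrFun (congrFun pull12_g i) j
theorem pull13_x (i j : Fin 2) : pull13 (BraidMF.x i j) = x i j := congrFun (congrFun pull13_X i) j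
theorem pull23_gg (i j : Fin 2) : pull23 (BraidMF.g i j) = b i j := congrFun (congrFun pull23_g i) j
theorem pull13_gg (i j : Fin 2) : pull13 (BraidMF.g i j) = a i 0 * b 0 j + a i 1 * b 1 j := by
  have := congrFun (congrFun pull13_g i) j
  rw [Matrix.mul_apply, Fin.sum_univ_two] at this
  exact this
theorem pull12_y (i : Fin 2) : pull12 (BraidMF.y i) = ![y 0, y 1] i :=
  congrFun (congrArg Pt.y map_pull12) i
theorem pull23_y (i : Fin 2) : pull23 (BraidMF.y i) = ![y 1, y 2] i :=
  congrFun (congrArg Pt.y map_pull23) i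
theorem pull13_y (i : Fin 2) : pull13 (BraidMF.y i) = ![y 0, y 2] i :=
  congrFun (congrArg Pt.y map_pull13) i

theorem pull23_x (i j : Fin 2) : pull23 (BraidMF.x i j) =
    (!![ia * a 1 1, -(ia * a 0 1); -(ia * a 1 0), ia * a 0 0] * !![x 0 0, x 0 1; x 1 0, x 1 1] *
      !![a 0 0, a 0 1; a 1 0, a 1 1]) i j := by
  have := congrFun (congrFun pull23_X i) j
  rw [matA_inv, matX, matA] at this
  exact this

theorem eq_inv_of_mul {S : Type} [CommRing S] {r s t : S} (h : r * t = 1) (h' : s * t = 1) : r = s := by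
  linear_combination (-r) * h' + s * h

theorem pull12_detInv : pull12 detInv = ia := by
  refine eq_inv_of_mul (t := da) ?_ ia_da
  have := congrArg pull12 detInv_mul
  simpa [pull12_gg, da] using this

theorem pull23_detInv : pull23 detInv = ib := by
  refine eq_inv_of_mul (t := db) ?_ ib_db
  have := congrArg pull23 detInv_mul
  simpa [pull23_gg, db] using this

theorem pull13_detInv : pull13 detInv = ia * ib := by
  refine eq_inv_of_mul (t := da * db) ?_ (by linear_combination ib * db * ia_da + ib_db)
  have := congrArg pull13 detInv_mul
  simp only [map_mul, map_sub, pull13_gg, map_one] at this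
  rw [← this, da, db]
  ring

theorem pull13_b1 : pull13 b1 = y 0 - ia * ib * gg 0 ^ 2 * y 2 := by
  simp [b1, pull13_y, pull13_gg, pull13_detInv, gg]

theorem pull13_xt : pull13 xt = b 0 0 * xc 0 + b 1 0 * xc 1 := by
  simp only [xt, map_add, map_mul, map_sub, pull13_gg, pull13_x, xc]
  ring

theorem lie_x (k : Fin 3) (hk : k ≠ 0) (i j : Fin 2) : lieDer 2 k (x i j) = 0 := by
  have h := congrFun (congrFun (lieDer_X (k := 2) k) i) j
  rw [if_neg hk] at h
  exact h

theorem lie_x0 : lieDer 2 0 (x 0 0) = x 1 0 ∧ lieDer 2 0 (x 0 1) = x 1 1 - x 0 0 ∧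
    lieDer 2 0 (x 1 0) = 0 ∧ lieDer 2 0 (x 1 1) = -x 1 0 := by
  have h := fun i j => congrFun (congrFun (lieDer_X (k := 2) 0) i) j
  refine ⟨(h 0 0).trans ?_, (h 0 1).trans ?_, (h 1 0).trans ?_, (h 1 1).trans ?_⟩ <;>
    rw [if_pos rfl, matX] <;> simp [E12]

theorem lie_a0 (j : Fin 2) : lieDer 2 0 (a 0 j) = a 1 j ∧ lieDer 2 0 (a 1 j) = 0 := by
  have h := fun i j => congrFun (congrFun (lieDer_g (k := 2) 0 0) i) j
  refine ⟨(h 0 j).trans ?_, (h 1 j).trans ?_⟩ <;>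
    rw [matA] <;> fin_cases j <;> simp [E12]

theorem lie_a1 (i : Fin 2) : lieDer 2 1 (a i 0) = 0 ∧ lieDer 2 1 (a i 1) = -a i 0 := by
  have h := fun i j => congrFun (congrFun (lieDer_g (k := 2) 1 0) i) j
  refine ⟨(h i 0).trans ?_, (h i 1).trans ?_⟩ <;>
    rw [matA] <;> fin_cases i <;> simp [E12]

theorem lie_a2 (i j : Fin 2) : lieDer 2 2 (a i j) = 0 := by
  have h := congrFun (congrFun (lieDer_g (k := 2) 2 0) i) j
  refine h.trans ?_
  rw [if_neg (by decide), if_neg (by decide)]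
  simp

theorem lie_b0 (i j : Fin 2) : lieDer 2 0 (b i j) = 0 := by
  have h := congrFun (congrFun (lieDer_g (k := 2) 0 1) i) j
  refine h.trans ?_
  rw [if_neg (by decide), if_neg (by decide)]
  simp

theorem lie_b1 (j : Fin 2) : lieDer 2 1 (b 0 j) = b 1 j ∧ lieDer 2 1 (b 1 j) = 0 := by
  have h := fun i j => congrFun (congrFun (lieDer_g (k := 2) 1 1) i) j
  refine ⟨(h 0 j).trans ?_, (h 1 j).trans ?_⟩ <;>
    rw [matB, if_pos (by decide), if_neg (by decide)] <;> fin_cases j <;>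
    simp [E12]

theorem lie_b2 (i : Fin 2) : lieDer 2 2 (b i 0) = 0 ∧ lieDer 2 2 (b i 1) = -b i 0 := by
  have h := fun i j => congrFun (congrFun (lieDer_g (k := 2) 2 1) i) j
  refine ⟨(h i 0).trans ?_, (h i 1).trans ?_⟩ <;>
    rw [matB, if_neg (by decide), if_pos (by decide)] <;> fin_cases i <;>
    simp [E12]

theorem lie_y (k : Fin 3) (i : Fin 3) : lieDer 2 k (y i) = 0 := lieDer_y k i

theorem deriv_inv {S : Type} [CommRing S] [Algebra ℂ S] (d : Derivation ℂ S S) {r t : S}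
    (h : r * t = 1) (ht : d t = 0) : d r = 0 := by
  have := congrArg d h
  rw [Derivation.leibniz, ht, Derivation.map_one_eq_zero, smul_zero, zero_add, smul_eq_mul] at this
  linear_combination r * this - d r * h

theorem lie_da (k : Fin 3) : lieDer 2 k da = 0 := by
  fin_cases k
  · simp [da, Derivation.leibniz, lie_a0]; ring
  · simp [da, Derivation.leibniz, lie_a1]; ring
  · simp [da, Derivation.leibniz, lie_a2]

theorem lie_db (k : Fin 3) : lieDer 2 k db = 0 := by
  fin_cases k
  · simp [db, Derivation.leibniz, lie_b0]
  · simp [db, Derivation.leibniz, lie_b1]; ring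
  · simp [db, Derivation.leibniz, lie_b2]; ring

theorem lie_ia (k : Fin 3) : lieDer 2 k ia = 0 := deriv_inv _ ia_da (lie_da k)
theorem lie_ib (k : Fin 3) : lieDer 2 k ib = 0 := deriv_inv _ ib_db (lie_db k)

/-! ### The section `y₂ = y₃ b₁₁² / det b` -/

/-- The retraction of the convolution space to the locus `z = 0`, on functions. -/
def τ : Coord 2 →ₐ[ℂ] Coord 2 :=
  evalPt { X := (generic 2).X, g := (generic 2).g, y := ![y 0, yb, y 2] }

theorem τ_x (i j : Fin 2) : τ (x i j) = x i j := evalPt_X _ _ _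
theorem τ_a (i j : Fin 2) : τ (a i j) = a i j := evalPt_g _ _ _ _
theorem τ_b (i j : Fin 2) : τ (b i j) = b i j := evalPt_g _ _ _ _
theorem τ_y0 : τ (y 0) = y 0 := evalPt_y _ _
theorem τ_y1 : τ (y 1) = yb := evalPt_y _ _
theorem τ_y2 : τ (y 2) = y 2 := evalPt_y _ _

theorem alg_ia {S : Type} [CommRing S] [Algebra ℂ S] {φ ψ : Coord 2 →ₐ[ℂ] S}
    (h : ∀ i j, φ (a i j) = ψ (a i j)) : φ ia = ψ ia := by
  refine eq_inv_of_mul (t := φ da) (by rw [← map_mul, ia_da, map_one]) ?_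
  rw [show φ da = ψ da by simp [da, h], ← map_mul, ia_da, map_one]

theorem alg_ib {S : Type} [CommRing S] [Algebra ℂ S] {φ ψ : Coord 2 →ₐ[ℂ] S}
    (h : ∀ i j, φ (b i j) = ψ (b i j)) : φ ib = ψ ib := by
  refine eq_inv_of_mul (t := φ db) (by rw [← map_mul, ib_db, map_one]) ?_
  rw [show φ db = ψ db by simp [db, h], ← map_mul, ib_db, map_one]

theorem τ_ia : τ ia = ia := alg_ia (ψ := AlgHom.id ℂ _) τ_a
theorem τ_ib : τ ib = ib := alg_ib (ψ := AlgHom.id ℂ _) τ_b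
theorem τ_yb : τ yb = yb := by simp [yb, τ_y2, τ_b, τ_ib]
theorem τ_z : τ z = 0 := by rw [z, map_sub, τ_y1, τ_yb, sub_self]

theorem coord_hom_ext {S : Type} [CommRing S] [Algebra ℂ S] {φ ψ : Coord 2 →ₐ[ℂ] S}
    (hx : ∀ i j, φ (x i j) = ψ (x i j)) (ha : ∀ i j, φ (a i j) = ψ (a i j))
    (hb : ∀ i j, φ (b i j) = ψ (b i j)) (hy : ∀ i, φ (y i) = ψ (y i)) : φ = ψ := by
  apply hom_ext
  · exact hx
  · intro k; fin_cases k
    · exact ha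
    · exact hb
  · exact hy

/-- On functions which do not depend on `z`, a homomorphism is determined by the coordinates other
than `y₂`. -/
theorem hom_eq_of_τ {S : Type} [CommRing S] [Algebra ℂ S] {φ ψ : Coord 2 →ₐ[ℂ] S}
    (hx : ∀ i j, φ (x i j) = ψ (x i j)) (ha : ∀ i j, φ (a i j) = ψ (a i j))
    (hb : ∀ i j, φ (b i j) = ψ (b i j)) (hy0 : φ (y 0) = ψ (y 0)) (hy2 : φ (y 2) = ψ (y 2))
    {f : Coord 2} (hf : τ f = f) : φ f = ψ f := by
  rw [← hf]
  suffices h : φ.comp τ = ψ.comp τ from DFunLike.congr_fun h f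
  apply coord_hom_ext
  · intro i j; simp [τ_x, hx]
  · intro i j; simp [τ_a, ha]
  · intro i j; simp [τ_b, hb]
  · intro k; fin_cases k
    · simp [τ_y0, hy0]
    · simp [τ_y1, yb, hb, hy2, alg_ib hb]
    · simp [τ_y2, hy2]

theorem τ_τ (f : Coord 2) : τ (τ f) = τ f := by
  suffices h : τ.comp τ = τ from DFunLike.congr_fun h f
  apply coord_hom_ext
  · intro i j; simp [τ_x]
  · intro i j; simp [τ_a]
  · intro i j; simp [τ_b]
  · intro k; fin_cases k
    · simp [τ_y0]
    · simp [τ_y1, τ_yb]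
    · simp [τ_y2]

theorem z_ne_zero : z ≠ 0 := by
  intro h
  have h1 := congrArg (evalPt (⟨0, fun _ => 1, ![0, 1, 0]⟩ : Pt 2 ℂ)) h
  simp [z, yb, y, evalPt_y] at h1

/-- `f - τ f` is divisible by `z`. -/
theorem exists_quot (f : Coord 2) : ∃ r, f = τ f + z * r := by
  have h : (Ideal.Quotient.mkₐ ℂ (Ideal.span {z})) = (Ideal.Quotient.mkₐ ℂ (Ideal.span {z})).comp τ := by
    apply coord_hom_ext
    · intro i j; simp [τ_x]
    · intro i j; simp [τ_a]
    · intro i j; simp [τ_b]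
    · intro k; fin_cases k
      · simp [τ_y0]
      · simp only [Ideal.Quotient.mkₐ_eq_mk, AlgHom.comp_apply]
        rw [Ideal.Quotient.eq]
        refine Ideal.mem_span_singleton'.2 ⟨1, ?_⟩
        simp [τ_y1, z]
      · simp [τ_y2]
  have h1 : Ideal.Quotient.mk (Ideal.span {z}) f = Ideal.Quotient.mk _ (τ f) :=
    DFunLike.congr_fun h f
  rw [Ideal.Quotient.eq, Ideal.mem_span_singleton] at h1
  obtain ⟨r, hr⟩ := h1
  exact ⟨r, by rw [← hr]; ring⟩

/-- The quotient of `f - τ f` by `z`. -/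
def quot (f : Coord 2) : Coord 2 := (exists_quot f).choose

theorem eq_τ_add (f : Coord 2) : f = τ f + z * quot f := (exists_quot f).choose_spec

theorem quot_unique {f r s : Coord 2} (hr : τ r = r) (h : f = r + z * s) : τ f = r ∧ quot f = s := by
  have h1 : τ f = r := by rw [h, map_add, map_mul, τ_z, zero_mul, add_zero, hr]
  refine ⟨h1, mul_left_cancel₀ z_ne_zero ?_⟩
  have h2 := eq_τ_add f
  rw [h1] at h2
  exact add_left_cancel (h2.symm.trans h)

theorem eq_zero_of_add_mul {r s : Coord 2} (hr : τ r = r) (h : r + z * s = 0) : r = 0 ∧ s = 0 := by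
  have h1 := quot_unique hr h.symm
  have h2 := quot_unique (f := 0) (r := 0) (s := 0) (map_zero _) (by simp)
  rw [map_zero] at h1 h2
  exact ⟨h1.1.symm, h1.2.symm.trans h2.2⟩

theorem τ_pull13 (f : Coord 1) : τ (pull13 f) = pull13 f := by
  suffices h : τ.comp pull13 = pull13 from DFunLike.congr_fun h f
  apply hom_ext
  · intro i j
    have : pull13 ((generic 1).X i j) = x i j := pull13_x i j
    simp [this, τ_x]
  · intro k i j
    have : pull13 (((generic 1).g k).val i j) = a i 0 * b 0 j + a i 1 * b 1 j := by
      have hk : k = 0 := Subsingleton.elim _ _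
      subst hk
      exact pull13_gg i j
    simp [this, τ_a, τ_b]
  · intro k
    have : pull13 ((generic 1).y k) = ![y 0, y 2] k := pull13_y k
    rw [AlgHom.comp_apply, this]
    fin_cases k <;> simp [τ_y0, τ_y2]

end Con

/-! ### The action of the middle copy of `GL₂` on the convolution space -/

/-- The action of `GL₂` on the two group factors: `(a, b) ↦ (a c, c⁻¹ b)`. The product `a b` does not change. -/
def Pt.midAct {S : Type} [CommRing S] (p : Pt 2 S) (c : GL (Fin 2) S) : Pt 2 S where
  X := p.X
  g := ![p.g 0 * c, c⁻¹ * p.g 1]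
  y := p.y

theorem Pt.midAct_midAct {S : Type} [CommRing S] (p : Pt 2 S) (c d : GL (Fin 2) S) :
    (p.midAct c).midAct d = p.midAct (c * d) := by
  simp [Pt.midAct, mul_assoc]

theorem Pt.midAct_one {S : Type} [CommRing S] (p : Pt 2 S) : p.midAct 1 = p := by
  refine Pt.ext rfl ?_ rfl
  funext i; fin_cases i <;> simp [Pt.midAct]

theorem Pt.map_midAct {S S' : Type} [CommRing S] [CommRing S'] (φ : S →+* S') (p : Pt 2 S)
    (c : GL (Fin 2) S) :
    (p.midAct c).map φ = (p.map φ).midAct (Matrix.GeneralLinearGroup.map φ c) := by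
  refine Pt.ext rfl ?_ rfl
  funext i; fin_cases i <;> simp [Pt.midAct, Pt.map]

/-- The permutation matrix `E₁₂ + E₂₁`. -/
def swapGL (S : Type) [CommRing S] : GL (Fin 2) S where
  val := !![0, 1; 1, 0]
  inv := !![0, 1; 1, 0]
  val_inv := by ext i j; fin_cases i <;> fin_cases j <;> simp
  inv_val := by ext i j; fin_cases i <;> fin_cases j <;> simp

theorem swapGL_inv {S : Type} [CommRing S] :
    ((swapGL S)⁻¹ : GL (Fin 2) S).val = !![0, 1; 1, 0] := rfl

theorem swapGL_mul_self (S : Type) [CommRing S] : swapGL S * swapGL S = 1 :=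
  Units.ext (swapGL S).val_inv

namespace Con

variable {S : Type} [CommRing S] [Algebra ℂ S]

theorem midAct_x (p : Pt 2 S) (c : GL (Fin 2) S) (i j : Fin 2) :
    evalPt (p.midAct c) (x i j) = evalPt p (x i j) := by
  rw [x, evalPt_X, evalPt_X]; rfl

theorem midAct_y (p : Pt 2 S) (c : GL (Fin 2) S) (i : Fin 3) :
    evalPt (p.midAct c) (y i) = evalPt p (y i) := by
  rw [y, evalPt_y, evalPt_y]; rfl

theorem midAct_a (p : Pt 2 S) (c : GL (Fin 2) S) (i j : Fin 2) :
    evalPt (p.midAct c) (a i j) =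
      evalPt p (a i 0) * c.val 0 j + evalPt p (a i 1) * c.val 1 j := by
  simp only [a, evalPt_g]
  simp [Pt.midAct, Matrix.mul_apply, Fin.sum_univ_two]

theorem midAct_b (p : Pt 2 S) (c : GL (Fin 2) S) (i j : Fin 2) :
    evalPt (p.midAct c) (b i j) =
      (c⁻¹ : GL (Fin 2) S).val i 0 * evalPt p (b 0 j) +
        (c⁻¹ : GL (Fin 2) S).val i 1 * evalPt p (b 1 j) := by
  simp only [b, evalPt_g]
  simp [Pt.midAct, Matrix.mul_apply, Fin.sum_univ_two, -Matrix.coe_units_inv]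

/-- Derivations along a homomorphism which agree on the coordinates are equal. -/
theorem coord_deriv_ext (φ : Coord 2 →ₐ[ℂ] S) {d d' : Coord 2 →ₗ[ℂ] S}
    (hd : ∀ f h, d (f * h) = φ f * d h + d f * φ h)
    (hd' : ∀ f h, d' (f * h) = φ f * d' h + d' f * φ h)
    (hx : ∀ i j, d (x i j) = d' (x i j)) (ha : ∀ i j, d (a i j) = d' (a i j))
    (hb : ∀ i j, d (b i j) = d' (b i j)) (hy : ∀ i, d (y i) = d' (y i)) : d = d' := by
  apply deriv_ext φ hd hd' hx
  · intro k; fin_cases k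
    · exact ha
    · exact hb
  · exact hy

/-- The action of `E₁₂` of the middle copy of `𝔫` on functions. -/
abbrev E : Derivation ℂ (Coord 2) (Coord 2) := lieDer 2 1

instance : CharZero (Coord 2) :=
  charZero_of_injective_algebraMap (algebraMap ℂ (Coord 2)).injective

/-! ### The one-parameter group of `E` -/

open Polynomial in
/-- The pull back of functions along `(a, b) ↦ (a exp(t E₁₂), exp(-t E₁₂) b)`, as polynomials in `t`. -/
def expE : Coord 2 →ₐ[ℂ] Polynomial (Coord 2) :=
  evalPt (((generic 2).map (C : Coord 2 →+* (Coord 2)[X])).midAct (unipGL X))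

open Polynomial in
theorem evalPt_map_C (f : Coord 2) : evalPt ((generic 2).map (C : Coord 2 →+* (Coord 2)[X])) f = C f := by
  have := alg_evalPt (CAlgHom (R := ℂ) (A := Coord 2)) (generic 2) f
  rw [evalPt_generic_self] at this
  exact this.symm

theorem evalPt_comp_expE (p : Pt 2 S) (r : S) (f : Coord 2) :
    (expE f).eval₂ (evalPt p : Coord 2 →+* S) r = evalPt (p.midAct (unipGL r)) f := by
  let ε : Polynomial (Coord 2) →ₐ[ℂ] S :=
    { Polynomial.eval₂RingHom (evalPt p : Coord 2 →+* S) r with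
      commutes' := fun c => by
        change Polynomial.eval₂ (evalPt p : Coord 2 →+* S) r (algebraMap ℂ _ c) = _
        rw [Polynomial.algebraMap_apply, Polynomial.eval₂_C]
        exact (evalPt p).commutes c }
  have hC : ∀ h, ε (Polynomial.C h) = evalPt p h := fun h => Polynomial.eval₂_C _ _
  have hX : ε Polynomial.X = r := Polynomial.eval₂_X _ _
  have := alg_evalPt ε
    (((generic 2).map (Polynomial.C : Coord 2 →+* Polynomial (Coord 2))).midAct (unipGL Polynomial.X)) f
  refine (Eq.trans ?_ this).trans ?_
  · rfl
  · have h1 : ((generic 2).map (Polynomial.C : Coord 2 →+* Polynomial (Coord 2))).map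
        (ε : Polynomial (Coord 2) →+* S) = p := by
      conv_rhs => rw [← evalPt_generic p]
      ext <;> simp [Pt.map, hC]
    have h2 : Matrix.GeneralLinearGroup.map (ε : Polynomial (Coord 2) →+* S)
        (unipGL Polynomial.X) = unipGL r := by
      ext i j
      fin_cases i <;> fin_cases j <;> simp [unipGL, hX]
    rw [Pt.map_midAct, h1, h2]

theorem derivative_expE (f : Coord 2) : Polynomial.derivative (expE f) = -expE (E f) := by
  suffices h : (Polynomial.derivative.restrictScalars ℂ) ∘ₗ expE.toLinearMap =
      -(expE.toLinearMap ∘ₗ E.toLinearMap) from LinearMap.congr_fun h f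
  apply coord_deriv_ext expE
  · intro f h; simp; ring
  · intro f h; simp; ring
  · intro i j; simp [lie_x, expE, midAct_x, evalPt_map_C]
  · intro i j
    fin_cases j <;> simp [lie_a1, expE, midAct_a, evalPt_map_C, unipGL]
  · intro i j
    fin_cases i <;> simp [lie_b1, expE, midAct_b, evalPt_map_C, unipGL_inv, -Matrix.coe_units_inv]
  · intro i; simp [lie_y, expE, midAct_y, evalPt_map_C]

theorem eval_expE (f : Coord 2) : (expE f).eval 0 = f := by
  have := evalPt_comp_expE (generic 2) 0 f
  rw [show (unipGL (0 : Coord 2)) = 1 by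
    ext i j; fin_cases i <;> fin_cases j <;> simp [unipGL], Pt.midAct_one, evalPt_generic_self] at this
  rw [Polynomial.eval]
  refine Eq.trans ?_ this
  congr 1
  ext g; exact (evalPt_generic_self g).symm

/-- `E` is locally nilpotent. -/
theorem exists_pow_E (f : Coord 2) : ∃ n : ℕ, (E.toLinearMap ^ n) f = 0 := by
  have h : ∀ n : ℕ, Polynomial.derivative^[n] (expE f) = (-1) ^ n * expE ((E.toLinearMap ^ n) f) := by
    intro n
    induction n with
    | zero => simp
    | succ n ih =>
      rw [Function.iterate_succ_apply', ih, pow_succ' E.toLinearMap, Module.End.mul_apply]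
      have : ((-1) ^ n * expE ((E.toLinearMap ^ n) f)) =
          ((-1 : ℤ) ^ n) • expE ((E.toLinearMap ^ n) f) := by simp [zsmul_eq_mul]
      rw [this, map_zsmul, derivative_expE, zsmul_eq_mul]
      push_cast
      rw [pow_succ]
      simp
  refine ⟨(expE f).natDegree + 1, ?_⟩
  have h1 := h ((expE f).natDegree + 1)
  rw [Polynomial.iterate_derivative_eq_zero (Nat.lt_succ_self _)] at h1
  have h2 : expE ((E.toLinearMap ^ ((expE f).natDegree + 1)) f) = 0 := by
    rcases mul_eq_zero.1 h1.symm with h3 | h3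
    · exact absurd h3 (pow_ne_zero _ (neg_ne_zero.2 one_ne_zero))
    · exact h3
  rw [← eval_expE ((E.toLinearMap ^ ((expE f).natDegree + 1)) f), h2, Polynomial.eval_zero]

/-- Functions killed by `E` are invariant under upper unipotent matrices. -/
theorem evalPt_unip_of_E {f : Coord 2} (hf : E f = 0) (p : Pt 2 S) (r : S) :
    evalPt (p.midAct (unipGL r)) f = evalPt p f := by
  have h1 := derivative_expE f
  rw [hf, map_zero, neg_zero] at h1
  have h2 := Polynomial.eq_C_of_natDegree_eq_zero (Polynomial.derivative_eq_zero.1 h1)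
  have h3 := eval_expE f
  rw [h2, Polynomial.eval_C] at h3
  rw [h3] at h2
  rw [← evalPt_comp_expE, h2, Polynomial.eval₂_C]
  rfl

/-! ### The opposite operator -/

/-- The action of the permutation matrix on functions. -/
def w : Coord 2 →ₐ[ℂ] Coord 2 := evalPt ((generic 2).midAct (swapGL _))

theorem evalPt_w (p : Pt 2 S) (f : Coord 2) : evalPt p (w f) = evalPt (p.midAct (swapGL S)) f := by
  rw [w, alg_evalPt, Pt.map_midAct, evalPt_generic]
  rw [show Matrix.GeneralLinearGroup.map (evalPt p : Coord 2 →+* S) (swapGL (Coord 2)) = swapGL S by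
    ext i j; fin_cases i <;> fin_cases j <;> simp [swapGL]]

theorem w_w (f : Coord 2) : w (w f) = f := by
  have := evalPt_w (generic 2) (w f)
  rwa [evalPt_generic_self, evalPt_w, Pt.midAct_midAct, swapGL_mul_self, Pt.midAct_one,
    evalPt_generic_self] at this

theorem w_x (i j : Fin 2) : w (x i j) = x i j := by
  rw [w, midAct_x, evalPt_generic_self]
theorem w_y (i : Fin 3) : w (y i) = y i := by
  rw [w, midAct_y, evalPt_generic_self]
theorem w_a (i : Fin 2) : w (a i 0) = a i 1 ∧ w (a i 1) = a i 0 := by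
  constructor <;> rw [w, midAct_a] <;> simp [evalPt_generic_self, swapGL]
theorem w_b (j : Fin 2) : w (b 0 j) = b 1 j ∧ w (b 1 j) = b 0 j := by
  constructor <;> rw [w, midAct_b] <;> simp [evalPt_generic_self, swapGL_inv, -Matrix.coe_units_inv]

/-- The action of `E₂₁` of the middle copy of `𝔤𝔩₂` on functions. -/
def F : Coord 2 →ₗ[ℂ] Coord 2 := w.toLinearMap ∘ₗ E.toLinearMap ∘ₗ w.toLinearMap

theorem F_apply (f : Coord 2) : F f = w (E (w f)) := rfl

theorem F_mul (f h : Coord 2) : F (f * h) = f * F h + F f * h := by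
  simp only [F_apply, map_mul, Derivation.leibniz, smul_eq_mul, map_add, w_w]
  ring

theorem F_x (i j : Fin 2) : F (x i j) = 0 := by
  rw [F_apply, w_x, lie_x _ (by decide), map_zero]
theorem F_y (i : Fin 3) : F (y i) = 0 := by
  rw [F_apply, w_y, lie_y, map_zero]
theorem F_a (i : Fin 2) : F (a i 0) = -a i 1 ∧ F (a i 1) = 0 := by
  constructor <;> simp [F_apply, w_a, lie_a1]
theorem F_b (j : Fin 2) : F (b 0 j) = 0 ∧ F (b 1 j) = b 0 j := by
  constructor <;> simp [F_apply, w_b, lie_b1]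

theorem exists_pow_F (f : Coord 2) : ∃ n : ℕ, (F ^ n) f = 0 := by
  obtain ⟨n, hn⟩ := exists_pow_E (w f)
  have h : ∀ n : ℕ, (F ^ n) f = w ((E.toLinearMap ^ n) (w f)) := by
    intro n
    induction n with
    | zero => simp [w_w]
    | succ n ih =>
      rw [pow_succ', Module.End.mul_apply, ih, F_apply, w_w, pow_succ', Module.End.mul_apply]
      rfl
  exact ⟨n, by rw [h, hn, map_zero]⟩

/-- Functions killed by `F` are invariant under lower unipotent matrices. -/
theorem evalPt_low_of_F {f : Coord 2} (hf : F f = 0) (p : Pt 2 S) (r : S) :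
    evalPt (p.midAct (swapGL S * unipGL r * swapGL S)) f = evalPt p f := by
  have h : E (w f) = 0 := by
    have := congrArg w hf
    rwa [F_apply, w_w, map_zero] at this
  rw [← Pt.midAct_midAct, ← Pt.midAct_midAct, ← evalPt_w, evalPt_unip_of_E h, evalPt_w,
    Pt.midAct_midAct, swapGL_mul_self, Pt.midAct_one]

end Con

namespace Con

variable {S : Type} [CommRing S] [Algebra ℂ S]

/-! ### Weights for the middle torus -/

/-- The functions of weight `(α, β)` for the middle torus which do not depend on `y₂`. -/
def wtSp (α β : ℤ) : Submodule ℂ (Coord 2) where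
  carrier := {f | τ f = f ∧
    ∀ s : Fin 2 → ℂˣ, torusAut 2 (mid s) f = ((s 0 ^ α * s 1 ^ β : ℂˣ) : ℂ) • f}
  zero_mem' := ⟨map_zero _, fun s => by simp⟩
  add_mem' := fun hf hh => ⟨by rw [map_add, hf.1, hh.1], fun s => by
    rw [map_add, hf.2, hh.2, smul_add]⟩
  smul_mem' := fun c f hf => ⟨by rw [map_smul, hf.1], fun s => by
    rw [map_smul, hf.2, smul_comm]⟩

theorem mid_x (s : Fin 2 → ℂˣ) (i j : Fin 2) : torusAut 2 (mid s) (x i j) = x i j := by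
  have := torusAut_X (mid s) i j
  simpa [mid, x] using this
theorem mid_a (s : Fin 2 → ℂˣ) (i j : Fin 2) :
    torusAut 2 (mid s) (a i j) = (((s j)⁻¹ : ℂˣ) : ℂ) • a i j := by
  have := torusAut_g (mid s) 0 i j
  simpa [mid, a] using this
theorem mid_b (s : Fin 2 → ℂˣ) (i j : Fin 2) :
    torusAut 2 (mid s) (b i j) = ((s i : ℂˣ) : ℂ) • b i j := by
  have := torusAut_g (mid s) 1 i j
  simpa [mid, b] using this
theorem mid_y0 (s : Fin 2 → ℂˣ) : torusAut 2 (mid s) (y 0) = y 0 := by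
  have := torusAut_y (mid s) 0
  simpa [mid, y] using this
theorem mid_y2 (s : Fin 2 → ℂˣ) : torusAut 2 (mid s) (y 2) = y 2 := by
  have := torusAut_y (mid s) 2
  simpa [mid, y] using this

open LaurentPolynomial in
/-- The variable as a unit of the ring of Laurent polynomials. -/
def unitT : ((Coord 2)[T;T⁻¹])ˣ where
  val := T 1
  inv := T (-1)
  val_inv := by rw [← T_add]; exact T_zero
  inv_val := by rw [← T_add]; exact T_zero

open LaurentPolynomial in
/-- The pull back of functions along `(a, b) ↦ (a c, c⁻¹ b)`, `c = diag(tᵐ, tⁿ)`, as Laurent polynomials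
in `t`. -/
def expT (m n : ℤ) : Coord 2 →ₐ[ℂ] (Coord 2)[T;T⁻¹] :=
  evalPt (((generic 2).map (C : Coord 2 →+* (Coord 2)[T;T⁻¹])).midAct
    (diagGL ![unitT ^ m, unitT ^ n]))

theorem map_diagGL {R R' : Type} [CommRing R] [CommRing R'] (φ : R →+* R') (t : Fin 2 → Rˣ) :
    Matrix.GeneralLinearGroup.map φ (diagGL t) = diagGL fun i => Units.map (φ : R →* R') (t i) := by
  ext i j
  simp [diagGL, Matrix.diagonal_apply]
  split_ifs <;> simp

open LaurentPolynomial in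
theorem evalPt_comp_expT (m n : ℤ) (p : Pt 2 S) (r : Sˣ) (f : Coord 2) :
    eval₂ (evalPt p : Coord 2 →+* S) r (expT m n f) =
      evalPt (p.midAct (diagGL ![r ^ m, r ^ n])) f := by
  let ε : (Coord 2)[T;T⁻¹] →ₐ[ℂ] S :=
    { eval₂ (evalPt p : Coord 2 →+* S) r with
      commutes' := fun c => by
        change eval₂ (evalPt p : Coord 2 →+* S) r (algebraMap ℂ _ c) = _
        rw [show algebraMap ℂ (Coord 2)[T;T⁻¹] c = C (algebraMap ℂ (Coord 2) c) from rfl, eval₂_C]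
        exact (evalPt p).commutes c }
  have hC : ∀ h, ε (C h) = evalPt p h := fun h => eval₂_C _ _ _
  have hX : Units.map (ε : (Coord 2)[T;T⁻¹] →* S) unitT = r := by
    ext
    refine (eval₂_T _ _ 1).trans ?_
    simp
  have := alg_evalPt ε (((generic 2).map (C : Coord 2 →+* (Coord 2)[T;T⁻¹])).midAct
    (diagGL ![unitT ^ m, unitT ^ n])) f
  refine (Eq.trans ?_ this).trans ?_
  · rfl
  · have h1 : ((generic 2).map (C : Coord 2 →+* (Coord 2)[T;T⁻¹])).map
        (ε : (Coord 2)[T;T⁻¹] →+* S) = p := by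
      conv_rhs => rw [← evalPt_generic p]
      ext <;> simp [Pt.map, hC]
    have h2 : Matrix.GeneralLinearGroup.map (ε : (Coord 2)[T;T⁻¹] →+* S)
        (diagGL ![unitT ^ m, unitT ^ n]) = diagGL ![r ^ m, r ^ n] := by
      rw [map_diagGL]
      congr 1
      funext i
      have hX' : ∀ l : ℤ, Units.map ((ε : (Coord 2)[T;T⁻¹] →+* S) : (Coord 2)[T;T⁻¹] →* S) (unitT ^ l) =
          r ^ l := fun l => (map_zpow _ _ _).trans (congrArg (· ^ l) hX)
      fin_cases i
      · exact hX' m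
      · exact hX' n
    rw [Pt.map_midAct, h1, h2]

open LaurentPolynomial in
theorem expT_of_mem {α β : ℤ} {f : Coord 2} (hf : f ∈ wtSp α β) (m n : ℤ) :
    expT m n f = C f * T (-(α * m + β * n)) := by
  set k := -(α * m + β * n) with hk
  have hc : ∀ c : ℂˣ, eval₂ (RingHom.id (Coord 2)) (scal (Coord 2) c) (expT m n f) =
      ((scal (Coord 2) c ^ k : (Coord 2)ˣ) : Coord 2) * f := by
    intro c
    have h1 := evalPt_comp_expT m n (generic 2) (scal (Coord 2) c) f
    rw [show (evalPt (generic 2) : Coord 2 →+* Coord 2) = RingHom.id _ by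
      ext h; exact evalPt_generic_self h] at h1
    rw [h1]
    have h2 := hf.2 ![c ^ (-m), c ^ (-n)]
    have h3 : evalPt ((generic 2).midAct (diagGL ![scal (Coord 2) c ^ m, scal (Coord 2) c ^ n])) f =
        torusAut 2 (mid ![c ^ (-m), c ^ (-n)]) f := by
      apply hom_eq_of_τ _ _ _ _ _ hf.1
      · intro i j; rw [midAct_x, mid_x, evalPt_generic_self]
      · intro i j
        rw [midAct_a, mid_a]
        fin_cases j <;> simp [evalPt_generic_self, diagGL, ← map_zpow, scal, Algebra.smul_def, mul_comm]
      · intro i j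
        rw [midAct_b, mid_b]
        fin_cases i <;> simp [evalPt_generic_self, diagGL_inv, ← map_zpow, ← map_inv, scal,
          Algebra.smul_def, -Matrix.coe_units_inv]
      · rw [midAct_y, mid_y0, evalPt_generic_self]
      · rw [midAct_y, mid_y2, evalPt_generic_self]
    have h4 : ![c ^ (-m), c ^ (-n)] 0 ^ α * ![c ^ (-m), c ^ (-n)] 1 ^ β = c ^ k := by
      simp only [Matrix.cons_val_zero, Matrix.cons_val_one, ← _root_.zpow_mul, ← _root_.zpow_add]
      congr 1
      rw [hk]
      ring
    rw [h3, h2, h4, Algebra.smul_def, ← map_zpow]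
    rfl
  obtain ⟨N, P, hP⟩ := exists_T_pow (expT m n f)
  obtain ⟨K, e, he⟩ : ∃ K e : ℕ, (e : ℤ) = N + k + K :=
    ⟨(N + k).natAbs, (N + k + (N + k).natAbs).toNat, by omega⟩
  have key : P * Polynomial.X ^ K = Polynomial.C f * Polynomial.X ^ e := by
    apply Polynomial.eq_of_infinite_eval_eq
    refine Set.Infinite.mono (s := algebraMap ℂ (Coord 2) '' {0}ᶜ) ?_ ?_
    · rintro _ ⟨c, hc0, rfl⟩
      lift c to ℂˣ using isUnit_iff_ne_zero.2 hc0
      have h4 := congrArg (eval₂ (RingHom.id (Coord 2)) (scal (Coord 2) c)) hP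
      rw [map_mul, hc, eval₂_toLaurent, eval₂_T] at h4
      have h5 : P.eval (algebraMap ℂ (Coord 2) c) = _ := h4
      simp only [Set.mem_ofPred_eq, Polynomial.eval_mul, Polynomial.eval_pow, Polynomial.eval_X,
        Polynomial.eval_C, h5]
      have h6 : ∀ d : ℕ, algebraMap ℂ (Coord 2) c ^ d =
          ((scal (Coord 2) c ^ (d : ℤ) : (Coord 2)ˣ) : Coord 2) := by
        intro d
        rw [zpow_natCast, Units.val_pow_eq_pow_val]; rfl
      rw [h6, h6, he, _root_.zpow_add, _root_.zpow_add]
      push_cast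
      ring
    · exact (Set.finite_singleton 0).infinite_compl.image (algebraMap ℂ (Coord 2)).injective.injOn
  have h7 := congrArg Polynomial.toLaurent key
  rw [map_mul, map_mul, hP, Polynomial.toLaurent_X_pow, Polynomial.toLaurent_X_pow,
    Polynomial.toLaurent_C, he] at h7
  have h8 := congrArg (fun q => q * T (-((N : ℤ) + K))) h7
  simp only [mul_assoc, ← T_add] at h8
  rw [show (N : ℤ) + K + -(N + K) = 0 by ring, T_zero, mul_one,
    show (N : ℤ) + k + K + -(N + K) = k by ring] at h8
  exact h8

/-- Functions of weight `(α, β)` are semi-invariant under diagonal matrices over every algebra. -/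
theorem evalPt_diag_of_mem {α β : ℤ} {f : Coord 2} (hf : f ∈ wtSp α β) (m n : ℤ) (p : Pt 2 S) (r : Sˣ) :
    evalPt (p.midAct (diagGL ![r ^ m, r ^ n])) f =
      evalPt p f * ((r ^ (-(α * m + β * n)) : Sˣ) : S) := by
  rw [← evalPt_comp_expT, expT_of_mem hf, LaurentPolynomial.eval₂_C_mul_T]
  rfl

end Con

namespace Con

variable {S : Type} [CommRing S] [Algebra ℂ S]

/-! ### The `𝔰𝔩₂`-action on the functions which do not depend on `y₂` -/

/-- The commutator of `E` and `F`; it is the infinitesimal generator of `diag(t, t⁻¹)` in the middle copy of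
`GL₂` (`snd_unitEps`). -/
def H (f : Coord 2) : Coord 2 := E (F f) - F (E f)

/-- `1 + ε` as a unit of the dual numbers. -/
def unitEps : (DualNumber (Coord 2))ˣ where
  val := 1 + DualNumber.eps
  inv := 1 - DualNumber.eps
  val_inv := by ring_nf; simp [pow_two]
  inv_val := by ring_nf; simp [pow_two]

theorem unitEps_zpow (k : ℤ) : ((unitEps ^ k : (DualNumber (Coord 2))ˣ) : DualNumber (Coord 2)) =
    1 + TrivSqZeroExt.inr (k : Coord 2) := by
  induction k using Int.induction_on with
  | zero => simp
  | succ n ih =>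
    rw [_root_.zpow_add_one, Units.val_mul, ih]
    ext <;> simp [unitEps, add_comm]
  | pred n ih =>
    rw [_root_.zpow_sub_one, Units.val_mul, ih]
    ext <;> simp [unitEps]
    ring

theorem evalPt_map_inl (f : Coord 2) :
    evalPt ((generic 2).map (TrivSqZeroExt.inlHom (Coord 2) (Coord 2))) f = TrivSqZeroExt.inl f := by
  have := alg_evalPt (TrivSqZeroExt.inlAlgHom ℂ (Coord 2) (Coord 2)) (generic 2) f
  rw [evalPt_generic_self] at this
  exact this.symm

theorem fst_unitEps (f : Coord 2) :
    TrivSqZeroExt.fst (evalPt (((generic 2).map (TrivSqZeroExt.inlHom (Coord 2) (Coord 2))).midAct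
      (diagGL ![unitEps ^ (1 : ℤ), unitEps ^ (-1 : ℤ)])) f) = f := by
  suffices h : (TrivSqZeroExt.fstHom ℂ (Coord 2) (Coord 2)).comp
      (evalPt (((generic 2).map (TrivSqZeroExt.inlHom (Coord 2) (Coord 2))).midAct
        (diagGL ![unitEps ^ (1 : ℤ), unitEps ^ (-1 : ℤ)]))) = AlgHom.id ℂ _ from DFunLike.congr_fun h f
  apply coord_hom_ext
  · intro i j; simp [midAct_x, evalPt_map_inl]
  · intro i j; fin_cases j <;> simp [midAct_a, evalPt_map_inl, diagGL, unitEps]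
  · intro i j; fin_cases i <;>
      simp [midAct_b, evalPt_map_inl, diagGL_inv, unitEps, -Matrix.coe_units_inv]
  · intro i; simp [midAct_y, evalPt_map_inl]

theorem snd_unitEps (f : Coord 2) :
    TrivSqZeroExt.snd (evalPt (((generic 2).map (TrivSqZeroExt.inlHom (Coord 2) (Coord 2))).midAct
      (diagGL ![unitEps ^ (1 : ℤ), unitEps ^ (-1 : ℤ)])) f) = H f := by
  suffices h : ((TrivSqZeroExt.sndHom (Coord 2) (Coord 2)).restrictScalars ℂ ∘ₗ
      (evalPt (((generic 2).map (TrivSqZeroExt.inlHom (Coord 2) (Coord 2))).midAct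
        (diagGL ![unitEps ^ (1 : ℤ), unitEps ^ (-1 : ℤ)]))).toLinearMap) =
      E.toLinearMap ∘ₗ F - F ∘ₗ E.toLinearMap from LinearMap.congr_fun h f
  apply coord_deriv_ext (AlgHom.id ℂ _)
  · intro f h
    simp only [LinearMap.comp_apply, AlgHom.toLinearMap_apply, map_mul, LinearMap.restrictScalars_apply,
      TrivSqZeroExt.sndHom_apply, TrivSqZeroExt.snd_mul, fst_unitEps, AlgHom.id_apply, smul_eq_mul,
      MulOpposite.smul_eq_mul_unop, MulOpposite.unop_op]
  · intro f h
    simp only [LinearMap.sub_apply, LinearMap.comp_apply, F_mul, Derivation.coeFn_coe,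
      Derivation.leibniz, smul_eq_mul, map_add, AlgHom.id_apply]
    ring
  · intro i j; simp [midAct_x, evalPt_map_inl, F_x, lie_x]
  · intro i j
    fin_cases j <;> simp [midAct_a, evalPt_map_inl, diagGL, unitEps, F_a, lie_a1]
  · intro i j; fin_cases i <;>
      simp [midAct_b, evalPt_map_inl, diagGL_inv, unitEps, -Matrix.coe_units_inv, F_b, lie_b1]
  · intro i; simp [midAct_y, evalPt_map_inl, F_y, lie_y]

theorem H_of_mem {α β : ℤ} {f : Coord 2} (hf : f ∈ wtSp α β) :
    E (F f) = F (E f) + ((β - α : ℤ) : ℂ) • f := by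
  have h := snd_unitEps f
  have hz := evalPt_diag_of_mem hf 1 (-1)
    ((generic 2).map (TrivSqZeroExt.inlHom (Coord 2) (Coord 2))) unitEps
  rw [hz, unitEps_zpow, evalPt_map_inl] at h
  have h2 : H f = ((β - α : ℤ) : ℂ) • f := by
    rw [← h, Algebra.smul_def]
    simp
    ring
  rw [← h2, H]
  ring

theorem τ_E {f : Coord 2} (hf : τ f = f) : τ (E f) = E f := by
  have h : τ.toLinearMap ∘ₗ E.toLinearMap ∘ₗ τ.toLinearMap = E.toLinearMap ∘ₗ τ.toLinearMap := by
    apply coord_deriv_ext τ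
    · intro f h; simp [τ_τ]; ring
    · intro f h; simp; ring
    · intro i j; simp [τ_x, lie_x]
    · intro i j; fin_cases j <;> simp [τ_a, lie_a1]
    · intro i j; fin_cases i <;> simp [τ_b, lie_b1]
    · intro i; fin_cases i <;> simp [τ_y0, τ_y1, τ_y2, lie_y, yb, lie_ib, lie_b1, Derivation.leibniz,
        pow_two, τ_b, τ_ib]
  have := LinearMap.congr_fun h f
  simpa [hf] using this

theorem τ_w {f : Coord 2} (hf : τ f = f) : τ (w f) = w f := by
  have := hom_eq_of_τ (φ := τ.comp w) (ψ := w) (f := f) (fun i j => by simp [w_x, τ_x])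
    (fun i j => by fin_cases j <;> simp [w_a, τ_a])
    (fun i j => by fin_cases i <;> simp [w_b, τ_b]) (by simp [w_y, τ_y0]) (by simp [w_y, τ_y2]) hf
  exact this

theorem E_mem {α β : ℤ} {f : Coord 2} (hf : f ∈ wtSp α β) : E f ∈ wtSp (α - 1) (β + 1) := by
  refine ⟨τ_E hf.1, fun s => ?_⟩
  have h := lieDer_torusAut 1 (mid s) f
  rw [hf.2, Derivation.map_smul] at h
  have h2 := congrArg (fun v => (((s 0 * (s 1)⁻¹)⁻¹ : ℂˣ) : ℂ) • v) h
  simp only [smul_smul] at h2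
  have e1 : (mid s).1 1 = s := rfl
  rw [e1, ← Units.val_mul, ← Units.val_mul, inv_mul_cancel, Units.val_one, one_smul] at h2
  rw [← h2]
  congr 2
  rw [_root_.zpow_sub_one, _root_.zpow_add_one, mul_inv, inv_inv]
  ac_rfl

theorem w_mem {α β : ℤ} {f : Coord 2} (hf : f ∈ wtSp α β) : w f ∈ wtSp β α := by
  refine ⟨τ_w hf.1, fun s => ?_⟩
  have h := hom_eq_of_τ (φ := (torusAut 2 (mid s)).comp w) (ψ := w.comp (torusAut 2 (mid ![s 1, s 0])))
    (f := f) (fun i j => by simp [w_x, mid_x])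
    (fun i j => by fin_cases j <;> simp [w_a, mid_a])
    (fun i j => by fin_cases i <;> simp [w_b, mid_b]) (by simp [w_y, mid_y0]) (by simp [w_y, mid_y2]) hf.1
  simp only [AlgHom.comp_apply] at h
  rw [h, hf.2, map_smul]
  simp [mul_comm]

theorem F_mem {α β : ℤ} {f : Coord 2} (hf : f ∈ wtSp α β) : F f ∈ wtSp (α + 1) (β - 1) :=
  w_mem (E_mem (w_mem hf))

theorem isSlTwo (α β : ℤ) : IsSlTwo E.toLinearMap F (β - α) fun k => wtSp (α - k) (β + k) where
  raise k v hv := by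
    have := E_mem hv
    rwa [show α - k - 1 = α - (k + 1) by ring, add_assoc] at this
  lower k v hv := by
    have := F_mem hv
    rwa [show α - k + 1 = α - (k - 1) by ring, show β + k - 1 = β + (k - 1) by ring] at this
  comm k v hv := by
    have := H_of_mem hv
    rwa [show β + k - (α - k) = 2 * k + (β - α) by ring] at this
  nilE := exists_pow_E
  nilF := exists_pow_F

/-- Functions of negative `𝔰𝔩₂`-weight are not killed by `E`. -/
theorem eq_zero_of_E {α β : ℤ} (h : β < α) {f : Coord 2} (hf : f ∈ wtSp α β) (h0 : E f = 0) : f = 0 :=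
  (isSlTwo α β).eq_zero_of_map_eq_zero (k := 0) (by omega) (by simpa using hf) h0

/-- Functions of positive `𝔰𝔩₂`-weight are in the image of `E`. -/
theorem exists_eq_E {α β : ℤ} (h : α < β) {f : Coord 2} (hf : f ∈ wtSp α β) :
    ∃ v ∈ wtSp (α + 1) (β - 1), f = E v := by
  obtain ⟨v, hv, he⟩ := (isSlTwo α β).exists_eq_map (k := 0) (by omega) (v := f) (by simpa using hf)
  exact ⟨v, by simpa [sub_eq_add_neg] using hv, he⟩

/-- `E` is injective on the image of functions of weight `(1, -1)`. -/
theorem eq_zero_of_E_E {f : Coord 2} (hf : f ∈ wtSp 1 (-1)) (h0 : E (E f) = 0) : f = 0 := by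
  have h := isSlTwo 0 0
  have h1 : F (E f) = 0 := h.map_lower_eq_zero (k := 0) (by norm_num)
    (by simpa using E_mem hf) h0
  exact h.eq_zero_of_comp_eq_zero (k := -1) (by norm_num) (by simpa using hf) h1

/-! ### Invariant functions -/

/-- Restriction of functions to the slice `a = 1`, `y₂ = 0` of the action of `GL₂`. -/
def slice : Coord 2 →ₐ[ℂ] Coord 1 :=
  evalPt { X := (generic 1).X, g := ![1, (generic 1).g 0], y := ![(generic 1).y 0, 0, (generic 1).y 1] }

theorem slice_pull13 (f : Coord 1) : slice (pull13 f) = f := by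
  rw [pull13, alg_evalPt]
  conv_rhs => rw [← evalPt_generic_self f]
  congr 2
  have h1 := evalPt_generic (k := 2) (S := Coord 1)
    { X := (generic 1).X, g := ![1, (generic 1).g 0], y := ![(generic 1).y 0, 0, (generic 1).y 1] }
  change (pt13 (generic 2)).map (slice : Coord 2 →+* Coord 1) = _
  change (generic 2).map (slice : Coord 2 →+* Coord 1) = _ at h1
  have hX := congrArg Pt.X h1
  have hg := congrArg Pt.g h1
  have hy := congrArg Pt.y h1
  apply Pt.ext
  · exact hX
  · funext i
    have hi : i = 0 := Subsingleton.elim _ _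
    subst hi
    have h0 := congrFun hg 0
    have h2 := congrFun hg 1
    simp only [Pt.map] at h0 h2
    simp only [Pt.map, pt13, map_mul, h0, h2]
    simp
  · funext i
    have h0 := congrFun hy 0
    have h2 := congrFun hy 2
    simp only [Pt.map] at h0 h2
    fin_cases i
    · simpa [Pt.map, pt13] using h0
    · simpa [Pt.map, pt13] using h2

theorem pull13_injective : Function.Injective pull13 :=
  Function.LeftInverse.injective slice_pull13

/-- The inverse of a matrix whose upper left entry is not zero, as a product of an upper unipotent, a lower
unipotent and two diagonal matrices. -/
theorem inv_val_decomposition {K : Type} [Field K] {p q u v d : K} (hu : u ≠ 0) (hd : d ≠ 0)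
    (h : d = u * q - p * v) : !![q / d, -(p / d); -(v / d), u / d] =
      (unipGL (-(p / u)) * (swapGL K * unipGL (-(u * v / d)) * swapGL K) *
        diagGL ![(Units.mk0 _ hu)⁻¹ ^ (1 : ℤ), (Units.mk0 _ hu)⁻¹ ^ (0 : ℤ)] *
        diagGL ![(Units.mk0 _ hu / Units.mk0 _ hd) ^ (0 : ℤ),
          (Units.mk0 _ hu / Units.mk0 _ hd) ^ (1 : ℤ)] : GL (Fin 2) K).val := by
  simp only [Units.val_mul, unipGL, swapGL, diagGL]
  ext i j
  fin_cases i <;> fin_cases j <;>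
    simp [Matrix.mul_apply, Fin.sum_univ_two, Matrix.vecMul, dotProduct]
  · field_simp
    rw [h]; ring
  · field_simp
  · field_simp

/-- A function of weight zero which is killed by `E` and does not depend on `y₂` is pulled back along `π₁₃`. -/
theorem eq_pull13_of_E {f : Coord 2} (hf : f ∈ wtSp 0 0) (h0 : E f = 0) : f = pull13 (slice f) := by
  have hF : F f = 0 := (isSlTwo 0 0).map_lower_eq_zero (k := 0) (by norm_num) (by simpa using hf) h0
  -- invariance under `a⁻¹`
  have key : evalPt ((generic 2).midAct ((generic 2).g 0)⁻¹) f = f := by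
    let K := FractionRing (Coord 2)
    let ι : Coord 2 →ₐ[ℂ] K := Algebra.algHom ℂ (Coord 2) K
    have hι : Function.Injective ι := IsFractionRing.injective (Coord 2) K
    have ha : ι (a 0 0) ≠ 0 := by
      rw [Ne, map_eq_zero_iff ι hι]
      intro h
      have := congrArg (evalPt (⟨0, fun _ => 1, 0⟩ : Pt 2 ℂ)) h
      simp [a, evalPt_g] at this
    have hd : ι da ≠ 0 := by
      intro h
      have := congrArg ι ia_da
      rw [map_mul, h, mul_zero, map_one] at this
      exact zero_ne_one this
    have hia : ι ia = (ι da)⁻¹ := by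
      refine eq_inv_of_mul_eq_one_left ?_
      rw [← map_mul, ia_da, map_one]
    apply hι
    rw [alg_evalPt, Pt.map_midAct]
    -- `a⁻¹` is a product of an upper unipotent, a lower unipotent and a diagonal matrix
    have hdec : Matrix.GeneralLinearGroup.map (ι : Coord 2 →+* K) ((generic 2).g 0)⁻¹ =
        unipGL (-(ι (a 0 1) / ι (a 0 0))) *
          (swapGL K * unipGL (-(ι (a 0 0) * ι (a 1 0) / ι da)) * swapGL K) *
          diagGL ![(Units.mk0 _ ha)⁻¹ ^ (1 : ℤ), (Units.mk0 _ ha)⁻¹ ^ (0 : ℤ)] *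
          diagGL ![(Units.mk0 _ ha / Units.mk0 _ hd) ^ (0 : ℤ),
            (Units.mk0 _ ha / Units.mk0 _ hd) ^ (1 : ℤ)] := by
      apply Units.ext
      have h1 : (Matrix.GeneralLinearGroup.map (ι : Coord 2 →+* K) ((generic 2).g 0)⁻¹).val =
          (((generic 2).g 0)⁻¹ : GL (Fin 2) (Coord 2)).val.map ι := rfl
      have h2 : ι da = ι (a 0 0) * ι (a 1 1) - ι (a 0 1) * ι (a 1 0) := by simp [da]
      rw [h1, matA_inv]
      rw [← inv_val_decomposition ha hd h2]
      ext i j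
      fin_cases i <;> fin_cases j <;> simp [hia, div_eq_inv_mul]
    rw [hdec, ← Pt.midAct_midAct, ← Pt.midAct_midAct, ← Pt.midAct_midAct, evalPt_diag_of_mem hf,
      evalPt_diag_of_mem hf, evalPt_low_of_F hF, evalPt_unip_of_E h0]
    simp only [zero_mul, add_zero, neg_zero, zpow_zero, Units.val_one, mul_one]
    rw [← alg_evalPt, evalPt_generic_self]
  conv_lhs => rw [← key]
  have hs : pull13 (slice f) = evalPt (Pt.mk (k := 2) (generic 2).X
      ![1, (generic 2).g 0 * (generic 2).g 1] ![y 0, 0, y 2]) f := by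
    rw [slice, alg_evalPt]
    congr 2
    have h1 := map_pull13
    have hX := congrArg Pt.X h1
    have hg := congrArg Pt.g h1
    have hy := congrArg Pt.y h1
    apply Pt.ext
    · exact hX
    · funext i
      have h0 := congrFun hg 0
      simp only [Pt.map, pt13] at h0
      fin_cases i
      · simp [Pt.map]
      · simp [Pt.map, h0]
    · funext i
      have h0 := congrFun hy 0
      have h2 := congrFun hy 1
      simp only [Pt.map, pt13] at h0 h2
      fin_cases i
      · simpa [Pt.map, y] using h0
      · simp [Pt.map]
      · simpa [Pt.map, y] using h2
  rw [hs]
  apply hom_eq_of_τ _ _ _ _ _ hf.1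
  · intro i j; rw [x, evalPt_X, evalPt_X]; rfl
  · intro i j; rw [a, evalPt_g, evalPt_g]; simp [Pt.midAct]
  · intro i j; rw [b, evalPt_g, evalPt_g]; simp [Pt.midAct]
  · rw [y, evalPt_y, evalPt_y]; rfl
  · rw [y, evalPt_y, evalPt_y]; rfl

theorem pull13_mem (f : Coord 1) : pull13 f ∈ wtSp 0 0 := by
  refine ⟨τ_pull13 f, fun s => ?_⟩
  rw [torus_pull13, tor13_mid, torusAut_one]
  simp

/-- Functions of weight zero are uniquely the sum of a function pulled back along `π₁₃` and of an element of the
image of `E`. -/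
theorem exists_eq_pull13_add {f : Coord 2} (hf : f ∈ wtSp 0 0) :
    ∃ q, ∃ v ∈ wtSp 1 (-1), f = pull13 q + E v := by
  obtain ⟨v, hv, u, hu, hu0, -, he⟩ := (isSlTwo 0 0).exists_eq_map_add (k := 0) (by norm_num) (v := f)
    (by simpa using hf)
  refine ⟨slice u, v, by simpa using hv, ?_⟩
  rw [← eq_pull13_of_E (by simpa using hu) hu0, he, add_comm]
  rfl

theorem eq_zero_of_pull13_add {q : Coord 1} {v : Coord 2} (hv : v ∈ wtSp 1 (-1))
    (h : pull13 q + E v = 0) : q = 0 ∧ v = 0 := by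
  have h1 : v = 0 := eq_zero_of_E_E hv (by
    have := congrArg E h
    rwa [map_add, lie_pull13_1, zero_add, map_zero] at this)
  refine ⟨pull13_injective ?_, h1⟩
  rw [h1, map_zero, add_zero] at h
  rw [h, map_zero]

/-- Functions of weight `(-1, 1)` are in the image of the square of `E`. -/
theorem exists_eq_E_E {f : Coord 2} (hf : f ∈ wtSp (-1) 1) : ∃ v ∈ wtSp 1 (-1), f = E (E v) := by
  obtain ⟨u, hu, rfl⟩ := exists_eq_E (by norm_num) hf
  obtain ⟨q, v, hv, rfl⟩ := exists_eq_pull13_add (by simpa using hu)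
  exact ⟨v, hv, by rw [map_add, lie_pull13_1, zero_add]⟩

end Con

/-! ### Row operations on tensor products of Koszul matrices -/

section Koszul

variable {R : Type} [CommRing R]

/-- The operator `∑ a_i θ_i + b_i ∂/∂θ_i` in the basis `1, θ₁, θ₂, θ₁θ₂`, over any ring. -/
def kos (a₁ b₁ a₂ b₂ : R) : Matrix (Fin 4) (Fin 4) R :=
  !![0, b₁, b₂, 0; a₁, 0, 0, -b₂; a₂, 0, 0, b₁; 0, -a₂, a₁, 0]

/-- The parity operator in the basis `1, θ₁, θ₂, θ₁θ₂`. -/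
def sg : Matrix (Fin 4) (Fin 4) R := !![1, 0, 0, 0; 0, -1, 0, 0; 0, 0, -1, 0; 0, 0, 0, 1]

/-- `∂/∂θ₁`, up to the parity operator. -/
def ctr₁ : Matrix (Fin 4) (Fin 4) R := !![0, 1, 0, 0; 0, 0, 0, 0; 0, 0, 0, -1; 0, 0, 0, 0]
/-- `∂/∂θ₂`, up to the parity operator. -/
def ctr₂ : Matrix (Fin 4) (Fin 4) R := !![0, 0, 1, 0; 0, 0, 0, 1; 0, 0, 0, 0; 0, 0, 0, 0]

/-- The operator `s θ₂ ∂/∂θ₁`. -/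
def shear (s : R) : Matrix (Fin 4) (Fin 4) R :=
  !![0, 0, 0, 0; 0, 0, 0, 0; 0, s, 0, 0; 0, 0, 0, 0]

/-- The operator which multiplies `θ₂` by `i`. -/
def scale (i : R) : Matrix (Fin 4) (Fin 4) R := !![1, 0, 0, 0; 0, 1, 0, 0; 0, 0, i, 0; 0, 0, 0, i]

theorem one_eq_literal : (1 : Matrix (Fin 4) (Fin 4) R) =
    !![1, 0, 0, 0; 0, 1, 0, 0; 0, 0, 1, 0; 0, 0, 0, 1] := by
  ext i j; fin_cases i <;> fin_cases j <;> rfl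

theorem zero_eq_literal : (0 : Matrix (Fin 4) (Fin 4) R) =
    !![0, 0, 0, 0; 0, 0, 0, 0; 0, 0, 0, 0; 0, 0, 0, 0] := by
  ext i j; fin_cases i <;> fin_cases j <;> rfl

theorem zero_eq_cons {n : ℕ} {r : R} {v : Fin n → R} :
    (0 : Fin (n + 1) → R) = Matrix.vecCons r v ↔ 0 = r ∧ 0 = v := by
  rw [eq_comm, Matrix.cons_eq_zero_iff, eq_comm, @eq_comm _ v]

theorem ctr₁_sq : (ctr₁ * ctr₁ : Matrix (Fin 4) (Fin 4) R) = 0 := by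
  simp [ctr₁, zero_eq_literal, zero_eq_cons]
theorem ctr₂_sq : (ctr₂ * ctr₂ : Matrix (Fin 4) (Fin 4) R) = 0 := by
  simp [ctr₂, zero_eq_literal, zero_eq_cons]
theorem ctr₂_ctr₁ : (ctr₂ * ctr₁ : Matrix (Fin 4) (Fin 4) R) = -(ctr₁ * ctr₂) := by
  simp [ctr₁, ctr₂, zero_eq_cons]
theorem sg_ctr₁ : (sg * ctr₁ : Matrix (Fin 4) (Fin 4) R) = -(ctr₁ * sg) := by
  simp [sg, ctr₁]
theorem sg_ctr₂ : (sg * ctr₂ : Matrix (Fin 4) (Fin 4) R) = -(ctr₂ * sg) := by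
  simp [sg, ctr₂]
theorem sg_kos (a₁ b₁ a₂ b₂ : R) : sg * kos a₁ b₁ a₂ b₂ = -(kos a₁ b₁ a₂ b₂ * sg) := by
  simp [sg, kos]
theorem sg_scale (i : R) : sg * scale i = scale i * sg := by
  simp [sg, scale]
theorem kos_ctr₁ (a₁ b₁ a₂ b₂ : R) :
    kos a₁ b₁ a₂ b₂ * ctr₁ - ctr₁ * kos a₁ b₁ a₂ b₂ = (-a₁) • sg := by
  simp [sg, kos, ctr₁, zero_eq_cons]
theorem kos_ctr₂ (a₁ b₁ a₂ b₂ : R) :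
    kos a₁ b₁ a₂ b₂ * ctr₂ - ctr₂ * kos a₁ b₁ a₂ b₂ = (-a₂) • sg := by
  simp [sg, kos, ctr₂, zero_eq_cons]
theorem kos_anticomm (a₁ b₁ a₂ b₂ c₁ d₁ c₂ d₂ : R) :
    kos a₁ b₁ a₂ b₂ * kos c₁ d₁ c₂ d₂ + kos c₁ d₁ c₂ d₂ * kos a₁ b₁ a₂ b₂ =
      (a₁ * d₁ + b₁ * c₁ + a₂ * d₂ + b₂ * c₂) • 1 := by
  simp [kos, one_eq_literal]
  refine ⟨⟨?_, ?_⟩, ⟨?_, ?_⟩, ⟨?_, ?_⟩, ?_, ?_⟩ <;> ring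
theorem kos_sq (α γ : R) : kos α 0 γ 0 * kos α 0 γ 0 = 0 := by
  simp [kos, zero_eq_literal, zero_eq_cons]
  ring
theorem kos_add_ctr₁ (a₁ b₁ a₂ b₂ m : R) :
    kos a₁ b₁ a₂ b₂ + m • (sg * ctr₁) = kos a₁ (b₁ + m) a₂ b₂ := by
  simp [sg, kos, ctr₁]
theorem kos_add_ctr₂ (a₁ b₁ a₂ b₂ m : R) :
    kos a₁ b₁ a₂ b₂ + m • (sg * ctr₂) = kos a₁ b₁ a₂ (b₂ + m) := by
  simp [sg, kos, ctr₂]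
  ring
theorem kos_add_smul (a₁ b₁ a₂ b₂ c α γ : R) :
    kos a₁ b₁ a₂ b₂ + c • kos α 0 γ 0 = kos (a₁ + c * α) b₁ (a₂ + c * γ) b₂ := by
  simp [kos]
  ring
theorem kos_scale (a₁ b₁ a₂ b₂ i : R) :
    kos a₁ b₁ (i * a₂) b₂ * scale i = scale i * kos a₁ b₁ a₂ (i * b₂) := by
  simp [kos, scale]
  exact ⟨mul_comm _ _, mul_comm _ _, mul_comm _ _⟩
theorem shear_ctr₁ (s : R) : shear s * ctr₁ = ctr₁ * shear s := by
  simp [shear, ctr₁, zero_eq_cons]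
theorem shear_ctr₂ (s : R) : shear s * ctr₂ = ctr₂ * shear s - s • ctr₁ := by
  simp [shear, ctr₁, ctr₂, zero_eq_cons]
theorem shear_kos (s α γ : R) : shear s * kos α 0 γ 0 = kos α 0 γ 0 * shear s + kos 0 0 (s * α) 0 := by
  simp [shear, kos, zero_eq_cons]
  ring
theorem shear_scale (s i : R) : shear (i * s) * scale i = scale i * shear s := by
  simp [shear, scale, zero_eq_cons]
theorem kos_theta_scale (i c : R) : kos 0 0 (i * c) 0 * scale i = scale i * kos 0 0 c 0 := by
  simp [kos, scale, zero_eq_cons]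
theorem scale_mul (i i' : R) : scale i * scale i' = scale (i * i') := by
  simp [scale]
theorem scale_one : scale (1 : R) = 1 := by
  simp [scale, one_eq_literal]

variable {I J : Type}

theorem neg_kronecker (M : Matrix I I R) (N : Matrix J J R) : (-M) ⊗ₖ N = -(M ⊗ₖ N) := by
  ext i j; simp

theorem kronecker_neg (M : Matrix I I R) (N : Matrix J J R) : M ⊗ₖ (-N) = -(M ⊗ₖ N) := by
  ext i j; simp

variable [Fintype I] [Fintype J] [DecidableEq I] [DecidableEq J]

/-- Conjugation of a tensor product of two odd operators by `1 + L ⊗ X`. -/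
theorem kronecker_conj {A s L : Matrix I I R} {B X : Matrix J J R} {a m : R} (hL : L * L = 0)
    (hs : s * L = -(L * s)) (hA : A * L - L * A = a • s) (hX : X * X = 0)
    (hB : B * X + X * B = m • 1) :
    (A ⊗ₖ 1 + s ⊗ₖ B) * (1 + L ⊗ₖ X) =
      (1 + L ⊗ₖ X) * ((A + m • (s * L)) ⊗ₖ 1 + s ⊗ₖ (B + a • X)) := by
  have h1 : A * L = L * A + a • s := by rw [← hA]; abel
  have h2 : X * B = m • 1 - B * X := by rw [← hB]; abel
  have h3 : L * s = -(s * L) := by rw [hs, neg_neg]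
  simp only [mul_add, add_mul, one_mul, mul_one, ← Matrix.mul_kronecker_mul, Matrix.mul_smul, h1, h2,
    hX, ← mul_assoc L s L, h3, mul_assoc s L L, neg_mul, hL, Matrix.mul_zero, Matrix.add_kronecker,
    Matrix.kronecker_add, smul_zero, neg_zero, Matrix.smul_kronecker, Matrix.kronecker_smul,
    sub_eq_add_neg, neg_kronecker, kronecker_neg, Matrix.kronecker_zero, Matrix.zero_kronecker]
  module

end Koszul

namespace Con

/-! ### A homogeneous basis adapted to the convolution -/

/-- The value of `b₂` of the second factor. -/
def e₂ : Coord 2 := ib * b 1 0 * y 2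
/-- The entries of `Ad(a)⁻¹ X`. -/
def x' (i j : Fin 2) : Coord 2 :=
  (!![ia * a 1 1, -(ia * a 0 1); -(ia * a 1 0), ia * a 0 0] * !![x 0 0, x 0 1; x 1 0, x 1 1] *
      !![a 0 0, a 0 1; a 1 0, a 1 1]) i j

/-- The differential of the first factor. -/
def dL : Matrix (Fin 4) (Fin 4) (Coord 2) :=
  kos (x 1 0) (y 0 - ia * a 0 0 ^ 2 * y 1) (xc 0) (ia * a 1 0 * y 1)
/-- The differential of the second factor. -/
def dR : Matrix (Fin 4) (Fin 4) (Coord 2) :=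
  kos (x' 1 0) z (b 0 0 * (x' 0 0 - x' 1 1) + b 1 0 * x' 0 1) e₂

/-- The differential of the tensor product of the two crossings. -/
def dOld : Matrix (Fin 4 × Fin 4) (Fin 4 × Fin 4) (Coord 2) := dL ⊗ₖ 1 + sg ⊗ₖ dR

/-- The linear parts of the three operators `∇` on the tensor product of the two crossings. -/
def aOld : Fin 3 → Matrix (Fin 4 × Fin 4) (Fin 4 × Fin 4) (Coord 2) :=
  ![shear (-(2 * a 0 0)) ⊗ₖ 1, 1 ⊗ₖ shear (-(2 * b 0 0)), 0]

/-- The coefficient of `θ₄` in the new generator `θ₁`, up to sign. -/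
def κ : Coord 2 := a 0 1 * (gg 0 + a 0 0 * b 0 0) * ia

/-- The correction `a₁₁² / det a · θ₃ - κ θ₄` of `θ₁`. -/
def X₁ : Matrix (Fin 4) (Fin 4) (Coord 2) := kos (a 0 0 ^ 2 * ia) 0 (-κ) 0
/-- The correction of `θ₂`. -/
def X₂ : Matrix (Fin 4) (Fin 4) (Coord 2) := kos (-(a 1 0 * ia)) 0 (a 1 1 * b 0 0 * ia) 0

/-- The change of basis. -/
def Q : Matrix (Fin 4 × Fin 4) (Fin 4 × Fin 4) (Coord 2) :=
  (1 + ctr₁ ⊗ₖ X₁) * ((1 + ctr₂ ⊗ₖ X₂) * (1 ⊗ₖ scale ia))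

/-- The inverse change of basis. -/
def Qinv : Matrix (Fin 4 × Fin 4) (Fin 4 × Fin 4) (Coord 2) :=
  (1 ⊗ₖ scale da) * (1 - ctr₂ ⊗ₖ X₂) * (1 - ctr₁ ⊗ₖ X₁)

theorem kron_scale_mul (r s : Coord 2) :
    ((1 : Matrix (Fin 4) (Fin 4) (Coord 2)) ⊗ₖ scale r) * (1 ⊗ₖ scale s) =
      (1 : Matrix (Fin 4) (Fin 4) (Coord 2)) ⊗ₖ scale (r * s) := by
  rw [← Matrix.mul_kronecker_mul, one_mul, scale_mul]

theorem one_add_mul_one_sub (L X : Matrix (Fin 4) (Fin 4) (Coord 2)) (h : L * L = 0) :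
    (1 + L ⊗ₖ X) * (1 - L ⊗ₖ X) = 1 ∧ (1 - L ⊗ₖ X) * (1 + L ⊗ₖ X) = 1 := by
  have : (L ⊗ₖ X) * (L ⊗ₖ X) = 0 := by
    rw [← Matrix.mul_kronecker_mul, h, Matrix.zero_kronecker]
  constructor <;> noncomm_ring <;> rw [this] <;> simp

theorem Q_Qinv : Q * Qinv = 1 := by
  have h1 := (one_add_mul_one_sub ctr₁ X₁ ctr₁_sq).1
  have h2 := (one_add_mul_one_sub ctr₂ X₂ ctr₂_sq).1
  have h3 := kron_scale_mul ia da
  rw [ia_da, scale_one, Matrix.one_kronecker_one] at h3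
  calc Q * Qinv = (1 + ctr₁ ⊗ₖ X₁) * ((1 + ctr₂ ⊗ₖ X₂) * ((1 ⊗ₖ scale ia) * (1 ⊗ₖ scale da)) *
        (1 - ctr₂ ⊗ₖ X₂)) * (1 - ctr₁ ⊗ₖ X₁) := by
        simp only [Q, Qinv, mul_assoc]
    _ = 1 := by rw [h3, mul_one, h2, mul_one, h1]

theorem Qinv_Q : Qinv * Q = 1 := mul_eq_one_comm.1 Q_Qinv

/-- The part of the differential which acts on the first tensor factor, in the new basis. -/
def kL : Matrix (Fin 4) (Fin 4) (Coord 2) :=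
  kos (x 1 0) (pull13 b1) (xc 0) (y 2 * ia * ib * b 0 0 * gg 1)
/-- The part of the differential which acts on the second tensor factor, in the new basis. -/
def kR : Matrix (Fin 4) (Fin 4) (Coord 2) := kos 0 z (gg 1 * xc 1) (ia * e₂)

/-- The differential in the new basis. -/
def dNew : Matrix (Fin 4 × Fin 4) (Fin 4 × Fin 4) (Coord 2) := kL ⊗ₖ 1 + sg ⊗ₖ kR

/-- The linear parts of the three operators `∇` in the new basis. -/
def aNew : Fin 3 → Matrix (Fin 4 × Fin 4) (Fin 4 × Fin 4) (Coord 2) :=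
  ![shear (-(2 * a 0 0)) ⊗ₖ 1 + ctr₁ ⊗ₖ kos 0 0 (-(2 * a 0 1 * gg 1)) 0,
    1 ⊗ₖ shear (-(2 * b 0 0 * da)) + ctr₂ ⊗ₖ kos 0 0 (gg 1) 0, 0]

theorem dOld_Q : dOld * Q = Q * dNew := by
  have h1 := kronecker_conj (s := sg) (X := X₁) (A := dL) (B := dR) ctr₁_sq sg_ctr₁ (kos_ctr₁ _ _ _ _)
    (kos_sq _ _) (kos_anticomm _ _ _ _ _ _ _ _)
  have h2 := kronecker_conj (s := sg) (X := X₂) ctr₂_sq sg_ctr₂ (kos_ctr₂ (x 1 0) (pull13 b1) (xc 0) (ia * a 1 0 * y 1))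
    (kos_sq _ _) (kos_anticomm (x' 1 0 - x 1 0 * (a 0 0 ^ 2 * ia)) z
      (b 0 0 * (x' 0 0 - x' 1 1) + b 1 0 * x' 0 1 + x 1 0 * κ) e₂ _ _ _ _)
  rw [dL, dR, X₁, kos_add_ctr₁, kos_add_smul] at h1
  rw [X₂, kos_add_ctr₂, kos_add_smul] at h2
  have h3 : ∀ (A B B' : Matrix (Fin 4) (Fin 4) (Coord 2)), B * scale ia = scale ia * B' →
      (A ⊗ₖ 1 + sg ⊗ₖ B) * (1 ⊗ₖ scale ia) = (1 ⊗ₖ scale ia) * (A ⊗ₖ 1 + sg ⊗ₖ B') := by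
    intro A B B' h
    simp only [add_mul, mul_add, ← Matrix.mul_kronecker_mul, one_mul, mul_one, h]
  have q1 : y 0 - ia * a 0 0 ^ 2 * y 1 + (x' 1 0 * 0 + z * (a 0 0 ^ 2 * ia) +
      (b 0 0 * (x' 0 0 - x' 1 1) + b 1 0 * x' 0 1) * 0 + e₂ * -κ) = pull13 b1 := by
    rw [pull13_b1, e₂, z, yb, κ, gg]
    ring
  have q2 : x' 1 0 + -x 1 0 * (a 0 0 ^ 2 * ia) = x' 1 0 - x 1 0 * (a 0 0 ^ 2 * ia) := by ring
  have q3 : b 0 0 * (x' 0 0 - x' 1 1) + b 1 0 * x' 0 1 + -x 1 0 * -κ =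
      b 0 0 * (x' 0 0 - x' 1 1) + b 1 0 * x' 0 1 + x 1 0 * κ := by ring
  rw [q1, q2, q3] at h1
  have q4 : ia * a 1 0 * y 1 + ((x' 1 0 - x 1 0 * (a 0 0 ^ 2 * ia)) * 0 + z * -(a 1 0 * ia) +
      (b 0 0 * (x' 0 0 - x' 1 1) + b 1 0 * x' 0 1 + x 1 0 * κ) * 0 + e₂ * (a 1 1 * b 0 0 * ia)) =
      y 2 * ia * ib * b 0 0 * gg 1 := by
    rw [e₂, z, yb, gg]
    ring
  have q5 : x' 1 0 - x 1 0 * (a 0 0 ^ 2 * ia) + -xc 0 * -(a 1 0 * ia) = 0 := by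
    simp only [x', xc, Matrix.mul_apply, Fin.sum_univ_two]
    simp
    ring
  have q6 : b 0 0 * (x' 0 0 - x' 1 1) + b 1 0 * x' 0 1 + x 1 0 * κ + -xc 0 * (a 1 1 * b 0 0 * ia) =
      ia * (gg 1 * xc 1) := by
    simp only [x', xc, κ, gg, Matrix.mul_apply, Fin.sum_univ_two]
    simp
    ring
  rw [q4, q5, q6] at h2
  have h4 := h3 kL _ _ (kos_scale 0 z (gg 1 * xc 1) e₂ ia)
  rw [dOld, dL, dR, Q, X₁, ← mul_assoc, h1, mul_assoc, X₂]
  rw [← mul_assoc _ (1 + ctr₂ ⊗ₖ _), h2, mul_assoc (1 + ctr₂ ⊗ₖ _)]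
  change _ * (_ * ((kL ⊗ₖ 1 + _) * _)) = _
  rw [h4]
  simp only [mul_assoc]
  rfl

/-- Conjugation of a connection with matrix `M` by `1 + P`, whose derivative is `P'`. -/
theorem cov_conj {I : Type} [Fintype I] [DecidableEq I] {M P P' C : Matrix I I (Coord 2)}
    (h : M * P + P' = C + P * M) (hC : P * C = 0) : M * (1 + P) + P' = (1 + P) * (M + C) := by
  rw [mul_add, mul_one, add_assoc, h, add_mul, one_mul, mul_add, hC]
  abel

theorem cov_conj_mul {I : Type} [Fintype I] [DecidableEq I] {M M' M'' N N' dN dN' : Matrix I I (Coord 2)}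
    (h : M * N + dN = N * M') (h' : M' * N' + dN' = N' * M'') :
    M * (N * N') + (dN * N' + N * dN') = N * N' * M'' := by
  rw [mul_assoc N, ← h', mul_add N, ← mul_assoc N, ← h]
  noncomm_ring

theorem kos_deriv (d : Derivation ℂ (Coord 2) (Coord 2)) (α γ : Coord 2) :
    (kos α 0 γ 0).map d = kos (d α) 0 (d γ) 0 := by
  ext i j; fin_cases i <;> fin_cases j <;> simp [kos]

theorem ctr₁_deriv (d : Derivation ℂ (Coord 2) (Coord 2)) : (ctr₁ : Matrix _ _ (Coord 2)).map d = 0 := by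
  ext i j; fin_cases i <;> fin_cases j <;> simp [ctr₁]

theorem ctr₂_deriv (d : Derivation ℂ (Coord 2) (Coord 2)) : (ctr₂ : Matrix _ _ (Coord 2)).map d = 0 := by
  ext i j; fin_cases i <;> fin_cases j <;> simp [ctr₂]

theorem scale_deriv (d : Derivation ℂ (Coord 2) (Coord 2)) (h : d ia = 0) : (scale ia).map d = 0 := by
  ext i j; fin_cases i <;> fin_cases j <;> simp [scale, h]

theorem Q_deriv (k : Fin 3) : Q.map (lieDer 2 k) =
    (ctr₁ ⊗ₖ X₁.map (lieDer 2 k)) * ((1 + ctr₂ ⊗ₖ X₂) * (1 ⊗ₖ scale ia)) +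
      (1 + ctr₁ ⊗ₖ X₁) * ((ctr₂ ⊗ₖ X₂.map (lieDer 2 k)) * (1 ⊗ₖ scale ia) + (1 + ctr₂ ⊗ₖ X₂) * 0) := by
  simp only [Q, map_mul_deriv, add_deriv, kronecker_deriv, one_deriv, ctr₁_deriv, ctr₂_deriv,
    scale_deriv _ (lie_ia k), Matrix.zero_kronecker, Matrix.kronecker_zero, zero_add]

theorem Q_cov_zero : aOld 0 * Q + Q.map (lieDer 2 0) = Q * aNew 0 := by
  set dX := X₁.map (lieDer 2 0) with hdX
  have hX : dX = kos (lieDer 2 0 (a 0 0 ^ 2 * ia)) 0 (lieDer 2 0 (-κ)) 0 := kos_deriv _ _ _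
  have hX₂ : X₂.map (lieDer 2 0) = 0 := by
    rw [X₂, kos_deriv]
    simp [Derivation.leibniz, lie_a0, lie_b0, lie_ia, kos, zero_eq_literal]
  have s1 : (shear (-(2 * a 0 0)) ⊗ₖ 1) * (1 + ctr₁ ⊗ₖ X₁) + ctr₁ ⊗ₖ dX =
      (1 + ctr₁ ⊗ₖ X₁) * (shear (-(2 * a 0 0)) ⊗ₖ 1 + ctr₁ ⊗ₖ dX) := by
    apply cov_conj
    · rw [← Matrix.mul_kronecker_mul, ← Matrix.mul_kronecker_mul, shear_ctr₁, one_mul, mul_one, add_comm]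
    · rw [← Matrix.mul_kronecker_mul, ctr₁_sq, Matrix.zero_kronecker]
  have s2 : (shear (-(2 * a 0 0)) ⊗ₖ 1 + ctr₁ ⊗ₖ dX) * (1 + ctr₂ ⊗ₖ X₂) + ctr₂ ⊗ₖ X₂.map (lieDer 2 0) =
      (1 + ctr₂ ⊗ₖ X₂) * (shear (-(2 * a 0 0)) ⊗ₖ 1 + ctr₁ ⊗ₖ dX +
        (2 * a 0 0) • (ctr₁ ⊗ₖ X₂)) := by
    have hc : dX * X₂ = -(X₂ * dX) := by
      rw [eq_neg_iff_add_eq_zero, hX, X₂, kos_anticomm]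
      simp
    apply cov_conj
    · simp only [add_mul, mul_add, ← Matrix.mul_kronecker_mul, shear_ctr₂, hX₂, Matrix.kronecker_zero,
        one_mul, mul_one, ctr₂_ctr₁, hc, neg_kron, kron_neg, sub_kron, Matrix.smul_kronecker, neg_smul]
      abel
    · rw [Matrix.mul_smul, ← Matrix.mul_kronecker_mul, X₂, kos_sq, Matrix.kronecker_zero, smul_zero]
  have s3 : ctr₁ ⊗ₖ dX + (2 * a 0 0) • (ctr₁ ⊗ₖ X₂) =
      ctr₁ ⊗ₖ kos 0 0 (ia * -(2 * a 0 1 * gg 1)) 0 := by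
    rw [← Matrix.kronecker_smul, ← Matrix.kronecker_add, hX, X₂, kos_add_smul]
    congr 2
    · simp [Derivation.leibniz, lie_a0, lie_ia, pow_two]
      ring
    · simp [κ, gg, Derivation.leibniz, lie_a0, lie_b0, lie_ia]
      ring
  rw [add_assoc, s3] at s2
  have s4 : (shear (-(2 * a 0 0)) ⊗ₖ 1 + ctr₁ ⊗ₖ kos 0 0 (ia * -(2 * a 0 1 * gg 1)) 0) * (1 ⊗ₖ scale ia) + 0 =
      (1 ⊗ₖ scale ia) * aNew 0 := by
    change _ = _ * (shear (-(2 * a 0 0)) ⊗ₖ 1 + ctr₁ ⊗ₖ kos 0 0 (-(2 * a 0 1 * gg 1)) 0)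
    simp only [add_mul, mul_add, ← Matrix.mul_kronecker_mul, kos_theta_scale, one_mul, mul_one, add_zero]
  have := cov_conj_mul s1 (cov_conj_mul s2 s4)
  rw [Q_deriv]
  exact this

/-- Conjugation of `1 ⊗ shear t` by `1 + L ⊗ X`. -/
theorem shear_cov_conj {L : Matrix (Fin 4) (Fin 4) (Coord 2)} {α γ t c : Coord 2}
    (d : Derivation ℂ (Coord 2) (Coord 2)) (hL : L * L = 0) (hα : d α = 0) (hγ : d γ + t * α = c) :
    ((1 : Matrix (Fin 4) (Fin 4) (Coord 2)) ⊗ₖ shear t) * (1 + L ⊗ₖ kos α 0 γ 0) +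
        L ⊗ₖ (kos α 0 γ 0).map d =
      (1 + L ⊗ₖ kos α 0 γ 0) * (1 ⊗ₖ shear t + L ⊗ₖ kos 0 0 c 0) := by
  apply cov_conj
  · rw [← Matrix.mul_kronecker_mul, ← Matrix.mul_kronecker_mul, shear_kos, one_mul, mul_one, kos_deriv,
      add_comm (L ⊗ₖ kos 0 0 c 0), Matrix.kronecker_add, add_assoc, ← Matrix.kronecker_add, hα, ← hγ]
    congr 2
    simp [kos]
    ring
  · rw [← Matrix.mul_kronecker_mul, hL, Matrix.zero_kronecker]

theorem Q_cov_one : aOld 1 * Q + Q.map (lieDer 2 1) = Q * aNew 1 := by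
  have s1 := shear_cov_conj (α := a 0 0 ^ 2 * ia) (γ := -κ) (t := -(2 * b 0 0)) (c := 0) (lieDer 2 1)
    ctr₁_sq (by simp [Derivation.leibniz, lie_a1, lie_ia, pow_two])
    (by
      simp [κ, gg, Derivation.leibniz, lie_a1, lie_b1, lie_ia]
      ring)
  have s2 := shear_cov_conj (α := -(a 1 0 * ia)) (γ := a 1 1 * b 0 0 * ia) (t := -(2 * b 0 0))
    (c := ia * gg 1) (lieDer 2 1) ctr₂_sq (by simp [Derivation.leibniz, lie_a1, lie_ia])
    (by
      simp [gg, Derivation.leibniz, lie_a1, lie_b1, lie_ia]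
      ring)
  have h0 : kos (0 : Coord 2) 0 0 0 = 0 := by simp [kos, zero_eq_literal]
  rw [h0, Matrix.kronecker_zero, add_zero] at s1
  have ht : -(2 * b 0 0) = ia * -(2 * b 0 0 * da) := by
    linear_combination (2 * b 0 0) * ia_da
  have s3 : ((1 : Matrix (Fin 4) (Fin 4) (Coord 2)) ⊗ₖ shear (-(2 * b 0 0)) +
      ctr₂ ⊗ₖ kos 0 0 (ia * gg 1) 0) * (1 ⊗ₖ scale ia) + 0 = (1 ⊗ₖ scale ia) * aNew 1 := by
    change _ = _ * (1 ⊗ₖ shear (-(2 * b 0 0 * da)) + ctr₂ ⊗ₖ kos 0 0 (gg 1) 0)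
    rw [ht]
    simp only [add_mul, mul_add, ← Matrix.mul_kronecker_mul, kos_theta_scale, shear_scale, one_mul,
      mul_one, add_zero]
  have := cov_conj_mul s1 (cov_conj_mul s2 s3)
  rw [Q_deriv]
  exact this

theorem Q_cov_two : aOld 2 * Q + Q.map (lieDer 2 2) = Q * aNew 2 := by
  have h₁ : X₁.map (lieDer 2 2) = 0 := by
    rw [X₁, kos_deriv]
    simp [κ, gg, Derivation.leibniz, lie_a2, lie_b2, lie_ia, kos, zero_eq_literal, pow_two]
  have h₂ : X₂.map (lieDer 2 2) = 0 := by
    rw [X₂, kos_deriv]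
    simp [Derivation.leibniz, lie_a2, lie_b2, lie_ia, kos, zero_eq_literal]
  rw [Q_deriv, h₁, h₂]
  change 0 * Q + _ = Q * 0
  simp

end Con

namespace Con

/-! ### The tensor product of the crossings in the adapted basis -/

/-- The tensor product whose pushforward is the convolution of the two crossings. -/
abbrev NN : ConMF := tensor Cplus Cminus

theorem koszulD_map_pull12 (a₁ b₁ a₂ b₂ : Coord 1) (φ : Coord 1 →ₐ[ℂ] Coord 2) :
    (koszulD a₁ b₁ a₂ b₂).map φ = kos (φ a₁) (φ b₁) (φ a₂) (φ b₂) := by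
  ext i j; fin_cases i <;> fin_cases j <;> simp [koszulD, kos]

theorem koszulA_map (s : Coord 1) (φ : Coord 1 →ₐ[ℂ] Coord 2) :
    (koszulA s).map φ = shear (φ s) := by
  ext i j; fin_cases i <;> fin_cases j <;> simp [koszulA, shear]

theorem signMat_eq_sg {k : ℕ} : (signMat ![1, -1, -1, 1] : Matrix (Fin 4) (Fin 4) (Coord k)) = sg := by
  ext i j; fin_cases i <;> fin_cases j <;> simp [signMat, sg]

theorem NN_D : NN.D = dOld := by
  change (koszulD _ _ _ _).map pull12 ⊗ₖ (1 : Matrix (Fin 4) (Fin 4) (Coord 2)) +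
    (signMat ![1, -1, -1, 1] : Matrix (Fin 4) (Fin 4) (Coord 2)) ⊗ₖ (koszulD _ _ _ _).map pull23 = _
  rw [koszulD_map_pull12, koszulD_map_pull12, signMat_eq_sg, dOld, dL, dR]
  congr 4
  · exact pull12_x 1 0
  · simp only [BraidMF.b1, map_sub, map_mul, map_pow, pull12_y, pull12_gg, pull12_detInv]
    rfl
  · simp only [BraidMF.xt, map_add, map_sub, map_mul, pull12_x, pull12_gg]
    rfl
  · simp only [map_mul, pull12_y, pull12_gg, pull12_detInv]
    rfl
  · rw [pull23_x]
    rfl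
  · simp only [BraidMF.b1, map_sub, map_mul, map_pow, pull23_y, pull23_gg, pull23_detInv, z, yb]
    simp
    ring
  · simp only [BraidMF.xt, map_add, map_sub, map_mul, pull23_x, pull23_gg]
    rfl
  · simp only [map_mul, pull23_y, pull23_gg, pull23_detInv]
    rfl

theorem NN_A_zero : NN.A 0 = aOld 0 := by
  change (koszulA _).map pull12 ⊗ₖ (1 : Matrix (Fin 4) (Fin 4) (Coord 2)) =
    shear (-(2 * a 0 0)) ⊗ₖ 1
  rw [koszulA_map, map_neg, map_mul, pull12_gg, map_ofNat]

theorem NN_A_one : NN.A 1 = aOld 1 := by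
  change (0 : Matrix (Fin 4) (Fin 4) (Coord 1)).map pull12 ⊗ₖ (1 : Matrix (Fin 4) (Fin 4) (Coord 2)) +
    (1 : Matrix (Fin 4) (Fin 4) (Coord 2)) ⊗ₖ (koszulA _).map pull23 = 1 ⊗ₖ shear (-(2 * b 0 0))
  rw [koszulA_map, map_zeroM, Matrix.zero_kronecker, zero_add, map_neg, map_mul, pull23_gg, map_ofNat]

theorem NN_A_two : NN.A 2 = aOld 2 := by
  change (1 : Matrix (Fin 4) (Fin 4) (Coord 2)) ⊗ₖ
    (0 : Matrix (Fin 4) (Fin 4) (Coord 1)).map pull23 = 0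
  rw [map_zeroM, Matrix.kronecker_zero]

theorem NN_E01 : NN.E01 = (0 : Matrix (Fin 4 × Fin 4) (Fin 4 × Fin 4) (Coord 2)) := by
  change (0 : Matrix (Fin 4) (Fin 4) (Coord 1)).map pull12 ⊗ₖ
    (1 : Matrix (Fin 4) (Fin 4) (Coord 2)) = 0
  rw [map_zeroM, Matrix.zero_kronecker]

theorem NN_E12 : NN.E12 = (0 : Matrix (Fin 4 × Fin 4) (Fin 4 × Fin 4) (Coord 2)) := by
  change (signMat ![1, -1, -1, 1] : Matrix (Fin 4) (Fin 4) (Coord 2)) ⊗ₖ (0 : Matrix (Fin 4) (Fin 4) (Coord 1)).map pull23 = 0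
  rw [map_zeroM, Matrix.kronecker_zero]

theorem NN_sgn : (signMat NN.sgn : Matrix NN.I NN.I (Coord 2)) = sg ⊗ₖ sg := by
  change signMat (fun p : Fin 4 × Fin 4 => (![1, -1, -1, 1] : Fin 4 → ℤˣ) p.1 *
    (![1, -1, -1, 1] : Fin 4 → ℤˣ) p.2) = _
  rw [signMat_prod, signMat_eq_sg]

/-- Matrices of size `4 × 4` as vectors of the free module with the basis `Fin 4 × Fin 4`. -/
def flat (M : Matrix (Fin 4) (Fin 4) (Coord 2)) : Fin 4 × Fin 4 → Coord 2 := fun p => M p.1 p.2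

theorem kronecker_mulVec_flat (A B M : Matrix (Fin 4) (Fin 4) (Coord 2)) :
    (A ⊗ₖ B) *ᵥ flat M = flat (A * M * Bᵀ) := by
  ext ⟨i, j⟩
  simp only [Matrix.mulVec, dotProduct, flat, Matrix.kroneckerMap_apply, Matrix.mul_apply,
    Matrix.transpose_apply, Fintype.sum_prod_type, Finset.sum_mul]
  rw [Finset.sum_comm]
  exact Finset.sum_congr rfl fun _ _ => Finset.sum_congr rfl fun _ _ => by ring

/-- The element of `ℂ[𝒳_con]^I ⊗ Λ(e₁)` whose coordinates in the adapted basis are `M + e₁ S`. -/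
def emb (M S : Matrix (Fin 4) (Fin 4) (Coord 2)) : Amb (Fin 4 × Fin 4) :=
  ⟨Q *ᵥ flat M, Q *ᵥ flat S⟩

/-- The differential `D` in the adapted basis. -/
def dN (M : Matrix (Fin 4) (Fin 4) (Coord 2)) : Matrix (Fin 4) (Fin 4) (Coord 2) :=
  kL * M + sg * M * kRᵀ

/-- The operator by which `E₁₂` of the first copy of `𝔫` acts, in the adapted basis. -/
def cN0 (M : Matrix (Fin 4) (Fin 4) (Coord 2)) : Matrix (Fin 4) (Fin 4) (Coord 2) :=
  M.map (lieDer 2 0) + (shear (-(2 * a 0 0)) * M + ctr₁ * M * (kos 0 0 (-(2 * a 0 1 * gg 1)) 0)ᵀ)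
/-- The operator by which `E₁₂` of the middle copy of `𝔫` acts, in the adapted basis. -/
def cN1 (M : Matrix (Fin 4) (Fin 4) (Coord 2)) : Matrix (Fin 4) (Fin 4) (Coord 2) :=
  M.map E + (M * (shear (-(2 * b 0 0 * da)))ᵀ + ctr₂ * M * (kos 0 0 (gg 1) 0)ᵀ)

theorem flat_add (M N : Matrix (Fin 4) (Fin 4) (Coord 2)) : flat (M + N) = flat M + flat N := rfl
theorem flat_sub (M N : Matrix (Fin 4) (Fin 4) (Coord 2)) : flat (M - N) = flat M - flat N := rfl
theorem flat_neg (M : Matrix (Fin 4) (Fin 4) (Coord 2)) : flat (-M) = -flat M := rfl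

theorem dNew_flat (M : Matrix (Fin 4) (Fin 4) (Coord 2)) : dNew *ᵥ flat M = flat (dN M) := by
  rw [dNew, Matrix.add_mulVec, kronecker_mulVec_flat, kronecker_mulVec_flat, Matrix.transpose_one,
    mul_one, ← flat_add, dN]

/-- A change of basis transforms a connection by the rule `A' = Q⁻¹ (A Q + ∂ Q)`. -/
theorem cov_mulVec {I : Type} [Fintype I] {k : Fin 3} {A A' P : Matrix I I (Coord 2)}
    (h : A * P + P.map (lieDer 2 k) = P * A') (v : I → Coord 2) :
    cov k A (P *ᵥ v) = P *ᵥ cov k A' v := by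
  have h1 : (fun i => lieDer 2 k ((P *ᵥ v) i)) =
      P.map (lieDer 2 k) *ᵥ v + P *ᵥ fun i => lieDer 2 k (v i) := by
    ext i
    simp only [Matrix.mulVec, dotProduct, map_sum, Derivation.leibniz, smul_eq_mul, Pi.add_apply,
      Matrix.map_apply, ← Finset.sum_add_distrib]
    exact Finset.sum_congr rfl fun j _ => by ring
  change (fun i => lieDer 2 k ((P *ᵥ v) i)) + A *ᵥ (P *ᵥ v) = P *ᵥ ((fun i => lieDer 2 k (v i)) + A' *ᵥ v)
  rw [h1, Matrix.mulVec_add, Matrix.mulVec_mulVec, Matrix.mulVec_mulVec, ← h, Matrix.add_mulVec]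
  abel

theorem cov_aNew_zero (M : Matrix (Fin 4) (Fin 4) (Coord 2)) :
    cov 0 (aNew 0) (flat M) = flat (cN0 M) := by
  change flat (M.map (lieDer 2 0)) + (shear (-(2 * a 0 0)) ⊗ₖ 1 +
    ctr₁ ⊗ₖ kos 0 0 (-(2 * a 0 1 * gg 1)) 0) *ᵥ flat M = _
  rw [Matrix.add_mulVec, kronecker_mulVec_flat, kronecker_mulVec_flat, Matrix.transpose_one,
    mul_one, ← flat_add, ← flat_add, cN0]

theorem cov_aNew_one (M : Matrix (Fin 4) (Fin 4) (Coord 2)) :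
    cov 1 (aNew 1) (flat M) = flat (cN1 M) := by
  change flat (M.map (lieDer 2 1)) + (1 ⊗ₖ shear (-(2 * b 0 0 * da)) +
    ctr₂ ⊗ₖ kos 0 0 (gg 1) 0) *ᵥ flat M = _
  rw [Matrix.add_mulVec, kronecker_mulVec_flat, kronecker_mulVec_flat, one_mul, ← flat_add,
    ← flat_add, cN1]

theorem cov_aNew_two (M : Matrix (Fin 4) (Fin 4) (Coord 2)) :
    cov 2 (aNew 2) (flat M) = flat (M.map (lieDer 2 2)) := by
  change flat (M.map (lieDer 2 2)) + 0 *ᵥ flat M = _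
  rw [Matrix.zero_mulVec, add_zero]

theorem NN_dAmb (f s : Fin 4 × Fin 4 → Coord 2) : NN.dAmb (⟨f, s⟩ : Amb (Fin 4 × Fin 4)) =
    (⟨dOld *ᵥ f, cov 1 (aOld 1) f - dOld *ᵥ s⟩ : Amb (Fin 4 × Fin 4)) := by
  rw [← NN_D, ← NN_A_one]
  rfl

theorem NN_nablaAmb_zero (f s : Fin 4 × Fin 4 → Coord 2) :
    NN.nablaAmb 0 (⟨f, s⟩ : Amb (Fin 4 × Fin 4)) =
      (⟨cov 0 (aOld 0) f, cov 0 (aOld 0) s⟩ : Amb (Fin 4 × Fin 4)) := by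
  have h : (⟨cov 0 (aOld 0) f, cov 0 (aOld 0) s⟩ : Amb (Fin 4 × Fin 4)) =
      ⟨cov 0 (aOld 0) f, cov 0 (aOld 0) s +
        (0 : Matrix (Fin 4 × Fin 4) (Fin 4 × Fin 4) (Coord 2)) *ᵥ f⟩ := by
    rw [Matrix.zero_mulVec, add_zero]
  rw [h, ← NN_A_zero, ← NN_E01]
  rfl

theorem NN_nablaAmb_one (f s : Fin 4 × Fin 4 → Coord 2) :
    NN.nablaAmb 1 (⟨f, s⟩ : Amb (Fin 4 × Fin 4)) =
      (⟨cov 2 (aOld 2) f, cov 2 (aOld 2) s⟩ : Amb (Fin 4 × Fin 4)) := by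
  have h : (⟨cov 2 (aOld 2) f, cov 2 (aOld 2) s⟩ : Amb (Fin 4 × Fin 4)) =
      ⟨cov 2 (aOld 2) f, cov 2 (aOld 2) s -
        (0 : Matrix (Fin 4 × Fin 4) (Fin 4 × Fin 4) (Coord 2)) *ᵥ f⟩ := by
    rw [Matrix.zero_mulVec, sub_zero]
  rw [h, ← NN_A_two, ← NN_E12]
  rfl

theorem NN_parAmb (f s : Fin 4 × Fin 4 → Coord 2) : NN.parAmb (⟨f, s⟩ : Amb (Fin 4 × Fin 4)) =
    (⟨(sg ⊗ₖ sg) *ᵥ f, -((sg ⊗ₖ sg) *ᵥ s)⟩ : Amb (Fin 4 × Fin 4)) := by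
  rw [← NN_sgn]
  rfl

theorem dAmb_emb (M S : Matrix (Fin 4) (Fin 4) (Coord 2)) :
    NN.dAmb (emb M S) = emb (dN M) (cN1 M - dN S) := by
  have hD : ∀ M, dOld *ᵥ (Q *ᵥ flat M) = Q *ᵥ flat (dN M) := fun M => by
    rw [Matrix.mulVec_mulVec, dOld_Q, ← Matrix.mulVec_mulVec, dNew_flat]
  rw [emb, NN_dAmb]
  rw [hD, hD, cov_mulVec Q_cov_one, cov_aNew_one, ← Matrix.mulVec_sub, ← flat_sub, emb]

theorem nablaAmb_zero_emb (M S : Matrix (Fin 4) (Fin 4) (Coord 2)) :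
    NN.nablaAmb 0 (emb M S) = emb (cN0 M) (cN0 S) := by
  rw [emb, NN_nablaAmb_zero]
  rw [cov_mulVec Q_cov_zero, cov_mulVec Q_cov_zero, cov_aNew_zero,
    cov_aNew_zero, emb]

theorem nablaAmb_one_emb (M S : Matrix (Fin 4) (Fin 4) (Coord 2)) :
    NN.nablaAmb 1 (emb M S) = emb (M.map (lieDer 2 2)) (S.map (lieDer 2 2)) := by
  rw [emb, NN_nablaAmb_one]
  rw [cov_mulVec Q_cov_two, cov_mulVec Q_cov_two, cov_aNew_two,
    cov_aNew_two, emb]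

theorem sg_transpose : (sg : Matrix (Fin 4) (Fin 4) (Coord 2))ᵀ = sg := by
  ext i j; fin_cases i <;> fin_cases j <;> rfl

theorem sg_Q : (sg ⊗ₖ sg) * Q = Q * (sg ⊗ₖ sg) := by
  have h : ∀ L X : Matrix (Fin 4) (Fin 4) (Coord 2), sg * L = -(L * sg) → sg * X = -(X * sg) →
      (sg ⊗ₖ sg) * (1 + L ⊗ₖ X) = (1 + L ⊗ₖ X) * (sg ⊗ₖ sg) := by
    intro L X hL hX
    rw [mul_add, add_mul, ← Matrix.mul_kronecker_mul, ← Matrix.mul_kronecker_mul, hL, hX, neg_kron,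
      kron_neg, neg_neg, mul_one, one_mul]
  have h₁ := h ctr₁ X₁ sg_ctr₁ (sg_kos _ _ _ _)
  have h₂ := h ctr₂ X₂ sg_ctr₂ (sg_kos _ _ _ _)
  have h₃ : (sg ⊗ₖ sg) * (1 ⊗ₖ scale ia) = (1 ⊗ₖ scale ia) * (sg ⊗ₖ sg) := by
    rw [← Matrix.mul_kronecker_mul, ← Matrix.mul_kronecker_mul, sg_scale, one_mul, mul_one]
  rw [Q, ← mul_assoc, h₁, mul_assoc, ← mul_assoc (sg ⊗ₖ sg), h₂, mul_assoc (1 + _), h₃]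
  simp only [mul_assoc]

theorem parAmb_emb (M S : Matrix (Fin 4) (Fin 4) (Coord 2)) :
    NN.parAmb (emb M S) = emb (sg * M * sg) (-(sg * S * sg)) := by
  have h : ∀ M, (sg ⊗ₖ sg) *ᵥ (Q *ᵥ flat M) = Q *ᵥ flat (sg * M * sg) := fun M => by
    rw [Matrix.mulVec_mulVec, sg_Q, ← Matrix.mulVec_mulVec, kronecker_mulVec_flat, sg_transpose]
  rw [emb, NN_parAmb]
  rw [h, h, emb, flat_neg, Matrix.mulVec_neg]

theorem emb_add (M S M' S' : Matrix (Fin 4) (Fin 4) (Coord 2)) :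
    emb (M + M') (S + S') = emb M S + emb M' S' := by
  apply Amb.ext
  · exact Matrix.mulVec_add Q (flat M) (flat M')
  · exact Matrix.mulVec_add Q (flat S) (flat S')

theorem emb_sub (M S M' S' : Matrix (Fin 4) (Fin 4) (Coord 2)) :
    emb (M - M') (S - S') = emb M S - emb M' S' := by
  apply Amb.ext
  · rw [Amb.fst_sub]; exact Matrix.mulVec_sub Q (flat M) (flat M')
  · rw [Amb.snd_sub]; exact Matrix.mulVec_sub Q (flat S) (flat S')

theorem emb_zero : emb 0 0 = 0 := by
  apply Amb.ext
  · exact Matrix.mulVec_zero Q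
  · exact Matrix.mulVec_zero Q

theorem emb_smul (f : Coord 1) (M S : Matrix (Fin 4) (Fin 4) (Coord 2)) :
    emb (pull13 f • M) (pull13 f • S) = f • emb M S := by
  apply Amb.ext
  · exact Matrix.mulVec_smul Q (pull13 f) (flat M)
  · exact Matrix.mulVec_smul Q (pull13 f) (flat S)

theorem exists_emb (n : Amb (Fin 4 × Fin 4)) : ∃ M S, n = emb M S := by
  have h : ∀ v : Fin 4 × Fin 4 → Coord 2, v = Q *ᵥ flat fun i j => (Qinv *ᵥ v) (i, j) := fun v => by
    change v = Q *ᵥ (Qinv *ᵥ v)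
    rw [Matrix.mulVec_mulVec, Q_Qinv, Matrix.one_mulVec]
  exact ⟨_, _, Amb.ext (h _) (h _)⟩

theorem emb_injective {M S M' S' : Matrix (Fin 4) (Fin 4) (Coord 2)} (h : emb M S = emb M' S') :
    M = M' ∧ S = S' := by
  have h' : ∀ {v w : Fin 4 × Fin 4 → Coord 2}, Q *ᵥ v = Q *ᵥ w → v = w := fun {v w} e => by
    have := congrArg (Qinv *ᵥ ·) e
    simpa only [Matrix.mulVec_mulVec, Qinv_Q, Matrix.one_mulVec] using this
  have h1 := h' (congrArg Amb.fst h)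
  have h2 := h' (congrArg Amb.snd h)
  exact ⟨by ext i j; exact congrFun h1 (i, j), by ext i j; exact congrFun h2 (i, j)⟩

end Con

namespace Con

/-! ### Weights of the adapted basis -/

/-- `f` is homogeneous of weight `c` for the torus element `t`. -/
def Homog (t : Torus 2) (c : ℂˣ) (f : Coord 2) : Prop := torusAut 2 t f = (c : ℂ) • f

theorem Homog.mul {t : Torus 2} {c d : ℂˣ} {f h : Coord 2} (hf : Homog t c f) (hh : Homog t d h) :
    Homog t (c * d) (f * h) := by
  rw [Homog, map_mul, hf, hh, smul_mul_smul_comm, ← Units.val_mul]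

theorem Homog.neg {t : Torus 2} {c : ℂˣ} {f : Coord 2} (hf : Homog t c f) : Homog t c (-f) := by
  rw [Homog, map_neg, hf, smul_neg]

theorem Homog.add {t : Torus 2} {c : ℂˣ} {f h : Coord 2} (hf : Homog t c f) (hh : Homog t c h) :
    Homog t c (f + h) := by
  rw [Homog, map_add, hf, hh, smul_add]

theorem Homog.sub {t : Torus 2} {c : ℂˣ} {f h : Coord 2} (hf : Homog t c f) (hh : Homog t c h) :
    Homog t c (f - h) := by
  rw [Homog, map_sub, hf, hh, smul_sub]

theorem Homog.congr {t : Torus 2} {c d : ℂˣ} {f : Coord 2} (hf : Homog t c f) (h : c = d) :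
    Homog t d f := h ▸ hf

theorem homog_two (t : Torus 2) : Homog t 1 2 := by
  rw [Homog, map_ofNat, Units.val_one, one_smul]

theorem homog_x (t : Torus 2) (i j : Fin 2) :
    Homog t (t.2.1⁻¹ ^ 2 * t.1 0 i * (t.1 0 j)⁻¹) (x i j) := torusAut_X t i j
theorem homog_a (t : Torus 2) (i j : Fin 2) : Homog t (t.1 0 i * (t.1 1 j)⁻¹) (a i j) :=
  torusAut_g t 0 i j
theorem homog_b (t : Torus 2) (i j : Fin 2) : Homog t (t.1 1 i * (t.1 2 j)⁻¹) (b i j) :=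
  torusAut_g t 1 i j
theorem homog_y (t : Torus 2) (i : Fin 3) :
    Homog t (t.2.1 ^ 2 * t.2.2⁻¹ ^ 2 * t.1 i 0 * (t.1 i 1)⁻¹) (y i) := torusAut_y t i

/-- The weight of `(det a)⁻¹`. -/
def wia (t : Torus 2) : ℂˣ := (t.1 0 0 * t.1 0 1)⁻¹ * (t.1 1 0 * t.1 1 1)

theorem homog_ia (t : Torus 2) : Homog t (wia t) ia := by
  rw [Homog, ← pull12_detInv, torus_pull12, torusAut_detInv, map_smul]
  rfl
theorem homog_da (t : Torus 2) : Homog t (wia t)⁻¹ da := by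
  refine (((homog_a t 0 0).mul (homog_a t 1 1)).congr ?_).sub
    (((homog_a t 0 1).mul (homog_a t 1 0)).congr ?_)
  all_goals
    rw [wia]
    ext
    push_cast
    field_simp
theorem homog_db (t : Torus 2) :
    Homog t (t.1 1 0 * t.1 1 1 * (t.1 2 0 * t.1 2 1)⁻¹) db := by
  refine (((homog_b t 0 0).mul (homog_b t 1 1)).congr ?_).sub
    (((homog_b t 0 1).mul (homog_b t 1 0)).congr ?_)
  all_goals
    ext
    push_cast
    field_simp
theorem homog_gg (t : Torus 2) (i : Fin 2) : Homog t (t.1 0 i * (t.1 2 0)⁻¹) (gg i) := by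
  refine (((homog_a t i 0).mul (homog_b t 0 0)).congr ?_).add
    (((homog_a t i 1).mul (homog_b t 1 0)).congr ?_)
  all_goals
    ext
    push_cast
    field_simp
theorem homog_xc (t : Torus 2) (j : Fin 2) :
    Homog t (t.2.1⁻¹ ^ 2 * t.1 0 0 * (t.1 1 j)⁻¹) (xc j) := by
  have h : Homog t (t.2.1⁻¹ ^ 2) (x 0 0 - x 1 1) := by
    refine ((homog_x t 0 0).congr ?_).sub ((homog_x t 1 1).congr ?_)
    all_goals
      ext
      push_cast
      field_simp
  refine (((homog_a t 0 j).mul h).congr ?_).add (((homog_a t 1 j).mul (homog_x t 0 1)).congr ?_)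
  all_goals
    ext
    push_cast
    field_simp

/-- The weights of the basis `1, θ₁, θ₂, θ₁θ₂` if `θ₁, θ₂` have the weights `u, v`. -/
def kosWt (u v : ℂˣ) : Fin 4 → ℂˣ := ![1, u, v, u * v]

/-- The matrix `M`, as a map between free modules with weights `w'` and `w`, is equivariant with respect
to the torus element `t`. -/
def IsEquiv {I J : Type} (t : Torus 2) (w : I → ℂˣ) (w' : J → ℂˣ) (M : Matrix I J (Coord 2)) : Prop :=
  ∀ i j, ((w' j : ℂˣ) : ℂ) • M i j = ((w i : ℂˣ) : ℂ) • torusAut 2 t (M i j)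

section IsEquiv

variable {I J K : Type} {t : Torus 2}

theorem IsEquiv.add {w w'} {M N : Matrix I J (Coord 2)} (hM : IsEquiv t w w' M) (hN : IsEquiv t w w' N) :
    IsEquiv t w w' (M + N) := by
  intro i j
  rw [Matrix.add_apply, smul_add, hM, hN, map_add, smul_add]

theorem IsEquiv.mul [Fintype J] {w w' w''} {M : Matrix I J (Coord 2)} {N : Matrix J K (Coord 2)}
    (hM : IsEquiv t w w' M) (hN : IsEquiv t w' w'' N) : IsEquiv t w w'' (M * N) := by
  intro i k
  simp only [Matrix.mul_apply, map_sum, map_mul, Finset.smul_sum]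
  refine Finset.sum_congr rfl fun j _ => ?_
  rw [← mul_smul_comm, hN, mul_smul_comm, ← smul_mul_assoc, hM, smul_mul_assoc]

theorem IsEquiv.one [DecidableEq I] (w : I → ℂˣ) : IsEquiv t w w (1 : Matrix I I (Coord 2)) := by
  intro i j
  rcases eq_or_ne i j with rfl | h
  · simp
  · simp [h]

theorem IsEquiv.kronecker {I' J' : Type} {w w'} {v v'} {M : Matrix I J (Coord 2)}
    {N : Matrix I' J' (Coord 2)} (hM : IsEquiv t w w' M) (hN : IsEquiv t v v' N) :
    IsEquiv t (fun p => w p.1 * v p.2) (fun p => w' p.1 * v' p.2) (M ⊗ₖ N) := by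
  intro i j
  rw [Matrix.kroneckerMap_apply, Units.val_mul, ← smul_mul_smul_comm, hM, hN, map_mul,
    smul_mul_smul_comm, ← Units.val_mul]

theorem IsEquiv.const_mul {w w'} {M : Matrix I J (Coord 2)} (hM : IsEquiv t w w' M) (c : ℂˣ) :
    IsEquiv t (fun i => w i * c) (fun j => w' j * c) M := by
  intro i j
  change ((w' j * c : ℂˣ) : ℂ) • M i j = ((w i * c : ℂˣ) : ℂ) • torusAut 2 t (M i j)
  rw [mul_comm (w' j), mul_comm (w i), Units.val_mul, mul_smul, hM, smul_smul, Units.val_mul]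

/-- The semilinear action of `t` on a free module with weights `w`. -/
def tws (t : Torus 2) (w : I → ℂˣ) (f : I → Coord 2) : I → Coord 2 :=
  fun i => ((w i : ℂˣ) : ℂ) • torusAut 2 t (f i)

theorem IsEquiv.mulVec [Fintype J] {w w'} {M : Matrix I J (Coord 2)} (hM : IsEquiv t w w' M)
    (f : J → Coord 2) : tws t w (M *ᵥ f) = M *ᵥ tws t w' f := by
  ext i
  simp only [tws, Matrix.mulVec, dotProduct, map_sum, map_mul, Finset.smul_sum]
  refine Finset.sum_congr rfl fun j _ => ?_
  rw [mul_smul_comm, ← smul_mul_assoc, ← smul_mul_assoc, hM]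

end IsEquiv

theorem isEquiv_ctr₁ (t : Torus 2) (u v : ℂˣ) :
    IsEquiv t (fun i => kosWt u v i * u) (kosWt u v) ctr₁ := by
  intro i j
  fin_cases i <;> fin_cases j <;> simp [ctr₁, kosWt, mul_comm]

theorem isEquiv_ctr₂ (t : Torus 2) (u v : ℂˣ) :
    IsEquiv t (fun i => kosWt u v i * v) (kosWt u v) ctr₂ := by
  intro i j
  fin_cases i <;> fin_cases j <;> simp [ctr₂, kosWt]

theorem isEquiv_kos {t : Torus 2} {u v c : ℂˣ} {α γ : Coord 2} (hα : Homog t (c * u⁻¹) α)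
    (hγ : Homog t (c * v⁻¹) γ) :
    IsEquiv t (fun i => kosWt u v i * c⁻¹) (kosWt u v) (kos α 0 γ 0) := by
  rw [Homog] at hα hγ
  have h₁ : ∀ u : ℂˣ, (u * (c : ℂ)⁻¹ * (c * (u : ℂ)⁻¹) : ℂ) = 1 := fun u => by field_simp
  have h₂ : (u * v * (c : ℂ)⁻¹ * (c * (v : ℂ)⁻¹) : ℂ) = u := by field_simp
  have h₃ : (u * v * (c : ℂ)⁻¹ * (c * (u : ℂ)⁻¹) : ℂ) = v := by field_simp
  intro i j
  fin_cases i <;> fin_cases j <;> simp [kos, kosWt, hα, hγ, smul_smul, h₁, h₂, h₃]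

theorem isEquiv_scale {t : Torus 2} {u v c : ℂˣ} {r : Coord 2} (hr : Homog t c r) :
    IsEquiv t (kosWt u v) (kosWt u (v * c)) (scale r) := by
  rw [Homog] at hr
  intro i j
  fin_cases i <;> fin_cases j <;> simp [scale, kosWt, hr, smul_smul, mul_assoc]

/-- The weight of `θ₁` in the first factor. -/
def wθ₁ (t : Torus 2) : ℂˣ := t.2.2⁻¹ * t.2.1 ^ 2 * t.1 0 0 * (t.1 0 1)⁻¹
/-- The weight of `θ₂` in the first factor. -/
def wθ₂ (t : Torus 2) : ℂˣ := t.2.2⁻¹ * t.2.1 ^ 2 * t.1 1 0 * (t.1 0 0)⁻¹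
/-- The weight of `θ₃` in the second factor. -/
def wθ₃ (t : Torus 2) : ℂˣ := t.2.2⁻¹ * t.2.1 ^ 2 * t.1 1 0 * (t.1 1 1)⁻¹
/-- The weight of `θ₄` in the second factor. -/
def wθ₄ (t : Torus 2) : ℂˣ := t.2.2⁻¹ * t.2.1 ^ 2 * t.1 2 0 * (t.1 1 0)⁻¹
/-- The weight of the generator `1` of the tensor product. -/
def wgen (t : Torus 2) : ℂˣ := t.2.1⁻¹ * t.2.2 * (t.2.1⁻¹ * t.2.2) * ((t.1 1 0)⁻¹ * t.1 2 1)

/-- The weights of the adapted basis. -/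
def wNew (t : Torus 2) (p : Fin 4 × Fin 4) : ℂˣ :=
  kosWt (wθ₁ t) (wθ₂ t) p.1 * kosWt (wθ₃ t) (wθ₄ t * wia t) p.2 * wgen t

theorem NN_wt (t : Torus 2) (p : Fin 4 × Fin 4) : NN.wt p t =
    kosWt (wθ₁ t) (wθ₂ t) p.1 * kosWt (wθ₃ t) (wθ₄ t) p.2 * wgen t := by
  have h : ∀ (t : Torus 1) (i : Fin 4), crossing.wt i t = kosWt (wTheta1 t) (wTheta2 t) i := by
    intro t i
    change (![1, wTheta1, wTheta2, wTheta1 * wTheta2] : Fin 4 → Torus 1 →* ℂˣ) i t = _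
    fin_cases i <;> rfl
  change crossing.wt p.1 (tor12 t) * (t.2.1⁻¹ * t.2.2) *
    (crossing.wt p.2 (tor23 t) * (t.2.1⁻¹ * t.2.2) * ((t.1 1 0)⁻¹ * t.1 2 1)) = _
  rw [h, h, wgen]
  change kosWt (wθ₁ t) (wθ₂ t) p.1 * _ * (kosWt (wθ₃ t) (wθ₄ t) p.2 * _ * _) = _
  ac_rfl

theorem isEquiv_Q (t : Torus 2) : IsEquiv t (fun p => NN.wt p t) (wNew t) Q := by
  have hκ : Homog t (wθ₁ t * (wθ₄ t)⁻¹) κ := by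
    have h : Homog t (t.1 0 0 * (t.1 2 0)⁻¹) (gg 0 + a 0 0 * b 0 0) := by
      refine (homog_gg t 0).add (((homog_a t 0 0).mul (homog_b t 0 0)).congr ?_)
      ext
      push_cast
      field_simp
    refine (((homog_a t 0 1).mul h).mul (homog_ia t)).congr ?_
    rw [wia, wθ₁, wθ₄]
    ext
    push_cast
    field_simp
  have h₁ : IsEquiv t _ _ X₁ := isEquiv_kos (c := wθ₁ t) (u := wθ₃ t) (v := wθ₄ t)
    (((homog_a t 0 0).mul (homog_a t 0 0)).mul (homog_ia t) |>.congr (by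
      rw [wia, wθ₁, wθ₃]
      ext
      push_cast
      field_simp) |> (pow_two (a 0 0) ▸ ·)) hκ.neg
  have h₂ : IsEquiv t _ _ X₂ := isEquiv_kos (c := wθ₂ t) (u := wθ₃ t) (v := wθ₄ t)
    (((homog_a t 1 0).mul (homog_ia t)).neg.congr (by
      rw [wia, wθ₂, wθ₃]
      ext
      push_cast
      field_simp))
    ((((homog_a t 1 1).mul (homog_b t 0 0)).mul (homog_ia t)).congr (by
      rw [wia, wθ₂, wθ₄]
      ext
      push_cast
      field_simp))
  have hadd : ∀ (L X : Matrix (Fin 4) (Fin 4) (Coord 2)) (c : ℂˣ),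
      IsEquiv t (fun i => kosWt (wθ₁ t) (wθ₂ t) i * c) (kosWt (wθ₁ t) (wθ₂ t)) L →
      IsEquiv t (fun i => kosWt (wθ₃ t) (wθ₄ t) i * c⁻¹) (kosWt (wθ₃ t) (wθ₄ t)) X →
      IsEquiv t (fun p : Fin 4 × Fin 4 => kosWt (wθ₁ t) (wθ₂ t) p.1 * kosWt (wθ₃ t) (wθ₄ t) p.2)
        (fun p => kosWt (wθ₁ t) (wθ₂ t) p.1 * kosWt (wθ₃ t) (wθ₄ t) p.2) (1 + L ⊗ₖ X) := by
    intro L X c hL hX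
    refine (IsEquiv.one _).add ?_
    have := hL.kronecker hX
    have e : (fun p : Fin 4 × Fin 4 => kosWt (wθ₁ t) (wθ₂ t) p.1 * c *
        (kosWt (wθ₃ t) (wθ₄ t) p.2 * c⁻¹)) =
        fun p => kosWt (wθ₁ t) (wθ₂ t) p.1 * kosWt (wθ₃ t) (wθ₄ t) p.2 := by
      funext p
      rw [mul_mul_mul_comm, mul_inv_cancel, mul_one]
    rwa [e] at this
  have h₃ := (IsEquiv.one (t := t) (kosWt (wθ₁ t) (wθ₂ t))).kronecker
    (isEquiv_scale (u := wθ₃ t) (v := wθ₄ t) (homog_ia t))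
  have := (((hadd _ _ _ (isEquiv_ctr₁ t _ _) h₁).mul
    ((hadd _ _ _ (isEquiv_ctr₂ t _ _) h₂).mul h₃)).const_mul (wgen t))
  rw [show (fun p => NN.wt p t) = fun p : Fin 4 × Fin 4 =>
    kosWt (wθ₁ t) (wθ₂ t) p.1 * kosWt (wθ₃ t) (wθ₄ t) p.2 * wgen t from funext (NN_wt t)]
  exact this

/-- The torus action in the adapted basis. -/
def tM (t : Torus 2) (M : Matrix (Fin 4) (Fin 4) (Coord 2)) : Matrix (Fin 4) (Fin 4) (Coord 2) :=
  Matrix.of fun i j => ((wNew t (i, j) : ℂˣ) : ℂ) • torusAut 2 t (M i j)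

theorem ρAmb_emb (t : Torus 2) (M S : Matrix (Fin 4) (Fin 4) (Coord 2)) :
    NN.ρAmb t (emb M S) = emb (tM t M) (((root 2 1 t * (chiT 2 t)⁻¹ : ℂˣ) : ℂ) • tM t S) := by
  apply Amb.ext
  · exact (isEquiv_Q t).mulVec (flat M)
  · refine (congrArg (((root 2 1 t * (chiT 2 t)⁻¹ : ℂˣ) : ℂ) • ·) ((isEquiv_Q t).mulVec (flat S))).trans ?_
    exact (Matrix.mulVec_smul Q (((root 2 1 t * (chiT 2 t)⁻¹ : ℂˣ) : ℂ)) (flat (tM t S))).symm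

end Con

namespace Con

/-! ### The inclusion of the unit -/

/-- `det (a b)`. -/
def dg : Coord 2 := da * db

theorem dg_mul : ia * ib * dg = 1 := by
  rw [dg, mul_mul_mul_comm, ia_da, ib_db, one_mul]

/-- The part of the image of `∑ q_i θ^i` without `e₁`. -/
def vec0 (q : Fin 4 → Coord 2) : Matrix (Fin 4) (Fin 4) (Coord 2) :=
  !![y 2 * b 0 0 * q 0, 0, 0, 0; y 2 * b 0 0 * q 1, 0, 0, 0;
    q 2, 0, -(xc 1 * dg * q 0), 0; q 3, 0, -(xc 1 * dg * q 1), 0]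

/-- The coefficient of `e₁` in the image of `∑ q_i θ^i`. -/
def vec1 (q : Fin 4 → Coord 2) : Matrix (Fin 4) (Fin 4) (Coord 2) :=
  !![0, 0, dg * q 0, 0; 0, 0, -(dg * q 1), 0; 0, 0, 0, 0; 0, 0, 0, 0]

/-- The coefficient of `e₀` in the image of `∑ q_i θ^i`. -/
def vecB (q : Fin 4 → Coord 2) : Matrix (Fin 4) (Fin 4) (Coord 2) :=
  !![0, 0, 0, 0; 0, 0, 0, 0; 0, 0, -(2 * a 0 1 * dg * q 1), 0; 0, 0, 0, 0]

theorem kos_transpose (a₁ b₁ a₂ b₂ : Coord 2) : (kos a₁ b₁ a₂ b₂)ᵀ =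
    !![0, a₁, a₂, 0; b₁, 0, 0, -a₂; b₂, 0, 0, a₁; 0, -b₂, b₁, 0] := by
  ext i j; fin_cases i <;> fin_cases j <;> rfl

theorem shear_transpose (s : Coord 2) : (shear s)ᵀ =
    !![0, 0, 0, 0; 0, 0, s, 0; 0, 0, 0, 0; 0, 0, 0, 0] := by
  ext i j; fin_cases i <;> fin_cases j <;> rfl

theorem map_literal (f : Coord 2 → Coord 2) (r₀ r₁ r₂ r₃ s₀ s₁ s₂ s₃ t₀ t₁ t₂ t₃ u₀ u₁ u₂ u₃ : Coord 2) :
    (!![r₀, r₁, r₂, r₃; s₀, s₁, s₂, s₃; t₀, t₁, t₂, t₃; u₀, u₁, u₂, u₃]).map f =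
      !![f r₀, f r₁, f r₂, f r₃; f s₀, f s₁, f s₂, f s₃; f t₀, f t₁, f t₂, f t₃; f u₀, f u₁, f u₂, f u₃] := by
  ext i j; fin_cases i <;> fin_cases j <;> rfl

/-- The differential of the unit, pulled back to the convolution space. -/
def kU : Matrix (Fin 4) (Fin 4) (Coord 2) :=
  kos (x 1 0) (pull13 BraidMF.b1) (y 2 * (b 0 0 * xc 0 + b 1 0 * xc 1)) (ia * ib * gg 1)

theorem kR_transpose : kRᵀ =
    !![0, 0, gg 1 * xc 1, 0; z, 0, 0, -(gg 1 * xc 1); ia * e₂, 0, 0, 0; 0, -(ia * e₂), z, 0] :=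
  kos_transpose _ _ _ _

theorem dN_vec0 (q : Fin 4 → Coord 2) : dN (vec0 q) = vec0 (kU *ᵥ q) := by
  have h := dg_mul
  rw [dN, kR_transpose]
  simp [vec0, kU, kL, kos, sg, Matrix.mulVec, dotProduct, Fin.sum_univ_four, e₂]
  refine ⟨⟨?_, ?_⟩, ⟨?_, ?_⟩, ⟨?_, ?_⟩, ?_, ?_⟩
  · ring
  · linear_combination (-(y 2 * b 0 0 * gg 1 * xc 1 * q 0)) * h
  · ring
  · linear_combination (y 2 * b 0 0 * gg 1 * xc 1 * q 1) * h
  · linear_combination (xc 1 * q 0 * b 1 0 * y 2) * h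
  · linear_combination (xc 1 * gg 1 * q 2) * h
  · linear_combination (-(xc 1 * q 1 * b 1 0 * y 2)) * h
  · linear_combination (-(xc 1 * gg 1 * q 3)) * h

/-- A derivation applied to a product with one constant factor. -/
theorem deriv_mul_of_zero {d : Derivation ℂ (Coord 2) (Coord 2)} {f : Coord 2} (g : Coord 2) (hf : d f = 0) :
    d (g * f) = d g * f := by
  rw [Derivation.leibniz, hf, smul_zero, zero_add, smul_eq_mul, mul_comm]

theorem deriv_two (d : Derivation ℂ (Coord 2) (Coord 2)) : d 2 = 0 := by
  simpa using d.map_natCast 2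

theorem lie_dg (k : Fin 3) : lieDer 2 k dg = 0 := by
  rw [dg, deriv_mul_of_zero _ (lie_db k), lie_da, zero_mul]

theorem E_xc : lieDer 2 1 (xc 1) = -xc 0 := by
  simp [xc, Derivation.leibniz, lie_a1, lie_x]
  ring

theorem cN1_vec0 (q : Fin 4 → Coord 2) (hq : ∀ i, lieDer 2 1 (q i) = 0) :
    cN1 (vec0 q) - dN (vec1 q) = vec1 (kU *ᵥ q) := by
  have h := dg_mul
  have h₁ : lieDer 2 1 (y 2 * b 0 0) = y 2 * b 1 0 := by
    rw [Derivation.leibniz, lie_y, smul_zero, add_zero, (lie_b1 0).1, smul_eq_mul]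
  have h₂ : lieDer 2 1 (xc 1 * dg) = -(xc 0 * dg) := by
    rw [deriv_mul_of_zero _ (lie_dg 1), E_xc, neg_mul]
  have hm : (vec0 q).map E = !![y 2 * b 1 0 * q 0, 0, 0, 0; y 2 * b 1 0 * q 1, 0, 0, 0;
      0, 0, xc 0 * dg * q 0, 0; 0, 0, xc 0 * dg * q 1, 0] := by
    rw [vec0, map_literal]
    simp only [map_zero, map_neg, deriv_mul_of_zero _ (hq _), h₁, h₂, hq, neg_mul, neg_neg]
  rw [dN, cN1, hm, kR_transpose, shear_transpose, kos_transpose]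
  simp [vec0, vec1, kU, kL, kos, sg, ctr₂, Matrix.mulVec,
    dotProduct, Fin.sum_univ_four, e₂, zero_eq_cons]
  refine ⟨⟨?_, ?_⟩, ⟨?_, ?_⟩, ?_, ?_⟩
  · linear_combination (-(y 2 * b 1 0 * q 0)) * h
  · linear_combination (-(q 2 * gg 1)) * h
  · linear_combination (-(y 2 * b 1 0 * q 1)) * h
  · linear_combination (-(q 3 * gg 1)) * h
  · ring
  · ring

/-- The operator `∇₀` of the unit, pulled back to the convolution space. -/
def nU (q : Fin 4 → Coord 2) : Fin 4 → Coord 2 :=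
  (fun i => lieDer 2 0 (q i)) + shear (-(2 * y 2 * gg 0)) *ᵥ q

theorem lie_xc0 (j : Fin 2) : lieDer 2 0 (xc j) = 2 * a 0 j * x 1 0 := by
  simp [xc, Derivation.leibniz, lie_a0, lie_x0]
  ring

theorem cN0_vec0 (q : Fin 4 → Coord 2) :
    cN0 (vec0 q) = vec0 (nU q) + (dN (vecB q) + vecB (kU *ᵥ q)) := by
  have h := dg_mul
  have h₁ : ∀ f, lieDer 2 0 (y 2 * b 0 0 * f) = y 2 * b 0 0 * lieDer 2 0 f := fun f => by
    simp [Derivation.leibniz, lie_y, lie_b0]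
  have h₂ : ∀ f, lieDer 2 0 (xc 1 * dg * f) = 2 * a 0 1 * x 1 0 * dg * f + xc 1 * dg * lieDer 2 0 f :=
    fun f => by
      simp [Derivation.leibniz, lie_dg, lie_xc0]
      ring
  rw [dN, cN0, kR_transpose, kos_transpose, vec0, map_literal]
  simp only [map_zero, map_neg, h₁, h₂]
  simp [vec0, vecB, nU, kU, kL, kos, sg, ctr₁, shear, Matrix.mulVec, dotProduct,
    Fin.sum_univ_four, e₂]
  refine ⟨?_, ⟨?_, ?_⟩, ?_⟩
  · linear_combination (-(2 * y 2 * b 0 0 * gg 1 * a 0 1 * q 1)) * h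
  · rw [show gg 0 = a 0 0 * b 0 0 + a 0 1 * b 1 0 from rfl]
    linear_combination (-(2 * y 2 * b 1 0 * a 0 1 * q 1)) * h
  · linear_combination (-(2 * a 0 1 * gg 1 * q 3)) * h
  · ring

theorem cN0_vec1 (q : Fin 4 → Coord 2) (hq : ∀ i, lieDer 2 1 (q i) = 0) :
    cN0 (vec1 q) = vec1 (nU q) + cN1 (vecB q) := by
  have h₁ : ∀ f, lieDer 2 0 (dg * f) = dg * lieDer 2 0 f := fun f => by
    simp [Derivation.leibniz, lie_dg]
  have h₂ : lieDer 2 1 (2 * a 0 1 * dg) = -(2 * a 0 0 * dg) := by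
    rw [deriv_mul_of_zero _ (lie_dg 1)]
    simp [Derivation.leibniz, lie_a1, deriv_two]
  rw [cN0, cN1, shear_transpose, kos_transpose, kos_transpose, vec1, vecB, map_literal, map_literal]
  simp only [map_zero, map_neg, h₁, deriv_mul_of_zero _ (hq _), h₂]
  simp [vec1, nU, ctr₁, ctr₂, shear, dotProduct, Fin.sum_univ_four]
  ring

theorem vec0_map_lie (q : Fin 4 → Coord 2) :
    (vec0 q).map (lieDer 2 2) = vec0 fun i => lieDer 2 2 (q i) := by
  rw [vec0, map_literal]
  simp [vec0, Derivation.leibniz, lie_y, lie_b2, lie_dg, xc, lie_a2, lie_x]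

theorem vec1_map_lie (q : Fin 4 → Coord 2) :
    (vec1 q).map (lieDer 2 2) = vec1 fun i => lieDer 2 2 (q i) := by
  rw [vec1, map_literal]
  simp [vec1, Derivation.leibniz, lie_dg]

theorem vecB_map_lie (q : Fin 4 → Coord 2) :
    (vecB q).map (lieDer 2 2) = vecB fun i => lieDer 2 2 (q i) := by
  rw [vecB, map_literal]
  simp [vecB, Derivation.leibniz, lie_dg, lie_a2, deriv_two]

theorem sg_vec0 (q : Fin 4 → Coord 2) : sg * vec0 q * sg = vec0 (sg *ᵥ q) := by
  simp [vec0, sg, Matrix.mulVec, dotProduct, Fin.sum_univ_four]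

theorem sg_vec1 (q : Fin 4 → Coord 2) : -(sg * vec1 q * sg) = vec1 (sg *ᵥ q) := by
  simp [vec1, sg, Matrix.mulVec, dotProduct, Fin.sum_univ_four, zero_eq_cons]

theorem sg_vecB (q : Fin 4 → Coord 2) : sg * vecB q * sg = -vecB (sg *ᵥ q) := by
  simp [vecB, sg, Matrix.mulVec, dotProduct, Fin.sum_univ_four, zero_eq_cons]

/-- The pullback of an element of the unit. -/
def hat (q : Fin 4 → Coord 1) : Fin 4 → Coord 2 := fun i => pull13 (q i)

/-- The torus action on the unit. -/
def twU (t : Torus 1) (q : Fin 4 → Coord 1) : Fin 4 → Coord 1 :=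
  fun i => ((kosWt (wTheta1 t) (wUnit2 t) i : ℂˣ) : ℂ) • torusAut 1 t (q i)

/-- The weight of the second generator of the unit, as a character of the torus of the convolution space. -/
def wU₂ (t : Torus 2) : ℂˣ := t.2.2 * t.1 2 1 * (t.1 0 0)⁻¹

/-- The coefficient `f` of a basis vector of weight `w` transforms as the coefficient of a basis vector of
weight `w'`. -/
theorem smul_torusAut_mul {t : Torus 2} {c w w' : ℂˣ} {f : Coord 2} (hf : Homog t c f) (h : w * c = w')
    (q : Coord 1) : (w : ℂ) • torusAut 2 t (f * pull13 q) =
      f * pull13 ((w' : ℂ) • torusAut 1 (tor13 t) q) := by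
  rw [map_mul, hf, torus_pull13, map_smul, smul_mul_assoc, smul_smul, ← Units.val_mul, h, mul_smul_comm]

theorem tM_literal (t : Torus 2) (r₀ r₁ r₂ r₃ s₀ s₁ s₂ s₃ : Coord 2) :
    tM t !![r₀, 0, r₁, 0; r₂, 0, r₃, 0; s₀, 0, s₁, 0; s₂, 0, s₃, 0] =
      !![(wgen t : ℂ) • torusAut 2 t r₀, 0, ((wθ₄ t * wia t * wgen t : ℂˣ) : ℂ) • torusAut 2 t r₁, 0;
        ((wθ₁ t * wgen t : ℂˣ) : ℂ) • torusAut 2 t r₂, 0,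
          ((wθ₁ t * (wθ₄ t * wia t) * wgen t : ℂˣ) : ℂ) • torusAut 2 t r₃, 0;
        ((wθ₂ t * wgen t : ℂˣ) : ℂ) • torusAut 2 t s₀, 0,
          ((wθ₂ t * (wθ₄ t * wia t) * wgen t : ℂˣ) : ℂ) • torusAut 2 t s₁, 0;
        ((wθ₁ t * wθ₂ t * wgen t : ℂˣ) : ℂ) • torusAut 2 t s₂, 0,
          ((wθ₁ t * wθ₂ t * (wθ₄ t * wia t) * wgen t : ℂˣ) : ℂ) • torusAut 2 t s₃, 0] := by
  ext i j
  fin_cases i <;> fin_cases j <;> simp [tM, wNew, kosWt]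

theorem hat_twU (t : Torus 2) (q : Fin 4 → Coord 1) : hat (twU (tor13 t) q) =
    ![pull13 (((1 : ℂˣ) : ℂ) • torusAut 1 (tor13 t) (q 0)),
      pull13 ((wθ₁ t : ℂ) • torusAut 1 (tor13 t) (q 1)),
      pull13 ((wU₂ t : ℂ) • torusAut 1 (tor13 t) (q 2)),
      pull13 (((wθ₁ t * wU₂ t : ℂˣ) : ℂ) • torusAut 1 (tor13 t) (q 3))] := by
  ext i
  fin_cases i <;> rfl

theorem tM_vec0 (t : Torus 2) (q : Fin 4 → Coord 1) :
    tM t (vec0 (hat q)) = vec0 (hat (twU (tor13 t) q)) := by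
  have h0 := (homog_y t 2).mul (homog_b t 0 0)
  have h1 := ((homog_xc t 1).mul ((homog_da t).mul (homog_db t))).neg
  have h2 : Homog t 1 1 := by rw [Homog, map_one, Units.val_one, one_smul]
  have e : vec0 (hat q) = !![y 2 * b 0 0 * pull13 (q 0), 0, 0, 0; y 2 * b 0 0 * pull13 (q 1), 0, 0, 0;
      1 * pull13 (q 2), 0, -(xc 1 * (da * db)) * pull13 (q 0), 0;
      1 * pull13 (q 3), 0, -(xc 1 * (da * db)) * pull13 (q 1), 0] := by
    simp only [one_mul, neg_mul]
    rfl
  rw [e, tM_literal, hat_twU, smul_torusAut_mul (w' := 1) h0, smul_torusAut_mul (w' := wθ₁ t) h0,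
    smul_torusAut_mul (w' := wU₂ t) h2, smul_torusAut_mul (w' := wθ₁ t * wU₂ t) h2,
    smul_torusAut_mul (w' := 1) h1, smul_torusAut_mul (w' := wθ₁ t) h1, map_zero, smul_zero, smul_zero,
    one_mul, one_mul, neg_mul, neg_mul]
  · rfl
  all_goals
    simp only [wgen, wθ₁, wθ₂, wθ₄, wia, wU₂]
    ext
    push_cast
    field_simp

theorem tM_vec1 (t : Torus 2) (q : Fin 4 → Coord 1) :
    ((root 2 1 t * (chiT 2 t)⁻¹ : ℂˣ) : ℂ) • tM t (vec1 (hat q)) = vec1 (hat (twU (tor13 t) q)) := by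
  have h1 := (homog_da t).mul (homog_db t)
  have e : vec1 (hat q) = !![0, 0, da * db * pull13 (q 0), 0; 0, 0, -(da * db) * pull13 (q 1), 0;
      0, 0, 0, 0; 0, 0, 0, 0] := by
    simp only [neg_mul]
    rfl
  have hr : root 2 1 t * (chiT 2 t)⁻¹ = t.1 1 0 * (t.1 1 1)⁻¹ * t.2.2⁻¹ := rfl
  rw [e, tM_literal, hat_twU]
  simp only [Matrix.smul_of, Matrix.smul_cons, smul_zero, Matrix.smul_empty, map_zero, smul_smul,
    ← Units.val_mul]
  rw [smul_torusAut_mul (w' := 1) h1, smul_torusAut_mul (w' := wθ₁ t) h1.neg, neg_mul]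
  · rfl
  all_goals
    simp only [hr, wgen, wθ₁, wθ₄, wia]
    ext
    push_cast
    field_simp

theorem tM_vecB (t : Torus 2) (q : Fin 4 → Coord 1) :
    vecB (hat (twU (tor13 t) q)) = ((root 2 0 t * (chiT 2 t)⁻¹ : ℂˣ) : ℂ) • tM t (vecB (hat q)) := by
  have h1 := ((((homog_two t).mul (homog_a t 0 1)).mul ((homog_da t).mul (homog_db t)))).neg
  have e : vecB (hat q) = !![0, 0, 0, 0; 0, 0, 0, 0; 0, 0, -(2 * a 0 1 * (da * db)) * pull13 (q 1), 0;
      0, 0, 0, 0] := by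
    simp only [neg_mul]
    rfl
  have hr : root 2 0 t * (chiT 2 t)⁻¹ = t.1 0 0 * (t.1 0 1)⁻¹ * t.2.2⁻¹ := rfl
  rw [e, tM_literal, hat_twU]
  simp only [Matrix.smul_of, Matrix.smul_cons, smul_zero, Matrix.smul_empty, map_zero, smul_smul,
    ← Units.val_mul]
  rw [smul_torusAut_mul (w' := wθ₁ t) h1, neg_mul]
  · rfl
  all_goals
    simp only [hr, wgen, wθ₁, wθ₂, wθ₄, wia]
    ext
    push_cast
    field_simp

end Con

namespace Con

/-! ### The morphism from the unit to the convolution -/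

theorem unit2_D_map : (unit2.D : Matrix (Fin 4) (Fin 4) (Coord 1)).map pull13 = kU := by
  refine (koszulD_map_pull12 _ _ _ _ pull13).trans ?_
  rw [kU, map_mul, map_mul, pull13_detInv, pull13_x, pull13_xt, pull13_y, pull13_gg]
  rfl

theorem hat_mulVec (K : Matrix (Fin 4) (Fin 4) (Coord 1)) (q : Fin 4 → Coord 1) :
    hat (K *ᵥ q) = K.map pull13 *ᵥ hat q := by
  ext i
  exact RingHom.map_mulVec (pull13 : Coord 1 →+* Coord 2) K q i

theorem hat_D (q : Fin 4 → Coord 1) : hat ((unit2.D : Matrix (Fin 4) (Fin 4) (Coord 1)) *ᵥ q) =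
    kU *ᵥ hat q := by
  rw [← unit2_D_map]
  exact hat_mulVec unit2.D q

theorem hat_nabla_zero (q : Fin 4 → Coord 1) :
    hat (cov 0 (unit2.A 0 : Matrix (Fin 4) (Fin 4) (Coord 1)) q) = nU (hat q) := by
  have h : (unit2.A 0 : Matrix (Fin 4) (Fin 4) (Coord 1)).map pull13 = shear (-(2 * y 2 * gg 0)) := by
    refine (koszulA_map _ pull13).trans ?_
    rw [map_neg, map_mul, map_mul, map_ofNat, pull13_y, pull13_gg]
    rfl
  rw [nU, ← h]
  refine Eq.trans ?_ (congrArg (_ + ·) (hat_mulVec (unit2.A 0) q))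
  ext i
  exact (map_add pull13 _ _).trans (congrArg (· + _) (lie_pull13_0 _).symm)

theorem hat_nabla_one (q : Fin 4 → Coord 1) :
    hat (cov 1 (unit2.A 1 : Matrix (Fin 4) (Fin 4) (Coord 1)) q) = fun i => lieDer 2 2 (hat q i) := by
  ext i
  change pull13 (lieDer 1 1 (q i) + ((0 : Matrix (Fin 4) (Fin 4) (Coord 1)) *ᵥ q) i) = lieDer 2 2 (pull13 (q i))
  rw [Matrix.zero_mulVec, Pi.zero_apply, add_zero, lie_pull13_2]

theorem hat_par (q : Fin 4 → Coord 1) :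
    hat ((signMat unit2.sgn : Matrix (Fin 4) (Fin 4) (Coord 1)) *ᵥ q) = sg *ᵥ hat q := by
  have h : (signMat unit2.sgn : Matrix (Fin 4) (Fin 4) (Coord 1)) = sg := signMat_eq_sg
  rw [h]
  ext i
  fin_cases i <;> simp [hat, sg, Matrix.mulVec, dotProduct, Fin.sum_univ_four]

theorem twU_eq (t : Torus 1) (q : Fin 4 → Coord 1) : tw unit2.wt t q = twU t q := by
  ext i
  fin_cases i <;> rfl

theorem twU_one (q : Fin 4 → Coord 1) : twU 1 q = q := by
  rw [← twU_eq, map_one]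
  rfl

theorem lie_hat (q : Fin 4 → Coord 1) (i : Fin 4) : lieDer 2 1 (hat q i) = 0 := lie_pull13_1 _

theorem tM_zero (t : Torus 2) : tM t 0 = 0 := by
  ext i j
  simp [tM]

theorem hat_add (p q : Fin 4 → Coord 1) : hat (p + q) = hat p + hat q := by
  ext i; exact map_add pull13 _ _
theorem hat_smul (f : Coord 1) (q : Fin 4 → Coord 1) : hat (f • q) = pull13 f • hat q := by
  ext i; exact map_mul pull13 _ _

theorem vec0_add (p q : Fin 4 → Coord 2) : vec0 (p + q) = vec0 p + vec0 q := by
  ext i j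
  fin_cases i <;> fin_cases j <;> simp [vec0] <;> ring
theorem vec0_smul (f : Coord 2) (q : Fin 4 → Coord 2) : vec0 (f • q) = f • vec0 q := by
  ext i j
  fin_cases i <;> fin_cases j <;> simp [vec0] <;> ring
theorem vec1_add (p q : Fin 4 → Coord 2) : vec1 (p + q) = vec1 p + vec1 q := by
  ext i j
  fin_cases i <;> fin_cases j <;> simp [vec1] <;> ring
theorem vec1_smul (f : Coord 2) (q : Fin 4 → Coord 2) : vec1 (f • q) = f • vec1 q := by
  ext i j
  fin_cases i <;> fin_cases j <;> simp [vec1] <;> ring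
theorem vecB_add (p q : Fin 4 → Coord 2) : vecB (p + q) = vecB p + vecB q := by
  ext i j
  fin_cases i <;> fin_cases j <;> simp [vecB]; ring
theorem vecB_smul (f : Coord 2) (q : Fin 4 → Coord 2) : vecB (f • q) = f • vecB q := by
  ext i j
  fin_cases i <;> fin_cases j <;> simp [vecB]; ring

/-- The underlying map of the morphism from the unit to the convolution, without the parts which involve
`e₀, e₁`. -/
def incl : (Fin 4 → Coord 1) →ₗ[Coord 1] NN.inv where
  toFun q := ⟨emb (vec0 (hat q)) (vec1 (hat q)), fun s => by
    rw [ρAmb_emb, tM_vec0, tM_vec1, tor13_mid, twU_one]⟩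
  map_add' p q := Subtype.ext ((congrArg (fun v => emb (vec0 v) (vec1 v)) (hat_add p q)).trans
    ((congrArg₂ emb (vec0_add _ _) (vec1_add _ _)).trans (emb_add _ _ _ _)))
  map_smul' f q := Subtype.ext ((congrArg (fun v => emb (vec0 v) (vec1 v)) (hat_smul f q)).trans
    ((congrArg₂ emb (vec0_smul _ _) (vec1_smul _ _)).trans (emb_smul _ _ _)))

/-- The coefficient of `e₀` in the morphism from the unit to the convolution. -/
def inclB : (Fin 4 → Coord 1) →ₗ[Coord 1] NN.inv where
  toFun q := ⟨emb (vecB (hat q)) 0, fun s => by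
    have h := tM_vecB (mid s) q
    rw [tor13_mid, twU_one, ConMF.root_mid 0 (by decide), one_mul, show chiT 2 (mid s) = 1 from rfl,
      inv_one, Units.val_one, one_smul] at h
    rw [ρAmb_emb, tM_zero, smul_zero, ← h]⟩
  map_add' p q := Subtype.ext ((congrArg (fun v => emb (vecB v) 0) (hat_add p q)).trans
    ((congrArg₂ emb (vecB_add _ _) (add_zero 0).symm).trans (emb_add _ _ _ _)))
  map_smul' f q := Subtype.ext ((congrArg (fun v => emb (vecB v) 0) (hat_smul f q)).trans
    ((congrArg₂ emb (vecB_smul _ _) (smul_zero (pull13 f)).symm).trans (emb_smul _ _ _)))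

theorem dN_zero : dN 0 = 0 := by
  simp [dN]

theorem emb_neg (M S : Matrix (Fin 4) (Fin 4) (Coord 2)) : emb (-M) (-S) = -emb M S := by
  rw [← zero_sub M, ← zero_sub S, emb_sub, emb_zero, zero_sub]

theorem csmul_emb (c : ℂˣ) (M S : Matrix (Fin 4) (Fin 4) (Coord 2)) :
    csmul c (emb M S) = emb ((c : ℂ) • M) ((c : ℂ) • S) := by
  rw [csmul, ← emb_smul, AlgHom.commutes, algebraMap_smul, algebraMap_smul]

theorem nabla_zero_incl (q : Fin 4 → Coord 1) :
    emb (cN0 (vec0 (hat q))) (cN0 (vec1 (hat q))) =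
      emb (vec0 (nU (hat q))) (vec1 (nU (hat q))) +
        (emb (dN (vecB (hat q))) (cN1 (vecB (hat q)) - dN 0) + emb (vecB (kU *ᵥ hat q)) 0) := by
  rw [cN0_vec0, cN0_vec1 _ (lie_hat q), dN_zero, sub_zero, ← emb_add, ← emb_add, add_zero]

theorem inclB_equivariant (t : Torus 1) (q : Fin 4 → Coord 1) :
    emb (vecB (hat (twU t q))) 0 = csmul (root 1 0 t * (chiT 1 t)⁻¹)
      (emb (tM (outer t) (vecB (hat q))) (((root 2 1 (outer t) * (chiT 2 (outer t))⁻¹ : ℂˣ) : ℂ) •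
        tM (outer t) 0)) := by
  have h := tM_vecB (outer t) q
  rw [tor13_outer] at h
  rw [tM_zero, smul_zero, csmul_emb, h, smul_zero]
  rfl

theorem exists_isHom : ∃ i : unit2.toWMF.Tot →ₗ[Coord 1] (conv Cplus Cminus).Tot,
    WMF.IsHom unit2.toWMF (conv Cplus Cminus) i ∧ ∀ q, (i (q, 0, 0, 0)).1 = incl q := by
  refine WMF.isHom_of_components (conv Cplus Cminus) unit2.toWMF incl inclB rfl
    (Matrix.mulVecLin_zero (R := Coord 1) (m := Fin 4) (n := Fin 4)) ?_ ?_ ?_ ?_ ?_ ?_ ?_ ?_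
  · intro (q : Fin 4 → Coord 1)
    apply Subtype.ext
    refine (dAmb_emb (vec0 (hat q)) (vec1 (hat q))).trans ?_
    rw [dN_vec0, cN1_vec0 _ (lie_hat q)]
    exact congrArg (fun v => emb (vec0 v) (vec1 v)) (hat_D q).symm
  · intro (q : Fin 4 → Coord 1)
    apply Subtype.ext
    refine ((nablaAmb_zero_emb (vec0 (hat q)) (vec1 (hat q))).trans (nabla_zero_incl q)).trans ?_
    refine Eq.trans ?_ (congrArg (fun v : Amb NN.I => (incl (unit2.toWMF.nabla 0 q)).1 +
      (v + (inclB (unit2.toWMF.D q)).1)) (dAmb_emb (vecB (hat q)) 0).symm)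
    exact congrArg₂ (fun v w => emb (vec0 v) (vec1 v) + (emb (dN (vecB (hat q)))
      (cN1 (vecB (hat q)) - dN 0) + emb (vecB w) 0)) (hat_nabla_zero q).symm (hat_D q).symm
  · intro (q : Fin 4 → Coord 1)
    apply Subtype.ext
    refine (nablaAmb_one_emb (vec0 (hat q)) (vec1 (hat q))).trans ?_
    rw [vec0_map_lie, vec1_map_lie]
    exact congrArg (fun v => emb (vec0 v) (vec1 v)) (hat_nabla_one q).symm
  · intro (q : Fin 4 → Coord 1)
    apply Subtype.ext
    refine (nablaAmb_one_emb (vecB (hat q)) 0).trans ?_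
    rw [vecB_map_lie, Matrix.map_zero _ (map_zero _)]
    exact congrArg (fun v => emb (vecB v) 0) (hat_nabla_one q).symm
  · intro (q : Fin 4 → Coord 1)
    apply Subtype.ext
    refine (parAmb_emb (vec0 (hat q)) (vec1 (hat q))).trans ?_
    rw [sg_vec0, sg_vec1]
    exact congrArg (fun v => emb (vec0 v) (vec1 v)) (hat_par q).symm
  · intro (q : Fin 4 → Coord 1)
    apply Subtype.ext
    refine (parAmb_emb (vecB (hat q)) 0).trans ?_
    rw [sg_vecB, mul_zero, zero_mul, emb_neg]
    refine Eq.trans ?_ (congrArg Neg.neg (show (emb (vecB (hat ((signMat unit2.sgn :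
      Matrix (Fin 4) (Fin 4) (Coord 1)) *ᵥ q))) 0 : Amb NN.I) = (inclB (unit2.toWMF.par q)).1 from rfl))
    exact congrArg (fun v => -emb (vecB v) 0) (hat_par q).symm
  · intro t (q : Fin 4 → Coord 1)
    apply Subtype.ext
    refine (ρAmb_emb (outer t) (vec0 (hat q)) (vec1 (hat q))).trans ?_
    rw [tM_vec0, tM_vec1, tor13_outer]
    exact congrArg (fun v => emb (vec0 (hat v)) (vec1 (hat v))) (twU_eq t q).symm
  · intro t (q : Fin 4 → Coord 1)
    apply Subtype.ext
    refine (congrArg (fun v => emb (vecB (hat v)) 0) (twU_eq t q)).trans ((inclB_equivariant t q).trans ?_)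
    exact congrArg (csmul (root 1 0 t * (chiT 1 t)⁻¹)) (ρAmb_emb (outer t) (vecB (hat q)) 0).symm

end Con

namespace Con

/-! ### Invariants of the middle torus in the adapted basis -/

/-- `f` has weight `(α, β)` for the middle torus. -/
def HasMid (α β : ℤ) (f : Coord 2) : Prop := ∀ s, Homog (mid s) (s 0 ^ α * s 1 ^ β) f

/-- The first component of the weight `(midα i j, midβ j)` which the coefficient of the basis vector `(i, j)` has
in an element invariant under the middle torus. -/
def midα (i j : Fin 4) : ℤ := ![1, 0, 1, 0] j - ![0, 0, 1, 1] i
/-- The second component of the weight of the coefficient of the basis vector `(i, j)`. -/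
def midβ (j : Fin 4) : ℤ := ![0, 1, -1, 0] j

theorem wNew_mid (s : Fin 2 → ℂˣ) (i j : Fin 4) :
    wNew (mid s) (i, j) = (s 0 ^ midα i j * s 1 ^ midβ j)⁻¹ := by
  have h₁ : wθ₁ (mid s) = 1 := by simp [wθ₁, mid]
  have h₂ : wθ₂ (mid s) = s 0 := by simp [wθ₂, mid]
  have h₃ : wθ₃ (mid s) = s 0 * (s 1)⁻¹ := by simp [wθ₃, mid]
  have h₄ : wθ₄ (mid s) * wia (mid s) = s 1 := by simp [wθ₄, wia, mid]
  have h₅ : wgen (mid s) = (s 0)⁻¹ := by simp [wgen, mid]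
  rw [wNew, h₁, h₂, h₃, h₄, h₅]
  fin_cases i <;> fin_cases j <;> simp [kosWt, midα, midβ, mul_comm]

theorem homog_inv_iff {t : Torus 2} {c : ℂˣ} {f : Coord 2} :
    (((c⁻¹ : ℂˣ) : ℂ)) • torusAut 2 t f = f ↔ Homog t c f := by
  rw [Homog]
  constructor
  · intro h
    conv_rhs => rw [← h, smul_smul, ← Units.val_mul, mul_inv_cancel, Units.val_one, one_smul]
  · intro h
    rw [h, smul_smul, ← Units.val_mul, inv_mul_cancel, Units.val_one, one_smul]

theorem emb_mem_inv {M S : Matrix (Fin 4) (Fin 4) (Coord 2)} : (emb M S : Amb NN.I) ∈ NN.inv ↔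
    (∀ i j, HasMid (midα i j) (midβ j) (M i j)) ∧
      ∀ i j, HasMid (midα i j - 1) (midβ j + 1) (S i j) := by
  have hM : ∀ s i j, tM (mid s) M i j = M i j ↔
      Homog (mid s) (s 0 ^ midα i j * s 1 ^ midβ j) (M i j) := by
    intro s i j
    rw [← homog_inv_iff, ← wNew_mid]
    rfl
  have hS : ∀ s i j, (((root 2 1 (mid s) * (chiT 2 (mid s))⁻¹ : ℂˣ) : ℂ) • tM (mid s) S) i j = S i j ↔
      Homog (mid s) (s 0 ^ (midα i j - 1) * s 1 ^ (midβ j + 1)) (S i j) := by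
    intro s i j
    rw [← homog_inv_iff]
    have : (s 0 ^ (midα i j - 1) * s 1 ^ (midβ j + 1))⁻¹ =
        root 2 1 (mid s) * (chiT 2 (mid s))⁻¹ * wNew (mid s) (i, j) := by
      rw [wNew_mid, _root_.zpow_sub_one, _root_.zpow_add_one,
        show root 2 1 (mid s) = s 0 * (s 1)⁻¹ from rfl, show chiT 2 (mid s) = 1 from rfl]
      ext
      push_cast
      field_simp
    rw [this, Units.val_mul _ (wNew _ _), mul_smul]
    rfl
  have key : (emb M S : Amb NN.I) ∈ NN.inv ↔ ∀ s, tM (mid s) M = M ∧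
      ((root 2 1 (mid s) * (chiT 2 (mid s))⁻¹ : ℂˣ) : ℂ) • tM (mid s) S = S := by
    refine forall_congr' fun s => ⟨fun h => ?_, fun h => ?_⟩
    · exact emb_injective ((ρAmb_emb (mid s) M S).symm.trans h)
    · exact (ρAmb_emb (mid s) M S).trans (congrArg₂ emb h.1 h.2)
  rw [key]
  constructor
  · intro h
    exact ⟨fun i j s => (hM s i j).1 (congrFun (congrFun (h s).1 i) j),
      fun i j s => (hS s i j).1 (congrFun (congrFun (h s).2 i) j)⟩
  · intro h s
    exact ⟨by ext i j; exact (hM s i j).2 (h.1 i j s), by ext i j; exact (hS s i j).2 (h.2 i j s)⟩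

theorem homog_ib (t : Torus 2) : Homog t ((t.1 1 0 * t.1 1 1)⁻¹ * (t.1 2 0 * t.1 2 1)) ib := by
  rw [Homog, ← pull23_detInv, torus_pull23, torusAut_detInv, map_smul]
  rfl

theorem homog_yb (t : Torus 2) : Homog t (t.2.1 ^ 2 * t.2.2⁻¹ ^ 2 * t.1 1 0 * (t.1 1 1)⁻¹) yb := by
  rw [yb, pow_two (b 0 0)]
  refine (((homog_y t 2).mul ((homog_b t 0 0).mul (homog_b t 0 0))).mul (homog_ib t)).congr ?_
  ext
  push_cast
  field_simp

theorem τ_torusAut (t : Torus 2) (f : Coord 2) : τ (torusAut 2 t f) = torusAut 2 t (τ f) := by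
  suffices h : τ.comp (torusAut 2 t) = (torusAut 2 t).comp τ from DFunLike.congr_fun h f
  apply coord_hom_ext
  · intro i j
    have := homog_x t i j
    rw [Homog] at this
    simp [τ_x, this]
  · intro i j
    have := homog_a t i j
    rw [Homog] at this
    simp [τ_a, this]
  · intro i j
    have := homog_b t i j
    rw [Homog] at this
    simp [τ_b, this]
  · intro i
    have h := homog_y t i
    have h' := homog_yb t
    rw [Homog] at h h'
    fin_cases i
    · simp only [Fin.zero_eta] at h ⊢
      simp [τ_y0, h]
    · simp only [Fin.mk_one] at h ⊢
      simp [τ_y1, h, h']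
    · simp only [Fin.reduceFinMk] at h ⊢
      simp [τ_y2, h]

theorem HasMid.τ {α β : ℤ} {f : Coord 2} (hf : HasMid α β f) : τ f ∈ wtSp α β :=
  ⟨τ_τ f, fun s => by rw [← τ_torusAut, hf s, map_smul]⟩

theorem homog_z (s : Fin 2 → ℂˣ) : Homog (mid s) (s 0 * (s 1)⁻¹) z := by
  have h := (homog_y (mid s) 1).sub (homog_yb (mid s))
  exact h.congr (by simp [mid])

theorem HasMid.quot {α β : ℤ} {f : Coord 2} (hf : HasMid α β f) : HasMid (α - 1) (β + 1) (quot f) := by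
  intro s
  rw [← homog_inv_iff]
  have h1 : f = Con.τ f + z * ((((s 0 ^ (α - 1) * s 1 ^ (β + 1))⁻¹ : ℂˣ) : ℂ) •
      torusAut 2 (mid s) (Con.quot f)) := by
    have h := congrArg (fun v => (((s 0 ^ α * s 1 ^ β)⁻¹ : ℂˣ) : ℂ) • torusAut 2 (mid s) v) (eq_τ_add f)
    simp only [map_add, map_mul, smul_add] at h
    rw [homog_inv_iff.2 (hf s), homog_inv_iff.2 (hf.τ.2 s), homog_z s, smul_mul_assoc, smul_smul,
      ← Units.val_mul, ← mul_smul_comm] at h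
    refine h.trans ?_
    congr 4
    rw [_root_.zpow_sub_one, _root_.zpow_add_one]
    ext
    push_cast
    field_simp
  exact (quot_unique (τ_τ f) h1).2.symm

theorem HasMid.neg {α β : ℤ} {f : Coord 2} (hf : HasMid α β f) : HasMid α β (-f) :=
  fun s => (hf s).neg

theorem hasMid_zero (α β : ℤ) : HasMid α β 0 := fun s => by rw [Homog, map_zero, smul_zero]

end Con

namespace Con

/-! ### The complement of the unit -/

/-- The signs of the parity operator. -/
def eps : Fin 4 → Coord 2 := ![1, -1, -1, 1]

theorem eps_mul_eps (i : Fin 4) (f : Coord 2) : eps i * (eps i * f) = f := by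
  fin_cases i <;> simp [eps]

theorem τ_eps (i : Fin 4) : τ (eps i) = eps i := by
  fin_cases i <;> simp [eps]

theorem HasMid.eps_mul {α β : ℤ} {f : Coord 2} (hf : HasMid α β f) (i : Fin 4) :
    HasMid α β (eps i * f) := by
  fin_cases i
  · simpa [eps] using hf
  · simpa [eps] using hf.neg
  · simpa [eps] using hf.neg
  · simpa [eps] using hf

theorem midα_one (i : Fin 4) : midα i 1 = midα i 0 - 1 := by fin_cases i <;> rfl
theorem midα_three (i : Fin 4) : midα i 3 = midα i 2 - 1 := by fin_cases i <;> rfl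

theorem sg_mul (M : Matrix (Fin 4) (Fin 4) (Coord 2)) (i j : Fin 4) :
    (sg * M : Matrix (Fin 4) (Fin 4) (Coord 2)) i j = eps i * M i j := by
  rw [Matrix.mul_apply, Fin.sum_univ_four]
  fin_cases i <;> simp [sg, eps]

theorem mul_sg (M : Matrix (Fin 4) (Fin 4) (Coord 2)) (i j : Fin 4) :
    (M * sg : Matrix (Fin 4) (Fin 4) (Coord 2)) i j = eps j * M i j := by
  rw [Matrix.mul_apply, Fin.sum_univ_four]
  fin_cases j <;> simp [sg, eps]

theorem dN_col_zero (M : Matrix (Fin 4) (Fin 4) (Coord 2)) (i : Fin 4) :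
    dN M i 0 = (kL * M) i 0 + eps i * (z * M i 1 + ia * e₂ * M i 2) := by
  rw [dN, kR_transpose, Matrix.add_apply]
  congr 1
  rw [Matrix.mul_assoc, sg_mul, Matrix.mul_apply, Fin.sum_univ_four]
  congr 1
  simp
  ring

theorem dN_col_two (M : Matrix (Fin 4) (Fin 4) (Coord 2)) (i : Fin 4) :
    dN M i 2 = (kL * M) i 2 + eps i * (gg 1 * xc 1 * M i 0 + z * M i 3) := by
  rw [dN, kR_transpose, Matrix.add_apply]
  congr 1
  rw [Matrix.mul_assoc, sg_mul, Matrix.mul_apply, Fin.sum_univ_four]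
  congr 1
  simp
  ring

theorem cN1_col_zero (M : Matrix (Fin 4) (Fin 4) (Coord 2)) (i : Fin 4) :
    cN1 M i 0 = E (M i 0) := by
  rw [cN1, shear_transpose, kos_transpose]
  simp [Matrix.mul_apply, Fin.sum_univ_four]

theorem cN1_col_two (M : Matrix (Fin 4) (Fin 4) (Coord 2)) (i : Fin 4) :
    cN1 M i 2 = E (M i 2) - 2 * b 0 0 * da * M i 1 + gg 1 * (ctr₂ * M : Matrix (Fin 4) (Fin 4) (Coord 2)) i 0 := by
  rw [cN1, shear_transpose, kos_transpose]
  simp [Matrix.mul_apply, Fin.sum_univ_four]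
  ring

theorem mul_col_zero (K M : Matrix (Fin 4) (Fin 4) (Coord 2)) {j : Fin 4} (h : ∀ i, M i j = 0) (i : Fin 4) :
    (K * M) i j = 0 := by
  simp [Matrix.mul_apply, h]

theorem τ_gg (i : Fin 2) : τ (gg i) = gg i := by simp [gg, τ_a, τ_b]
theorem τ_xc (i : Fin 2) : τ (xc i) = xc i := by simp [xc, τ_a, τ_x]
theorem τ_e₂ : τ e₂ = e₂ := by simp [e₂, τ_ib, τ_b, τ_y2]
theorem τ_dg : τ dg = dg := by simp [dg, da, db, τ_a, τ_b]

theorem τ_kL (i j : Fin 4) : τ (kL i j) = kL i j := by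
  fin_cases i <;> fin_cases j <;>
    simp [kL, kos, τ_x, τ_xc, τ_pull13, τ_y2, τ_ia, τ_ib, τ_b, τ_gg]

theorem τ_kL_mul {M : Matrix (Fin 4) (Fin 4) (Coord 2)} {j : Fin 4} (h : ∀ i, τ (M i j) = M i j)
    (i : Fin 4) : τ ((kL * M) i j) = (kL * M) i j := by
  simp [Matrix.mul_apply, τ_kL, h]

theorem τ_vec0 (q : Fin 4 → Coord 1) (i j : Fin 4) : τ (vec0 (hat q) i j) = vec0 (hat q) i j := by
  fin_cases i <;> fin_cases j <;> simp [vec0, hat, τ_y2, τ_b, τ_pull13, τ_xc, τ_dg]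

theorem τ_vec1 (q : Fin 4 → Coord 1) (i j : Fin 4) : τ (vec1 (hat q) i j) = vec1 (hat q) i j := by
  fin_cases i <;> fin_cases j <;> simp [vec1, hat, τ_pull13, τ_dg]

/-- The condition that `M + e₁ S` lies in the complement of the unit.

The differential sends `M i 1`, `M i 3`, `S i 1`, `S i 3`, multiplied by `z`, to the entries to the left of them,
and `M i 0`, `M i 2` by `E` to `S i 0`, `S i 2`. Accordingly the targets `S i 0`, `S i 2` vanish on the
complement, `M i 0`, `M i 2` are restricted to functions which do not depend on `y₂`, and the invariant functions
among the possible values of `M 2 0`, `M 3 0`, which belong to the unit, are excluded. -/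
structure IsComp (M S : Matrix (Fin 4) (Fin 4) (Coord 2)) : Prop where
  snd_zero : ∀ i, S i 0 = 0
  snd_two : ∀ i, S i 2 = 0
  τ_zero : ∀ i, τ (M i 0) = M i 0
  τ_two : ∀ i, τ (M i 2) = M i 2
  exists_E : ∀ i, i = 2 ∨ i = 3 → ∃ v ∈ wtSp 1 (-1), M i 0 = E v

theorem torusAut_outer_mem (t : Torus 1) {α β : ℤ} {f : Coord 2} (hf : f ∈ wtSp α β) :
    torusAut 2 (outer t) f ∈ wtSp α β := by
  refine ⟨by rw [τ_torusAut, hf.1], fun s => ?_⟩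
  rw [← torusAut_mul, mul_comm, torusAut_mul, hf.2, map_smul]

theorem IsComp.add {M S M' S' : Matrix (Fin 4) (Fin 4) (Coord 2)} (h : IsComp M S) (h' : IsComp M' S') :
    IsComp (M + M') (S + S') where
  snd_zero i := by rw [Matrix.add_apply, h.snd_zero, h'.snd_zero, add_zero]
  snd_two i := by rw [Matrix.add_apply, h.snd_two, h'.snd_two, add_zero]
  τ_zero i := by rw [Matrix.add_apply, map_add, h.τ_zero, h'.τ_zero]
  τ_two i := by rw [Matrix.add_apply, map_add, h.τ_two, h'.τ_two]
  exists_E i hi := by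
    obtain ⟨v, hv, e⟩ := h.exists_E i hi
    obtain ⟨v', hv', e'⟩ := h'.exists_E i hi
    exact ⟨v + v', add_mem hv hv', by rw [Matrix.add_apply, e, e', map_add]⟩

theorem isComp_zero : IsComp 0 0 where
  snd_zero _ := rfl
  snd_two _ := rfl
  τ_zero _ := map_zero τ
  τ_two _ := map_zero τ
  exists_E _ _ := ⟨0, zero_mem _, (map_zero E).symm⟩

theorem IsComp.smul {M S : Matrix (Fin 4) (Fin 4) (Coord 2)} (h : IsComp M S) (f : Coord 1) :
    IsComp (pull13 f • M) (pull13 f • S) where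
  snd_zero i := by rw [Matrix.smul_apply, h.snd_zero, smul_zero]
  snd_two i := by rw [Matrix.smul_apply, h.snd_two, smul_zero]
  τ_zero i := by rw [Matrix.smul_apply, smul_eq_mul, map_mul, h.τ_zero, τ_pull13]
  τ_two i := by rw [Matrix.smul_apply, smul_eq_mul, map_mul, h.τ_two, τ_pull13]
  exists_E i hi := by
    obtain ⟨v, hv, e⟩ := h.exists_E i hi
    refine ⟨v * pull13 f, ⟨by rw [map_mul, hv.1, τ_pull13], fun s => ?_⟩, ?_⟩
    · rw [map_mul, hv.2, (pull13_mem f).2, smul_mul_smul_comm]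
      simp
    · rw [Matrix.smul_apply, e, deriv_mul_of_zero _ (lie_pull13_1 f), smul_eq_mul, mul_comm]

/-- Stability of the complement under an operation which applies to every entry a linear map preserving the
functions without `y₂` and the image of `E`, and multiplies the result by a scalar. -/
theorem IsComp.map {M S M' S' : Matrix (Fin 4) (Fin 4) (Coord 2)} (h : IsComp M S)
    (φ : Coord 2 →ₗ[ℂ] Coord 2) (hτ : ∀ f, τ f = f → τ (φ f) = φ f)
    (hE : ∀ v ∈ wtSp 1 (-1), ∃ w ∈ wtSp 1 (-1), φ (E v) = E w) {c d : Fin 4 → Fin 4 → ℂ}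
    (hM : ∀ i j, M' i j = c i j • φ (M i j)) (hS : ∀ i j, S' i j = d i j • φ (S i j)) :
    IsComp M' S' where
  snd_zero i := by rw [hS, h.snd_zero, map_zero, smul_zero]
  snd_two i := by rw [hS, h.snd_two, map_zero, smul_zero]
  τ_zero i := by rw [hM, map_smul, hτ _ (h.τ_zero i)]
  τ_two i := by rw [hM, map_smul, hτ _ (h.τ_two i)]
  exists_E i hi := by
    obtain ⟨v, hv, e⟩ := h.exists_E i hi
    obtain ⟨w, hw, e'⟩ := hE v hv
    exact ⟨c i 0 • w, Submodule.smul_mem _ _ hw, by rw [hM, e, e', Derivation.map_smul]⟩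

/-- The complement of the unit in the convolution. -/
def comp : Submodule (Coord 1) NN.inv where
  carrier := {n | ∃ M S, n.1 = emb M S ∧ IsComp M S}
  zero_mem' := ⟨0, 0, emb_zero.symm, isComp_zero⟩
  add_mem' := by
    rintro m n ⟨M, S, e, h⟩ ⟨M', S', e', h'⟩
    exact ⟨M + M', S + S', (congrArg₂ (· + ·) e e').trans (emb_add _ _ _ _).symm, h.add h'⟩
  smul_mem' := by
    rintro f n ⟨M, S, e, h⟩
    exact ⟨pull13 f • M, pull13 f • S, (congrArg (f • ·) e).trans (emb_smul _ _ _).symm, h.smul f⟩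

theorem par_mem_comp (n : NN.inv) (hn : n ∈ comp) : (conv Cplus Cminus).par n ∈ comp := by
  obtain ⟨M, S, e, h⟩ := hn
  refine ⟨sg * M * sg, -(sg * S * sg), (congrArg NN.parAmb e).trans (parAmb_emb M S), ?_⟩
  let ε : Fin 4 → ℂ := ![1, -1, -1, 1]
  have hs : ∀ (M : Matrix (Fin 4) (Fin 4) (Coord 2)) (i j : Fin 4),
      (sg * M * sg : Matrix (Fin 4) (Fin 4) (Coord 2)) i j = (ε i * ε j) • M i j := by
    intro M i j
    rw [mul_sg, sg_mul]
    fin_cases i <;> fin_cases j <;> simp [ε, eps]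
  refine h.map LinearMap.id (fun f hf => hf) (fun v hv => ⟨v, hv, rfl⟩) (c := fun i j => ε i * ε j)
    (d := fun i j => -(ε i * ε j)) (hs M) fun i j => ?_
  rw [Matrix.neg_apply, hs, neg_smul]
  rfl

theorem ρ_mem_comp (t : Torus 1) (n : NN.inv) (hn : n ∈ comp) : (conv Cplus Cminus).ρ t n ∈ comp := by
  obtain ⟨M, S, e, h⟩ := hn
  refine ⟨tM (outer t) M, ((root 2 1 (outer t) * (chiT 2 (outer t))⁻¹ : ℂˣ) : ℂ) • tM (outer t) S,
    (congrArg (NN.ρAmb (outer t)) e).trans (ρAmb_emb (outer t) M S), ?_⟩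
  refine h.map (torusAut 2 (outer t)).toLinearMap (fun f hf => ?_) (fun v hv => ?_)
    (c := fun i j => (wNew (outer t) (i, j) : ℂ))
    (d := fun i j => ((root 2 1 (outer t) * (chiT 2 (outer t))⁻¹ : ℂˣ) : ℂ) * wNew (outer t) (i, j))
    (fun i j => rfl) (fun i j => ?_)
  · change τ (torusAut 2 (outer t) f) = torusAut 2 (outer t) f
    rw [τ_torusAut, hf]
  · refine ⟨torusAut 2 (outer t) v, torusAut_outer_mem t hv, ?_⟩
    refine Eq.trans ?_ (lieDer_torusAut 1 (outer t) v).symm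
    simp [outer]
  · rw [mul_smul]
    rfl

end Con

namespace Con

/-! ### The convolution as the sum of the unit and a contractible part -/

/-- A function of the weight of `S i 0` is `E f`, where `f` is in the range allowed for elements of the
complement. -/
theorem exists_col_zero {i : Fin 4} {h : Coord 2} (hh : h ∈ wtSp (midα i 0 - 1) 1) :
    ∃ f ∈ wtSp (midα i 0) 0, h = E f ∧ (i = 2 ∨ i = 3 → ∃ v ∈ wtSp 1 (-1), f = E v) := by
  have low : h ∈ wtSp 0 1 → ∃ f ∈ wtSp 1 0, h = E f := fun hh => by
    simpa using exists_eq_E (by norm_num) hh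
  have high : h ∈ wtSp (-1) 1 → ∃ f ∈ wtSp 0 0, h = E f ∧ ∃ v ∈ wtSp 1 (-1), f = E v := fun hh => by
    obtain ⟨v, hv, e⟩ := exists_eq_E_E hh
    exact ⟨E v, by simpa using E_mem hv, e, v, hv, rfl⟩
  fin_cases i
  · obtain ⟨f, hf, e⟩ := low hh
    exact ⟨f, hf, e, fun h => absurd h (by decide)⟩
  · obtain ⟨f, hf, e⟩ := low hh
    exact ⟨f, hf, e, fun h => absurd h (by decide)⟩
  · obtain ⟨f, hf, e, h⟩ := high hh
    exact ⟨f, hf, e, fun _ => h⟩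
  · obtain ⟨f, hf, e, h⟩ := high hh
    exact ⟨f, hf, e, fun _ => h⟩

/-- A function of the weight of `S i 2` is the sum of an element of the image of `E` and, in the first two
rows, of a function on the target of `π₁₃`. -/
theorem exists_col_two {i : Fin 4} {h : Coord 2} (hh : h ∈ wtSp (midα i 2 - 1) 0) :
    ∃ p, ∃ f ∈ wtSp (midα i 2) (-1), h = pull13 p + E f ∧ (i = 2 ∨ i = 3 → p = 0) := by
  have high : h ∈ wtSp (-1) 0 → ∃ f ∈ wtSp 0 (-1), h = pull13 0 + E f := fun hh => by
    obtain ⟨f, hf, e⟩ := exists_eq_E (by norm_num) hh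
    exact ⟨f, hf, by rw [map_zero, zero_add, e]⟩
  fin_cases i
  · obtain ⟨p, f, hf, e⟩ := exists_eq_pull13_add hh
    exact ⟨p, f, hf, e, fun h => absurd h (by decide)⟩
  · obtain ⟨p, f, hf, e⟩ := exists_eq_pull13_add hh
    exact ⟨p, f, hf, e, fun h => absurd h (by decide)⟩
  · obtain ⟨f, hf, e⟩ := high hh
    exact ⟨0, f, hf, e, fun _ => rfl⟩
  · obtain ⟨f, hf, e⟩ := high hh
    exact ⟨0, f, hf, e, fun _ => rfl⟩

theorem sub_mem_inv {M S M' S' : Matrix (Fin 4) (Fin 4) (Coord 2)} (h : (emb M S : Amb NN.I) ∈ NN.inv)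
    (h' : (emb M' S' : Amb NN.I) ∈ NN.inv) :
    (emb (M - dN M') (S - (cN1 M' - dN S')) : Amb NN.I) ∈ NN.inv := by
  have h1 := sub_mem h (NN.dAmb_mem _ h')
  rwa [dAmb_emb, ← emb_sub] at h1

/-- Modulo the differentials of elements of the complement, the column `S i 0` vanishes, and the columns
`M i 0` and `M i 2` do not depend on `z`. -/
theorem exists_sub_col_zero {M S : Matrix (Fin 4) (Fin 4) (Coord 2)}
    (h : (emb M S : Amb NN.I) ∈ NN.inv) : ∃ M' S', IsComp M' S' ∧ (emb M' S' : Amb NN.I) ∈ NN.inv ∧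
      (∀ i, (S - (cN1 M' - dN S')) i 0 = 0) ∧ (∀ i, τ ((M - dN M') i 0) = (M - dN M') i 0) ∧
      ∀ i, τ ((M - dN M') i 2) = (M - dN M') i 2 := by
  obtain ⟨hM, hS⟩ := emb_mem_inv.1 h
  choose f hf he hv using fun i => exists_col_zero (hS i 0).τ
  let M' : Matrix (Fin 4) (Fin 4) (Coord 2) :=
    Matrix.of fun i => ![f i, eps i * quot (M i 0), 0, eps i * quot (M i 2)]
  let S' : Matrix (Fin 4) (Fin 4) (Coord 2) := Matrix.of fun i => ![0, -(eps i * quot (S i 0)), 0, 0]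
  have m0 : ∀ i, M' i 0 = f i := fun i => rfl
  have m1 : ∀ i, M' i 1 = eps i * quot (M i 0) := fun i => rfl
  have m2 : ∀ i, M' i 2 = 0 := fun i => rfl
  have m3 : ∀ i, M' i 3 = eps i * quot (M i 2) := fun i => rfl
  have s0 : ∀ i, S' i 0 = 0 := fun i => rfl
  have s1 : ∀ i, S' i 1 = -(eps i * quot (S i 0)) := fun i => rfl
  have s2 : ∀ i, S' i 2 = 0 := fun i => rfl
  have s3 : ∀ i, S' i 3 = 0 := fun i => rfl
  refine ⟨M', S', ⟨s0, s2, fun i => by rw [m0, (hf i).1], fun i => by rw [m2, map_zero],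
    fun i hi => hv i hi⟩, emb_mem_inv.2 ⟨fun i j => ?_, fun i j => ?_⟩, fun i => ?_, fun i => ?_,
    fun i => ?_⟩
  · fin_cases j
    · exact (hf i).2
    · have := ((hM i 0).quot).eps_mul i
      rw [← midα_one] at this
      exact this
    · exact hasMid_zero _ _
    · have := ((hM i 2).quot).eps_mul i
      rw [← midα_three] at this
      exact this
  · fin_cases j
    · exact hasMid_zero _ _
    · have := ((hS i 0).quot).eps_mul i |>.neg
      rw [← midα_one] at this
      exact this
    · exact hasMid_zero _ _
    · exact hasMid_zero _ _
  · rw [Matrix.sub_apply, Matrix.sub_apply, cN1_col_zero, dN_col_zero, mul_col_zero _ _ s0, m0, s1, s2,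
      ← he]
    have := eq_τ_add (S i 0)
    linear_combination this - z * eps_mul_eps i (quot (S i 0))
  · have e : (M - dN M') i 0 = τ (M i 0) - (kL * M' : Matrix (Fin 4) (Fin 4) (Coord 2)) i 0 := by
      rw [Matrix.sub_apply, dN_col_zero, m1, m2]
      linear_combination eq_τ_add (M i 0) - z * eps_mul_eps i (quot (M i 0))
    rw [e, map_sub, τ_τ, τ_kL_mul fun i => by rw [m0, (hf i).1]]
  · have e : (M - dN M') i 2 = τ (M i 2) - eps i * (gg 1 * xc 1 * f i) := by
      rw [Matrix.sub_apply, dN_col_two, m0, m3, mul_col_zero _ _ m2]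
      linear_combination eq_τ_add (M i 2) - z * eps_mul_eps i (quot (M i 2))
    rw [e]
    simp only [map_sub, map_mul, τ_τ, τ_eps, τ_gg, τ_xc, (hf i).1]

theorem dg_mul_pull13 (p : Coord 1) : dg * pull13 (detInv * p) = pull13 p := by
  rw [map_mul, pull13_detInv]
  linear_combination pull13 p * dg_mul

/-- Modulo the unit and the differentials of elements of the complement, the columns `S i 0` and `S i 2`
vanish, hence the remainder lies in the complement. -/
theorem exists_isComp {M S : Matrix (Fin 4) (Fin 4) (Coord 2)}
    (h : (emb M S : Amb NN.I) ∈ NN.inv) (h0 : ∀ i, S i 0 = 0) (hτ0 : ∀ i, τ (M i 0) = M i 0)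
    (hτ2 : ∀ i, τ (M i 2) = M i 2) : ∃ (q : Fin 4 → Coord 1) (M' S' : _), IsComp M' S' ∧
      (emb M' S' : Amb NN.I) ∈ NN.inv ∧
      IsComp (M - dN M' - vec0 (hat q)) (S - (cN1 M' - dN S') - vec1 (hat q)) := by
  obtain ⟨hM, hS⟩ := emb_mem_inv.1 h
  choose p f hf he hp using fun i => exists_col_two (hS i 2).τ
  let M' : Matrix (Fin 4) (Fin 4) (Coord 2) := Matrix.of fun i => ![0, 0, f i, 0]
  let S' : Matrix (Fin 4) (Fin 4) (Coord 2) := Matrix.of fun i => ![0, 0, 0, -(eps i * quot (S i 2))]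
  have m0 : ∀ i, M' i 0 = 0 := fun i => rfl
  have m1 : ∀ i, M' i 1 = 0 := fun i => rfl
  have m2 : ∀ i, M' i 2 = f i := fun i => rfl
  have m3 : ∀ i, M' i 3 = 0 := fun i => rfl
  have s0 : ∀ i, S' i 0 = 0 := fun i => rfl
  have s1 : ∀ i, S' i 1 = 0 := fun i => rfl
  have s2 : ∀ i, S' i 2 = 0 := fun i => rfl
  have s3 : ∀ i, S' i 3 = -(eps i * quot (S i 2)) := fun i => rfl
  have hc : IsComp M' S' := ⟨s0, s2, fun i => by rw [m0, map_zero], fun i => by rw [m2, (hf i).1],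
    fun i _ => ⟨0, zero_mem _, by rw [m0, map_zero]⟩⟩
  have hi : (emb M' S' : Amb NN.I) ∈ NN.inv := by
    refine emb_mem_inv.2 ⟨fun i j => ?_, fun i j => ?_⟩
    · fin_cases j
      · exact hasMid_zero _ _
      · exact hasMid_zero _ _
      · exact (hf i).2
      · exact hasMid_zero _ _
    · fin_cases j
      · exact hasMid_zero _ _
      · exact hasMid_zero _ _
      · exact hasMid_zero _ _
      · have := ((hS i 2).quot).eps_mul i |>.neg
        rw [← midα_three] at this
        exact this
  obtain ⟨hM', -⟩ := emb_mem_inv.1 (sub_mem_inv h hi)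
  have t0 : ∀ i, τ ((M - dN M') i 0) = (M - dN M') i 0 := fun i => by
    rw [Matrix.sub_apply, dN_col_zero, m1, m2, mul_col_zero _ _ m0]
    simp only [map_sub, map_mul, τ_eps, τ_ia, τ_e₂, (hf i).1, hτ0, mul_zero, zero_add]
  have t2 : ∀ i, τ ((M - dN M') i 2) = (M - dN M') i 2 := fun i => by
    rw [Matrix.sub_apply, dN_col_two, m0, m3, mul_zero, mul_zero, add_zero, mul_zero, add_zero, map_sub,
      hτ2, τ_kL_mul fun i => by rw [m2, (hf i).1]]
  obtain ⟨q₂, v₂, hv₂, e₂⟩ := exists_eq_pull13_add (f := (M - dN M') 2 0) ⟨t0 2, hM' 2 0⟩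
  obtain ⟨q₃, v₃, hv₃, e₃⟩ := exists_eq_pull13_add (f := (M - dN M') 3 0) ⟨t0 3, hM' 3 0⟩
  refine ⟨![detInv * p 0, -(detInv * p 1), q₂, q₃], M', S', hc, hi, fun i => ?_, fun i => ?_,
    fun i => ?_, fun i => ?_, fun i hi => ?_⟩
  · rw [Matrix.sub_apply, Matrix.sub_apply, Matrix.sub_apply, cN1_col_zero, dN_col_zero,
      mul_col_zero _ _ s0, m0, s1, s2, h0, map_zero]
    fin_cases i <;> simp [vec1]
  · rw [Matrix.sub_apply, Matrix.sub_apply, Matrix.sub_apply, cN1_col_two, dN_col_two,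
      mul_col_zero _ _ s2, mul_col_zero _ _ m0, m1, m2, s0, s3]
    have hq : pull13 (p i) = vec1 (hat ![detInv * p 0, -(detInv * p 1), q₂, q₃]) i 2 := by
      fin_cases i
      · exact (dg_mul_pull13 _).symm
      · change pull13 (p 1) = -(dg * pull13 (-(detInv * p 1)))
        rw [map_neg, mul_neg, neg_neg, dg_mul_pull13]
      · exact (congrArg pull13 (hp 2 (Or.inl rfl))).trans (map_zero _)
      · exact (congrArg pull13 (hp 3 (Or.inr rfl))).trans (map_zero _)
    rw [← hq]
    linear_combination eq_τ_add (S i 2) + he i - z * eps_mul_eps i (quot (S i 2))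
  · rw [Matrix.sub_apply _ (vec0 _), map_sub, t0, τ_vec0]
  · rw [Matrix.sub_apply _ (vec0 _), map_sub, t2, τ_vec0]
  · rcases hi with rfl | rfl
    · exact ⟨v₂, hv₂, by rw [Matrix.sub_apply _ (vec0 _), e₂]; exact add_sub_cancel_left _ _⟩
    · exact ⟨v₃, hv₃, by rw [Matrix.sub_apply _ (vec0 _), e₃]; exact add_sub_cancel_left _ _⟩

/-- The convolution is the sum of the unit, of the complement and of the differential of the latter. -/
theorem exists_decomposition (n : NN.inv) : ∃ q, ∃ c ∈ comp, ∃ c' ∈ comp,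
    n = incl q + c + NN.dAmb.restrict NN.dAmb_mem c' := by
  obtain ⟨n, hn⟩ := n
  obtain ⟨M, S, rfl⟩ := exists_emb n
  obtain ⟨M₁, S₁, hc₁, hi₁, a, b, c⟩ := exists_sub_col_zero hn
  obtain ⟨q, M₂, S₂, hc₂, hi₂, hc⟩ := exists_isComp (sub_mem_inv hn hi₁) a b c
  have hi := sub_mem (sub_mem_inv (sub_mem_inv hn hi₁) hi₂) (incl q).2
  have e := emb_sub (M - dN M₁ - dN M₂) (S - (cN1 M₁ - dN S₁) - (cN1 M₂ - dN S₂)) (vec0 (hat q))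
    (vec1 (hat q))
  refine ⟨q, ⟨_, hi⟩, ⟨_, _, e.symm, hc⟩, ⟨_, hi₁⟩ + ⟨_, hi₂⟩,
    add_mem ⟨_, _, rfl, hc₁⟩ ⟨_, _, rfl, hc₂⟩, Subtype.ext ?_⟩
  have key : emb M S = emb (vec0 (hat q)) (vec1 (hat q)) +
      (emb (M - dN M₁ - dN M₂) (S - (cN1 M₁ - dN S₁) - (cN1 M₂ - dN S₂)) -
        emb (vec0 (hat q)) (vec1 (hat q))) +
      (emb (dN M₁) (cN1 M₁ - dN S₁) + emb (dN M₂) (cN1 M₂ - dN S₂)) := by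
    rw [add_sub_cancel, ← emb_add, ← emb_add]
    congr 1 <;> abel
  rw [map_add]
  exact key.trans (congrArg₂ (fun v w : Amb (Fin 4 × Fin 4) => emb (vec0 (hat q)) (vec1 (hat q)) +
    (emb (M - dN M₁ - dN M₂) (S - (cN1 M₁ - dN S₁) - (cN1 M₂ - dN S₂)) -
      emb (vec0 (hat q)) (vec1 (hat q))) + (v + w)) (dAmb_emb M₁ S₁).symm (dAmb_emb M₂ S₂).symm)

end Con

namespace Con

/-- `E` is injective on the column `M i 0` of elements of the complement: in the first two rows because of the
weights, in the others because the invariant functions are excluded. -/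
theorem eq_zero_of_E_col_zero {M S : Matrix (Fin 4) (Fin 4) (Coord 2)} (hc : IsComp M S)
    (h : ∀ i, HasMid (midα i 0) 0 (M i 0)) {i : Fin 4} (h0 : E (M i 0) = 0) : M i 0 = 0 := by
  have low : ∀ {f}, τ f = f → HasMid 1 0 f → E f = 0 → f = 0 := fun hτ h =>
    eq_zero_of_E (α := 1) (β := 0) (by norm_num) ⟨hτ, h⟩
  have high : ∀ i, i = 2 ∨ i = 3 → E (M i 0) = 0 → M i 0 = 0 := fun i hi h0 => by
    obtain ⟨v, hv, e⟩ := hc.exists_E i hi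
    rw [e] at h0 ⊢
    rw [eq_zero_of_E_E hv h0, map_zero]
  fin_cases i
  · exact low (hc.τ_zero 0) (h 0) h0
  · exact low (hc.τ_zero 1) (h 1) h0
  · exact high 2 (Or.inl rfl) h0
  · exact high 3 (Or.inr rfl) h0

theorem dg_ne_zero : dg ≠ 0 := fun h => by
  have := dg_mul
  rw [h, mul_zero] at this
  exact zero_ne_one this

/-- The sum of the unit, the complement and its differential is direct. -/
theorem eq_zero_of_sum {q : Fin 4 → Coord 1} {M S M' S' : Matrix (Fin 4) (Fin 4) (Coord 2)}
    (hc : IsComp M S) (hc' : IsComp M' S') (hi : (emb M' S' : Amb NN.I) ∈ NN.inv)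
    (h₁ : vec0 (hat q) + M + dN M' = 0) (h₂ : vec1 (hat q) + S + (cN1 M' - dN S') = 0) :
    q = 0 ∧ M = 0 ∧ S = 0 ∧ M' = 0 ∧ S' = 0 := by
  obtain ⟨hM, hS⟩ := emb_mem_inv.1 hi
  have e₁ : ∀ i j, vec0 (hat q) i j + M i j + dN M' i j = 0 := fun i j => congrFun (congrFun h₁ i) j
  have e₂ : ∀ i j, vec1 (hat q) i j + S i j + (cN1 M' i j - dN S' i j) = 0 :=
    fun i j => congrFun (congrFun h₂ i) j
  -- the column `S i 0`
  have r₀ : ∀ i, M' i 0 = 0 ∧ S' i 1 = 0 := fun i => by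
    have h := e₂ i 0
    rw [cN1_col_zero, dN_col_zero, mul_col_zero _ _ hc'.snd_zero, hc.snd_zero, hc'.snd_two,
      show vec1 (hat q) i 0 = 0 by fin_cases i <;> rfl] at h
    have h' := eq_zero_of_add_mul (r := E (M' i 0)) (s := -(eps i * S' i 1)) (τ_E (hc'.τ_zero i)) (by
      linear_combination h)
    refine ⟨eq_zero_of_E_col_zero hc' (fun i => hM i 0) h'.1, ?_⟩
    rw [← eps_mul_eps i (S' i 1), neg_eq_zero.1 h'.2, mul_zero]
  have m₀ : ∀ i, M' i 0 = 0 := fun i => (r₀ i).1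
  -- the column `M i 0`
  have r₁ : ∀ i, vec0 (hat q) i 0 + M i 0 + eps i * (ia * Con.e₂ * M' i 2) = 0 ∧ M' i 1 = 0 := fun i => by
    have h := e₁ i 0
    rw [dN_col_zero, mul_col_zero _ _ m₀] at h
    have h' := eq_zero_of_add_mul (r := vec0 (hat q) i 0 + M i 0 + eps i * (ia * Con.e₂ * M' i 2))
      (s := eps i * M' i 1)
      (by simp only [map_add, map_mul, τ_vec0, hc.τ_zero, τ_eps, τ_ia, τ_e₂, hc'.τ_two])
      (by linear_combination h)
    exact ⟨h'.1, by rw [← eps_mul_eps i (M' i 1), h'.2, mul_zero]⟩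
  -- the column `M i 2`
  have r₂ : ∀ i, vec0 (hat q) i 2 + M i 2 + (kL * M' : Matrix (Fin 4) (Fin 4) (Coord 2)) i 2 = 0 ∧
      M' i 3 = 0 := fun i => by
    have h := e₁ i 2
    rw [dN_col_two, m₀] at h
    have h' := eq_zero_of_add_mul
      (r := vec0 (hat q) i 2 + M i 2 + (kL * M' : Matrix (Fin 4) (Fin 4) (Coord 2)) i 2)
      (s := eps i * M' i 3)
      (by rw [map_add, map_add, τ_vec0, hc.τ_two, τ_kL_mul hc'.τ_two])
      (by linear_combination h)
    exact ⟨h'.1, by rw [← eps_mul_eps i (M' i 3), h'.2, mul_zero]⟩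
  -- the column `S i 2`
  have r₃ : ∀ i, vec1 (hat q) i 2 + E (M' i 2) = 0 ∧ S' i 3 = 0 := fun i => by
    have h := e₂ i 2
    rw [cN1_col_two, dN_col_two, mul_col_zero _ _ hc'.snd_two, mul_col_zero _ _ m₀, hc.snd_two,
      hc'.snd_zero, (r₁ i).2] at h
    have h' := eq_zero_of_add_mul (r := vec1 (hat q) i 2 + E (M' i 2)) (s := -(eps i * S' i 3))
      (by rw [map_add, τ_vec1, τ_E (hc'.τ_two i)])
      (by linear_combination h)
    refine ⟨h'.1, ?_⟩
    rw [← eps_mul_eps i (S' i 3), neg_eq_zero.1 h'.2, mul_zero]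
  have hdet : ∀ p : Coord 1, dg * pull13 p = 0 → p = 0 := fun p h =>
    pull13_injective (((mul_eq_zero.1 h).resolve_left dg_ne_zero).trans (map_zero _).symm)
  have hpull : ∀ p : Coord 1, dg * pull13 p = pull13 ((BraidMF.g 0 0 * BraidMF.g 1 1 -
      BraidMF.g 0 1 * BraidMF.g 1 0) * p) := fun p => by
    simp only [map_mul, map_sub, pull13_gg, dg, da, db]
    ring
  have hdet' : ∀ p : Coord 1, ∀ f, τ f = f → HasMid 1 (-1) f → dg * pull13 p + E f = 0 →
      p = 0 ∧ f = 0 := fun p f hτ hf h => by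
    have h' := eq_zero_of_pull13_add (v := f) ⟨hτ, hf⟩ (by rw [← hpull]; exact h)
    refine ⟨hdet p ?_, h'.2⟩
    rw [hpull, h'.1, map_zero]
  have hlow : ∀ f, τ f = f → HasMid 0 (-1) f → 0 + E f = 0 → f = 0 := fun f hτ hf h =>
    eq_zero_of_E (α := 0) (β := -1) (by norm_num) ⟨hτ, hf⟩ (by rw [← h, zero_add])
  have q₀ := hdet' (q 0) _ (hc'.τ_two 0) (hM 0 2) (r₃ 0).1
  have q₁ := hdet' (-q 1) _ (hc'.τ_two 1) (hM 1 2) (by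
    rw [map_neg, mul_neg]
    exact (r₃ 1).1)
  have m₂ : ∀ i, M' i 2 = 0 := fun i => by
    fin_cases i
    · exact q₀.2
    · exact q₁.2
    · exact hlow _ (hc'.τ_two 2) (hM 2 2) (r₃ 2).1
    · exact hlow _ (hc'.τ_two 3) (hM 3 2) (r₃ 3).1
  have hM' : M' = 0 := by
    ext i j
    fin_cases j
    · exact m₀ i
    · exact (r₁ i).2
    · exact m₂ i
    · exact (r₂ i).2
  have hS' : S' = 0 := by
    ext i j
    fin_cases j
    · exact hc'.snd_zero i
    · exact (r₀ i).2
    · exact hc'.snd_two i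
    · exact (r₃ i).2
  -- the rows `M 2 0` and `M 3 0`
  have hq : ∀ i, i = 2 ∨ i = 3 → vec0 (hat q) i 0 = pull13 (q i) → q i = 0 := fun i hi e => by
    obtain ⟨v, hv, h⟩ := hc.exists_E i hi
    have h' := (r₁ i).1
    rw [m₂, mul_zero, mul_zero, add_zero, e, h] at h'
    exact (eq_zero_of_pull13_add hv h').1
  have hq0 : q = 0 := by
    ext i
    fin_cases i
    · exact q₀.1
    · exact neg_eq_zero.1 q₁.1
    · exact hq 2 (Or.inl rfl) rfl
    · exact hq 3 (Or.inr rfl) rfl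
  have z₀ : vec0 (hat q) = 0 := by
    rw [hq0]
    ext i j
    fin_cases i <;> fin_cases j <;> simp [vec0, hat]
  have z₁ : vec1 (hat q) = 0 := by
    rw [hq0]
    ext i j
    fin_cases i <;> fin_cases j <;> simp [vec1, hat]
  have hcN : cN1 0 = 0 := by
    rw [cN1]
    ext i j
    simp
  rw [z₀, hM', dN_zero, zero_add, add_zero] at h₁
  rw [z₁, hM', hS', hcN, dN_zero, zero_add, sub_zero, add_zero] at h₂
  exact ⟨hq0, h₁, h₂, hM', hS'⟩

theorem decomposition_unique (q : Fin 4 → Coord 1) (c : NN.inv) (hc : c ∈ comp) (c' : NN.inv)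
    (hc' : c' ∈ comp) (h : incl q + c + NN.dAmb.restrict NN.dAmb_mem c' = 0) : q = 0 ∧ c = 0 ∧ c' = 0 := by
  obtain ⟨c, hi⟩ := c
  obtain ⟨c', hi'⟩ := c'
  obtain ⟨M, S, e, hc⟩ := hc
  obtain ⟨M', S', e', hc'⟩ := hc'
  change c = emb M S at e
  change c' = emb M' S' at e'
  subst e e'
  have key : emb (vec0 (hat q) + M + dN M') (vec1 (hat q) + S + (cN1 M' - dN S')) = emb 0 0 := by
    rw [emb_add, emb_add, emb_zero]
    exact (congrArg (fun v : Amb (Fin 4 × Fin 4) => emb (vec0 (hat q)) (vec1 (hat q)) + emb M S + v)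
      (dAmb_emb M' S').symm).trans (congrArg Subtype.val h)
  obtain ⟨h₁, h₂⟩ := emb_injective key
  obtain ⟨hq, rfl, rfl, rfl, rfl⟩ := eq_zero_of_sum hc hc' hi' h₁ h₂
  exact ⟨hq, Subtype.ext emb_zero, Subtype.ext emb_zero⟩

end Con

/-- The convolution of the positive and the negative crossing is the unit. -/
theorem conv_isomorphic_unit : (conv Cplus Cminus).Isomorphic unit2.toWMF := by
  obtain ⟨i, hi, h⟩ := Con.exists_isHom
  refine WMF.isomorphic_of_bijective (conv Cplus Cminus) unit2.toWMF i hi Con.comp Con.par_mem_comp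
    Con.ρ_mem_comp (fun m => ?_) fun q (c : Con.NN.inv) hc (c' : Con.NN.inv) hc' e => ?_
  · obtain ⟨q, c, hc, c', hc', e⟩ := Con.exists_decomposition m
    exact ⟨q, c, hc, c', hc', e.trans (congrArg (fun v : Con.NN.inv => v + c +
      Con.NN.dAmb.restrict Con.NN.dAmb_mem c') (h q).symm)⟩
  · exact Con.decomposition_unique q c hc c' hc' ((congrArg (fun v : Con.NN.inv => v + c +
      Con.NN.dAmb.restrict Con.NN.dAmb_mem c') (h q).symm).trans e)

end

end BraidMF

theorem mainTheorem3 :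
    (BraidMF.conv BraidMF.Cplus BraidMF.Cminus).Isomorphic BraidMF.unit2.toWMF :=
  BraidMF.conv_isomorphic_unit
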